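/- **Data.** Let $s,N,N_D\ge 0$ be integers and, for $j=0,\dots,s$, let $\alpha_j$ run over $N_j$ values with Grassmann parities $\epsilon_{\alpha_j}\in\mathbb Z_2$. Put $a_{\rm ext}=\{\alpha_0;\alpha_2;\alpha_4;\dots\}$, $a_\pi=\{\alpha_1;\alpha_3;\dots\}$ and $a_i=\{\alpha_i;\alpha_{i+1};\dots;\alpha_s\}$ for $i=1,\dots,s$. The zeroth-level variables are $\Gamma_{\rm ext}=\{\Gamma^A;\pi_{a_\pi};\pi^{*a_\pi}\}$, where $A=1,\dots,2N$, $\epsilon(\pi_a)=\epsilon_a$ and $\epsilon(\pi^{*a})=\epsilon_a+1$. The first-level fields are $\lambda^{a_{\rm ext}}$ (parity $\epsilon_a$, Planck number $1$), $c^{a_i}$ (parity $\epsilon_a+i$, Planck number $i+1$) and $\bar c_{a_i}$ (parity $\epsilon_a+i$, Planck number $-i$) for $i=1,\dots,s$. Each field $\varphi$ comes with an antifield $\varphi^*$ of opposite parity and opposite Planck number. The variables $\Gamma_{\rm ext}$ have Planck number $0$. Superfunctions are smooth complex-valued functions of the real bosonic variables among $\Gamma_{\rm ext}$ on an open set $U$.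 They are polynomial in all fermionic variables and formal power series in the bosonic first-level variables. The body of a superfunction is its value when all fermionic and all first-level variables are put to zero. Let $E^{AB}(\Gamma)$ be a non-degenerate antisymplectic bivector with antibracket $(\cdot,\cdot)$. Let $\Theta^a(\Gamma)$, $a=1,\dots,2N_D$, be second-class constraints, meaning that $E^{ab}=(\Theta^a,\Theta^b)$ is invertible, with inverse $E_{ab}$. Let $(f,g)_D=(f,g)-(f,\Theta^a)E_{ab}(\Theta^b,g)$ be the Dirac antibracket. Let $(\cdot,\cdot)_{D,{\rm ext}}$ be its extension by the canonical antibracket of the pairs $\pi_a,\pi^{*a}$. Let $\rho_D(\Gamma)$ be an even, invertible density, and set $$\Delta_D=\frac{(-1)^{\epsilon_A}}{2\rho_D}\,\partial_A\,\rho_D\,E_D^{AB}\,\partial_B,\qquad E_D^{AB}=(\Gamma^A,\Gamma^B)_D,$$ $$\Delta_{[1]D}=\Delta_D+\sum_{\varphi\in\{\pi,\lambda,c,\bar c\}}(-1)^{\epsilon_\varphi}\,\partial_\varphi\,\partial_{\varphi^*}.$$ **Gauge-fixing action.** Let $\hbar\in\mathbb C\setminus\{0\}$ and let $X=\sum_{k\ge0}(i\hbar)^k\Omega_k$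 be an even action in which $\Omega_k$ has Planck number $1-k$, and which satisfies the Quantum Master Equation $$\Delta_{[1]D}\,e^{\frac i\hbar X}=0 .$$ With all first-level variables put to zero after differentiation, let $\mathcal G_{a_{\rm ext}}$ be the coefficient of $\lambda^{a_{\rm ext}}$ in $X$, let $\mathcal H$ be the coefficient of $i\hbar$, and for $i=1,\dots,s$ let $\Delta^{a_i}{}_{b_i}$ be the coefficient matrix of $\bar c_{a_i}c^{b_i}$. We abbreviate the last matrix to $\Delta_i$. Let $\Sigma\subset U$ be the set of points where the bodies of all $\mathcal G_{a_{\rm ext}}$ and all $\Theta^a$ vanish. Assume that at each point of $\Sigma$ the body of the Hessian of $\Omega_0$ in the variables $\Gamma_{\rm ext},\lambda,c,\bar c$ has rank $2\big(|a_{\rm ext}|+\sum_{i=1}^s|a_i|\big)$. Let $\mathcal F^{a_{\rm ext}}(\Gamma_{\rm ext})$ be functions such that $\bar\Gamma=\{\mathcal F^{a_{\rm ext}};\mathcal G_{a_{\rm ext}};\Theta^a\}$ is a coordinate system on the space of the $\Gamma_{\rm ext}$, with Jacobian $\mathcal J_D={\rm sdet}(\partial\bar\Gamma/\partial\Gamma_{\rm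 ext})$. Write $\mathcal O(\mathcal G;\Theta)$ for superfunctions of the form $\mathcal G_{a_{\rm ext}}u^{a_{\rm ext}}+\Theta^a v_a$ with $u,v$ smooth functions of $\Gamma_{\rm ext}$. **Theorem.** On $\Sigma$ the matrices $(\mathcal F^{a_{\rm ext}},\mathcal G_{b_{\rm ext}})_{D,{\rm ext}}$ and $\Delta_1,\dots,\Delta_s$ are invertible. Let $W\subset U$ be any open set on which these matrices are invertible and for which $W\cap\Sigma$ is connected or empty. Then on $W$ $$\mathcal H=c-\ln\left[\sqrt{\frac{\mathcal J_D\;{\rm sdet}(\mathcal F^{a_{\rm ext}},\mathcal G_{b_{\rm ext}})_{D,{\rm ext}}}{\rho_D}}\;\prod_{i=1}^s{\rm sdet}(\Delta^{a_i}{}_{b_i})^{(-1)^i}\right]+\mathcal O(\mathcal G;\Theta)$$ for every choice of smooth branches of the square root and of the logarithm on $W$, where $c\in\mathbb C$ is an unphysical integration constant that may depend on this choice. Independently of any choice of branches, there is a constant $C\in\mathbb C\setminus\{0\}$ with $$e^{-2\mathcal H}=C\;\frac{\mathcal J_D\;{\rm sdet}(\mathcal F^{a_{\rm ext}},\mathcal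 G_{b_{\rm ext}})_{D,{\rm ext}}}{\rho_D}\;\prod_{i=1}^s{\rm sdet}(\Delta^{a_i}{}_{b_i})^{2(-1)^i}+\mathcal O(\mathcal G;\Theta)\quad\text{on }W .$$ -/

import Mathlib

open scoped ContDiff

noncomputable section

namespace BV

/-! ### Superdeterminants over a (noncommutative) ring

In a supercommutative ring the even elements are central, so the determinants below are taken over
the commutative ring `Subring.center R`. -/

/-- Regard a matrix with central entries as a matrix over the center
(non-central entries are replaced by `0`). -/
def centralLift {R : Type*} [Ring R] {m n : Type*} (M : Matrix m n R) :
    Matrix m n (Subring.center R) := by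
  classical
  exact fun i j => if h : M i j ∈ Subring.center R then ⟨M i j, h⟩ else 0

/-- The superdeterminant (Berezinian)
`sdet [[A, B], [C, D]] = det (A - B D⁻¹ C) * (det D)⁻¹` of a square matrix whose rows and columns
have the Grassmann parities `p`; `A` is the even-even and `D` the odd-odd block. -/
def sdet {R : Type*} [Ring R] {ι : Type*} [Fintype ι] [DecidableEq ι]
    (p : ι → ZMod 2) (M : Matrix ι ι R) : R :=
  let A : Matrix {i // p i = 0} {i // p i = 0} R := fun i j => M i.1 j.1
  let B : Matrix {i // p i = 0} {i // ¬ p i = 0} R := fun i j => M i.1 j.1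
  let C : Matrix {i // ¬ p i = 0} {i // p i = 0} R := fun i j => M i.1 j.1
  let D : Matrix {i // ¬ p i = 0} {i // ¬ p i = 0} R := fun i j => M i.1 j.1
  let Dinv : Matrix {i // ¬ p i = 0} {i // ¬ p i = 0} R :=
    fun i j => (((centralLift D)⁻¹ i j : Subring.center R) : R)
  (((centralLift (A - B * Dinv * C)).det : Subring.center R) : R) *
    Ring.inverse (((centralLift D).det : Subring.center R) : R)

/-- The sign `(-1)^p`. -/
def sgn (p : ZMod 2) : ℂ := if p = 0 then 1 else -1

/-! ### The fields -/

/-- The numerical data of a first-level theory of stage `s` with second-class constraints: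
`2N` zeroth-level variables `Γ^A`, `2N_D` second-class constraints `Θ^a`, and `N_j` indices
`α_j` for each stage `j = 0, …, s`, together with their Grassmann parities. -/
structure FieldContent where
  s : ℕ
  N : ℕ
  ND : ℕ
  num : Fin (s + 1) → ℕ
  parΓ : Fin (2 * N) → ZMod 2
  parΘ : Fin (2 * ND) → ZMod 2
  parα : (j : Fin (s + 1)) → Fin (num j) → ZMod 2

variable (D : FieldContent)

/-- All stage indices `α_0, α_1, …, α_s`. -/
abbrev Al : Type := (j : Fin (D.s + 1)) × Fin (D.num j)

/-- `ε_{α_j}`. -/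
def parAl (a : Al D) : ZMod 2 := D.parα a.1 a.2

/-- `a_ext = {α_0; α_2; α_4; …}`. -/
abbrev AExt : Type := {a : Al D // Even (a.1 : ℕ)}

/-- `a_π = {α_1; α_3; α_5; …}`. -/
abbrev APi : Type := {a : Al D // Odd (a.1 : ℕ)}

/-- `a_i = {α_i; α_{i+1}; …; α_s}`. -/
abbrev AIdx (i : ℕ) : Type := {a : Al D // i ≤ (a.1 : ℕ)}

/-- The zeroth-level variables `Γ^{A_ext} = {Γ^A; π_{a_π}; π^{* a_π}}`. -/
abbrev Ext : Type := Fin (2 * D.N) ⊕ (APi D ⊕ APi D)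

/-- The ghost indices `(i, a_i)` with `i = 1, …, s`; the natural number `i` is stored as
`i - 1 : Fin s`. -/
abbrev Gh : Type := (i : Fin D.s) × AIdx D ((i : ℕ) + 1)

/-- The first-level fields, in the order `λ^{a_ext}`, `c^{a_i}`, `c̄_{a_i}`. -/
abbrev Fld : Type := AExt D ⊕ (Gh D ⊕ Gh D)

/-- The first-level variables: fields (left) and their antifields (right). -/
abbrev Aux : Type := Fld D ⊕ Fld D

/-- All the variables `Γ_[1]`. -/
abbrev Coord : Type := Ext D ⊕ Aux D

/-- Grassmann parities of `Γ^{A_ext}`. -/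
def parExt : Ext D → ZMod 2
  | Sum.inl A => D.parΓ A
  | Sum.inr (Sum.inl a) => parAl D a.1
  | Sum.inr (Sum.inr a) => parAl D a.1 + 1

/-- Grassmann parities of `λ^{a_ext}`, `c^{a_i}`, `c̄_{a_i}`. -/
def parFld : Fld D → ZMod 2
  | Sum.inl a => parAl D a.1
  | Sum.inr (Sum.inl g) => parAl D g.2.1 + (((g.1 : ℕ) + 1 : ℕ) : ZMod 2)
  | Sum.inr (Sum.inr g) => parAl D g.2.1 + (((g.1 : ℕ) + 1 : ℕ) : ZMod 2)

/-- Grassmann parities of all variables. -/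
def par : Coord D → ZMod 2
  | Sum.inl A => parExt D A
  | Sum.inr (Sum.inl f) => parFld D f
  | Sum.inr (Sum.inr f) => parFld D f + 1

/-- Planck numbers `Pl(λ) = 1`, `Pl(c^{a_i}) = i + 1`, `Pl(c̄_{a_i}) = -i` of the fields. -/
def plFld : Fld D → ℤ
  | Sum.inl _ => 1
  | Sum.inr (Sum.inl g) => ((g.1 : ℕ) : ℤ) + 2
  | Sum.inr (Sum.inr g) => -(((g.1 : ℕ) : ℤ) + 1)

/-- Planck numbers of the first-level variables; an antifield has the opposite Planck number. -/
def pl : Aux D → ℤ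
  | Sum.inl f => plFld D f
  | Sum.inr f => -plFld D f

/-! ### Superfunctions

A superfunction is a function of the bosonic variables among `Γ^{A_ext}` (genuine real variables)
with values in formal power series in the bosonic first-level variables over the Grassmann algebra
generated by all fermionic variables. -/

/-- The bosonic variables among `Γ^{A_ext}`. -/
abbrev BodyIdx : Type := {A : Ext D // par D (Sum.inl A) = 0}

/-- The bosonic first-level variables. -/
abbrev FormalIdx : Type := {z : Aux D // par D (Sum.inr z) = 0}

/-- All fermionic variables. -/
abbrev OddIdx : Type := {z : Coord D // ¬ par D z = 0}

/-- The underlying space of the bosonic variables in `Γ^{A_ext}`. -/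
abbrev Body : Type := BodyIdx D → ℝ

/-- The Grassmann algebra generated by the fermionic variables. -/
abbrev Lam : Type := ExteriorAlgebra ℂ (OddIdx D → ℂ)

/-- Values of superfunctions. -/
abbrev Val : Type := MvPowerSeries (FormalIdx D) (Lam D)

/-- Superfunctions of all variables. -/
abbrev SF : Type := Body D → Val D

/-- The basis of monomials of the Grassmann algebra. -/
def monoBasis : Module.Basis (Finset (OddIdx D)) ℂ (Lam D) :=
  letI : LinearOrder (OddIdx D) :=
    LinearOrder.lift' (Fintype.equivFin (OddIdx D)) (Fintype.equivFin (OddIdx D)).injective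
  (Pi.basisFun ℂ (OddIdx D)).ExteriorAlgebra

/-- The complex-valued component functions of a superfunction. -/
def comp (f : SF D) (d : FormalIdx D →₀ ℕ) (S : Finset (OddIdx D)) : Body D → ℂ :=
  fun x => (monoBasis D).repr (MvPowerSeries.coeff d (f x)) S

/-- Smoothness on an open set: all component functions are smooth. -/
def Smooth (U : Set (Body D)) (f : SF D) : Prop :=
  ∀ d S, ContDiffOn ℝ ∞ (comp D f d S) U

/-- The coordinate functions. -/
def coord (z : Coord D) : SF D :=
  if h : par D z = 0 then
    match z, h with
    | Sum.inl A, h => fun x => algebraMap ℂ (Val D) ((x ⟨A, h⟩ : ℝ) : ℂ)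
    | Sum.inr a, h => fun _ => MvPowerSeries.X ⟨a, h⟩
  else fun _ => MvPowerSeries.C (ExteriorAlgebra.ι ℂ (Pi.single (⟨z, h⟩ : OddIdx D) (1 : ℂ)))

/-- Partial derivative along a bosonic variable of `Γ^{A_ext}`. -/
def pdBody (b : BodyIdx D) (f : SF D) : SF D :=
  fun x d => ∑ S : Finset (OddIdx D),
    (fderiv ℝ (comp D f d S) x (Pi.single b 1)) • monoBasis D S

/-- Partial derivative along a bosonic first-level variable. -/
def pdFormal (z : FormalIdx D) (f : SF D) : SF D :=
  fun x d => ((d z + 1 : ℕ) : ℂ) • MvPowerSeries.coeff (d + Finsupp.single z 1) (f x)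

/-- Left derivative along a fermionic variable. -/
def pdOdd (o : OddIdx D) (f : SF D) : SF D :=
  fun x d => CliffordAlgebra.contractLeft (LinearMap.proj o : (OddIdx D → ℂ) →ₗ[ℂ] ℂ)
    (MvPowerSeries.coeff d (f x))

/-- The left derivative along any variable. -/
def ld (z : Coord D) (f : SF D) : SF D :=
  if h : par D z = 0 then
    match z, h with
    | Sum.inl A, h => pdBody D ⟨A, h⟩ f
    | Sum.inr a, h => pdFormal D ⟨a, h⟩ f
  else pdOdd D ⟨z, h⟩ f

/-- The parity automorphism `f ↦ (-1)^{ε_f} f`. -/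
def flip (f : SF D) : SF D :=
  fun x d => CliffordAlgebra.involute (MvPowerSeries.coeff d (f x))

/-- The right derivative along any variable,
`f ∂ʳ_z = (-1)^{ε_z (ε_f + 1)} ∂ˡ_z f`. -/
def rd (z : Coord D) (f : SF D) : SF D :=
  if par D z = 0 then ld D z f else -ld D z (flip D f)

/-- `f` has Grassmann parity `p` on `U`. -/
def HasParity (U : Set (Body D)) (p : ZMod 2) (f : SF D) : Prop :=
  ∀ x ∈ U, flip D f x = sgn p • f x

/-- The value with all fermionic and all first-level variables put to zero. -/
def body (v : Val D) : ℂ := ExteriorAlgebra.algebraMapInv (MvPowerSeries.constantCoeff v)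

/-- Put to zero all bosonic first-level variables and all those fermionic variables which do not
satisfy `P`. -/
def kill (P : Coord D → Prop) (f : SF D) : SF D := by
  classical
  exact fun x => MvPowerSeries.C (ExteriorAlgebra.map
    (LinearMap.pi fun o : OddIdx D =>
      if P o.1 then (LinearMap.proj o : (OddIdx D → ℂ) →ₗ[ℂ] ℂ) else 0)
    (MvPowerSeries.constantCoeff (f x)))

/-- The restriction of a superfunction to vanishing first-level variables. -/
def atZero (f : SF D) : SF D := kill D (fun z => z.isLeft = true) f

/-- `f` is a function of `Γ^{A_ext}` only. -/
def IsExtFun (U : Set (Body D)) (f : SF D) : Prop := ∀ x ∈ U, atZero D f x = f x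

/-- `f` is a function of the variables `Γ^A` only. -/
def IsΓFun (U : Set (Body D)) (f : SF D) : Prop :=
  (∀ x ∈ U, kill D (fun z => ∃ A, z = Sum.inl (Sum.inl A)) f x = f x) ∧
  ∀ x ∈ U, ∀ y ∈ U, (∀ b : BodyIdx D, b.1.isLeft = true → x b = y b) → f x = f y

/-- The exponential `e^f = e^{body f} ∑ₙ (f - body f)ⁿ / n!`. The sum is finite in each coefficient:
`(f - body f)ⁿ` has no component of degree `< n` in the formal and fermionic variables. -/
def expVal (v : Val D) : Val D :=
  fun d => Complex.exp (body D v) •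
    ∑ n ∈ Finset.range (d.degree + Fintype.card (OddIdx D) + 1),
      ((n.factorial : ℂ)⁻¹) •
        MvPowerSeries.coeff d ((v - algebraMap ℂ (Val D) (body D v)) ^ n)

/-! ### Antibrackets and odd Laplacians -/

/-- The index of `Γ^A` among all variables. -/
abbrev gam (A : Fin (2 * D.N)) : Coord D := Sum.inl (Sum.inl A)
/-- The index of `π_a`. -/
abbrev piI (a : APi D) : Coord D := Sum.inl (Sum.inr (Sum.inl a))
/-- The index of `π^{* a}`. -/
abbrev piS (a : APi D) : Coord D := Sum.inl (Sum.inr (Sum.inr a))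
/-- The index of a first-level field. -/
abbrev fld (f : Fld D) : Coord D := Sum.inr (Sum.inl f)
/-- The index of a first-level antifield. -/
abbrev afld (f : Fld D) : Coord D := Sum.inr (Sum.inr f)
/-- The index of `λ^a`. -/
abbrev lam (a : AExt D) : Coord D := fld D (Sum.inl a)
/-- The index of `c^{a_i}`, where `i - 1 : Fin s` is given. -/
abbrev gh (i : Fin D.s) (a : AIdx D ((i : ℕ) + 1)) : Coord D := fld D (Sum.inr (Sum.inl ⟨i, a⟩))
/-- The index of `c̄_{a_i}`, where `i - 1 : Fin s` is given. -/
abbrev ghBar (i : Fin D.s) (a : AIdx D ((i : ℕ) + 1)) : Coord D :=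
  fld D (Sum.inr (Sum.inr ⟨i, a⟩))

/-- A bivector on the zeroth-level space. -/
abbrev Bivector : Type := Fin (2 * D.N) → Fin (2 * D.N) → SF D

/-- The antibracket `(f, g) = (f ∂ʳ_A) E^{AB} (∂ˡ_B g)`. -/
def bracket (E : Bivector D) (f g : SF D) : SF D :=
  ∑ A, ∑ B, rd D (gam D A) f * E A B * ld D (gam D B) g

/-- `E^{AB}(Γ)` is a non-degenerate antisymplectic bivector: it has the graded skewsymmetry, is
invertible, and its antibracket satisfies the graded Jacobi identity. -/
structure IsAntisymplectic (U : Set (Body D)) (E : Bivector D) : Prop where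
  isΓFun : ∀ A B, IsΓFun D U (E A B)
  smooth : ∀ A B, Smooth D U (E A B)
  parity : ∀ A B, HasParity D U (D.parΓ A + D.parΓ B + 1) (E A B)
  skew : ∀ A B, ∀ x ∈ U, E B A x = -(sgn ((D.parΓ A + 1) * (D.parΓ B + 1)) • E A B x)
  nondeg : ∀ x ∈ U, IsUnit (Matrix.of fun A B => E A B x)
  jacobi : ∀ (p q r : ZMod 2) (f g h : SF D), Smooth D U f → Smooth D U g → Smooth D U h →
    HasParity D U p f → HasParity D U q g → HasParity D U r h → ∀ x ∈ U,
      sgn ((p + 1) * (r + 1)) • bracket D E f (bracket D E g h) x +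
      sgn ((q + 1) * (p + 1)) • bracket D E g (bracket D E h f) x +
      sgn ((r + 1) * (q + 1)) • bracket D E h (bracket D E f g) x = 0

/-- The matrix `E^{ab} = (Θ^a, Θ^b)`. -/
def thetaMatrix (E : Bivector D) (Θ : Fin (2 * D.ND) → SF D) (x : Body D) :
    Matrix (Fin (2 * D.ND)) (Fin (2 * D.ND)) (Val D) :=
  Matrix.of fun a b => bracket D E (Θ a) (Θ b) x

/-- `Θ^a(Γ)` are antisymplectic second-class constraints: `(Θ^a, Θ^b)` is invertible. -/
structure IsSecondClass (U : Set (Body D)) (E : Bivector D) (Θ : Fin (2 * D.ND) → SF D) :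
    Prop where
  isΓFun : ∀ a, IsΓFun D U (Θ a)
  smooth : ∀ a, Smooth D U (Θ a)
  parity : ∀ a, HasParity D U (D.parΘ a) (Θ a)
  isUnit : ∀ x ∈ U, IsUnit (thetaMatrix D E Θ x)

/-- `ρ_D(Γ)` is a measure density: even, smooth and invertible. -/
structure IsDensity (U : Set (Body D)) (ρ : SF D) : Prop where
  isΓFun : IsΓFun D U ρ
  smooth : Smooth D U ρ
  parity : HasParity D U 0 ρ
  isUnit : ∀ x ∈ U, IsUnit (ρ x)

/-- The Dirac antibracket `(f, g)_D = (f, g) - (f, Θ^a) E_{ab} (Θ^b, g)`. -/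
def dirac (E : Bivector D) (Θ : Fin (2 * D.ND) → SF D) (f g : SF D) : SF D :=
  fun x => bracket D E f g x - ∑ a, ∑ b,
    bracket D E f (Θ a) x * (Ring.inverse (thetaMatrix D E Θ x)) a b * bracket D E (Θ b) g x

/-- The extended Dirac antibracket `(·,·)_{D,ext}`, with `(π_a, π^{*b}) = δ_a^b`. -/
def diracExt (E : Bivector D) (Θ : Fin (2 * D.ND) → SF D) (f g : SF D) : SF D :=
  dirac D E Θ f g + ∑ a : APi D,
    (rd D (piI D a) f * ld D (piS D a) g - rd D (piS D a) f * ld D (piI D a) g)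

/-- `E_D^{AB} = (Γ^A, Γ^B)_D`. -/
def diracBivector (E : Bivector D) (Θ : Fin (2 * D.ND) → SF D) : Bivector D :=
  fun A B => dirac D E Θ (coord D (gam D A)) (coord D (gam D B))

/-- The odd Laplacian `(-1)^{ε_A}/(2ρ) ∂_A ρ E^{AB} ∂_B` on the zeroth-level space. -/
def oddLaplacian (ρ : SF D) (E : Bivector D) (f : SF D) : SF D :=
  fun x => ∑ A, ∑ B, (sgn (D.parΓ A) / 2) •
    (Ring.inverse (ρ x) * ld D (gam D A) (ρ * E A B * ld D (gam D B) f) x)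

/-- `Δ_{[1]D} = Δ_D + ∑ (-1)^{ε_φ} ∂_φ ∂_{φ^*}`, the sum running over `φ = π, λ, c, c̄`. -/
def lapD (E : Bivector D) (Θ : Fin (2 * D.ND) → SF D) (ρ : SF D) (f : SF D) : SF D :=
  oddLaplacian D ρ (diracBivector D E Θ) f +
  ∑ a : APi D, sgn (par D (piI D a)) • ld D (piI D a) (ld D (piS D a) f) +
  ∑ φ : Fld D, sgn (par D (fld D φ)) • ld D (fld D φ) (ld D (afld D φ) f)

/-! ### The gauge-fixing action -/

/-- The action `X = ∑ₖ (iħ)^k Ω_k`; under Planck number conservation only finitely many terms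
contribute to each coefficient. -/
def action (ħ : ℂ) (Ω : ℕ → SF D) : SF D :=
  fun x d => ∑ᶠ k : ℕ, (Complex.I * ħ) ^ k • MvPowerSeries.coeff d (Ω k x)

/-- The Boltzmann factor `exp (i X / ħ)`. -/
def boltzmann (ħ : ℂ) (Ω : ℕ → SF D) : SF D :=
  fun x => expVal D ((Complex.I / ħ) • action D ħ Ω x)

/-- The Planck number operator (without its `ħ ∂/∂ħ` term). -/
def planck (f : SF D) : SF D :=
  ∑ z : Aux D, (pl D z : ℂ) • (coord D (Sum.inr z) * ld D (Sum.inr z) f)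

/-- `𝒢_a`: the coefficient of `λ^a` in `X`. -/
def G (Ω : ℕ → SF D) (a : AExt D) : SF D := atZero D (rd D (lam D a) (Ω 0))

/-- `𝓗`: the coefficient of `iħ` in `X` at vanishing first-level variables. -/
def H (Ω : ℕ → SF D) : SF D := atZero D (Ω 1)

/-- `Δ^{a_i}_{b_i}`: the coefficient matrix of `c̄_{a_i} c^{b_i}` in `X`
(`i - 1 : Fin s` is given). -/
def FP (Ω : ℕ → SF D) (i : Fin D.s) (x : Body D) :
    Matrix (AIdx D ((i : ℕ) + 1)) (AIdx D ((i : ℕ) + 1)) (Val D) :=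
  Matrix.of fun a b => atZero D (ld D (ghBar D i a) (rd D (gh D i b) (Ω 0))) x

/-- The on-shell surface `𝒢 = 0 = Θ`. -/
def onShell (U : Set (Body D)) (Ω : ℕ → SF D) (Θ : Fin (2 * D.ND) → SF D) : Set (Body D) :=
  {x | x ∈ U ∧ (∀ a, body D (G D Ω a x) = 0) ∧ ∀ a, body D (Θ a x) = 0}

/-- The quadrant of the Hessian of `X` (at `ħ`-order zero and at vanishing first-level variables)
belonging to `Γ^{A_ext}` and to the first-level fields. -/
def hessian (Ω : ℕ → SF D) (x : Body D) : Matrix (Ext D ⊕ Fld D) (Ext D ⊕ Fld D) ℂ :=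
  let idx : Ext D ⊕ Fld D → Coord D := Sum.elim Sum.inl (fld D)
  Matrix.of fun i j => body D (ld D (idx i) (rd D (idx j) (Ω 0)) x)

/-- The requirements on a non-minimal gauge-fixing action: Planck number conservation, the Quantum
Master Equation, and the rank condition that the Hessian reaches half the number
`2 M_even + 2 M_even + 4 ∑ᵢ |a_i|` of physical variables on the stationary configurations, with the
first-level antifields put to zero. -/
structure IsGaugeFixingAction (U : Set (Body D)) (ħ : ℂ) (E : Bivector D)
    (Θ : Fin (2 * D.ND) → SF D) (ρ : SF D) (Ω : ℕ → SF D) : Prop where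
  smooth : ∀ k, Smooth D U (Ω k)
  parity : ∀ k, HasParity D U 0 (Ω k)
  planck : ∀ k, ∀ x ∈ U, planck D (Ω k) x = (1 - (k : ℂ)) • Ω k x
  master : ∀ x ∈ U, lapD D E Θ ρ (boltzmann D ħ Ω) x = 0
  rank : ∀ x ∈ onShell D U Ω Θ, (hessian D Ω x).rank =
    2 * (Fintype.card (AExt D) + ∑ i : Fin D.s, Fintype.card (AIdx D ((i : ℕ) + 1)))

/-! ### The coordinates `{𝓕; 𝒢; Θ}` -/

/-- The index set of `Γ̄ = {𝓕^a; 𝒢_a; Θ^a}`. -/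
abbrev BarIdx : Type := AExt D ⊕ (AExt D ⊕ Fin (2 * D.ND))

/-- Grassmann parities of `{𝓕^a; 𝒢_a; Θ^a}`. -/
def parBar : BarIdx D → ZMod 2
  | Sum.inl a => parAl D a.1 + 1
  | Sum.inr (Sum.inl a) => parAl D a.1
  | Sum.inr (Sum.inr a) => D.parΘ a

/-- `{𝓕^a; 𝒢_a; Θ^a}`. -/
def barΓ (F : AExt D → SF D) (Ω : ℕ → SF D) (Θ : Fin (2 * D.ND) → SF D) : BarIdx D → SF D
  | Sum.inl a => F a
  | Sum.inr (Sum.inl a) => G D Ω a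
  | Sum.inr (Sum.inr a) => Θ a

/-- The Jacobian matrix `Γ̄^A ∂ʳ_B` of functions `Γ̄` enumerated as the variables `Γ^{A_ext}`. -/
def jacobian (e : BarIdx D ≃ Ext D) (Γbar : BarIdx D → SF D) (x : Body D) :
    Matrix (Ext D) (Ext D) (Val D) :=
  Matrix.of fun A B => rd D (Sum.inl B) (Γbar (e.symm A)) x

/-- The functions `Γ̄` form a coordinate system of the space of the `Γ^{A_ext}` on `U`, the
enumeration `e` respecting parities: they are smooth functions of `Γ^{A_ext}` of the right
parities, the bosonic ones have real bodies, which separate points, and the Jacobian matrix is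
invertible. -/
structure IsCoordinateSystem (U : Set (Body D)) (e : BarIdx D ≃ Ext D)
    (Γbar : BarIdx D → SF D) : Prop where
  parity_eq : ∀ i, parExt D (e i) = parBar D i
  isExtFun : ∀ i, IsExtFun D U (Γbar i)
  smooth : ∀ i, Smooth D U (Γbar i)
  parity : ∀ i, HasParity D U (parBar D i) (Γbar i)
  real : ∀ i, ∀ x ∈ U, (body D (Γbar i x)).im = 0
  injective : ∀ x ∈ U, ∀ y ∈ U, (∀ i, body D (Γbar i x) = body D (Γbar i y)) → x = y
  isUnit : ∀ x ∈ U, IsUnit (jacobian D e Γbar x)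

/-- The matrix `(𝓕^a, 𝒢_b)_{D,ext}`. -/
def FG (E : Bivector D) (Θ : Fin (2 * D.ND) → SF D) (F : AExt D → SF D) (Ω : ℕ → SF D)
    (x : Body D) : Matrix (AExt D) (AExt D) (Val D) :=
  Matrix.of fun a b => diracExt D E Θ (F a) (G D Ω b) x

/-- The quantity `𝒥_D sdet(𝓕, 𝒢)_{D,ext} / ρ_D` under the square root. -/
def radicand (E : Bivector D) (Θ : Fin (2 * D.ND) → SF D) (ρ : SF D) (F : AExt D → SF D)
    (Ω : ℕ → SF D) (e : BarIdx D ≃ Ext D) : SF D :=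
  fun x => sdet (parExt D) (jacobian D e (barΓ D F Ω Θ) x) *
    sdet (fun a : AExt D => parAl D a.1) (FG D E Θ F Ω x) * Ring.inverse (ρ x)

/-- The alternating product `∏_{i=1}^s sdet(Δ_i)^{(-1)^i}` (all factors are central). -/
def altProd (Ω : ℕ → SF D) : SF D :=
  fun x => (List.ofFn fun i : Fin D.s =>
    let δ := sdet (fun a : AIdx D ((i : ℕ) + 1) => parAl D a.1) (FP D Ω i x)
    if Even ((i : ℕ) + 1) then δ else Ring.inverse δ).prod

/-- `f = O(𝒢; Θ)` on `W`: `f = 𝒢_a u^a + Θ^a v_a` with smooth functions `u^a`, `v_a` of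
`Γ^{A_ext}`. -/
def IsBigO (W : Set (Body D)) (Ω : ℕ → SF D) (Θ : Fin (2 * D.ND) → SF D) (f : SF D) : Prop :=
  ∃ (u : AExt D → SF D) (v : Fin (2 * D.ND) → SF D),
    (∀ a, IsExtFun D W (u a) ∧ Smooth D W (u a)) ∧
    (∀ a, IsExtFun D W (v a) ∧ Smooth D W (v a)) ∧
    ∀ x ∈ W, f x = ∑ a, G D Ω a x * u a x + ∑ a, Θ a x * v a x

end BV

end

noncomputable section

open Finset (sum_congr sum_eq_zero sum_comm sum_add_distrib mul_sum smul_sum sum_mul mem_univ sum_eq_single mem_filter sum_sub_distrib sum_neg_distrib)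
open MvPowerSeries (coeff coeff_C)
open Sum (inl inr)
open Matrix (mul_apply one_apply of_apply)
open Fintype (sum_sum_type card)

namespace Grassmann

open ExteriorAlgebra

set_option linter.unusedSectionVars false

variable {O : Type*}

/-- The Grassmann algebra with generators indexed by `O`. -/
abbrev Gr (O : Type*) : Type _ := ExteriorAlgebra ℂ (O → ℂ)

/-- The parity automorphism. -/
abbrev inv : Gr O →ₐ[ℂ] Gr O := CliffordAlgebra.involute

/-- The odd derivative `∂ / ∂θ_o`. -/
abbrev dO (o : O) : Gr O →ₗ[ℂ] Gr O :=
  CliffordAlgebra.contractLeft (LinearMap.proj o : (O → ℂ) →ₗ[ℂ] ℂ)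

/-- The generators. -/
abbrev th [DecidableEq O] (o : O) : Gr O := ExteriorAlgebra.ι ℂ (Pi.single o (1 : ℂ))

lemma inv_ι (m : O → ℂ) : inv (ExteriorAlgebra.ι ℂ m) = -ExteriorAlgebra.ι ℂ m :=
  CliffordAlgebra.involute_ι m

lemma inv_inv (a : Gr O) : inv (inv a) = a := CliffordAlgebra.involute_involute a

lemma ι_mul_eq (m : O → ℂ) (b : Gr O) : ExteriorAlgebra.ι ℂ m * b = inv b * ExteriorAlgebra.ι ℂ m :=
    by
  induction b using ExteriorAlgebra.induction with
  | algebraMap r => rw [AlgHom.commutes]; exact (Algebra.commutes r _).symm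
  | ι n =>
    rw [inv_ι, neg_mul, eq_neg_iff_add_eq_zero]
    exact ExteriorAlgebra.ι_add_mul_swap m n
  | mul a b ha hb => rw [← mul_assoc, ha, mul_assoc, hb, map_mul, mul_assoc]
  | add a b ha hb => rw [mul_add, ha, hb, map_add, add_mul]

lemma exists_even_odd (a : Gr O) : ∃ a0 a1 : Gr O, a = a0 + a1 ∧ inv a0 = a0 ∧ inv a1 = -a1 ∧
    (∀ b, a0 * b = b * a0) ∧ ∀ b, a1 * b = inv b * a1 := by
  induction a using ExteriorAlgebra.induction with
  | algebraMap r =>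
    exact ⟨algebraMap ℂ _ r, 0, by simp, AlgHom.commutes _ _, by simp,
      fun b => Algebra.commutes _ _, by simp⟩
  | ι n => exact ⟨0, ExteriorAlgebra.ι ℂ n, by simp, by simp, inv_ι n, by simp, ι_mul_eq n⟩
  | add a a' ha ha' =>
    obtain ⟨x, y, h1, h2, h3, h4, h5⟩ := ha
    obtain ⟨x', y', h1', h2', h3', h4', h5'⟩ := ha'
    refine ⟨x + x', y + y', by rw [h1, h1']; abel, by rw [map_add, h2, h2'],
      by rw [map_add, h3, h3', neg_add], fun b => by rw [add_mul, mul_add, h4, h4'],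
      fun b => by rw [add_mul, mul_add, h5, h5']⟩
  | mul a a' ha ha' =>
    obtain ⟨x, y, h1, h2, h3, h4, h5⟩ := ha
    obtain ⟨x', y', h1', h2', h3', h4', h5'⟩ := ha'
    refine ⟨x * x' + y * y', x * y' + y * x', by rw [h1, h1']; noncomm_ring,
      by rw [map_add, map_mul, map_mul, h2, h2', h3, h3']; noncomm_ring,
      by rw [map_add, map_mul, map_mul, h2, h2', h3, h3']; noncomm_ring,
      fun b => ?_, fun b => ?_⟩
    · rw [add_mul, mul_add, mul_assoc, h4', ← mul_assoc, h4, mul_assoc, mul_assoc y, h5', ←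
        mul_assoc y, h5, inv_inv, mul_assoc]
    · rw [add_mul, mul_add, mul_assoc, h5', ← mul_assoc, h4, mul_assoc, mul_assoc y, h4', ←
        mul_assoc y, h5, mul_assoc]

lemma eq_zero_of_eq_neg {M : Type*} [AddCommGroup M] [Module ℂ M] {x : M} (h : x = -x) : x = 0 := by
  have h2 : (2 : ℂ) • x = 0 := by
    rw [two_smul]; nth_rw 1 [h]; exact neg_add_cancel x
  exact (smul_eq_zero.mp h2).resolve_left two_ne_zero

lemma even_mul {a : Gr O} (h : inv a = a) (b : Gr O) : a * b = b * a := by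
  obtain ⟨x, y, h1, h2, h3, h4, h5⟩ := exists_even_odd a
  have : y = 0 := by
    rw [h1, map_add, h2, h3] at h
    exact eq_zero_of_eq_neg (add_left_cancel h).symm
  rw [h1, this, add_zero, h4]

lemma odd_mul {a : Gr O} (h : inv a = -a) (b : Gr O) : a * b = inv b * a := by
  obtain ⟨x, y, h1, h2, h3, h4, h5⟩ := exists_even_odd a
  have : x = 0 := by
    rw [h1, map_add, h2, h3, neg_add] at h
    exact eq_zero_of_eq_neg (add_right_cancel h)
  rw [h1, this, zero_add, h5]

lemma dO_algebraMap (o : O) (r : ℂ) : dO o (algebraMap ℂ (Gr O) r) = 0 :=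
  CliffordAlgebra.contractLeft_algebraMap (Q := (0 : QuadraticForm ℂ (O → ℂ))) _ r

lemma dO_ι (o : O) (n : O → ℂ) : dO o (ExteriorAlgebra.ι ℂ n) = algebraMap ℂ (Gr O) (n o) :=
  CliffordAlgebra.contractLeft_ι (Q := (0 : QuadraticForm ℂ (O → ℂ))) _ n

lemma dO_mul (o : O) (a b : Gr O) : dO o (a * b) = dO o a * b + inv a * dO o b := by
  induction a using ExteriorAlgebra.induction generalizing b with
  | algebraMap r =>
    rw [AlgHom.commutes]
    rw [dO_algebraMap, zero_mul, zero_add]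
    exact CliffordAlgebra.contractLeft_algebraMap_mul _ _ _
  | ι n =>
    rw [dO_ι, inv_ι]
    have := CliffordAlgebra.contractLeft_ι_mul (Q := (0 : QuadraticForm ℂ (O → ℂ)))
      (LinearMap.proj o : (O → ℂ) →ₗ[ℂ] ℂ) n b
    refine this.trans ?_
    rw [Algebra.smul_def, neg_mul, sub_eq_add_neg]; rfl
  | mul a a' ha ha' => rw [mul_assoc, ha, ha', ha, map_mul]; noncomm_ring
  | add a a' ha ha' => rw [add_mul, map_add, ha, ha', map_add, map_add]; noncomm_ring

lemma dO_inv (o : O) (a : Gr O) : dO o (inv a) = -inv (dO o a) := by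
  induction a using ExteriorAlgebra.induction with
  | algebraMap r =>
    rw [AlgHom.commutes]
    rw [dO_algebraMap, map_zero, neg_zero]
  | ι n =>
    rw [inv_ι, map_neg, dO_ι, AlgHom.commutes]
  | mul a a' ha ha' =>
    rw [map_mul, dO_mul, dO_mul, ha, ha', map_add, map_mul, map_mul]; noncomm_ring
  | add a a' ha ha' => rw [map_add, map_add, ha, ha', map_add, map_add, neg_add]

lemma dO_comm (o o' : O) (a : Gr O) : dO o (dO o' a) = -dO o' (dO o a) :=
  CliffordAlgebra.contractLeft_comm _ _ _

lemma dO_th [DecidableEq O] (o o' : O) : dO o (th o') = algebraMap ℂ (Gr O)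
    (if o = o' then 1 else 0) := by
  rw [dO_ι, Pi.single_apply]

/-- The value at `θ = 0`. -/
abbrev bod : Gr O →ₐ[ℂ] ℂ := ExteriorAlgebra.algebraMapInv

lemma bod_ι (m : O → ℂ) : bod (ExteriorAlgebra.ι ℂ m) = 0 := by
  simp [ExteriorAlgebra.algebraMapInv]

variable [Fintype O] [DecidableEq O]

/-- The weight operator `∑ w(o) θ_o ∂_o`. -/
def wtOp (w : O → ℤ) : Gr O →ₗ[ℂ] Gr O :=
  ∑ o, (w o : ℂ) • (LinearMap.mulLeft ℂ (th o)).comp (dO o)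

lemma wtOp_apply (w : O → ℤ) (a : Gr O) : wtOp w a = ∑ o, (w o : ℂ) • (th o * dO o a) := by
  simp [wtOp]

lemma wtOp_mul (w : O → ℤ) (a b : Gr O) : wtOp w (a * b) = wtOp w a * b + a * wtOp w b := by
  simp only [wtOp_apply, sum_mul, mul_sum, ← sum_add_distrib]
  refine sum_congr rfl fun o _ => ?_
  rw [dO_mul, mul_add, smul_add, ← mul_assoc, ← mul_assoc (th o), ι_mul_eq _ (inv a), inv_inv,
    mul_assoc a, smul_mul_assoc, mul_smul_comm]

lemma wtOp_th (w : O → ℤ) (o : O) : wtOp w (th o) = (w o : ℂ) • th o := by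
  rw [wtOp_apply, sum_eq_single o]
  · rw [dO_th, if_pos rfl, map_one, mul_one]
  · intro o' _ h; rw [dO_th, if_neg h, map_zero, mul_zero, smul_zero]
  · simp

lemma wtOp_algebraMap (w : O → ℤ) (r : ℂ) : wtOp w (algebraMap ℂ (Gr O) r) = 0 := by
  rw [wtOp_apply]
  refine sum_eq_zero fun o _ => ?_
  rw [dO_algebraMap, mul_zero, smul_zero]

lemma wtOp_dO (w : O → ℤ) (o : O) (a : Gr O) : wtOp w (dO o a) = dO o (wtOp w a) - (w o : ℂ) • dO o
    a := by
  rw [wtOp_apply, wtOp_apply, map_sum, eq_sub_iff_add_eq]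
  have : ∀ o', dO o ((w o' : ℂ) • (th o' * dO o' a)) = (w o' : ℂ) • (th o' * dO o' (dO o a)) +
      if o = o' then (w o : ℂ) • dO o a else 0 := by
    intro o'
    rw [map_smul, dO_mul, dO_th, inv_ι, dO_comm o o']
    split_ifs with h
    · subst h; rw [map_one, one_mul, smul_add, add_comm]; simp
    · simp
  rw [sum_congr rfl fun o' _ => this o', sum_add_distrib]
  simp

lemma wtOp_list (w : O → ℤ) (l : List O) : wtOp w (l.map th).prod = (((l.map w).sum : ℤ) : ℂ) •
    (l.map th).prod := by
  induction l with
  | nil =>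
    have := wtOp_algebraMap w (1 : ℂ)
    rw [map_one] at this
    simp [this]
  | cons o l ih =>
    rw [List.map_cons, List.prod_cons, wtOp_mul, ih, wtOp_th, List.map_cons, List.sum_cons]
    push_cast
    rw [add_smul, smul_mul_assoc, mul_smul_comm]

/-- A basis of ordered monomials. -/
def IsMono (b : Module.Basis (Finset O) ℂ (Gr O)) : Prop :=
  ∀ S, ∃ l : List O, l.Nodup ∧ l.toFinset = S ∧ b S = (l.map th).prod

lemma isMono_exteriorAlgebra (lo : LinearOrder O) : IsMono
    (Module.Basis.ExteriorAlgebra (Pi.basisFun ℂ O)) := by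
  intro S
  let emb := Set.powersetCard.ofFinEmbEquiv.symm (Set.powersetCard.ofCard (rfl : S.card = S.card))
  refine ⟨List.ofFn emb, List.nodup_ofFn.mpr emb.injective, ?_, ?_⟩
  · ext o
    rw [List.mem_toFinset, List.mem_ofFn]
    exact Set.powersetCard.mem_range_ofFinEmbEquiv_symm_iff_mem _ _
  · rw [ExteriorAlgebra.basis_apply_ofCard _ (rfl : S.card = S.card)]
    change ExteriorAlgebra.ιMulti ℂ _ (_ ∘ _) = _
    rw [ExteriorAlgebra.ιMulti_apply, List.map_ofFn]
    congr 2
    funext i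
    simp only [Function.comp_apply]
    congr 1
    funext o
    rw [Pi.basisFun_apply, Pi.single_apply]

lemma exists_isMono : ∃ b : Module.Basis (Finset O) ℂ (Gr O), IsMono b :=
  ⟨_, isMono_exteriorAlgebra (LinearOrder.lift' (Fintype.equivFin O) (Fintype.equivFin
    O).injective)⟩

/-- The span of the elements with weight in `T`. -/
def K (w : O → ℤ) (T : Set ℤ) : Submodule ℂ (Gr O) :=
  Submodule.span ℂ {v | ∃ u ∈ T, wtOp w v = (u : ℂ) • v}

lemma repr_wtOp {b : Module.Basis (Finset O) ℂ (Gr O)} (hb : IsMono b) (w : O → ℤ) (v : Gr O)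
    (S : Finset O) : b.repr (wtOp w v) S = ((∑ o ∈ S, w o : ℤ) : ℂ) * b.repr v S := by
  have hS : ∀ S, wtOp w (b S) = ((∑ o ∈ S, w o : ℤ) : ℂ) • b S := by
    intro S
    obtain ⟨l, hl, rfl, h⟩ := hb S
    rw [h, wtOp_list, List.sum_toFinset _ hl]
  conv_lhs => rw [← b.sum_repr v]
  simp only [map_sum, map_smul, hS, Finsupp.coe_finsetSum, Finset.sum_apply, Finsupp.smul_apply,
    b.repr_self, Finsupp.single_apply, smul_eq_mul]
  rw [sum_eq_single S]
  · simp; ring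
  · intro S' _ h; simp [h]
  · simp

lemma mem_K_iff {b : Module.Basis (Finset O) ℂ (Gr O)} (hb : IsMono b) {w : O → ℤ} {T : Set ℤ}
    {v : Gr O} : v ∈ K w T ↔ ∀ S, b.repr v S ≠ 0 → ∑ o ∈ S, w o ∈ T := by
  constructor
  · intro h
    induction h using Submodule.span_induction with
    | mem v hv =>
      obtain ⟨u, hu, h⟩ := hv
      intro S hS
      have := repr_wtOp hb w v S
      rw [h, map_smul, Finsupp.smul_apply, smul_eq_mul] at this
      have := mul_right_cancel₀ hS this
      rw [← Int.cast_injective this]; exact hu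
    | zero => simp
    | add x y _ _ hx hy =>
      intro S hS
      by_cases h : b.repr x S = 0
      · refine hy S fun h' => hS ?_
        rw [map_add, Finsupp.add_apply, h, h', add_zero]
      · exact hx S h
    | smul c x _ hx =>
      intro S hS
      refine hx S fun h => hS ?_
      rw [map_smul, Finsupp.smul_apply, h, smul_zero]
  · intro h
    rw [← b.sum_repr v]
    refine sum_mem fun S _ => ?_
    by_cases h0 : b.repr v S = 0
    · rw [h0, zero_smul]; exact zero_mem _
    · refine Submodule.smul_mem _ _ (Submodule.subset_span ⟨_, h S h0, ?_⟩)
      obtain ⟨l, hl, rfl, hl'⟩ := hb S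
      rw [hl', wtOp_list, List.sum_toFinset _ hl]

lemma mem_K_of_wtOp {w : O → ℤ} {T : Set ℤ} {v : Gr O} {u : ℤ} (h : wtOp w v = (u : ℂ) • v)
    (hu : u ∈ T) : v ∈ K w T := Submodule.subset_span ⟨u, hu, h⟩

lemma K_mono {w : O → ℤ} {T T' : Set ℤ} (h : T ⊆ T') : K w T ≤ K w T' :=
  Submodule.span_mono fun _ ⟨u, hu, e⟩ => ⟨u, h hu, e⟩

lemma K_disjoint {w : O → ℤ} {T T' : Set ℤ} (h : Disjoint T T') {v : Gr O} (h1 : v ∈ K w T)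
    (h2 : v ∈ K w T') : v = 0 := by
  obtain ⟨b, hb⟩ := exists_isMono (O := O)
  rw [mem_K_iff hb] at h1 h2
  refine b.repr.injective (Finsupp.ext fun S => ?_)
  rw [map_zero, Finsupp.zero_apply]
  by_contra h0
  exact Set.disjoint_left.mp h (h1 S h0) (h2 S h0)

lemma K_mul {w : O → ℤ} {T T' T'' : Set ℤ} (hT : ∀ u ∈ T, ∀ u' ∈ T', u + u' ∈ T'') {v v' : Gr O}
    (h1 : v ∈ K w T) (h2 : v' ∈ K w T') : v * v' ∈ K w T'' := by
  induction h1, h2 using Submodule.span_induction₂ with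
  | mem_mem x y hx hy =>
    obtain ⟨u, hu, h⟩ := hx
    obtain ⟨u', hu', h'⟩ := hy
    refine mem_K_of_wtOp (u := u + u') ?_ (hT _ hu _ hu')
    rw [wtOp_mul, h, h', smul_mul_assoc, mul_smul_comm, ← add_smul]; push_cast; rfl
  | zero_left => rw [zero_mul]; exact zero_mem _
  | zero_right => rw [mul_zero]; exact zero_mem _
  | add_left _ _ _ _ _ _ h h' => rw [add_mul]; exact add_mem h h'
  | add_right _ _ _ _ _ _ h h' => rw [mul_add]; exact add_mem h h'
  | smul_left r _ _ _ _ h => rw [smul_mul_assoc]; exact Submodule.smul_mem _ _ h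
  | smul_right r _ _ _ _ h => rw [mul_smul_comm]; exact Submodule.smul_mem _ _ h

lemma K_inv {w : O → ℤ} {T : Set ℤ} {v : Gr O} (h : v ∈ K w T) : inv v ∈ K w T := by
  induction h using Submodule.span_induction with
  | mem v hv =>
    obtain ⟨u, hu, e⟩ := hv
    refine mem_K_of_wtOp (u := u) ?_ hu
    rw [← map_smul, ← e, wtOp_apply, wtOp_apply, map_sum]
    exact sum_congr rfl fun o _ => by rw [map_smul, map_mul, inv_ι, dO_inv, mul_neg, neg_mul]
  | zero => rw [map_zero]; exact zero_mem _
  | add a b _ _ ha hb => rw [map_add]; exact add_mem ha hb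
  | smul c a _ ha => rw [map_smul]; exact Submodule.smul_mem _ _ ha

lemma K_dO {w : O → ℤ} {T T' : Set ℤ} (o : O) (hT : ∀ u ∈ T, u - w o ∈ T') {v : Gr O}
    (h : v ∈ K w T) : dO o v ∈ K w T' := by
  induction h using Submodule.span_induction with
  | mem v hv =>
    obtain ⟨u, hu, h⟩ := hv
    refine mem_K_of_wtOp (u := u - w o) ?_ (hT _ hu)
    rw [wtOp_dO, h, map_smul, ← sub_smul]; push_cast; rfl
  | zero => rw [map_zero]; exact zero_mem _
  | add x y _ _ hx hy => rw [map_add]; exact add_mem hx hy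
  | smul c x _ hx => rw [map_smul]; exact Submodule.smul_mem _ _ hx

lemma bod_list (l : List O) (h : l ≠ []) : bod (l.map th).prod = 0 := by
  cases l with
  | nil => exact absurd rfl h
  | cons o l => rw [List.map_cons, List.prod_cons, map_mul, bod_ι, zero_mul]

lemma repr_empty {b : Module.Basis (Finset O) ℂ (Gr O)} (hb : IsMono b) (v : Gr O) : b.repr v ∅ =
    bod v := by
  conv_rhs => rw [← b.sum_repr v]
  rw [map_sum, sum_eq_single ∅]
  · obtain ⟨l, hl, h1, h⟩ := hb ∅
    rw [List.toFinset_eq_empty_iff] at h1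
    subst h1
    rw [map_smul, h]; simp
  · intro S _ hS
    obtain ⟨l, hl, h1, h⟩ := hb S
    rw [map_smul, h, bod_list, smul_zero]
    rintro rfl; exact hS (by simpa using h1.symm)
  · simp

/-- The `k`-th power of the augmentation ideal. -/
def aug (k : ℕ) : Submodule ℂ (Gr O) := K (fun _ => 1) (Set.Ici (k : ℤ))

lemma mem_aug_one {v : Gr O} (h : bod v = 0) : v ∈ aug (O := O) 1 := by
  obtain ⟨b, hb⟩ := exists_isMono (O := O)
  rw [aug, mem_K_iff hb]
  intro S hS
  have : S.Nonempty := by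
    rw [Finset.nonempty_iff_ne_empty]; rintro rfl
    rw [repr_empty hb, h] at hS; exact hS rfl
  simpa using Finset.card_pos.mpr this

lemma aug_eq_zero {k : ℕ} (hk : card O < k) {v : Gr O} (h : v ∈ aug (O := O) k) :
    v = 0 := by
  obtain ⟨b, hb⟩ := exists_isMono (O := O)
  rw [aug, mem_K_iff hb] at h
  refine b.repr.injective (Finsupp.ext fun S => ?_)
  rw [map_zero, Finsupp.zero_apply]
  by_contra h0
  have := h S h0
  simp only [Finset.sum_const, nsmul_eq_mul, mul_one, Set.mem_Ici, Nat.cast_le] at this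
  exact absurd (this.trans (Finset.card_le_univ S)) (not_le.mpr hk)

lemma aug_mul {k l : ℕ} {v v' : Gr O} (h : v ∈ aug (O := O) k) (h' : v' ∈ aug (O := O) l) :
    v * v' ∈ aug (O := O) (k + l) := by
  refine K_mul (fun u hu u' hu' => ?_) h h'
  simp only [Set.mem_Ici] at *; push_cast; omega

lemma mem_aug_zero (v : Gr O) : v ∈ aug (O := O) 0 := by
  obtain ⟨b, hb⟩ := exists_isMono (O := O)
  rw [aug, mem_K_iff hb]
  intro S _; simp

lemma aug_anti {k l : ℕ} (h : k ≤ l) : aug (O := O) l ≤ aug k :=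
  K_mono (Set.Ici_subset_Ici.mpr (by exact_mod_cast h))

end Grassmann

open BV

lemma sgn_add (p q : ZMod 2) : sgn (p + q) = sgn p * sgn q := by
  have h : ∀ x : ZMod 2, x = 0 ∨ x = 1 := by decide
  rcases h p with rfl | rfl <;> rcases h q with rfl | rfl <;>
    simp [sgn, show (1 : ZMod 2) + 1 = 0 from rfl]

lemma sgn_zero : sgn 0 = 1 := by simp [sgn]

lemma sgn_one : sgn 1 = -1 := by simp [sgn]

lemma sgn_mul_self (p : ZMod 2) : sgn p * sgn p = 1 := by
  rw [← sgn_add, CharTwo.add_self_eq_zero, sgn_zero]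

lemma sgn_ne_zero (p : ZMod 2) : sgn p ≠ 0 := left_ne_zero_of_mul_eq_one (sgn_mul_self p)

lemma sgn_smul_smul {M : Type*} [AddCommGroup M] [Module ℂ M] (p q : ZMod 2) (a : M) : sgn p • sgn
    q • a = sgn (p + q) • a := by rw [smul_smul, sgn_add]

lemma neg_eq_sgn_smul {M : Type*} [AddCommGroup M] [Module ℂ M] (a : M) : -a = sgn 1 • a := by
  rw [sgn_one, neg_one_smul]

/-- Left derivatives on a supercommutative algebra with parity automorphism `σ`. -/
structure SuperCalc (R : Type*) [Ring R] [Algebra ℂ R] {Z : Type*} (p : Z → ZMod 2) where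
  σ : R →ₐ[ℂ] R
  σσ : ∀ a, σ (σ a) = a
  even_mul : ∀ a b, σ a = a → a * b = b * a
  odd_mul : ∀ a b, σ a = -a → a * b = σ b * a
  ld : Z → R →ₗ[ℂ] R
  ld_mul : ∀ z a b, ld z (a * b) = ld z a * b + (if p z = 0 then a else σ a) * ld z b
  ld_σ : ∀ z a, ld z (σ a) = sgn (p z) • σ (ld z a)
  ld_comm : ∀ z w a, ld z (ld w a) = sgn (p z * p w) • ld w (ld z a)

namespace SuperCalc

variable {R : Type*} [Ring R] [Algebra ℂ R] {Z : Type*} {p : Z → ZMod 2} (C : SuperCalc R p)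

/-- The power `σ ^ q`. -/
def tw (q : ZMod 2) (a : R) : R := if q = 0 then a else C.σ a

/-- `a` is homogeneous of parity `q`. -/
def Hom (q : ZMod 2) (a : R) : Prop := C.σ a = sgn q • a

variable {C} {q r : ZMod 2} {a b : R}

lemma Hom.tw (h : C.Hom r a) (q : ZMod 2) : C.tw q a = sgn (q * r) • a := by
  unfold SuperCalc.tw
  split_ifs with h0
  · rw [h0, zero_mul, sgn_zero, one_smul]
  · rw [h, (show q = 1 by revert q; decide), one_mul]

lemma tw_mul (q : ZMod 2) (a b : R) : C.tw q (a * b) = C.tw q a * C.tw q b := by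
  unfold SuperCalc.tw; split_ifs <;> simp

lemma Hom.mul (h : C.Hom q a) (h' : C.Hom r b) : C.Hom (q + r) (a * b) := by
  unfold Hom at *
  rw [map_mul, h, h', smul_mul_smul_comm, sgn_add]

lemma Hom.add (h : C.Hom q a) (h' : C.Hom q b) : C.Hom q (a + b) := by
  unfold Hom at *
  rw [map_add, h, h', smul_add]

lemma Hom.neg (h : C.Hom q a) : C.Hom q (-a) := by
  unfold Hom at *
  rw [map_neg, h, smul_neg]

lemma Hom.sub (h : C.Hom q a) (h' : C.Hom q b) : C.Hom q (a - b) := by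
  rw [sub_eq_add_neg]; exact h.add h'.neg

lemma Hom.smul (h : C.Hom q a) (c : ℂ) : C.Hom q (c • a) := by
  unfold Hom at *
  rw [map_smul, h, smul_comm]

lemma Hom.zero : C.Hom q 0 := by unfold Hom; rw [map_zero, smul_zero]

lemma Hom.one : C.Hom 0 1 := by unfold Hom; rw [map_one, sgn_zero, one_smul]

lemma Hom.sum {ι : Type*} {s : Finset ι} {f : ι → R} (h : ∀ i ∈ s, C.Hom q (f i)) : C.Hom q
    (∑ i ∈ s, f i) := by
  unfold Hom at *
  rw [map_sum, smul_sum]; exact sum_congr rfl h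

lemma Hom.cast (h : C.Hom q a) (e : q = r) : C.Hom r a := e ▸ h

lemma hom_zero_iff : C.Hom 0 a ↔ C.σ a = a := by unfold Hom; rw [sgn_zero, one_smul]

lemma Hom.mul_eq_tw (h : C.Hom q a) (b : R) : a * b = C.tw q b * a := by
  unfold SuperCalc.tw
  split_ifs with h0
  · subst h0; exact C.even_mul _ _ (hom_zero_iff.mp h)
  · refine C.odd_mul _ _ ?_
    rw [h, (show q = 1 by have := ‹¬q = 0›; clear h; revert q; decide), sgn_one, neg_one_smul]

lemma Hom.comm (h : C.Hom q a) (h' : C.Hom r b) : a * b = sgn (q * r) • (b * a) := by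
  rw [h.mul_eq_tw, h'.tw, smul_mul_assoc]

lemma Hom.comm_of (h : C.Hom q a) (h' : C.Hom r b) (e : q * r = 0) : a * b = b * a := by
  rw [h.comm h', e, sgn_zero, one_smul]

lemma ld_mul' (z : Z) (a b : R) : C.ld z (a * b) = C.ld z a * b + C.tw (p z) a * C.ld z b :=
  C.ld_mul z a b

lemma Hom.ld (h : C.Hom q a) (z : Z) : C.Hom (p z + q) (C.ld z a) := by
  unfold Hom at *
  have := C.ld_σ z a
  rw [h, map_smul] at this
  rw [sgn_add, ← smul_smul, this, smul_smul, sgn_mul_self, one_smul]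

lemma exists_hom_add (C : SuperCalc R p) (a : R) : ∃ a0 a1, C.Hom 0 a0 ∧ C.Hom 1 a1 ∧ a = a0 + a1 :=
    by
  refine ⟨(2⁻¹ : ℂ) • (a + C.σ a), (2⁻¹ : ℂ) • (a - C.σ a), ?_, ?_, ?_⟩
  · rw [hom_zero_iff, map_smul, map_add, C.σσ, add_comm]
  · unfold Hom
    rw [map_smul, map_sub, C.σσ, sgn_one, neg_one_smul, ← smul_neg, neg_sub]
  · rw [← smul_add, show a + C.σ a + (a - C.σ a) = (2 : ℂ) • a by rw [two_smul]; abel, smul_smul]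
    norm_num

variable (C) in
/-- The right derivative. -/
def rd (z : Z) : R →ₗ[ℂ] R :=
  if p z = 0 then C.ld z else -(C.ld z).comp C.σ.toLinearMap

lemma Hom.rd_eq (h : C.Hom q a) (z : Z) : C.rd z a = sgn (p z * (q + 1)) • C.ld z a := by
  unfold SuperCalc.rd
  split_ifs with h0
  · rw [h0, zero_mul, sgn_zero, one_smul]
  · rw [(show p z = 1 by generalize p z = x at *; revert x; decide), one_mul, sgn_add, sgn_one,
      mul_neg_one, neg_smul]
    simp only [LinearMap.neg_apply, LinearMap.comp_apply, AlgHom.toLinearMap_apply]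
    rw [h, map_smul]

lemma Hom.rd (h : C.Hom q a) (z : Z) : C.Hom (p z + q) (C.rd z a) := by
  rw [h.rd_eq]; exact (h.ld z).smul _

lemma rd_mul (z : Z) (a b : R) : C.rd z (a * b) = a * C.rd z b + C.rd z a * C.tw (p z) b := by
  unfold SuperCalc.rd SuperCalc.tw
  split_ifs with h0
  · rw [C.ld_mul, if_pos h0, add_comm]
  · simp only [LinearMap.neg_apply, LinearMap.comp_apply, AlgHom.toLinearMap_apply]
    rw [map_mul, C.ld_mul, if_neg h0, C.σσ]; noncomm_ring

lemma ld_rd (z w : Z) (a : R) : C.ld z (C.rd w a) = C.rd w (C.ld z a) := by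
  unfold SuperCalc.rd
  split_ifs with h0
  · rw [C.ld_comm, h0, mul_zero, sgn_zero, one_smul]
  · simp only [LinearMap.neg_apply, LinearMap.comp_apply, AlgHom.toLinearMap_apply, map_neg]
    rw [C.ld_comm, C.ld_σ z, map_smul, (show p w = 1 by generalize p w = x at *; revert x; decide),
      mul_one, smul_smul, sgn_mul_self, one_smul]

lemma rd_comm (z w : Z) (a : R) : C.rd z (C.rd w a) = sgn (p z * p w) • C.rd w (C.rd z a) := by
  obtain ⟨a0, a1, h0, h1, rfl⟩ := C.exists_hom_add a
  have key : ∀ {q : ZMod 2} {b : R}, C.Hom q b →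
      C.rd z (C.rd w b) = sgn (p z * p w) • C.rd w (C.rd z b) := by
    intro q b h
    rw [(h.rd w).rd_eq, (h.rd z).rd_eq, h.rd_eq, h.rd_eq, map_smul, map_smul, C.ld_comm z w]
    simp only [sgn_smul_smul]
    congr 2
    generalize p z = x; generalize p w = y; clear * -; revert x y q; decide
  simp only [map_add, key h0, key h1, smul_add]

lemma ld_one (z : Z) : C.ld z 1 = 0 := by
  have := C.ld_mul z 1 1
  rw [map_one C.σ, ite_self, mul_one, mul_one, one_mul] at this
  exact left_eq_add.mp this

lemma ld_algebraMap (z : Z) (c : ℂ) : C.ld z (algebraMap ℂ R c) = 0 := by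
  rw [Algebra.algebraMap_eq_smul_one, map_smul, ld_one, smul_zero]

lemma rd_algebraMap (z : Z) (c : ℂ) : C.rd z (algebraMap ℂ R c) = 0 := by
  have : C.Hom 0 (algebraMap ℂ R c) := by rw [hom_zero_iff, AlgHom.commutes]
  rw [this.rd_eq, ld_algebraMap, smul_zero]

section Bracket

variable {ι : Type*} [Fintype ι] (c : ι → Z) (E : ι → ι → R)

variable (C) in
/-- The bracket of the bivector `E`. -/
def br (f g : R) : R := ∑ i, ∑ j, C.rd (c i) f * E i j * C.ld (c j) g

variable (C) in
/-- The parities and graded antisymmetry of an odd bivector. -/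
structure OddBivector : Prop where
  hom : ∀ i j, C.Hom (p (c i) + p (c j) + 1) (E i j)
  skew : ∀ i j, E j i = -(sgn ((p (c i) + 1) * (p (c j) + 1)) • E i j)

variable {c E} {f g h : R} (hE : C.OddBivector c E)

lemma br_add_left (f f' g : R) : C.br c E (f + f') g = C.br c E f g + C.br c E f' g := by
  simp only [br, map_add, add_mul, sum_add_distrib]

lemma br_add_right (f g g' : R) : C.br c E f (g + g') = C.br c E f g + C.br c E f g' := by
  simp only [br, map_add, mul_add, sum_add_distrib]

lemma br_smul_left (k : ℂ) (f g : R) : C.br c E (k • f) g = k • C.br c E f g := by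
  simp only [br, map_smul, smul_mul_assoc, smul_sum]

lemma br_smul_right (k : ℂ) (f g : R) : C.br c E f (k • g) = k • C.br c E f g := by
  simp only [br, map_smul, mul_smul_comm, smul_sum]

lemma br_sum_right {κ : Type*} (s : Finset κ) (f : R) (g : κ → R) : C.br c E f (∑ k ∈ s, g k) = ∑
    k ∈ s, C.br c E f (g k) := by
  classical
  induction s using Finset.induction_on with
  | empty => simp [br]
  | insert a s ha ih => rw [Finset.sum_insert ha, br_add_right, ih, Finset.sum_insert ha]

lemma br_sum_left {κ : Type*} (s : Finset κ) (f : κ → R) (g : R) : C.br c E (∑ k ∈ s, f k) g = ∑ k ∈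
    s, C.br c E (f k) g := by
  classical
  induction s using Finset.induction_on with
  | empty => simp [br]
  | insert a s ha ih => rw [Finset.sum_insert ha, br_add_left, ih, Finset.sum_insert ha]

lemma br_neg_right (f g : R) : C.br c E f (-g) = -C.br c E f g := by
  rw [← neg_one_smul ℂ, br_smul_right, neg_one_smul]

lemma br_neg_left (f g : R) : C.br c E (-f) g = -C.br c E f g := by
  rw [← neg_one_smul ℂ, br_smul_left, neg_one_smul]

lemma br_sub_right (f g g' : R) : C.br c E f (g - g') = C.br c E f g - C.br c E f g' := by
  rw [sub_eq_add_neg, br_add_right, br_neg_right, sub_eq_add_neg]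

lemma br_sub_left (f f' g : R) : C.br c E (f - f') g = C.br c E f g - C.br c E f' g := by
  rw [sub_eq_add_neg, br_add_left, br_neg_left, sub_eq_add_neg]

include hE

lemma OddBivector.br_hom (hf : C.Hom q f) (hg : C.Hom r g) : C.Hom (q + r + 1) (C.br c E f g) :=
  Hom.sum fun i _ => Hom.sum fun j _ => (((hf.rd _).mul (hE.hom i j)).mul (hg.ld _)).cast (by
    generalize p (c i) = x; generalize p (c j) = y; clear * -; revert x y q r; decide)

lemma OddBivector.br_skew (hf : C.Hom q f) (hg : C.Hom r g) : C.br c E f g =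
    -(sgn ((q + 1) * (r + 1)) • C.br c E g f) := by
  simp only [br, smul_sum, ← sum_neg_distrib]
  rw [sum_comm]
  refine sum_congr rfl fun j _ => sum_congr rfl fun i _ => ?_
  have h1 := hE.hom i j
  rw [hE.skew i j, hf.rd_eq, hg.rd_eq, smul_mul_assoc, smul_mul_assoc, smul_mul_assoc,
    smul_mul_assoc, mul_neg, mul_smul_comm, neg_mul, smul_mul_assoc, smul_neg, smul_neg, neg_neg,
    mul_assoc, (hf.ld (c i)).comm (h1.mul (hg.ld (c j))), h1.comm (hg.ld (c j)), smul_mul_assoc]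
  simp only [sgn_smul_smul]
  congr 2
  generalize p (c i) = x; generalize p (c j) = y; clear * -; revert x y q r; decide

lemma OddBivector.br_mul_right (hf : C.Hom q f) (hg : C.Hom r g) (h : R) : C.br c E f (g * h) = C.br
    c E f g * h + sgn (r * (q + 1)) • (g * C.br c E f h) := by
  simp only [br, sum_mul, mul_sum, smul_sum, ← sum_add_distrib]
  refine sum_congr rfl fun i _ => sum_congr rfl fun j _ => ?_
  rw [ld_mul', mul_add, hg.tw, ← mul_assoc, smul_mul_assoc, mul_smul_comm, ← mul_assoc, ((hf.rd (c
    i)).mul (hE.hom i j)).comm hg, smul_mul_assoc, sgn_smul_smul, mul_assoc g]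
  congr 3
  generalize p (c i) = x; generalize p (c j) = y; clear * -; revert x y q r; decide

lemma OddBivector.br_mul_left (hg : C.Hom 0 g) (f h : R) : C.br c E (f * h) g = f * C.br c E h g +
    C.br c E f g * C.σ h := by
  simp only [br, sum_mul, mul_sum, ← sum_add_distrib]
  refine sum_congr rfl fun i _ => sum_congr rfl fun j _ => ?_
  have key : ∀ {r : ZMod 2} {h : R}, C.Hom r h → C.rd (c i) f * C.tw (p (c i)) h * E i j *
      C.ld (c j) g = C.rd (c i) f * E i j * C.ld (c j) g * C.σ h := by
    intro r h hh
    rw [mul_assoc _ (C.tw _ _), mul_assoc _ (C.tw _ _ * _), hh.tw, smul_mul_assoc, smul_mul_assoc,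
      mul_assoc h, hh.comm ((hE.hom i j).mul (hg.ld (c j))), sgn_smul_smul, hh, mul_smul_comm,
      mul_smul_comm, mul_assoc, mul_assoc, mul_assoc]
    congr 2
    generalize p (c i) = x; generalize p (c j) = y; clear * -; revert x y r; decide
  obtain ⟨h0, h1, e0, e1, rfl⟩ := C.exists_hom_add h
  rw [rd_mul, add_mul, add_mul]
  congr 1
  · simp only [mul_assoc]
  · have : C.tw (p (c i)) (h0 + h1) = C.tw (p (c i)) h0 + C.tw (p (c i)) h1 := by
      unfold SuperCalc.tw; split_ifs <;> simp
    rw [this, mul_add, add_mul, add_mul, key e0, key e1, map_add, mul_add]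

lemma OddBivector.ld_br {u : Z} (hu : ∀ i j, C.ld u (E i j) = 0) (hf : C.Hom q f) (g : R) : C.ld u
    (C.br c E f g) = C.br c E (C.ld u f) g + sgn (p u * (q + 1)) • C.br c E f (C.ld u g) := by
  simp only [br, map_sum, smul_sum, ← sum_add_distrib]
  refine sum_congr rfl fun i _ => sum_congr rfl fun j _ => ?_
  rw [ld_mul', ld_mul', hu, mul_zero, add_zero, ld_rd, ((hf.rd (c i)).mul (hE.hom i j)).tw,
    C.ld_comm u, smul_mul_assoc, mul_smul_comm, sgn_smul_smul]
  congr 3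
  generalize p (c i) = x; generalize p (c j) = y; generalize p u = z; clear * -; revert x y z q; decide

lemma OddBivector.rd_br {v : Z} (hv : ∀ i j, C.ld v (E i j) = 0) (f : R) (hg : C.Hom r g) : C.rd v
    (C.br c E f g) = C.br c E f (C.rd v g) + sgn (p v * (r + 1)) • C.br c E (C.rd v f) g := by
  simp only [br, map_sum, smul_sum, ← sum_add_distrib]
  refine sum_congr rfl fun i _ => sum_congr rfl fun j _ => ?_
  rw [rd_mul, rd_mul, (hE.hom i j).rd_eq, hv, smul_zero, mul_zero, zero_add, ld_rd, (hg.ld (c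
    j)).tw, (hE.hom i j).tw, rd_comm v, mul_smul_comm, mul_smul_comm]
  simp only [smul_mul_assoc, sgn_smul_smul]
  congr 3
  generalize p (c i) = x; generalize p (c j) = y; generalize p v = z; clear * -; revert x y z r; decide

lemma OddBivector.br_rd_self {v : Z} (hv : ∀ i j, C.ld v (E i j) = 0) (hf : C.Hom 0 f)
    (h0 : C.br c E f f = 0) : C.br c E f (C.rd v f) = 0 := by
  have h1 := hE.rd_br hv f hf
  rw [h0, map_zero, hE.br_skew (hf.rd v) hf, smul_neg, sgn_smul_smul, neg_eq_sgn_smul,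
    sgn_smul_smul] at h1
  rw [show p v * (0 + 1) + (p v + 0 + 1) * (0 + 1) = 1 by generalize p v = x; revert x; decide,
    CharTwo.add_self_eq_zero, sgn_zero, one_smul, ← two_smul ℂ] at h1
  exact (smul_eq_zero.mp h1.symm).resolve_left two_ne_zero

lemma OddBivector.hessian_br {u v : Z} (hu : ∀ i j, C.ld u (E i j) = 0)
    (hv : ∀ i j, C.ld v (E i j) = 0) (hf : C.Hom 0 f) (h0 : C.br c E f f = 0) : C.br c E (C.ld u f)
    (C.rd v f) + sgn (p u) • C.br c E f (C.ld u (C.rd v f)) = 0 := by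
  have h1 := hE.ld_br hu hf (C.rd v f)
  rw [hE.br_rd_self hv hf h0, map_zero, zero_add, mul_one] at h1
  exact h1.symm

end Bracket

end SuperCalc

open Finsupp (single)
open MvPowerSeries (ext)
open Finset.HasAntidiagonal (antidiagonal mem_antidiagonal)
open Grassmann TopologicalSpace

lemma fderiv_sum_mul_const {E : Type*} [NormedAddCommGroup E] [NormedSpace ℝ E] {ι : Type*}
    [Fintype ι] {φ : ι → E → ℂ} (c : ι → ℂ) {x : E} (v : E) (h : ∀ i, DifferentiableAt ℝ (φ i) x) :
    fderiv ℝ (fun y => ∑ i, φ i y * c i) x v = ∑ i, fderiv ℝ (φ i) x v * c i := by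
  rw [fderiv_fun_sum fun i _ => (h i).mul_const _, sum_apply]
  refine sum_congr rfl fun i _ => ?_
  rw [fderiv_mul_const (h i), smul_apply, smul_eq_mul, mul_comm]

lemma fderiv_sum_mul_mul {E : Type*} [NormedAddCommGroup E] [NormedSpace ℝ E] {κ ι : Type*}
    [Fintype ι] (s : Finset κ) {φ ψ : κ → ι → E → ℂ} (c : ι → ι → ℂ) {x : E} (v : E)
    (h : ∀ k i, DifferentiableAt ℝ (φ k i) x) (h' : ∀ k i, DifferentiableAt ℝ (ψ k i) x) : fderiv ℝ
    (fun y => ∑ k ∈ s, ∑ i, ∑ j, φ k i y * ψ k j y * c i j) x v = ∑ k ∈ s, ∑ i, ∑ j,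
    (fderiv ℝ (φ k i) x v * ψ k j x + φ k i x * fderiv ℝ (ψ k j) x v) * c i j := by
  have d : ∀ k i j, DifferentiableAt ℝ (fun y => φ k i y * ψ k j y * c i j) x := fun k i j =>
    ((h k i).fun_mul (h' k j)).mul_const _
  rw [fderiv_fun_sum fun k _ => DifferentiableAt.fun_sum fun i _ =>
    DifferentiableAt.fun_sum fun j _ => d k i j, sum_apply]
  refine sum_congr rfl fun k _ => ?_
  rw [fderiv_fun_sum fun i _ => DifferentiableAt.fun_sum fun j _ => d k i j, sum_apply]
  refine sum_congr rfl fun i _ => ?_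
  rw [fderiv_fun_sum fun j _ => d k i j, sum_apply]
  refine sum_congr rfl fun j _ => ?_
  rw [fderiv_mul_const ((h k i).fun_mul (h' k j)), fderiv_fun_mul (h k i) (h' k j)]
  simp only [smul_apply, add_apply, smul_eq_mul]
  ring

namespace BV

variable {D : FieldContent} {x : Body D}

lemma Lam_ext {a b : Lam D} (h : ∀ ℓ : Lam D →ₗ[ℂ] ℂ, ℓ a = ℓ b) : a = b :=
  (monoBasis D).ext_elem fun S => h ((monoBasis D).coord S)

/-- The exponents of the monomials in the first-level variables. -/
abbrev Expo (D : FieldContent) : Type := FormalIdx D →₀ ℕ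

lemma coeff_mul' (d : Expo D) (v w : Val D) : coeff d (v * w) = ∑ q ∈ antidiagonal d, coeff q.1 v *
    coeff q.2 w := by
  classical
  rw [MvPowerSeries.coeff_mul]

lemma coeff_smul' (d : Expo D) (c : ℂ) (v : Val D) : coeff d (c • v) = c • coeff d v := rfl

lemma monoBasis_isMono : IsMono (monoBasis D) := isMono_exteriorAlgebra _

lemma apply_coeff (f : SF D) (d) (ℓ : Lam D →ₗ[ℂ] ℂ) (x : Body D) : ℓ (coeff d (f x)) = ∑ S, comp D
    f d S x * ℓ (monoBasis D S) := by
  conv_lhs => rw [← (monoBasis D).sum_repr (coeff d (f x))]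
  simp only [map_sum, map_smul, smul_eq_mul]; rfl

lemma smooth_iff {W : Set (Body D)} {f : SF D} : Smooth D W f ↔ ∀ d (ℓ : Lam D →ₗ[ℂ] ℂ), ContDiffOn
    ℝ ∞ (fun x => ℓ (coeff d (f x))) W := by
  constructor
  · intro h d ℓ
    simp only [apply_coeff]
    exact ContDiffOn.sum fun S _ => (h d S).mul contDiffOn_const
  · exact fun h d S => h d ((monoBasis D).coord S)

lemma Smooth.congr {W : Set (Body D)} {f g : SF D} (h : Smooth D W f) (e : ∀ x ∈ W, g x = f x) :
    Smooth D W g :=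
  fun d S => (h d S).congr fun x hx => by simp only [comp, e x hx]

lemma smooth_mul {W : Set (Body D)} {f g : SF D} (hf : Smooth D W f) (hg : Smooth D W g) : Smooth D
    W (f * g) := by
  rw [smooth_iff] at *
  intro d ℓ
  have : ∀ x, ℓ (coeff d ((f * g) x)) = ∑ q ∈ antidiagonal d, ∑ S, ∑ T,
      comp D f q.1 S x * comp D g q.2 T x * ℓ (monoBasis D S * monoBasis D T) := by
    intro x
    rw [Pi.mul_apply, coeff_mul', map_sum]
    refine sum_congr rfl fun q _ => ?_
    conv_lhs => rw [← (monoBasis D).sum_repr (coeff q.1 (f x)), ← (monoBasis D).sum_repr (coeff q.2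
      (g x)), Finset.sum_mul_sum]
    simp only [map_sum, smul_mul_smul_comm, map_smul, smul_eq_mul]; rfl
  simp only [this]
  exact ContDiffOn.sum fun q _ => ContDiffOn.sum fun S _ => ContDiffOn.sum fun T _ =>
    ((hf q.1 ((monoBasis D).coord S)).mul (hg q.2 ((monoBasis D).coord T))).mul contDiffOn_const

section Point

variable {W : Opens (Body D)} {f g : SF D}

lemma Smooth.diff (hf : Smooth D W f) (d) (ℓ : Lam D →ₗ[ℂ] ℂ) (hx : x ∈ W) : DifferentiableAt ℝ
    (fun y => ℓ (coeff d (f y))) x :=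
  ((smooth_iff.mp hf d ℓ).contDiffAt (W.isOpen.mem_nhds hx)).differentiableAt (by simp)

lemma coeff_pdBody (b : BodyIdx D) (d) (x : Body D) : coeff d (pdBody D b f x) = ∑ S : Finset
    (OddIdx D), (fderiv ℝ (comp D f d S) x (Pi.single b 1)) • monoBasis D S := by
  have h : coeff d (pdBody D b f x) = pdBody D b f x d := by
    generalize pdBody D b f x = v
    rfl
  rw [h]
  unfold pdBody
  with_reducible rfl

lemma pdBody_apply (hf : Smooth D W f) (b : BodyIdx D) (d) (ℓ : Lam D →ₗ[ℂ] ℂ) (hx : x ∈ W) : ℓ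
    (coeff d (pdBody D b f x)) = fderiv ℝ (fun y => ℓ (coeff d (f y))) x (Pi.single b 1) := by
  have hd : ∀ S, DifferentiableAt ℝ (comp D f d S) x := fun S =>
    hf.diff d ((monoBasis D).coord S) hx
  have : (fun y => ℓ (coeff d (f y))) =
      fun y => ∑ S, comp D f d S y * ℓ (monoBasis D S) := by
    funext y; exact apply_coeff f d ℓ y
  rw [this, fderiv_sum_mul_const _ _ hd]
  rw [coeff_pdBody, map_sum]
  refine sum_congr rfl fun S _ => ?_
  rw [map_smul, smul_eq_mul]

lemma smooth_pdBody (hf : Smooth D W f) (b : BodyIdx D) : Smooth D W (pdBody D b f) := by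
  rw [smooth_iff]
  intro d ℓ
  have h := ((smooth_iff.mp hf d ℓ).fderiv_of_isOpen W.isOpen (m := ∞) (by simp)).clm_apply
    (contDiffOn_const (c := Pi.single b (1 : ℝ)))
  exact h.congr fun x hx => pdBody_apply hf b d ℓ hx

lemma smooth_pdFormal (hf : Smooth D W f) (z : FormalIdx D) : Smooth D W (pdFormal D z f) := by
  rw [smooth_iff] at *
  intro d ℓ
  have : ∀ x, ℓ (coeff d (pdFormal D z f x)) = ((d z + 1 : ℕ) : ℂ) *
      ℓ (coeff (d + single z 1) (f x)) := fun x => map_smul _ _ _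
  simp only [this]
  exact contDiffOn_const.mul (hf _ _)

lemma smooth_pdOdd (hf : Smooth D W f) (o : OddIdx D) : Smooth D W (pdOdd D o f) := by
  rw [smooth_iff] at *
  intro d ℓ
  exact hf d (ℓ.comp (dO o))

/-- The parity automorphism on values. -/
def sig : Val D →ₐ[ℂ] Val D := MvPowerSeries.mapAlgHom inv

lemma coeff_sig (d) (v : Val D) : coeff d (sig v) = inv (coeff d v) := by
  rw [sig, MvPowerSeries.mapAlgHom_apply, MvPowerSeries.coeff_map]; rfl

lemma flip_apply (f : SF D) (x : Body D) : flip D f x = sig (f x) :=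
  ext fun d => (coeff_sig d _).symm

lemma smooth_sig (hf : Smooth D W f) : Smooth D W (fun x => sig (f x)) := by
  rw [smooth_iff] at *
  intro d ℓ
  simp only [coeff_sig]
  exact hf d (ℓ.comp inv.toLinearMap)

lemma smooth_const (v : Val D) (W : Set (Body D)) : Smooth D W (fun _ => v) :=
  fun _ _ => contDiffOn_const

lemma smooth_add (hf : Smooth D W f) (hg : Smooth D W g) : Smooth D W (f + g) := by
  rw [smooth_iff] at *
  intro d ℓ
  simpa using (hf d ℓ).add (hg d ℓ)

lemma smooth_smul (hf : Smooth D W f) (c : ℂ) : Smooth D W (c • f) := by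
  rw [smooth_iff] at *
  intro d ℓ
  have : ∀ x, ℓ (coeff d ((c • f) x)) = c * ℓ (coeff d (f x)) :=
    fun x => map_smul ℓ c _
  simp only [this]
  exact contDiffOn_const.mul (hf d ℓ)

lemma ld_body {A : Ext D} (h : par D (inl A) = 0) (f : SF D) : BV.ld D (inl A) f = pdBody D ⟨A, h⟩
    f := by
  rw [BV.ld, dif_pos h]

lemma ld_formal {a : Aux D} (h : par D (inr a) = 0) (f : SF D) : BV.ld D (inr a) f = pdFormal D
    ⟨a, h⟩ f := by
  rw [BV.ld, dif_pos h]

lemma ld_odd {z : Coord D} (h : ¬ par D z = 0) (f : SF D) : BV.ld D z f = pdOdd D ⟨z, h⟩ f := by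
  rw [BV.ld, dif_neg h]

lemma smooth_ld (hf : Smooth D W f) (z : Coord D) : Smooth D W (BV.ld D z f) := by
  by_cases h : par D z = 0
  · rcases z with A | a
    · rw [ld_body h]; exact smooth_pdBody hf _
    · rw [ld_formal h]; exact smooth_pdFormal hf _
  · rw [ld_odd h]; exact smooth_pdOdd hf _

lemma pdBody_congr (e : ∀ x ∈ W, f x = g x) (b : BodyIdx D) (hx : x ∈ W) : pdBody D b f x = pdBody D
    b g x := by
  funext d
  simp only [pdBody]
  refine sum_congr rfl fun S _ => ?_
  rw [Filter.EventuallyEq.fderiv_eq]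
  filter_upwards [W.isOpen.mem_nhds hx] with y hy
  simp only [comp, e y hy]

lemma ld_congr (e : ∀ x ∈ W, f x = g x) (z : Coord D) (hx : x ∈ W) : BV.ld D z f x = BV.ld D z g
    x := by
  by_cases h : par D z = 0
  · rcases z with A | a
    · rw [ld_body h, ld_body h]; exact pdBody_congr e _ hx
    · rw [ld_formal h, ld_formal h]; unfold pdFormal; rw [e x hx]
  · rw [ld_odd h, ld_odd h]; unfold pdOdd; rw [e x hx]

lemma pdBody_mul (hf : Smooth D W f) (hg : Smooth D W g) (b : BodyIdx D) (hx : x ∈ W) : pdBody D b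
    (f * g) x = pdBody D b f x * g x + f x * pdBody D b g x := by
  refine ext fun d => Lam_ext fun ℓ => ?_
  rw [pdBody_apply (smooth_mul hf hg) b d ℓ hx]
  have : (fun y => ℓ (coeff d ((f * g) y))) = fun y =>
      ∑ q ∈ antidiagonal d, ∑ S, ∑ T,
      comp D f q.1 S y * comp D g q.2 T y * ℓ (monoBasis D S * monoBasis D T) := by
    funext y
    rw [Pi.mul_apply, coeff_mul', map_sum]
    refine sum_congr rfl fun q _ => ?_
    conv_lhs => rw [← (monoBasis D).sum_repr (coeff q.1 (f y)), ← (monoBasis D).sum_repr (coeff q.2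
      (g y)), Finset.sum_mul_sum]
    simp only [map_sum, smul_mul_smul_comm, map_smul, smul_eq_mul]; rfl
  have df : ∀ d S, DifferentiableAt ℝ (comp D f d S) x := fun d S =>
    hf.diff d ((monoBasis D).coord S) hx
  have dg : ∀ d S, DifferentiableAt ℝ (comp D g d S) x := fun d S =>
    hg.diff d ((monoBasis D).coord S) hx
  rw [this, fderiv_sum_mul_mul _ (φ := fun (q : _ × _) S => comp D f q.1 S)
    (ψ := fun (q : _ × _) S => comp D g q.2 S) _ _ (fun q S => df _ _) (fun q S => dg _ _),
    map_add, map_add, coeff_mul', coeff_mul', map_sum, map_sum, ← sum_add_distrib]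
  refine sum_congr rfl fun q _ => ?_
  have e3 : coeff q.1 (f x) = ∑ S, comp D f q.1 S x • monoBasis D S :=
    ((monoBasis D).sum_repr _).symm
  have e4 : coeff q.2 (g x) = ∑ S, comp D g q.2 S x • monoBasis D S :=
    ((monoBasis D).sum_repr _).symm
  rw [coeff_pdBody, coeff_pdBody, e3, e4, Finset.sum_mul_sum, Finset.sum_mul_sum, map_sum, map_sum,
    ← sum_add_distrib]
  refine sum_congr rfl fun S _ => ?_
  rw [map_sum, map_sum, ← sum_add_distrib]
  refine sum_congr rfl fun T _ => ?_
  simp only [smul_mul_smul_comm, map_smul, smul_eq_mul, add_mul]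

lemma pdFormal_mul (z : FormalIdx D) (x : Body D) : pdFormal D z (f * g) x = pdFormal D z f x * g
    x + f x * pdFormal D z g x := by
  refine ext fun d => ?_
  have e0 : ∀ f : SF D, ∀ d, coeff d (pdFormal D z f x) = ((d z + 1 : ℕ) : ℂ) •
    coeff (d + single z 1) (f x) := fun _ _ => rfl
  have key : ∀ F : Expo D → Expo D → Lam D,
      ∑ q ∈ antidiagonal (d + single z 1), (((q.1 : Expo D) z : ℕ) : ℂ) • F q.1 q.2 =
      ∑ q ∈ antidiagonal d, (((q.1 : Expo D) z + 1 : ℕ) : ℂ) • F (q.1 + single z 1) q.2 := by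
    intro F
    symm
    refine Finset.sum_of_injOn (fun q => (q.1 + single z 1, q.2)) ?_ ?_ ?_ ?_
    · intro a _ b _ h
      simp only [Prod.mk.injEq, add_left_inj] at h
      exact Prod.ext h.1 h.2
    · intro q hq
      simp only [Finset.mem_coe, mem_antidiagonal] at *
      rw [← hq]; abel
    · intro q hq hn
      have : q.1 z = 0 := by
        by_contra h0
        refine hn ⟨(q.1 - single z 1, q.2), ?_, ?_⟩
        · simp only [Finset.mem_coe, mem_antidiagonal] at *
          have h1 : q.1 - single z 1 + single z 1 = q.1 :=
            tsub_add_cancel_of_le (Finsupp.single_le_iff.mpr (Nat.one_le_iff_ne_zero.mpr h0))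
          rw [← h1, add_right_comm] at hq
          exact add_right_cancel hq
        · simp only
          rw [tsub_add_cancel_of_le (Finsupp.single_le_iff.mpr (Nat.one_le_iff_ne_zero.mpr h0))]
      rw [this, Nat.cast_zero, zero_smul]
    · intro q _; simp
  have key2 : ∀ F : Expo D → Expo D → Lam D,
      ∑ q ∈ antidiagonal (d + single z 1), (((q.2 : Expo D) z : ℕ) : ℂ) • F q.1 q.2 =
      ∑ q ∈ antidiagonal d, (((q.2 : Expo D) z + 1 : ℕ) : ℂ) • F q.1 (q.2 + single z 1) := by
    intro F
    exact (Finsupp.sum_antidiagonal_swap _ fun a b => (b z : ℂ) • F a b).trans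
      ((key fun a b => F b a).trans (Finsupp.sum_antidiagonal_swap d fun a b =>
        ((a z + 1 : ℕ) : ℂ) • F b (a + single z 1)))
  rw [map_add, e0, Pi.mul_apply, coeff_mul', coeff_mul', coeff_mul']
  simp only [e0, smul_mul_assoc, mul_smul_comm]
  rw [← key fun a b => coeff a (f x) * coeff b (g x), ← key2 fun a b => coeff a (f x) * coeff b (g
    x), ← sum_add_distrib, smul_sum]
  refine sum_congr rfl fun q hq => ?_
  rw [← add_smul]
  congr 1
  rw [mem_antidiagonal] at hq
  have := DFunLike.congr_fun hq z
  simp only [Finsupp.coe_add, Pi.add_apply, Finsupp.single_eq_same] at this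
  rw [← this]; push_cast; rfl

lemma pdOdd_mul (o : OddIdx D) (x : Body D) : pdOdd D o (f * g) x = pdOdd D o f x * g x + sig
    (f x) * pdOdd D o g x := by
  refine ext fun d => ?_
  have e0 : ∀ f : SF D, ∀ d, coeff d (pdOdd D o f x) =
    dO o (coeff d (f x)) := fun _ _ => rfl
  rw [e0, Pi.mul_apply, map_add, coeff_mul', coeff_mul', coeff_mul', map_sum, ← sum_add_distrib]
  refine sum_congr rfl fun q _ => ?_
  rw [dO_mul, e0, e0, coeff_sig]

lemma ld_mul (hf : Smooth D W f) (hg : Smooth D W g) (z : Coord D) (hx : x ∈ W) : BV.ld D z (f * g)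
    x = BV.ld D z f x * g x + (if par D z = 0 then f x else sig (f x)) * BV.ld D z g x := by
  by_cases h : par D z = 0
  · rw [if_pos h]
    rcases z with A | a
    · rw [ld_body h, ld_body h, ld_body h, pdBody_mul hf hg _ hx]
    · rw [ld_formal h, ld_formal h, ld_formal h, pdFormal_mul]
  · rw [ld_odd h, ld_odd h, ld_odd h, pdOdd_mul, if_neg h]

/-- A coefficient functional of the derivative `BV.ld D z`, for `z` not a body variable. -/
lemma coeff_pdOdd (o : OddIdx D) (d) (x : Body D) : coeff d (pdOdd D o f x) = dO o
    (coeff d (f x)) := rfl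

lemma coeff_pdFormal (z : FormalIdx D) (d) (x : Body D) : coeff d (pdFormal D z f x) =
    ((d z + 1 : ℕ) : ℂ) • coeff (d + single z 1) (f x) := rfl

lemma pdBody_pdOdd (hf : Smooth D W f) (b : BodyIdx D) (o : OddIdx D) (hx : x ∈ W) : pdBody D b
    (pdOdd D o f) x = pdOdd D o (pdBody D b f) x := by
  refine ext fun d => Lam_ext fun ℓ => ?_
  rw [pdBody_apply (smooth_pdOdd hf o) b d ℓ hx, coeff_pdOdd]
  exact (pdBody_apply hf b d (ℓ.comp (dO o)) hx).symm

lemma pdBody_pdFormal (hf : Smooth D W f) (b : BodyIdx D) (z : FormalIdx D) (hx : x ∈ W) : pdBody D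
    b (pdFormal D z f) x = pdFormal D z (pdBody D b f) x := by
  refine ext fun d => Lam_ext fun ℓ => ?_
  rw [pdBody_apply (smooth_pdFormal hf z) b d ℓ hx, coeff_pdFormal]
  exact (pdBody_apply hf b (d + single z 1) (ℓ.comp (((d z + 1 : ℕ) : ℂ) • LinearMap.id)) hx).symm

end Point

variable {W : Opens (Body D)}

lemma pdFormal_pdOdd (f : SF D) (z : FormalIdx D) (o : OddIdx D) : pdFormal D z (pdOdd D o f) =
    pdOdd D o (pdFormal D z f) := by
  funext x
  refine ext fun d => ?_
  rw [coeff_pdFormal, coeff_pdOdd, coeff_pdOdd, coeff_pdFormal, map_smul]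

lemma pdOdd_pdOdd (f : SF D) (o o' : OddIdx D) : pdOdd D o (pdOdd D o' f) = -pdOdd D o'
    (pdOdd D o f) := by
  funext x
  refine ext fun d => ?_
  rw [Pi.neg_apply, map_neg, coeff_pdOdd, coeff_pdOdd, coeff_pdOdd, coeff_pdOdd, dO_comm]

lemma pdFormal_pdFormal (f : SF D) (z z' : FormalIdx D) : pdFormal D z (pdFormal D z' f) = pdFormal
    D z' (pdFormal D z f) := by
  funext x
  refine ext fun d => ?_
  simp only [coeff_pdFormal, smul_smul]
  rw [add_right_comm]
  congr 1
  by_cases h : z = z'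
  · subst h; rfl
  · simp only [Finsupp.coe_add, Pi.add_apply, Finsupp.single_apply, if_neg h, if_neg (Ne.symm h)]
    push_cast; ring

lemma pdBody_pdBody {f : SF D} (hf : Smooth D W f) (b b' : BodyIdx D) (hx : x ∈ W) : pdBody D b
    (pdBody D b' f) x = pdBody D b' (pdBody D b f) x := by
  refine ext fun d => Lam_ext fun ℓ => ?_
  have key : ∀ b b', ℓ (coeff d (pdBody D b (pdBody D b' f) x)) =
      fderiv ℝ (fderiv ℝ (fun y => ℓ (coeff d (f y)))) x (Pi.single b 1)
        (Pi.single b' 1) := by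
    intro b b'
    rw [pdBody_apply (smooth_pdBody hf b') b d ℓ hx]
    have e : (fun y => ℓ (coeff d (pdBody D b' f y))) =ᶠ[nhds x]
        fun y => fderiv ℝ (fun y => ℓ (coeff d (f y))) y (Pi.single b' 1) := by
      filter_upwards [W.isOpen.mem_nhds hx] with y hy
      exact pdBody_apply hf b' d ℓ hy
    have hd : DifferentiableAt ℝ (fderiv ℝ (fun y => ℓ (coeff d (f y)))) x :=
      (((smooth_iff.mp hf d ℓ).fderiv_of_isOpen W.isOpen (m := ∞) (by simp)).contDiffAt
        (W.isOpen.mem_nhds hx)).differentiableAt (by simp)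
    rw [e.fderiv_eq, fderiv_clm_apply hd (differentiableAt_const _)]
    simp
  rw [key, key]
  refine ContDiffAt.isSymmSndFDerivAt ((smooth_iff.mp hf d ℓ).contDiffAt (W.isOpen.mem_nhds hx))
    ?_ _ _
  rw [minSmoothness_of_isRCLikeNormedField]
  exact WithTop.coe_le_coe.mpr le_top

/-- Extension by zero. -/
def ext0 (f : W → Val D) : SF D := by
  classical
  exact fun x => if h : x ∈ W then f ⟨x, h⟩ else 0

lemma ext0_apply (f : W → Val D) (hx : x ∈ W) : ext0 f x = f ⟨x, hx⟩ := by
  unfold ext0; rw [dif_pos hx]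

variable (W) in
/-- The algebra of superfunctions on an open set, as a subalgebra. -/
def SFRalg : Subalgebra ℂ (W → Val D) where
  carrier := {f | Smooth D W (ext0 f)}
  mul_mem' {f g} hf hg := (smooth_mul hf hg).congr fun x hx => by
    rw [Pi.mul_apply, ext0_apply _ hx, ext0_apply _ hx, ext0_apply _ hx]; rfl
  add_mem' {f g} hf hg := (smooth_add hf hg).congr fun x hx => by
    rw [Pi.add_apply, ext0_apply _ hx, ext0_apply _ hx, ext0_apply _ hx]; rfl
  algebraMap_mem' c := (smooth_const (algebraMap ℂ (Val D) c) _).congr fun x hx => by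
    rw [ext0_apply _ hx]; rfl

variable (W) in
/-- The algebra of superfunctions on an open set. -/
def SFR : Type := SFRalg W

instance : Ring (SFR W) := inferInstanceAs (Ring (SFRalg W))

instance : Algebra ℂ (SFR W) := inferInstanceAs (Algebra ℂ (SFRalg W))

/-- The restriction of a smooth superfunction. -/
def SFR.of (f : SF D) (hf : Smooth D W f) : SFR W :=
  ⟨fun x => f x, hf.congr fun x hx => by rw [ext0_apply _ hx]⟩

/-- A function representing an element of `SFR W`. -/
def SFR.rep (f : SFR W) : SF D := ext0 f.1

lemma SFR.smooth (f : SFR W) : Smooth D W f.rep := f.2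

lemma SFR.rep_of (f : SF D) (hf : Smooth D W f) (hx : x ∈ W) : (SFR.of f hf).rep x = f x :=
    ext0_apply _ hx

lemma SFR.of_rep (f : SFR W) : SFR.of f.rep f.smooth = f := by
  apply Subtype.ext; funext x
  exact ext0_apply _ x.2

lemma SFR.ext {f g : SFR W} (h : ∀ x ∈ W, f.rep x = g.rep x) : f = g := by
  apply Subtype.ext; funext x
  have := h x x.2
  rwa [SFR.rep, SFR.rep, ext0_apply _ x.2, ext0_apply _ x.2] at this

lemma SFR.of_congr {f g : SF D} (hf : Smooth D W f) (hg : Smooth D W g) (h : ∀ x ∈ W, f x = g x) :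
    SFR.of f hf = SFR.of g hg := SFR.ext fun x hx => by rw [rep_of _ _ hx, rep_of _ _ hx, h x hx]

/-- Evaluation at a point. -/
def SFR.ev (x : Body D) (hx : x ∈ W) : SFR W →ₐ[ℂ] Val D :=
  (Pi.evalAlgHom ℂ (fun _ : W => Val D) ⟨x, hx⟩).comp (SFRalg W).val

lemma SFR.at_apply (f : SFR W) (hx : x ∈ W) : SFR.ev x hx f = f.rep x :=
  (ext0_apply _ hx).symm

lemma SFR.at_of (f : SF D) (hf : Smooth D W f) (hx : x ∈ W) : SFR.ev x hx (SFR.of f hf) = f x := rfl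

open BV.SFR (ev of)

lemma SFR.ext_at {f g : SFR W} (h : ∀ x (hx : x ∈ W), ev x hx f = ev x hx g) : f = g :=
  SFR.ext fun x hx => by rw [← at_apply _ hx, ← at_apply _ hx, h]

lemma sig_even_mul (a b : Val D) (h : sig a = a) : a * b = b * a := by
  refine ext fun d => ?_
  rw [coeff_mul', coeff_mul']
  refine (sum_congr rfl fun q _ => ?_).trans
    (Finsupp.sum_antidiagonal_swap d fun x y => coeff x b * coeff y a).symm
  exact Grassmann.even_mul (by rw [← coeff_sig, h]) _

lemma sig_odd_mul (a b : Val D) (h : sig a = -a) : a * b = sig b * a := by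
  refine ext fun d => ?_
  rw [coeff_mul', coeff_mul']
  refine (sum_congr rfl fun q _ => ?_).trans
    (Finsupp.sum_antidiagonal_swap d fun x y => coeff x (sig b) * coeff y a).symm
  rw [coeff_sig]
  exact Grassmann.odd_mul (by rw [← coeff_sig, h, map_neg]) _

lemma sig_sig (a : Val D) : sig (sig a) = a := by
  refine ext fun d => ?_
  rw [coeff_sig, coeff_sig, inv_inv]

lemma ld_sig {f : SF D} (hf : Smooth D W f) (z : Coord D) (hx : x ∈ W) : BV.ld D z
    (fun y => sig (f y)) x = sgn (par D z) • sig (BV.ld D z f x) := by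
  refine ext fun d => ?_
  rw [coeff_smul', coeff_sig]
  by_cases h : par D z = 0
  · rw [h, sgn_zero, one_smul]
    rcases z with A | a
    · rw [ld_body h, ld_body h]
      refine Lam_ext fun ℓ => ?_
      rw [pdBody_apply (smooth_sig hf) _ d ℓ hx]
      simp only [coeff_sig]
      have h2 := pdBody_apply hf ⟨A, h⟩ d (ℓ.comp inv.toLinearMap) hx
      simp only [LinearMap.comp_apply, AlgHom.toLinearMap_apply] at h2
      exact h2.symm
    · rw [ld_formal h, ld_formal h, coeff_pdFormal, coeff_pdFormal, coeff_sig, map_smul]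
  · rw [ld_odd h, ld_odd h, coeff_pdOdd, coeff_pdOdd, coeff_sig, dO_inv, sgn, if_neg h,
      neg_one_smul]

lemma ld_ld {f : SF D} (hf : Smooth D W f) (z w : Coord D) (hx : x ∈ W) : BV.ld D z (BV.ld D w f)
    x = sgn (par D z * par D w) • BV.ld D w (BV.ld D z f) x := by
  by_cases h : par D z = 0
  · rw [h, zero_mul, sgn_zero, one_smul]
    by_cases h' : par D w = 0
    · rcases z with A | a <;> rcases w with A' | a'
      · simp only [ld_body h, ld_body h', pdBody_pdBody hf _ _ hx]
      · simp only [ld_body h, ld_formal h', pdBody_pdFormal hf _ _ hx]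
      · simp only [ld_formal h, ld_body h', pdBody_pdFormal hf _ _ hx]
      · simp only [ld_formal h, ld_formal h', pdFormal_pdFormal f ⟨a, h⟩]
    · rcases z with A | a
      · simp only [ld_body h, ld_odd h', pdBody_pdOdd hf _ _ hx]
      · simp only [ld_formal h, ld_odd h', pdFormal_pdOdd f]
  · by_cases h' : par D w = 0
    · rw [h', mul_zero, sgn_zero, one_smul]
      rcases w with A | a
      · simp only [ld_odd h, ld_body h', pdBody_pdOdd hf _ _ hx]
      · simp only [ld_odd h, ld_formal h', pdFormal_pdOdd f]
    · have e : ∀ x : ZMod 2, ¬x = 0 → x = 1 := by decide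
      rw [e _ h, e _ h', one_mul, sgn_one, neg_one_smul]
      simp only [ld_odd h, ld_odd h', pdOdd_pdOdd f ⟨z, h⟩, Pi.neg_apply]

lemma ld_add {f g : SF D} (hf : Smooth D W f) (hg : Smooth D W g) (z : Coord D) (hx : x ∈ W) : BV.ld
    D z (f + g) x = BV.ld D z f x + BV.ld D z g x := by
  refine ext fun d => ?_
  rw [map_add]
  by_cases h : par D z = 0
  · rcases z with A | a
    · rw [ld_body h, ld_body h, ld_body h]
      refine Lam_ext fun ℓ => ?_
      rw [map_add, pdBody_apply (smooth_add hf hg) _ d ℓ hx, pdBody_apply hf _ d ℓ hx, pdBody_apply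
        hg _ d ℓ hx]
      simp only [Pi.add_apply, map_add]
      rw [fderiv_fun_add (hf.diff d ℓ hx) (hg.diff d ℓ hx)]; rfl
    · rw [ld_formal h, ld_formal h, ld_formal h, coeff_pdFormal, coeff_pdFormal, coeff_pdFormal,
        Pi.add_apply, map_add, smul_add]
  · rw [ld_odd h, ld_odd h, ld_odd h, coeff_pdOdd, coeff_pdOdd, coeff_pdOdd, Pi.add_apply, map_add,
      map_add]

lemma ld_const (v : ℂ) (z : Coord D) : BV.ld D z (fun _ => algebraMap ℂ (Val D) v) = 0 := by
  funext x
  refine ext fun d => ?_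
  have hs : Smooth D (⊤ : Opens (Body D)) (fun _ => algebraMap ℂ (Val D) v) := smooth_const _ _
  by_cases h : par D z = 0
  · rcases z with A | a
    · rw [ld_body h]
      refine Lam_ext fun ℓ => ?_
      rw [pdBody_apply hs _ d ℓ (Opens.mem_top x)]
      simp
    · rw [ld_formal h, coeff_pdFormal, MvPowerSeries.algebraMap_apply, MvPowerSeries.coeff_add_single_C,
        smul_zero]; rfl
  · rw [ld_odd h, coeff_pdOdd, MvPowerSeries.algebraMap_apply]
    classical
    rw [coeff_C]
    split_ifs
    · rw [dO_algebraMap]; rfl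
    · rw [map_zero]; rfl

/-- The parity automorphism. -/
def SFR.sg (f : SFR W) : SFR W := of (fun x => sig (f.rep x)) (smooth_sig f.smooth)

lemma SFR.at_sg (f : SFR W) (hx : x ∈ W) : ev x hx f.sg = sig (ev x hx f) := by
  rw [SFR.sg, SFR.at_of, SFR.at_apply]

/-- The left derivative. -/
def SFR.der (z : Coord D) (f : SFR W) : SFR W := of (BV.ld D z f.rep) (smooth_ld f.smooth z)

lemma SFR.at_der (z : Coord D) (f : SFR W) (hx : x ∈ W) : ev x hx (SFR.der z f) = BV.ld D z f.rep
    x := SFR.at_of _ _ hx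

lemma SFR.der_of (f : SF D) (hf : Smooth D W f) (z : Coord D) : SFR.der z (of f hf) = of
    (BV.ld D z f) (smooth_ld hf z) :=
  SFR.of_congr _ _ fun _ hx => ld_congr (W := W) (fun _ hy => SFR.rep_of _ _ hy) z hx

lemma SFR.rep_mul (a b : SFR W) (hx : x ∈ W) : (a * b).rep x = (a.rep * b.rep) x := by
  rw [Pi.mul_apply, ← SFR.at_apply _ hx, ← SFR.at_apply _ hx, ← SFR.at_apply _ hx, map_mul]

lemma SFR.rep_add (a b : SFR W) (hx : x ∈ W) : (a + b).rep x = (a.rep + b.rep) x := by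
  rw [Pi.add_apply, ← SFR.at_apply _ hx, ← SFR.at_apply _ hx, ← SFR.at_apply _ hx, map_add]

lemma SFR.rep_sg (a : SFR W) (hx : x ∈ W) : a.sg.rep x = sig (a.rep x) :=
  SFR.rep_of _ _ hx

lemma SFR.rep_der (z : Coord D) (a : SFR W) (hx : x ∈ W) : (SFR.der z a).rep x = BV.ld D z a.rep
    x :=
  SFR.rep_of _ _ hx

/-- The parity automorphism as an algebra map. -/
def SFR.sgHom : SFR W →ₐ[ℂ] SFR W where
  toFun := SFR.sg
  map_one' := SFR.ext_at fun x hx => by rw [SFR.at_sg, map_one, map_one]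
  map_mul' f g := SFR.ext_at fun x hx => by simp only [SFR.at_sg, map_mul]
  map_zero' := SFR.ext_at fun x hx => by rw [SFR.at_sg, map_zero, map_zero]
  map_add' f g := SFR.ext_at fun x hx => by simp only [SFR.at_sg, map_add]
  commutes' c := SFR.ext_at fun x hx => by rw [SFR.at_sg, AlgHom.commutes, AlgHom.commutes]

lemma SFR.rep_smul (c : ℂ) (f : SFR W) (hx : x ∈ W) : (c • f).rep x =
    ((fun _ => algebraMap ℂ (Val D) c : SF D) * f.rep) x := by
  rw [Pi.mul_apply, ← SFR.at_apply _ hx, ← SFR.at_apply _ hx, map_smul, Algebra.smul_def]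

/-- The left derivative as a linear map. -/
def SFR.derLin (z : Coord D) : SFR W →ₗ[ℂ] SFR W where
  toFun := SFR.der z
  map_add' f g := SFR.ext_at fun x hx => by
    rw [map_add, SFR.at_der, SFR.at_der, SFR.at_der, ← ld_add f.smooth g.smooth z hx]
    exact ld_congr (W := W) (fun y hy => SFR.rep_add _ _ hy) z hx
  map_smul' c f := SFR.ext_at fun x hx => by
    rw [RingHom.id_apply, map_smul, SFR.at_der, SFR.at_der, ld_congr (W := W) (fun y hy =>
      SFR.rep_smul c f hy) z hx, ld_mul (W := W) (smooth_const _ _) f.smooth z hx, ld_const,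
      Pi.zero_apply, zero_mul, zero_add, AlgHom.commutes, ite_self, Algebra.smul_def]

lemma SFR.der_mul (z : Coord D) (a b : SFR W) : SFR.der z (a * b) = SFR.der z a * b +
    (if par D z = 0 then a else a.sg) * SFR.der z b := SFR.ext_at fun x hx => by
  rw [SFR.at_der, ld_congr (W := W) (fun y hy => SFR.rep_mul a b hy) z hx, ld_mul a.smooth b.smooth
    z hx, map_add, map_mul, map_mul, SFR.at_der, SFR.at_der, SFR.at_apply b]
  congr 2
  split_ifs
  · rw [SFR.at_apply]
  · rw [SFR.at_sg, SFR.at_apply]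

lemma SFR.der_sg (z : Coord D) (a : SFR W) : SFR.der z a.sg = sgn (par D z) • (SFR.der z a).sg :=
  SFR.ext_at fun x hx => by
    rw [map_smul, SFR.at_der, SFR.at_sg, SFR.at_der, ← ld_sig a.smooth z hx]
    exact ld_congr (W := W) (fun y hy => SFR.rep_sg _ hy) z hx

lemma SFR.der_der (z w : Coord D) (a : SFR W) : SFR.der z (SFR.der w a) = sgn (par D z * par D w) •
    SFR.der w (SFR.der z a) :=
  SFR.ext_at fun x hx => by
    rw [map_smul, SFR.at_der, SFR.at_der, ld_congr (W := W) (fun y hy => SFR.rep_der w a hy) z hx,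
      ld_ld a.smooth z w hx, ld_congr (W := W) (fun y hy => SFR.rep_der z a hy) w hx]

/-- The calculus of superfunctions on an open set. -/
def sc (W : Opens (Body D)) : SuperCalc (SFR W) (par D) where
  σ := SFR.sgHom
  σσ f := SFR.ext_at fun x hx => by
    change ev x hx (SFR.sg (SFR.sg f)) = _
    rw [SFR.at_sg, SFR.at_sg, sig_sig]
  even_mul a b h := SFR.ext_at fun x hx => by
    rw [map_mul, map_mul]
    refine sig_even_mul _ _ ?_
    rw [← SFR.at_sg]; exact congrArg _ h
  odd_mul a b h := SFR.ext_at fun x hx => by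
    rw [map_mul, map_mul]
    change _ = ev x hx (SFR.sg b) * _
    rw [SFR.at_sg]
    refine sig_odd_mul _ _ ?_
    rw [← SFR.at_sg, ← map_neg]; exact congrArg _ h
  ld := SFR.derLin
  ld_mul := SFR.der_mul
  ld_σ := SFR.der_sg
  ld_comm := SFR.der_der

lemma sc_σ_at (f : SFR W) (hx : x ∈ W) : ev x hx ((sc W).σ f) = sig (ev x hx f) := SFR.at_sg f hx

lemma sc_ld_of (f : SF D) (hf : Smooth D W f) (z : Coord D) : (sc W).ld z (of f hf) = of
    (BV.ld D z f) (smooth_ld hf z) := SFR.der_of f hf z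

lemma sc_ld_at (f : SFR W) (z : Coord D) (hx : x ∈ W) : ev x hx ((sc W).ld z f) = BV.ld D z f.rep
    x := SFR.at_der z f hx

lemma smooth_neg {f : SF D} (hf : Smooth D W f) : Smooth D W (-f) := by
  have := smooth_smul hf (-1); rwa [neg_one_smul] at this

lemma smooth_flip {f : SF D} (hf : Smooth D W f) : Smooth D W (flip D f) :=
  (smooth_sig hf).congr fun _ _ => flip_apply _ _

lemma smooth_rd {f : SF D} (hf : Smooth D W f) (z : Coord D) : Smooth D W (BV.rd D z f) := by
  unfold BV.rd; split_ifs
  · exact smooth_ld hf z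
  · exact smooth_neg (smooth_ld (smooth_flip hf) z)

lemma sc_rd_of (f : SF D) (hf : Smooth D W f) (z : Coord D) : (sc W).rd z (of f hf) = of
    (BV.rd D z f) (smooth_rd hf z) := by
  unfold SuperCalc.rd
  split_ifs with h
  · rw [sc_ld_of]
    exact SFR.of_congr _ _ fun x _ => by rw [BV.rd, if_pos h]
  · have e : (sc W).σ (of f hf) = of (flip D f) (smooth_flip hf) :=
      SFR.ext_at fun x hx => by rw [sc_σ_at, SFR.at_of, SFR.at_of, flip_apply]
    change -(sc W).ld z ((sc W).σ (of f hf)) = _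
    rw [e, sc_ld_of]
    exact SFR.ext_at fun x hx => by
      rw [map_neg, SFR.at_of, SFR.at_of, BV.rd, if_neg h]; rfl

lemma hom_of_iff {f : SF D} {hf : Smooth D W f} {q : ZMod 2} : (sc W).Hom q (of f hf) ↔ HasParity D
    W q f := by
  constructor
  · intro h x hx
    have := congrArg (ev x hx) h
    rwa [sc_σ_at, map_smul, SFR.at_of, ← flip_apply] at this
  · intro h
    exact SFR.ext_at fun x hx => by rw [sc_σ_at, map_smul, SFR.at_of, ← flip_apply, h x hx]

attribute [irreducible] ev of SFR.rep sc

end BV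

open BV.SFR (ev of of_congr)

namespace Grassmann

set_option linter.unusedSectionVars false

variable {O : Type*} (P : O → Prop)

/-- The algebra endomorphism putting to zero the generators which do not satisfy `P`. -/
def kl : Gr O →ₐ[ℂ] Gr O := by
  classical
  exact ExteriorAlgebra.map (LinearMap.pi fun o : O =>
    if P o then (LinearMap.proj o : (O → ℂ) →ₗ[ℂ] ℂ) else 0)

/-- The projection of the generators. -/
def klι (m : O → ℂ) : O → ℂ := by
  classical
  exact fun o => if P o then m o else 0

lemma kl_ι (m : O → ℂ) : kl P (ExteriorAlgebra.ι ℂ m) = ExteriorAlgebra.ι ℂ (klι P m) := by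
  classical
  rw [kl, ExteriorAlgebra.map_apply_ι]
  congr 1
  funext o
  rw [LinearMap.pi_apply, klι]
  split_ifs <;> simp

lemma inv_kl (a : Gr O) : inv (kl P a) = kl P (inv a) := by
  induction a using ExteriorAlgebra.induction with
  | algebraMap r => simp only [AlgHom.commutes]
  | ι m => rw [kl_ι, inv_ι, inv_ι, map_neg, kl_ι]
  | mul a b ha hb => simp only [map_mul, ha, hb]
  | add a b ha hb => simp only [map_add, ha, hb]

lemma dO_kl_pos {o : O} (h : P o) (a : Gr O) : dO o (kl P a) = kl P (dO o a) := by
  induction a using ExteriorAlgebra.induction with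
  | algebraMap r => rw [AlgHom.commutes, dO_algebraMap, map_zero]
  | ι m => rw [kl_ι, dO_ι, dO_ι, AlgHom.commutes, klι, if_pos h]
  | mul a b ha hb => rw [map_mul, dO_mul, dO_mul, ha, hb, inv_kl, map_add, map_mul, map_mul]
  | add a b ha hb => simp only [map_add, ha, hb]

lemma dO_kl_neg {o : O} (h : ¬ P o) (a : Gr O) : dO o (kl P a) = 0 := by
  induction a using ExteriorAlgebra.induction with
  | algebraMap r => rw [AlgHom.commutes, dO_algebraMap]
  | ι m => rw [kl_ι, dO_ι, klι, if_neg h, map_zero]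
  | mul a b ha hb => rw [map_mul, dO_mul, ha, hb, zero_mul, mul_zero, add_zero]
  | add a b ha hb => rw [map_add, map_add, ha, hb, add_zero]

lemma bod_kl (a : Gr O) : bod (kl P a) = bod a := by
  induction a using ExteriorAlgebra.induction with
  | algebraMap r => rw [AlgHom.commutes]
  | ι m => rw [kl_ι, bod_ι, bod_ι]
  | mul a b ha hb => rw [map_mul, map_mul, map_mul, ha, hb]
  | add a b ha hb => rw [map_add, map_add, map_add, ha, hb]

variable [Fintype O] [DecidableEq O]

lemma kl_th (o : O) : kl P (th o) = (by classical exact if P o then th o else 0) := by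
  classical
  rw [kl_ι]
  split_ifs with h
  · congr 1; funext o'
    rw [klι, Pi.single_apply]
    split_ifs with h1 h2 h2
    · rfl
    · rfl
    · exact absurd (h2 ▸ h) h1
    · rfl
  · rw [← map_zero (ExteriorAlgebra.ι ℂ)]
    congr 1; funext o'
    rw [klι, Pi.single_apply]
    split_ifs with h1 h2
    · exact absurd (h2 ▸ h1) h
    · rfl
    · rfl

lemma kl_list_pos {l : List O} (h : ∀ o ∈ l, P o) : kl P (l.map th).prod = (l.map th).prod := by
  rw [map_list_prod, List.map_map]
  congr 1
  refine List.map_congr_left fun o ho => ?_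
  rw [Function.comp_apply, kl_th, if_pos (h o ho)]

lemma kl_list_neg {l : List O} {o : O} (ho : o ∈ l) (h : ¬ P o) : kl P (l.map th).prod = 0 := by
  rw [map_list_prod, List.map_map]
  refine List.prod_eq_zero ?_
  rw [List.mem_map]
  exact ⟨o, ho, by rw [Function.comp_apply, kl_th, if_neg h]⟩

lemma repr_kl {b : Module.Basis (Finset O) ℂ (Gr O)} (hb : IsMono b) (a : Gr O) (S : Finset O) :
    b.repr (kl P a) S = (by classical exact if ∀ o ∈ S, P o then b.repr a S else 0) := by
  classical
  have hS : ∀ S, kl P (b S) = if ∀ o ∈ S, P o then b S else 0 := by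
    intro S
    obtain ⟨l, -, rfl, h⟩ := hb S
    rw [h]
    split_ifs with h1
    · exact kl_list_pos P fun o ho => h1 o (List.mem_toFinset.mpr ho)
    · push Not at h1
      obtain ⟨o, ho, h2⟩ := h1
      exact kl_list_neg P (List.mem_toFinset.mp ho) h2
  conv_lhs => rw [← b.sum_repr a]
  rw [map_sum, map_sum, Finsupp.finsetSum_apply]
  have : ∀ T, (b.repr (kl P (b.repr a T • b T))) S =
      if T = S then (if ∀ o ∈ S, P o then b.repr a S else 0) else 0 := by
    intro T
    rw [map_smul, hS]
    split_ifs with h1 h2 h3 h3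
    · subst h2; rw [map_smul, b.repr_self]; simp
    · subst h2; exact absurd h1 h3
    · rw [map_smul, b.repr_self]; simp [h2]
    · subst h3; exact absurd (by assumption) h1
    · simp
    · simp
  simp only [this, Finset.sum_ite_eq', mem_univ, if_true]

end Grassmann

namespace BV

variable {D : FieldContent} {x : Body D} {W : Opens (Body D)}

/-- A multidegree supported on the variables satisfying `P`. -/
def Supp (P : Coord D → Prop) (d : Expo D) : Prop := ∀ z ∈ d.support, P (inr z.1)

lemma supp_add {P : Coord D → Prop} {d d' : Expo D} : Supp P (d + d') ↔ Supp P d ∧ Supp P d' := by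
  classical
  simp only [Supp, Finsupp.mem_support_iff, Finsupp.add_apply]
  constructor
  · exact fun h => ⟨fun z hz => h z (by omega), fun z hz => h z (by omega)⟩
  · rintro ⟨h1, h2⟩ z hz
    by_cases h : d z = 0
    · exact h2 z (by omega)
    · exact h1 z h

/-- The restriction of a multidegree component. -/
def resCoeff (P : Coord D → Prop) (d : Expo D) : Lam D →ₗ[ℂ] Lam D := by
  classical
  exact if Supp P d then (kl fun o : OddIdx D => P o.1).toLinearMap else 0

lemma resCoeff_pos {P : Coord D → Prop} {d : Expo D} (h : Supp P d) (a : Lam D) : resCoeff P d a =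
    kl (fun o : OddIdx D => P o.1) a := by rw [resCoeff, if_pos h]; rfl

lemma resCoeff_neg {P : Coord D → Prop} {d : Expo D} (h : ¬ Supp P d) (a : Lam D) : resCoeff P d a =
    0 := by rw [resCoeff, if_neg h]; rfl

/-- Put to zero the fermionic and the formal variables which do not satisfy `P`. -/
def resFun (P : Coord D → Prop) (v : Val D) : Val D :=
  fun d => resCoeff P d (coeff d v)

lemma coeff_resFun (P : Coord D → Prop) (v : Val D) (d) : coeff d (resFun P v) = resCoeff P d
    (coeff d v) := rfl

lemma resFun_mul (P : Coord D → Prop) (v w : Val D) : resFun P (v * w) = resFun P v * resFun P w :=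
    by
  refine ext fun d => ?_
  rw [coeff_resFun, coeff_mul', coeff_mul', map_sum]
  refine sum_congr rfl fun q hq => ?_
  rw [mem_antidiagonal] at hq
  rw [coeff_resFun, coeff_resFun]
  by_cases h : Supp P d
  · rw [← hq, supp_add] at h
    rw [resCoeff_pos h.1, resCoeff_pos h.2, ← hq, resCoeff_pos (supp_add.mpr h), map_mul]
  · rw [resCoeff_neg h]
    rw [← hq, supp_add] at h
    by_cases h1 : Supp P q.1
    · rw [resCoeff_neg (fun h2 => h ⟨h1, h2⟩), mul_zero]
    · rw [resCoeff_neg h1, zero_mul]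

lemma supp_zero (P : Coord D → Prop) : Supp P 0 := by intro z hz; simp at hz

lemma resFun_algebraMap (P : Coord D → Prop) (c : ℂ) : resFun P (algebraMap ℂ (Val D) c) =
    algebraMap ℂ (Val D) c := by
  classical
  refine ext fun d => ?_
  rw [coeff_resFun, MvPowerSeries.algebraMap_apply, coeff_C]
  split_ifs with h
  · rw [h, resCoeff_pos (supp_zero P), AlgHom.commutes]
  · rw [map_zero]

/-- Put to zero the fermionic and the formal variables which do not satisfy `P`. -/
def res (P : Coord D → Prop) : Val D →ₐ[ℂ] Val D where
  toFun := resFun P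
  map_one' := by rw [← map_one (algebraMap ℂ (Val D)), resFun_algebraMap]
  map_mul' := resFun_mul P
  map_zero' := by rw [← map_zero (algebraMap ℂ (Val D)), resFun_algebraMap]
  map_add' v w := ext fun d => by
    rw [map_add, coeff_resFun, coeff_resFun, coeff_resFun, map_add, map_add]
  commutes' := resFun_algebraMap P

lemma coeff_res (P : Coord D → Prop) (v : Val D) (d) : coeff d (res P v) = resCoeff P d
    (coeff d v) := rfl

attribute [irreducible] res

lemma smooth_res (P : Coord D → Prop) {f : SF D} (hf : Smooth D W f) : Smooth D W
    (fun x => res P (f x)) := by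
  rw [smooth_iff] at *
  intro d ℓ
  simp only [coeff_res]
  exact hf d (ℓ.comp (resCoeff P d))

lemma sig_res (P : Coord D → Prop) (v : Val D) : sig (res P v) = res P (sig v) := by
  refine ext fun d => ?_
  rw [coeff_sig, coeff_res, coeff_res, coeff_sig]
  by_cases h : Supp P d
  · rw [resCoeff_pos h, resCoeff_pos h, inv_kl]
  · rw [resCoeff_neg h, resCoeff_neg h, map_zero]

lemma ld_res_pos {P : Coord D → Prop} {f : SF D} (hf : Smooth D W f) {z : Coord D} (hz : P z)
    (hx : x ∈ W) : BV.ld D z (fun y => res P (f y)) x = res P (BV.ld D z f x) := by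
  refine ext fun d => ?_
  rw [coeff_res]
  by_cases h : par D z = 0
  · rcases z with A | a
    · rw [ld_body h, ld_body h]
      refine Lam_ext fun ℓ => ?_
      rw [pdBody_apply (smooth_res P hf) _ d ℓ hx]
      simp only [coeff_res]
      have h2 := pdBody_apply hf ⟨A, h⟩ d (ℓ.comp (resCoeff P d)) hx
      simp only [LinearMap.comp_apply] at h2
      exact h2.symm
    · rw [ld_formal h, ld_formal h, coeff_pdFormal, coeff_pdFormal, coeff_res, map_smul]
      congr 1
      have h1 : Supp P (Finsupp.single (⟨a, h⟩ : FormalIdx D) 1) := by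
        intro z' hz'
        rw [Finsupp.mem_support_iff, Finsupp.single_apply] at hz'
        split_ifs at hz' with h3
        · rw [← h3]; exact hz
        · exact absurd rfl hz'
      by_cases h2 : Supp P d
      · rw [resCoeff_pos h2, resCoeff_pos (supp_add.mpr ⟨h2, h1⟩)]
      · rw [resCoeff_neg h2, resCoeff_neg (fun h3 => h2 (supp_add.mp h3).1)]
  · rw [ld_odd h, ld_odd h, coeff_pdOdd, coeff_pdOdd, coeff_res]
    by_cases h2 : Supp P d
    · rw [resCoeff_pos h2, resCoeff_pos h2, dO_kl_pos (fun o : OddIdx D => P o.1) (o := ⟨z, h⟩) hz]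
    · rw [resCoeff_neg h2, resCoeff_neg h2, map_zero]

lemma ld_res_neg {P : Coord D → Prop} (f : SF D) {a : Aux D} (hz : ¬ P (inr a)) (x : Body D) : BV.ld
    D (inr a) (fun y => res P (f y)) x = 0 := by
  refine ext fun d => ?_
  by_cases h : par D (inr a) = 0
  · rw [ld_formal h, coeff_pdFormal, coeff_res, resCoeff_neg, smul_zero, map_zero]
    intro h2
    exact hz (h2 ⟨a, h⟩ (by simp))
  · rw [ld_odd h, coeff_pdOdd, coeff_res]
    by_cases h2 : Supp P d
    · rw [resCoeff_pos h2, dO_kl_neg _ (by exact hz)]; rfl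
    · rw [resCoeff_neg h2, map_zero]; rfl

lemma repr_res (P : Coord D → Prop) (v : Val D) (d) (S : Finset (OddIdx D)) : (monoBasis D).repr
    (coeff d (res P v)) S = (by
      classical exact if Supp P d ∧ ∀ o ∈ S, P o.1 then
        (monoBasis D).repr (coeff d v) S else 0) := by
  classical
  rw [coeff_res]
  by_cases h : Supp P d
  · rw [resCoeff_pos h, repr_kl _ monoBasis_isMono]
    by_cases h2 : ∀ o ∈ S, P o.1
    · rw [if_pos h2, if_pos ⟨h, h2⟩]
    · rw [if_neg h2, if_neg fun h3 => h2 h3.2]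
  · rw [resCoeff_neg h, if_neg fun h3 => h h3.1, map_zero]; rfl

lemma Val_ext_repr {v w : Val D}
    (h : ∀ d S, (monoBasis D).repr (coeff d v) S = (monoBasis D).repr (coeff d w) S) : v = w :=
  ext fun d => (monoBasis D).ext_elem fun S => h d S

lemma res_res (P P' : Coord D → Prop) (v : Val D) : res P (res P' v) = res (fun z => P z ∧ P' z)
    v := by
  refine Val_ext_repr fun d S => ?_
  rw [repr_res, repr_res, repr_res]
  by_cases h1 : Supp P d ∧ ∀ o ∈ S, P o.1 <;> by_cases h2 : Supp P' d ∧ ∀ o ∈ S, P' o.1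
  · rw [if_pos h1, if_pos h2, if_pos ⟨fun z hz => ⟨h1.1 z hz, h2.1 z hz⟩, fun o ho => ⟨h1.2 o ho,
      h2.2 o ho⟩⟩]
  · rw [if_pos h1, if_neg h2, if_neg fun h => h2 ⟨fun z hz => (h.1 z hz).2, fun o ho => (h.2 o
      ho).2⟩]
  · rw [if_neg h1, if_neg fun h => h1 ⟨fun z hz => (h.1 z hz).1, fun o ho => (h.2 o ho).1⟩]
  · rw [if_neg h1, if_neg fun h => h1 ⟨fun z hz => (h.1 z hz).1, fun o ho => (h.2 o ho).1⟩]

/-- The projection to vanishing first-level variables. -/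
abbrev z0 : Val D →ₐ[ℂ] Val D := res fun z => z.isLeft = true

lemma supp_isLeft {d : Expo D} : Supp (fun z : Coord D => z.isLeft = true) d ↔ d = 0 := by
  constructor
  · intro h
    ext z
    by_contra h2
    simpa using h z (Finsupp.mem_support_iff.mpr h2)
  · rintro rfl; exact supp_zero _

lemma kill_eq_res {P : Coord D → Prop} (hP : ∀ a, ¬ P (inr a)) (f : SF D) (x : Body D) : kill D P f
    x = res P (f x) := by
  classical
  refine ext fun d => ?_
  rw [coeff_res]
  by_cases h : d = 0
  · subst h
    rw [resCoeff_pos (supp_zero P)]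
    exact (coeff_C _ _).trans (if_pos rfl)
  · rw [resCoeff_neg (fun h2 => h (by
      ext z
      by_contra h3
      exact hP _ (h2 z (Finsupp.mem_support_iff.mpr h3))))]
    exact (coeff_C _ _).trans (if_neg h)

lemma atZero_eq (f : SF D) (x : Body D) : atZero D f x = z0 (f x) :=
  kill_eq_res (by simp) f x

/-- `SFR` version of `res`. -/
def SFR.resF (P : Coord D → Prop) (f : SFR W) : SFR W :=
  of (fun x => res P (f.rep x)) (smooth_res P f.smooth)

lemma SFR.at_resF (P : Coord D → Prop) (f : SFR W) (hx : x ∈ W) : ev x hx (f.resF P) = res P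
    (ev x hx f) := by
  rw [SFR.resF, SFR.at_of, SFR.at_apply]

/-- Put to zero the fermionic and the formal variables which do not satisfy `P`. -/
def SFR.res (P : Coord D → Prop) : SFR W →ₐ[ℂ] SFR W where
  toFun := SFR.resF P
  map_one' := SFR.ext_at fun x hx => by rw [SFR.at_resF, map_one, map_one]
  map_mul' f g := SFR.ext_at fun x hx => by simp only [SFR.at_resF, map_mul]
  map_zero' := SFR.ext_at fun x hx => by rw [SFR.at_resF, map_zero, map_zero]
  map_add' f g := SFR.ext_at fun x hx => by simp only [SFR.at_resF, map_add]
  commutes' c := SFR.ext_at fun x hx => by rw [SFR.at_resF, AlgHom.commutes, AlgHom.commutes]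

lemma SFR.at_res (P : Coord D → Prop) (f : SFR W) (hx : x ∈ W) : ev x hx (SFR.res P f) = BV.res P
    (ev x hx f) := SFR.at_resF P f hx

lemma SFR.res_of (P : Coord D → Prop) (f : SF D) (hf : Smooth D W f) : SFR.res P (of f hf) = of
    (fun x => BV.res P (f x)) (smooth_res P hf) :=
  SFR.ext_at fun x hx => by rw [SFR.at_res, SFR.at_of, SFR.at_of]

lemma SFR.σ_res (P : Coord D → Prop) (f : SFR W) : (sc W).σ (SFR.res P f) = SFR.res P
    ((sc W).σ f) := SFR.ext_at fun x hx => by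
  rw [sc_σ_at, SFR.at_res, SFR.at_res, sc_σ_at, sig_res]

lemma SFR.ld_res_pos {P : Coord D → Prop} {z : Coord D} (hz : P z) (f : SFR W) : (sc W).ld z
    (SFR.res P f) = SFR.res P ((sc W).ld z f) := by
  rw [← f.of_rep, SFR.res_of, sc_ld_of, sc_ld_of, SFR.res_of]
  exact of_congr _ _ fun x hx => BV.ld_res_pos f.smooth hz hx

lemma SFR.ld_res_neg {P : Coord D → Prop} {a : Aux D} (hz : ¬ P (inr a)) (f : SFR W) : (sc W).ld
    (inr a) (SFR.res P f) = 0 := by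
  rw [← f.of_rep, SFR.res_of, sc_ld_of]
  exact SFR.ext_at fun x hx => by rw [SFR.at_of, BV.ld_res_neg _ hz, map_zero]

lemma SFR.rd_res_pos {P : Coord D → Prop} {z : Coord D} (hz : P z) (f : SFR W) : (sc W).rd z
    (SFR.res P f) = SFR.res P ((sc W).rd z f) := by
  unfold SuperCalc.rd
  split_ifs
  · exact SFR.ld_res_pos hz f
  · simp only [LinearMap.neg_apply, LinearMap.comp_apply, AlgHom.toLinearMap_apply, map_neg,
      SFR.σ_res, SFR.ld_res_pos hz]

lemma SFR.rd_res_neg {P : Coord D → Prop} {a : Aux D} (hz : ¬ P (inr a)) (f : SFR W) : (sc W).rd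
    (inr a) (SFR.res P f) = 0 := by
  unfold SuperCalc.rd
  split_ifs
  · exact SFR.ld_res_neg hz f
  · simp only [LinearMap.neg_apply, LinearMap.comp_apply, AlgHom.toLinearMap_apply, SFR.σ_res,
      SFR.ld_res_neg hz, neg_zero]

lemma SFR.hom_res {P : Coord D → Prop} {q : ZMod 2} {f : SFR W} (h : (sc W).Hom q f) : (sc W).Hom q
    (SFR.res P f) := by
  unfold SuperCalc.Hom at *
  rw [SFR.σ_res, h, map_smul]

attribute [irreducible] SFR.res

open BV.SFR (at_of ext_at at_apply at_res at_sg at_der rep_of of_rep)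
open BV.SFR (res_of hom_res rd_res_pos resF at_resF)

lemma coord_body {A : Ext D} (h : par D (inl A) = 0) : coord D (inl A) = fun x => algebraMap ℂ
    (Val D) ((x ⟨A, h⟩ : ℝ) : ℂ) := by
  rw [coord, dif_pos h]

lemma coord_formal {a : Aux D} (h : par D (inr a) = 0) : coord D (inr a) = fun _ => MvPowerSeries.X
    ⟨a, h⟩ := by
  rw [coord, dif_pos h]

lemma coord_odd {z : Coord D} (h : ¬ par D z = 0) : coord D z = fun _ => MvPowerSeries.C
    (ExteriorAlgebra.ι ℂ (Pi.single (⟨z, h⟩ : OddIdx D) (1 : ℂ))) := by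
  rw [coord, dif_neg h]

/-- A complex-valued function as a superfunction. -/
def fnSF (φ : Body D → ℂ) : SF D := fun x => algebraMap ℂ (Val D) (φ x)

lemma coeff_fnSF (φ : Body D → ℂ) (d) (x : Body D) : coeff d (fnSF φ x) =
    (by classical exact if d = 0 then algebraMap ℂ (Lam D) (φ x) else 0) := by
  classical
  rw [fnSF, MvPowerSeries.algebraMap_apply, coeff_C]

lemma apply_coeff_fnSF (φ : Body D → ℂ) (d) (ℓ : Lam D →ₗ[ℂ] ℂ) (x : Body D) : ℓ
    (coeff d (fnSF φ x)) = φ x * (by classical exact if d = 0 then ℓ 1 else 0) := by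
  classical
  rw [coeff_fnSF]
  split_ifs with h
  · rw [Algebra.algebraMap_eq_smul_one, map_smul, smul_eq_mul]
  · rw [map_zero, mul_zero]

lemma smooth_fnSF {φ : Body D → ℂ} (h : ContDiffOn ℝ ∞ φ W) : Smooth D W (fnSF φ) := by
  rw [smooth_iff]
  intro d ℓ
  simp only [apply_coeff_fnSF]
  exact h.mul contDiffOn_const

lemma ld_fnSF {φ : Body D → ℂ} (h : ContDiffOn ℝ ∞ φ W) {A : Ext D} (hA : par D (inl A) = 0)
    (hx : x ∈ W) : BV.ld D (inl A) (fnSF φ) x = fnSF (fun y => fderiv ℝ φ y (Pi.single ⟨A, hA⟩ 1))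
    x := by
  rw [ld_body hA]
  refine ext fun d => Lam_ext fun ℓ => ?_
  rw [pdBody_apply (smooth_fnSF h) _ d ℓ hx, apply_coeff_fnSF]
  simp only [apply_coeff_fnSF]
  have hd : DifferentiableAt ℝ φ x :=
    (h.contDiffAt (W.isOpen.mem_nhds hx)).differentiableAt (by simp)
  rw [fderiv_mul_const hd, smul_apply, smul_eq_mul, mul_comm]

lemma ld_fnSF_odd (φ : Body D → ℂ) {z : Coord D} (hz : ¬ par D z = 0) : BV.ld D z (fnSF φ) = 0 := by
  classical
  funext x
  refine ext fun d => ?_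
  rw [ld_odd hz, coeff_pdOdd, coeff_fnSF]
  split_ifs
  · rw [dO_algebraMap]; rfl
  · rw [map_zero]; rfl

lemma ld_fnSF_aux (φ : Body D → ℂ) (a : Aux D) : BV.ld D (inr a) (fnSF φ) = 0 := by
  classical
  by_cases h : par D (inr a) = 0
  · funext x
    refine ext fun d => ?_
    rw [ld_formal h, coeff_pdFormal, coeff_fnSF, if_neg, smul_zero]
    · rfl
    · intro h2; simpa using DFunLike.congr_fun h2 ⟨a, h⟩
  · exact ld_fnSF_odd φ h

lemma smooth_coord (z : Coord D) : Smooth D W (coord D z) := by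
  by_cases h : par D z = 0
  · rcases z with A | a
    · rw [coord_body h]
      refine smooth_fnSF (φ := fun x => ((x ⟨A, h⟩ : ℝ) : ℂ)) (ContDiff.contDiffOn ?_)
      exact Complex.ofRealCLM.contDiff.comp (contDiff_apply ℝ ℝ _)
    · rw [coord_formal h]; exact smooth_const _ _
  · rw [coord_odd h]; exact smooth_const _ _

lemma sig_algebraMap (c : ℂ) : sig (algebraMap ℂ (Val D) c) = algebraMap ℂ (Val D) c :=
  AlgHom.commutes _ _

lemma sig_coord (z : Coord D) (x : Body D) : sig (coord D z x) = sgn (par D z) • coord D z x := by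
  classical
  by_cases h : par D z = 0
  · rw [h, sgn_zero, one_smul]
    rcases z with A | a
    · rw [coord_body h]; exact sig_algebraMap _
    · rw [coord_formal h]
      refine ext fun d => ?_
      rw [coeff_sig, MvPowerSeries.coeff_X]
      split_ifs <;> simp
  · rw [coord_odd h, sgn, if_neg h, neg_one_smul]
    refine ext fun d => ?_
    rw [coeff_sig, map_neg, coeff_C]
    split_ifs
    · rw [inv_ι]
    · rw [map_zero, neg_zero]

lemma ld_coord (z w : Coord D) (x : Body D) : BV.ld D z (coord D w) x =
    (by classical exact if z = w then 1 else 0) := by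
  classical
  by_cases hw : par D w = 0
  · rcases w with A | a
    · have e : coord D (inl A) = fnSF fun x => ((x ⟨A, hw⟩ : ℝ) : ℂ) := coord_body hw
      have hs : ContDiff ℝ ∞ (fun x : Body D => ((x ⟨A, hw⟩ : ℝ) : ℂ)) :=
        Complex.ofRealCLM.contDiff.comp (contDiff_apply ℝ ℝ _)
      rw [e]
      by_cases hz : par D z = 0
      · rcases z with B | b
        · rw [ld_fnSF (W := ⊤) hs.contDiffOn hz (Opens.mem_top x)]
          have h2 : fderiv ℝ (fun x : Body D => ((x ⟨A, hw⟩ : ℝ) : ℂ)) x =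
              Complex.ofRealCLM.comp (ContinuousLinearMap.proj ⟨A, hw⟩) :=
            (Complex.ofRealCLM.comp (ContinuousLinearMap.proj (R := ℝ)
              (φ := fun _ : BodyIdx D => ℝ) ⟨A, hw⟩)).hasFDerivAt.fderiv
          rw [fnSF, h2, ContinuousLinearMap.comp_apply, ContinuousLinearMap.proj_apply,
            Pi.single_apply]
          by_cases hAB : B = A
          · subst hAB; rw [if_pos rfl, if_pos rfl]; simp
          · rw [if_neg (fun h => hAB (by simpa using h.symm)), if_neg (by simpa using hAB)]
            simp
        · rw [ld_fnSF_aux, if_neg (by simp)]; rfl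
      · rw [ld_fnSF_odd _ hz, if_neg (by rintro rfl; exact hz hw)]; rfl
    · rw [coord_formal hw]
      by_cases hz : par D z = 0
      · rcases z with B | b
        · rw [ld_body hz, if_neg (by simp)]
          refine ext fun d => Lam_ext fun ℓ => ?_
          rw [pdBody_apply (W := ⊤) (smooth_const _ _) _ d ℓ (Opens.mem_top x)]
          simp
        · rw [ld_formal hz]
          refine ext fun d => ?_
          rw [coeff_pdFormal, MvPowerSeries.coeff_X]
          by_cases hab : b = a
          · subst hab
            rw [if_pos rfl, MvPowerSeries.coeff_one]
            by_cases hd : d = 0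
            · subst hd; simp
            · rw [if_neg hd, if_neg (by simpa using hd), smul_zero]
          · rw [if_neg (show ¬ (inr b : Coord D) = inr a by simpa using hab), if_neg, smul_zero,
              map_zero]
            intro (h : d + Finsupp.single ⟨b, hz⟩ 1 = Finsupp.single ⟨a, hw⟩ 1)
            have := DFunLike.congr_fun h ⟨b, hz⟩
            rw [Finsupp.add_apply, Finsupp.single_eq_same, Finsupp.single_apply,
              if_neg (fun h => hab (by simpa using h.symm))] at this
            omega
      · rw [ld_odd hz, if_neg (by rintro rfl; exact hz hw)]
        refine ext fun d => ?_
        rw [coeff_pdOdd, MvPowerSeries.coeff_X, map_zero]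
        split_ifs
        · rw [← map_one (algebraMap ℂ (Lam D)), dO_algebraMap]
        · rw [map_zero]
  · rw [coord_odd hw]
    by_cases hz : par D z = 0
    · rw [if_neg (by rintro rfl; exact hw hz)]
      rcases z with B | b
      · rw [ld_body hz]
        refine ext fun d => Lam_ext fun ℓ => ?_
        rw [pdBody_apply (W := ⊤) (smooth_const _ _) _ d ℓ (Opens.mem_top x)]
        simp
      · rw [ld_formal hz]
        refine ext fun d => ?_
        rw [coeff_pdFormal, MvPowerSeries.coeff_add_single_C, smul_zero, map_zero]
    · rw [ld_odd hz]
      refine ext fun d => ?_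
      rw [coeff_pdOdd, coeff_C]
      by_cases hzw : z = w
      · subst hzw
        rw [if_pos rfl, MvPowerSeries.coeff_one]
        split_ifs
        · rw [dO_th, if_pos rfl, map_one]
        · rw [map_zero]
      · rw [if_neg hzw, map_zero]
        split_ifs
        · rw [dO_th, if_neg (by simpa using hzw), map_zero]
        · rw [map_zero]

/-- The coordinates as elements of the algebra of superfunctions. -/
def SFR.xc (z : Coord D) : SFR W := of (coord D z) (smooth_coord z)

lemma SFR.hom_X (z : Coord D) : (sc W).Hom (par D z) (SFR.xc z) := ext_at fun x hx => by
  rw [sc_σ_at, map_smul, SFR.xc, at_of, sig_coord]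

lemma SFR.ld_X (z w : Coord D) : (sc W).ld z (SFR.xc w) =
    (by classical exact if z = w then 1 else 0) := by
  classical
  refine ext_at fun x hx => ?_
  rw [SFR.xc, sc_ld_of, at_of, ld_coord]
  split_ifs <;> simp

lemma SFR.rd_X (z w : Coord D) : (sc W).rd z (SFR.xc w) =
    (by classical exact if z = w then 1 else 0) := by
  classical
  rw [(SFR.hom_X w).rd_eq, SFR.ld_X]
  split_ifs with h
  · subst h
    generalize par D z = q
    have : q * (q + 1) = 0 := by revert q; decide
    rw [this, sgn_zero, one_smul]
  · rw [smul_zero]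

lemma SFR.res_X_pos {P : Coord D → Prop} {z : Coord D} (h : P z) : SFR.res P (SFR.xc z : SFR W) =
    SFR.xc z := by
  classical
  refine ext_at fun x hx => ?_
  rw [at_res, SFR.xc, at_of]
  by_cases hz : par D z = 0
  · rcases z with A | a
    · rw [coord_body hz]; exact AlgHom.commutes _ _
    · rw [coord_formal hz]
      refine MvPowerSeries.ext fun d => ?_
      rw [coeff_res, MvPowerSeries.coeff_X]
      split_ifs with h1
      · rw [h1, resCoeff_pos, map_one]
        intro z hz'
        rw [Finsupp.mem_support_iff, Finsupp.single_apply] at hz'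
        split_ifs at hz' with h3
        · rw [← h3]; exact h
        · exact absurd rfl hz'
      · rw [map_zero]
  · rw [coord_odd hz]
    refine MvPowerSeries.ext fun d => ?_
    rw [coeff_res, coeff_C]
    split_ifs with h1
    · rw [h1, resCoeff_pos (supp_zero P)]
      exact (kl_th _ _).trans (if_pos h)
    · rw [map_zero]

/-! ### Planck weights -/

/-- The Planck number of a variable. -/
def plC : Coord D → ℤ
  | inl _ => 0
  | inr a => pl D a

/-- The Planck number of a monomial in the bosonic first-level variables. -/
def plD : Expo D →+ ℤ :=
  Finsupp.liftAddHom fun z => (AddMonoidHom.mulRight (pl D z.1)).comp (Nat.castAddMonoidHom ℤ)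

lemma plD_single (z : FormalIdx D) (n : ℕ) : plD (Finsupp.single z n) = n * pl D z.1 := by
  rw [plD, Finsupp.liftAddHom_apply_single]; rfl

lemma plD_eq (d : Expo D) : plD d = ∑ z, (d z : ℤ) * pl D z.1 := by
  rw [plD, Finsupp.liftAddHom_apply, Finsupp.sum_fintype _ _ (fun _ => map_zero _)]; rfl

/-- The values with components of Planck numbers in `T`. -/
def VW (T : Set ℤ) (v : Val D) : Prop :=
  ∀ d, coeff d v ∈ K (fun o : OddIdx D => plC o.1) {t | plD d + t ∈ T}

lemma vw_iff {T : Set ℤ} {v : Val D} : VW T v ↔ ∀ d S, (monoBasis D).repr (coeff d v) S ≠ 0 → plD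
    d + ∑ o ∈ S, plC o.1 ∈ T := by
  simp only [VW, mem_K_iff monoBasis_isMono, Set.mem_ofPred_eq]

lemma VW.mul {T T' T'' : Set ℤ} (hT : ∀ u ∈ T, ∀ u' ∈ T', u + u' ∈ T'') {v v' : Val D} (h : VW T v)
    (h' : VW T' v') : VW T'' (v * v') := by
  intro d
  rw [coeff_mul']
  refine sum_mem fun q hq => K_mul (fun u hu u' hu' => ?_) (h q.1) (h' q.2)
  rw [mem_antidiagonal] at hq
  simp only [Set.mem_ofPred_eq] at *
  have := hT _ hu _ hu'
  rwa [← hq, map_add, add_add_add_comm]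

variable (W) in
/-- The superfunctions with components of Planck numbers in `T`. -/
def Wt (T : Set ℤ) : Submodule ℂ (SFR W) where
  carrier := {f | ∀ x (hx : x ∈ W), VW T (ev x hx f)}
  add_mem' hf hg x hx d := by rw [map_add, map_add]; exact add_mem (hf x hx d) (hg x hx d)
  zero_mem' x hx d := by rw [map_zero, map_zero]; exact zero_mem _
  smul_mem' c f hf x hx d := by
    rw [map_smul, coeff_smul']; exact Submodule.smul_mem _ _ (hf x hx d)

lemma mem_wt {T : Set ℤ} {f : SFR W} : f ∈ Wt W T ↔ ∀ x (hx : x ∈ W), VW T (ev x hx f) := Iff.rfl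

attribute [irreducible] Wt

lemma mem_wt_iff {T : Set ℤ} {f : SFR W} : f ∈ Wt W T ↔ ∀ x (hx : x ∈ W) d S, (monoBasis D).repr
    (coeff d (ev x hx f)) S ≠ 0 → plD d + ∑ o ∈ S, plC o.1 ∈ T := by
  simp only [mem_wt, vw_iff]

lemma wt_mono {T T' : Set ℤ} (h : T ⊆ T') : Wt W T ≤ Wt W T' :=
  fun _ hf => mem_wt_iff.mpr fun x hx d S hS => h (mem_wt_iff.mp hf x hx d S hS)

lemma wt_disjoint {T T' : Set ℤ} (h : Disjoint T T') {f : SFR W} (h1 : f ∈ Wt W T)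
    (h2 : f ∈ Wt W T') : f = 0 := ext_at fun x hx => ext fun d => by
  rw [map_zero, map_zero]
  refine K_disjoint ?_ (mem_wt.mp h1 x hx d) (mem_wt.mp h2 x hx d)
  exact Set.disjoint_left.mpr fun t ht ht' => Set.disjoint_left.mp h ht ht'

lemma wt_mul {T T' T'' : Set ℤ} (hT : ∀ u ∈ T, ∀ u' ∈ T', u + u' ∈ T'') {f g : SFR W}
    (h : f ∈ Wt W T) (h' : g ∈ Wt W T') : f * g ∈ Wt W T'' := mem_wt.mpr fun x hx => by
  rw [map_mul]; exact VW.mul hT (mem_wt.mp h x hx) (mem_wt.mp h' x hx)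

lemma K_pdBody {f : SF D} (hf : Smooth D W f) {d : Expo D} {w : OddIdx D → ℤ} {T : Set ℤ}
    (h : ∀ y ∈ W, coeff d (f y) ∈ K w T) (b : BodyIdx D) (hx : x ∈ W) : coeff d (pdBody D b f x) ∈ K
    w T := by
  rw [mem_K_iff monoBasis_isMono]
  intro S hS
  by_contra h2
  apply hS
  have h3 := pdBody_apply hf b d ((monoBasis D).coord S) hx
  rw [Module.Basis.coord_apply] at h3
  have h4 : (fun y => (monoBasis D).coord S (coeff d (f y))) =ᶠ[nhds x] fun _ => 0 := by
    filter_upwards [W.isOpen.mem_nhds hx] with y hy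
    by_contra h5
    exact h2 ((mem_K_iff monoBasis_isMono).mp (h y hy) S h5)
  rw [h3, h4.fderiv_eq]; simp

lemma wt_ld {T T' : Set ℤ} (z : Coord D) (hT : ∀ u ∈ T, u - plC z ∈ T') {f : SFR W}
    (h : f ∈ Wt W T) : (sc W).ld z f ∈ Wt W T' := by
  rw [mem_wt] at h ⊢
  intro x hx d
  rw [sc_ld_at]
  have hf : ∀ y ∈ W, VW T (f.rep y) := fun y hy => by
    have := h y hy; rwa [at_apply] at this
  by_cases hz : par D z = 0
  · rcases z with A | a
    · rw [ld_body hz]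
      refine K_pdBody f.smooth (fun y hy => K_mono (fun t ht => ?_) (hf y hy d)) _ hx
      have := hT _ ht
      simpa [plC] using this
    · rw [ld_formal hz, coeff_pdFormal]
      refine Submodule.smul_mem _ _ (K_mono ?_ (hf x hx (d + Finsupp.single ⟨a, hz⟩ 1)))
      intro t ht
      have := hT _ ht
      rw [map_add, plD_single] at this
      simp only [plC, Nat.cast_one, one_mul] at this
      rw [Set.mem_ofPred_eq]
      convert this using 1
      ring
  · rw [ld_odd hz, coeff_pdOdd]
    refine K_dO _ (fun t ht => ?_) (hf x hx d)
    have := hT _ ht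
    rw [Set.mem_ofPred_eq]
    convert this using 1
    ring

lemma wt_σ {T : Set ℤ} {f : SFR W} (h : f ∈ Wt W T) : (sc W).σ f ∈ Wt W T :=
  mem_wt.mpr fun x hx d => by rw [sc_σ_at, coeff_sig]; exact K_inv (mem_wt.mp h x hx d)

lemma wt_rd {T T' : Set ℤ} (z : Coord D) (hT : ∀ u ∈ T, u - plC z ∈ T') {f : SFR W}
    (h : f ∈ Wt W T) : (sc W).rd z f ∈ Wt W T' := by
  unfold SuperCalc.rd
  split_ifs
  · exact wt_ld z hT h
  · exact neg_mem (wt_ld z hT (wt_σ h))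

lemma wt_ext {f : SFR W} (h : SFR.res (fun z => z.isLeft = true) f = f) : f ∈ Wt W {0} := by
  rw [mem_wt_iff]
  intro x hx d S hS
  rw [← h, at_res, repr_res] at hS
  split_ifs at hS with h1
  · rw [supp_isLeft] at h1
    rw [h1.1, map_zero, zero_add, Set.mem_singleton_iff]
    refine sum_eq_zero fun o ho => ?_
    have := h1.2 o ho
    rcases o with ⟨A | a, _⟩
    · rfl
    · simp at this
  · exact absurd rfl hS

/-- The variables `Γ^{A_ext}` and `λ^{a_ext}`. -/
def keepL (z : Coord D) : Prop := z.isLeft = true ∨ ∃ a, z = lam D a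

lemma plC_keepL {z : Coord D} (h : keepL z) : 0 ≤ plC z := by
  rcases h with h | ⟨a, rfl⟩
  · rcases z with A | a
    · exact le_rfl
    · simp at h
  · exact zero_le_one

lemma plC_keepL_pos {z : Coord D} (h : keepL z) (h' : ¬ z.isLeft = true) : 0 < plC z := by
  rcases h with h | ⟨a, rfl⟩
  · exact absurd h h'
  · exact zero_lt_one

lemma plD_nonneg {d : Expo D} (h : Supp keepL d) : 0 ≤ plD d := by
  rw [plD_eq]
  refine Finset.sum_nonneg fun z _ => ?_
  by_cases hz : d z = 0
  · rw [hz]; simp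
  · exact mul_nonneg (by positivity) (plC_keepL (h z (Finsupp.mem_support_iff.mpr hz)))

lemma plD_pos {d : Expo D} (h : Supp keepL d) (hd : d ≠ 0) : 0 < plD d := by
  rw [plD_eq]
  obtain ⟨z, hz⟩ := Finsupp.ne_iff.mp hd
  have hz' : d z ≠ 0 := hz
  refine Finset.sum_pos' (fun z _ => ?_) ⟨z, mem_univ _, ?_⟩
  · by_cases hz : d z = 0
    · rw [hz]; simp
    · exact mul_nonneg (by positivity) (plC_keepL (h z (Finsupp.mem_support_iff.mpr hz)))
  · exact mul_pos (by positivity)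
      (plC_keepL_pos (z := inr z.1) (h z (Finsupp.mem_support_iff.mpr hz')) (by simp))

lemma resL_neg {u : ℤ} (hu : u < 0) {f : SFR W} (h : f ∈ Wt W {u}) : SFR.res keepL f = 0 :=
  ext_at fun x hx => Val_ext_repr fun d S => by
    rw [at_res, repr_res, map_zero]
    split_ifs with h1
    · rw [map_zero, map_zero, Finsupp.zero_apply]
      by_contra h2
      have h3 := mem_wt_iff.mp h x hx d S h2
      rw [Set.mem_singleton_iff] at h3
      have h4 := plD_nonneg h1.1
      have h5 : 0 ≤ ∑ o ∈ S, plC o.1 := Finset.sum_nonneg fun o ho => plC_keepL (h1.2 o ho)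
      omega
    · rw [map_zero, map_zero, Finsupp.zero_apply]

lemma resL_zero {f : SFR W} (h : f ∈ Wt W {0}) : SFR.res keepL f = SFR.res
    (fun z => z.isLeft = true) f :=
  ext_at fun x hx => Val_ext_repr fun d S => by
    rw [at_res, repr_res, at_res, repr_res]
    by_cases h0 : (monoBasis D).repr (coeff d (ev x hx f)) S = 0
    · rw [h0, ite_self, ite_self]
    have h3 := mem_wt_iff.mp h x hx d S h0
    rw [Set.mem_singleton_iff] at h3
    by_cases h1 : Supp keepL d ∧ ∀ o ∈ S, keepL o.1
    · rw [if_pos h1, if_pos]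
      have h4 := plD_nonneg h1.1
      have h5 : ∀ o ∈ S, 0 ≤ plC o.1 := fun o ho => plC_keepL (h1.2 o ho)
      have h6 := Finset.sum_nonneg h5
      have h7 : ∑ o ∈ S, plC o.1 = 0 := by omega
      rw [Finset.sum_eq_zero_iff_of_nonneg h5] at h7
      rw [supp_isLeft]
      constructor
      · by_contra h8
        have := plD_pos h1.1 h8
        omega
      · intro o ho
        by_contra h8
        exact absurd (h7 o ho) (plC_keepL_pos (h1.2 o ho) h8).ne'
    · rw [if_neg h1, if_neg]
      rintro ⟨h4, h5⟩
      exact h1 ⟨fun z hz => Or.inl (h4 z hz), fun o ho => Or.inl (h5 o ho)⟩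

lemma coeff_coord_mul_ld (f : SF D) (a : Aux D) (d) (x : Body D) : coeff d
    ((coord D (inr a) * BV.ld D (inr a) f) x) = (if h : par D (inr a) = 0 then (d ⟨a, h⟩ : ℂ) •
    coeff d (f x) else th ⟨inr a, h⟩ * dO ⟨inr a, h⟩ (coeff d (f x))) := by
  classical
  rw [Pi.mul_apply]
  split_ifs with h
  · rw [coord_formal h, ld_formal h, MvPowerSeries.X_def, MvPowerSeries.coeff_monomial_mul, one_mul,
      coeff_pdFormal]
    by_cases hd : d ⟨a, h⟩ = 0
    · rw [hd, if_neg, Nat.cast_zero, zero_smul]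
      intro h2
      have := h2 ⟨a, h⟩
      rw [Finsupp.single_eq_same, hd] at this
      omega
    · have h2 : Finsupp.single (⟨a, h⟩ : FormalIdx D) 1 ≤ d := by
        rw [Finsupp.single_le_iff]; omega
      rw [if_pos h2, tsub_add_cancel_of_le h2, Finsupp.tsub_apply, Finsupp.single_eq_same,
        Nat.sub_add_cancel (by omega)]
  · rw [coord_odd h, ld_odd h, MvPowerSeries.coeff_C_mul, coeff_pdOdd]

lemma sum_dite_zero {ι M : Type*} [Fintype ι] [AddCommMonoid M] (p : ι → Prop) [DecidablePred p]
    (f : {i // p i} → M) : ∑ i, (if h : p i then f ⟨i, h⟩ else 0) = ∑ z, f z := by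
  rw [Finset.sum_dite, Finset.sum_const_zero, add_zero]
  exact Finset.sum_bij' (fun i _ => ⟨i.1, (Finset.mem_filter.mp i.2).2⟩)
    (fun z _ => ⟨z.1, Finset.mem_filter.mpr ⟨mem_univ _, z.2⟩⟩)
    (by simp) (by simp) (by simp) (by simp) (by simp)

lemma repr_planck (f : SF D) (d) (S : Finset (OddIdx D)) (x : Body D) : (monoBasis D).repr
    (coeff d (planck D f x)) S = ((plD d + ∑ o ∈ S, plC o.1 : ℤ) : ℂ) * (monoBasis D).repr
    (coeff d (f x)) S := by
  classical
  have h1 : coeff d (planck D f x) = ((plD d : ℤ) : ℂ) • coeff d (f x) +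
      wtOp (fun o : OddIdx D => plC o.1) (coeff d (f x)) := by
    rw [planck, Finset.sum_apply, map_sum]
    have h2 : ∀ a : Aux D, coeff d (((pl D a : ℂ) • (coord D (inr a) * BV.ld D (inr a) f)) x) =
        (if h : par D (inr a) = 0 then
          (pl D a : ℂ) • (d ⟨a, h⟩ : ℂ) • coeff d (f x) else 0) +
        (if h : ¬ par D (inr a) = 0 then (pl D a : ℂ) • (th ⟨inr a, h⟩ * dO ⟨inr a, h⟩ (coeff d (f
          x))) else 0) := by
      intro a
      rw [Pi.smul_apply, coeff_smul', coeff_coord_mul_ld]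
      split_ifs with h
      · rw [add_zero]
      · rw [zero_add]
    simp only [h2, sum_add_distrib]
    congr 1
    · rw [plD_eq, Int.cast_sum, Finset.sum_smul, sum_dite_zero (fun a : Aux D =>
        par D (inr a) = 0) fun z => (pl D z.1 : ℂ) • (d z : ℂ) • coeff d (f x)]
      refine sum_congr rfl fun z _ => ?_
      rw [smul_smul, Int.cast_mul, mul_comm, Int.cast_natCast]
    · rw [wtOp_apply, ← sum_dite_zero (fun z : Coord D => ¬ par D z = 0) fun o => (plC o.1 : ℂ) •
        (th o * dO o (coeff d (f x)))]
      symm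
      rw [sum_sum_type]
      rw [sum_eq_zero (s := (Finset.univ : Finset (Ext D))), zero_add]
      · rfl
      · intro A _
        split_ifs
        · rfl
        · rw [plC, Int.cast_zero, zero_smul]
  rw [h1, map_add, Finsupp.add_apply, repr_wtOp monoBasis_isMono, map_smul, Finsupp.smul_apply,
    smul_eq_mul]
  push_cast; ring

lemma wt_of_planck {f : SF D} (hf : Smooth D W f) {u : ℤ}
    (h : ∀ x ∈ W, planck D f x = (u : ℂ) • f x) : of f hf ∈ Wt W {u} := by
  rw [mem_wt_iff]
  intro x hx d S hS
  rw [at_of] at hS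
  have := repr_planck f d S x
  rw [h x hx, coeff_smul', map_smul, Finsupp.smul_apply, smul_eq_mul] at this
  have := mul_right_cancel₀ hS this
  exact (by exact_mod_cast this.symm)

open BV.SFR (xc hom_X rd_X ld_X)
open Matrix (fromBlocks fromBlocks_multiply isUnit_iff_isUnit_det det_one det_mul)
open Finset (range mem_range sum_range_succ)

/-- The body as an algebra homomorphism. -/
def bodyHom : Val D →ₐ[ℂ] ℂ where
  toRingHom := (bod : Lam D →ₐ[ℂ] ℂ).toRingHom.comp MvPowerSeries.constantCoeff
  commutes' c := by
    change bod (MvPowerSeries.constantCoeff (algebraMap ℂ (Val D) c)) = c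
    rw [MvPowerSeries.algebraMap_apply, MvPowerSeries.constantCoeff_C]
    exact AlgHom.commutes _ _

lemma bodyHom_apply (v : Val D) : bodyHom v = body D v := rfl

lemma body_eq_coeff (v : Val D) : body D v = bod (coeff 0 v) := by
  rw [MvPowerSeries.coeff_zero_eq_constantCoeff]; rfl

/-- The values whose monomials have total degree at least `m`. -/
def Au (m : ℕ) : Submodule ℂ (Val D) where
  carrier := {v | ∀ d, coeff d v ∈ aug (m - d.degree)}
  add_mem' hv hw d := by rw [map_add]; exact add_mem (hv d) (hw d)
  zero_mem' d := by rw [map_zero]; exact zero_mem _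
  smul_mem' c v hv d := by rw [coeff_smul']; exact Submodule.smul_mem _ _ (hv d)

lemma Au_mul {m l : ℕ} {v w : Val D} (hv : v ∈ Au m) (hw : w ∈ Au l) : v * w ∈ Au (m + l) := by
  intro d
  rw [coeff_mul']
  refine sum_mem fun q hq => aug_anti ?_ (aug_mul (hv q.1) (hw q.2))
  rw [mem_antidiagonal] at hq
  rw [← hq, map_add]
  omega

lemma Au_zero (v : Val D) : v ∈ Au 0 := fun d => by rw [Nat.zero_sub]; exact mem_aug_zero _

lemma Au_anti {k l : ℕ} (h : k ≤ l) : Au (D := D) l ≤ Au k :=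
  fun v hv d => aug_anti (by omega) (hv d)

lemma Au_one {v : Val D} (h : body D v = 0) : v ∈ Au 1 := by
  intro d
  by_cases hd : d = 0
  · subst hd
    rw [map_zero]
    exact mem_aug_one (by rw [← body_eq_coeff, h])
  · have : d.degree ≠ 0 := by rwa [Ne, Finsupp.degree_eq_zero_iff]
    rw [show 1 - d.degree = 0 by omega]
    exact mem_aug_zero _

lemma Au_pow {v : Val D} (h : v ∈ Au 1) (n : ℕ) : v ^ n ∈ Au n := by
  induction n with
  | zero => exact Au_zero _
  | succ n ih => rw [pow_succ]; exact Au_mul ih h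

lemma coeff_of_Au {m : ℕ} {v : Val D} (h : v ∈ Au m) {d : Expo D}
    (hd : d.degree + card (OddIdx D) < m) : coeff d v = 0 :=
  aug_eq_zero (by omega) (h d)

lemma body_sub_body (v : Val D) : body D (v - algebraMap ℂ (Val D) (body D v)) = 0 := by
  rw [← bodyHom_apply, map_sub, AlgHom.commutes, ← bodyHom_apply]
  exact sub_self _

lemma isUnit_Gr {a : Lam D} (h : bod a ≠ 0) : IsUnit a := by
  have h1 : IsNilpotent (1 - (bod a)⁻¹ • a) := by
    refine ⟨card (OddIdx D) + 1, aug_eq_zero (Nat.lt_succ_self _) ?_⟩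
    have h2 : 1 - (bod a)⁻¹ • a ∈ aug (O := OddIdx D) 1 := mem_aug_one (by
      rw [map_sub, map_one, map_smul, smul_eq_mul, inv_mul_cancel₀ h, sub_self])
    have : ∀ n, (1 - (bod a)⁻¹ • a) ^ n ∈ aug (O := OddIdx D) n := by
      intro n
      induction n with
      | zero => exact mem_aug_zero _
      | succ n ih => rw [pow_succ]; exact aug_mul ih h2
    exact this _
  have h2 := h1.isUnit_one_sub
  rw [sub_sub_cancel] at h2
  have h3 := h2.mul ((IsUnit.mk0 _ h).map (algebraMap ℂ (Lam D)))
  rwa [smul_mul_assoc, ← Algebra.commutes, ← Algebra.smul_def, smul_smul, inv_mul_cancel₀ h,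
    one_smul] at h3

lemma isUnit_Val_iff {v : Val D} : IsUnit v ↔ body D v ≠ 0 := by
  constructor
  · intro h
    exact (h.map (bodyHom (D := D))).ne_zero
  · intro h
    rw [MvPowerSeries.isUnit_iff_constantCoeff]
    exact isUnit_Gr h

lemma coeff_expVal {v : Val D} {d : Expo D} {n : ℕ} (hn : d.degree + card (OddIdx D) < n) : coeff d
    (expVal D v) = Complex.exp (body D v) • ∑ k ∈ range n, ((k.factorial : ℂ)⁻¹) • coeff d
    ((v - algebraMap ℂ (Val D) (body D v)) ^ k) := by
  have h1 : coeff d (expVal D v) = Complex.exp (body D v) •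
      ∑ n ∈ range (d.degree + card (OddIdx D) + 1), ((n.factorial : ℂ)⁻¹) •
        coeff d ((v - algebraMap ℂ (Val D) (body D v)) ^ n) := rfl
  have key : ∀ (F : ℕ → Lam D) (m : ℕ), m ≤ n → (∀ k, m ≤ k → F k = 0) →
      ∑ k ∈ range m, F k = ∑ k ∈ range n, F k := fun F m hm hF =>
    Finset.sum_subset (Finset.range_subset_range.mpr hm) fun k _ hk =>
      hF k (by rwa [mem_range, not_lt] at hk)
  rw [h1, key _ _ hn]
  intro k hk
  rw [coeff_of_Au (Au_pow (Au_one (body_sub_body v)) k) hk, smul_zero]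

lemma body_expVal (v : Val D) : body D (expVal D v) = Complex.exp (body D v) := by
  rw [body_eq_coeff, coeff_expVal (n := card (OddIdx D) + 1) (by rw [map_zero]; omega), map_smul,
    map_sum, sum_eq_single 0]
  · rw [map_smul, ← body_eq_coeff, pow_zero, ← bodyHom_apply 1, map_one, Nat.factorial_zero,
      Nat.cast_one, inv_one, one_smul, smul_eq_mul, mul_one]
  · intro n _ hn
    rw [map_smul, ← body_eq_coeff, ← bodyHom_apply, map_pow, bodyHom_apply, body_sub_body, zero_pow
      hn, smul_zero]
  · intro h; exact absurd (mem_range.mpr (Nat.succ_pos _)) h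

lemma isUnit_expVal (v : Val D) : IsUnit (expVal D v) := by
  rw [isUnit_Val_iff, body_expVal]; exact Complex.exp_ne_zero _

lemma body_sig (v : Val D) : body D (sig v) = body D v := by
  rw [body_eq_coeff, body_eq_coeff, coeff_sig]
  generalize coeff 0 v = a
  induction a using ExteriorAlgebra.induction with
  | algebraMap r => rw [AlgHom.commutes]
  | ι m => rw [inv_ι, map_neg, bod_ι, neg_zero]
  | mul a b ha hb => rw [map_mul, map_mul, map_mul, ha, hb]
  | add a b ha hb => rw [map_add, map_add, map_add, ha, hb]

lemma sig_expVal (v : Val D) : sig (expVal D v) = expVal D (sig v) := by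
  refine ext fun d => ?_
  rw [coeff_sig, coeff_expVal (Nat.lt_succ_self _), coeff_expVal (Nat.lt_succ_self _), map_smul,
    map_sum, body_sig]
  refine congrArg _ ?_
  refine sum_congr rfl fun n _ => ?_
  rw [map_smul, ← coeff_sig, map_pow, map_sub, sig_algebraMap]

lemma smooth_body {f : SF D} (hf : Smooth D W f) : ContDiffOn ℝ ∞ (fun x => body D (f x)) W := by
  simp only [body_eq_coeff]
  exact smooth_iff.mp hf 0 bod.toLinearMap

/-- A smooth complex-valued function as a superfunction. -/
def SFR.fn (φ : Body D → ℂ) (h : ContDiffOn ℝ ∞ φ W) : SFR W := of (fnSF φ) (smooth_fnSF h)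

lemma SFR.at_fn (φ : Body D → ℂ) (h : ContDiffOn ℝ ∞ φ W) (hx : x ∈ W) : ev x hx (SFR.fn φ h) =
    algebraMap ℂ (Val D) (φ x) := by rw [SFR.fn, at_of]; rfl

/-- The body of a superfunction, as a superfunction. -/
def SFR.bd (f : SFR W) : SFR W := SFR.fn (fun x => body D (f.rep x)) (smooth_body f.smooth)

lemma SFR.at_bd (f : SFR W) (hx : x ∈ W) : ev x hx f.bd = algebraMap ℂ (Val D)
    (body D (ev x hx f)) := by
  rw [SFR.bd, SFR.at_fn, at_apply]

lemma SFR.ld_fn (φ : Body D → ℂ) (h : ContDiffOn ℝ ∞ φ W) {A : Ext D} (hA : par D (inl A) = 0)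
    (hx : x ∈ W) : ev x hx ((sc W).ld (inl A) (SFR.fn φ h)) = algebraMap ℂ (Val D)
    (fderiv ℝ φ x (Pi.single ⟨A, hA⟩ 1)) := by
  rw [SFR.fn, sc_ld_of, at_of, ld_fnSF h hA hx, fnSF]

lemma SFR.ld_fn_odd (φ : Body D → ℂ) (h : ContDiffOn ℝ ∞ φ W) {z : Coord D} (hz : ¬ par D z = 0) :
    (sc W).ld z (SFR.fn φ h) = 0 := ext_at fun x hx => by
  rw [SFR.fn, sc_ld_of, at_of, ld_fnSF_odd _ hz, map_zero]; rfl

lemma SFR.ld_fn_aux (φ : Body D → ℂ) (h : ContDiffOn ℝ ∞ φ W) (a : Aux D) : (sc W).ld (inr a)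
    (SFR.fn φ h) = 0 := ext_at fun x hx => by
  rw [SFR.fn, sc_ld_of, at_of, ld_fnSF_aux, map_zero]; rfl

lemma SFR.σ_fn (φ : Body D → ℂ) (h : ContDiffOn ℝ ∞ φ W) : (sc W).σ (SFR.fn φ h) = SFR.fn φ h :=
    ext_at fun x hx => by
  rw [sc_σ_at, SFR.at_fn, sig_algebraMap]

/-- The exponential of the body. -/
def SFR.ebd (f : SFR W) : SFR W := SFR.fn (fun x => Complex.exp (body D (f.rep x)))
  (Complex.contDiff_exp.comp_contDiffOn (smooth_body f.smooth))

lemma SFR.ld_ebd (f : SFR W) (z : Coord D) : (sc W).ld z f.ebd = (sc W).ld z f.bd * f.ebd := by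
  by_cases hz : par D z = 0
  · rcases z with A | a
    · refine ext_at fun x hx => ?_
      rw [map_mul, SFR.ebd, SFR.ld_fn _ _ hz hx, SFR.bd, SFR.ld_fn _ _ hz hx, SFR.at_fn, ← map_mul]
      congr 1
      have hd := ((smooth_body f.smooth).contDiffAt (W.isOpen.mem_nhds hx)).differentiableAt
        (by simp)
      rw [hd.hasFDerivAt.cexp.fderiv, smul_apply, smul_eq_mul, mul_comm]
    · rw [SFR.ebd, SFR.ld_fn_aux, SFR.bd, SFR.ld_fn_aux, zero_mul]
  · rw [SFR.ebd, SFR.ld_fn_odd _ _ hz, SFR.bd, SFR.ld_fn_odd _ _ hz, zero_mul]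

/-- Truncations of the exponential. -/
def SFR.expT (Y : SFR W) (n : ℕ) : SFR W :=
  Y.ebd * ∑ k ∈ range n, ((k.factorial : ℂ)⁻¹) • (Y - Y.bd) ^ k

lemma coeff_expT (Y : SFR W) {n : ℕ} {d : Expo D} (hn : d.degree + card (OddIdx D) < n)
    (hx : x ∈ W) : coeff d (expVal D (Y.rep x)) = coeff d (ev x hx (Y.expT n)) := by
  rw [coeff_expVal hn, SFR.expT, map_mul, SFR.ebd, SFR.at_fn, ← Algebra.smul_def, coeff_smul',
    map_sum, map_sum]
  refine congrArg _ ?_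
  refine sum_congr rfl fun k _ => ?_
  rw [map_smul, coeff_smul', map_pow (ev x hx), map_sub (ev x hx), SFR.at_bd, at_apply]

/-- The exponential of a superfunction. -/
def SFR.exp (Y : SFR W) : SFR W := of (fun x => expVal D (Y.rep x)) (by
  rw [smooth_iff]
  intro d ℓ
  refine (smooth_iff.mp (SFR.smooth (Y.expT (d.degree + card (OddIdx D) + 1))) d ℓ).congr
    fun x hx => ?_
  rw [coeff_expT Y (Nat.lt_succ_self _) hx, at_apply])

lemma SFR.at_exp (Y : SFR W) (hx : x ∈ W) : ev x hx Y.exp = expVal D (ev x hx Y) := by rw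
    [SFR.exp, at_of, at_apply]

lemma ld_vanish {f : SFR W} {m : ℕ}
    (h : ∀ x (hx : x ∈ W) d, d.degree ≤ m + 1 → coeff d (ev x hx f) = 0) (z : Coord D) (hx : x ∈ W)
    {d : Expo D} (hd : d.degree ≤ m) : coeff d (ev x hx ((sc W).ld z f)) = 0 := by
  rw [sc_ld_at]
  by_cases hz : par D z = 0
  · rcases z with A | a
    · rw [ld_body hz]
      refine Lam_ext fun ℓ => ?_
      rw [pdBody_apply f.smooth _ d ℓ hx]
      have h4 : (fun y => ℓ (coeff d (f.rep y))) =ᶠ[nhds x] fun _ => 0 := by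
        filter_upwards [W.isOpen.mem_nhds hx] with y hy
        rw [← at_apply _ hy, h y hy d (by omega), map_zero]
      rw [h4.fderiv_eq]; simp
    · rw [ld_formal hz, coeff_pdFormal, ← at_apply _ hx, h x hx _ (by
        rw [map_add, Finsupp.degree_single]; omega), smul_zero]
  · rw [ld_odd hz, coeff_pdOdd, ← at_apply _ hx, h x hx _ (by omega), map_zero]

lemma SFR.ld_pow {f : SFR W} (hf : (sc W).σ f = f) (z : Coord D) (n : ℕ) : (sc W).ld z
    (f ^ (n + 1)) = ((n + 1 : ℕ) : ℂ) • ((sc W).ld z f * f ^ n) := by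
  have hc : ∀ b, f * b = b * f := fun b => (sc W).even_mul f b hf
  induction n with
  | zero => simp
  | succ n ih =>
    rw [pow_succ, SuperCalc.ld_mul', ih]
    have : (sc W).tw (par D z) (f ^ (n + 1)) = f ^ (n + 1) := by
      unfold SuperCalc.tw
      split_ifs
      · rfl
      · rw [map_pow, hf]
    rw [this, smul_mul_assoc, mul_assoc, ← pow_succ]
    have h2 : f ^ (n + 1) * (sc W).ld z f = (sc W).ld z f * f ^ (n + 1) :=
      ((show Commute f _ from hc _).pow_left _).eq
    rw [h2]
    push_cast
    rw [add_smul (_ + 1 : ℂ), one_smul]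

lemma SFR.σ_bd (f : SFR W) : (sc W).σ f.bd = f.bd := SFR.σ_fn _ _

lemma SFR.ld_expT_succ {Y : SFR W} (hY : (sc W).σ Y = Y) (z : Coord D) (n : ℕ) : (sc W).ld z
    (Y.expT (n + 1)) = (sc W).ld z Y.bd * Y.expT (n + 1) + ((sc W).ld z Y - (sc W).ld z Y.bd) *
    Y.expT n := by
  have hν : (sc W).σ (Y - Y.bd) = Y - Y.bd := by rw [map_sub, hY, SFR.σ_bd]
  have he : (sc W).σ Y.ebd = Y.ebd := SFR.σ_fn _ _
  have ht : (sc W).tw (par D z) Y.ebd = Y.ebd := by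
    unfold SuperCalc.tw
    split_ifs
    · rfl
    · exact he
  rw [SFR.expT, SuperCalc.ld_mul', SFR.ld_ebd, mul_assoc, ht]
  congr 1
  rw [Finset.sum_range_succ', map_add, map_sum]
  have h0 : (sc W).ld z (((Nat.factorial 0 : ℂ)⁻¹) • (Y - Y.bd) ^ 0) = 0 := by
    rw [pow_zero, map_smul, SuperCalc.ld_one, smul_zero]
  rw [h0, add_zero, SFR.expT, ← mul_assoc _ Y.ebd, ← (sc W).even_mul _ _ he, mul_assoc]
  refine congrArg (Y.ebd * ·) ?_
  rw [mul_sum]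
  refine sum_congr rfl fun k _ => ?_
  rw [map_smul, SFR.ld_pow hν, map_sub, smul_smul, mul_smul_comm]
  congr 1
  rw [Nat.factorial_succ, Nat.cast_mul, mul_inv, mul_comm, ← mul_assoc, mul_inv_cancel₀, one_mul]
  exact_mod_cast Nat.succ_ne_zero k

lemma SFR.coeff_exp_expT (Y : SFR W) {n : ℕ} {d : Expo D} (hn : d.degree + card (OddIdx D) < n)
    (hx : x ∈ W) : coeff d (ev x hx Y.exp) = coeff d (ev x hx (Y.expT n)) := by
  rw [SFR.at_exp, at_apply, coeff_expT Y hn hx]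

lemma SFR.coeff_mul_exp (a Y : SFR W) {n : ℕ} {d : Expo D} (hn : d.degree + card (OddIdx D) < n)
    (hx : x ∈ W) : coeff d (ev x hx (a * Y.exp)) = coeff d (ev x hx (a * Y.expT n)) := by
  rw [map_mul (ev x hx), map_mul (ev x hx), coeff_mul', coeff_mul']
  refine sum_congr rfl fun q hq => ?_
  rw [mem_antidiagonal] at hq
  rw [SFR.coeff_exp_expT (n := n)]
  have : q.2.degree ≤ d.degree := by rw [← hq, map_add]; omega
  omega

lemma SFR.ld_exp {Y : SFR W} (hY : (sc W).σ Y = Y) (z : Coord D) : (sc W).ld z Y.exp = (sc W).ld z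
    Y * Y.exp := by
  refine ext_at fun x hx => MvPowerSeries.ext fun d => ?_
  set n := d.degree + card (OddIdx D) + 2 with hn
  have h1 : coeff d (ev x hx ((sc W).ld z (Y.exp - Y.expT (n + 1)))) = 0 := by
    refine ld_vanish (m := d.degree) (fun y hy d' hd' => ?_) z hx le_rfl
    rw [map_sub, map_sub, SFR.coeff_exp_expT (n := n + 1) Y (by omega) hy, sub_self]
  rw [map_sub, map_sub, map_sub, sub_eq_zero] at h1
  rw [h1, SFR.ld_expT_succ hY, map_add, map_add, ← SFR.coeff_mul_exp _ _ (by omega) hx,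
    ← SFR.coeff_mul_exp _ _ (by omega) hx, ← map_add, ← map_add, ← add_mul, add_sub_cancel]

lemma SFR.σ_exp {Y : SFR W} (hY : (sc W).σ Y = Y) : (sc W).σ Y.exp = Y.exp :=
  ext_at fun x hx => by
    rw [sc_σ_at, SFR.at_exp, sig_expVal, ← sc_σ_at, hY]

lemma SFR.mul_exp_eq_zero {a Y : SFR W} (h : a * Y.exp = 0) : a = 0 := ext_at fun x hx => by
  have h2 := congrArg (ev x hx) h
  rw [map_mul, map_zero, SFR.at_exp] at h2
  rw [map_zero]
  exact (isUnit_expVal _).mul_left_eq_zero.mp h2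

/-! ### Units -/

variable (D) in
/-- The predicate selecting the variables `Γ^{A_ext}`. -/
abbrev extP (z : Coord D) : Prop := z.isLeft = true

/-- Superfunctions of the variables `Γ^{A_ext}` only. -/
def IsExt (f : SFR W) : Prop := SFR.res (extP D) f = f

lemma isExt_of_iff {f : SF D} {hf : Smooth D W f} : IsExt (of f hf) ↔ IsExtFun D W f := by
  constructor
  · intro h x hx
    have := congrArg (ev x hx) h
    rwa [at_res, at_of, ← atZero_eq] at this
  · exact fun h => ext_at fun x hx => by rw [at_res, at_of, ← atZero_eq, h x hx]

variable (W) in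
/-- The subalgebra of superfunctions of the variables `Γ^{A_ext}`. -/
def ExtAlg : Subalgebra ℂ (SFR W) := AlgHom.equalizer (SFR.res (extP D)) (AlgHom.id ℂ _)

lemma isExt_fn (φ : Body D → ℂ) (h : ContDiffOn ℝ ∞ φ W) : IsExt (SFR.fn φ h) :=
  ext_at fun x hx => by rw [at_res, SFR.at_fn, AlgHom.commutes]

lemma IsExt.coeff {f : SFR W} (h : IsExt f) (hx : x ∈ W) {d : Expo D} (hd : d ≠ 0) : coeff d
    (ev x hx f) = 0 := by
  rw [← h, at_res, coeff_res, resCoeff_neg]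
  rwa [supp_isLeft]

lemma IsExt.eq_zero {f : SFR W} (h : IsExt f) {m : ℕ} (hm : card (OddIdx D) < m)
    (hf : ∀ x (hx : x ∈ W), ev x hx f ∈ Au m) : f = 0 :=
  ext_at fun x hx => ext fun d => by
    rw [map_zero, map_zero]
    by_cases hd : d = 0
    · subst hd; exact coeff_of_Au (hf x hx) (by rw [map_zero]; omega)
    · exact h.coeff hx hd

lemma contDiffOn_det {ι : Type*} [Fintype ι] [DecidableEq ι] {A : Body D → Matrix ι ι ℂ}
    {s : Set (Body D)} (h : ∀ i j, ContDiffOn ℝ ∞ (fun x => A x i j) s) : ContDiffOn ℝ ∞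
    (fun x => (A x).det) s := by
  simp only [Matrix.det_apply']
  exact ContDiffOn.sum fun σ _ => contDiffOn_const.mul (contDiffOn_prod fun i _ => h _ _)

lemma contDiffOn_inv {ι : Type*} [Fintype ι] [DecidableEq ι] {A : Body D → Matrix ι ι ℂ}
    {s : Set (Body D)} (h : ∀ i j, ContDiffOn ℝ ∞ (fun x => A x i j) s) (h0 : ∀ x ∈ s, IsUnit (A x))
    (i j : ι) : ContDiffOn ℝ ∞ (fun x => (A x)⁻¹ i j) s := by
  have : ∀ x, (A x)⁻¹ i j = ((A x).det)⁻¹ * ((A x).updateRow j (Pi.single i 1)).det := by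
    intro x
    rw [Matrix.inv_def, Matrix.smul_apply, Matrix.adjugate_apply, Ring.inverse_eq_inv', smul_eq_mul]
  simp only [this]
  refine ((contDiffOn_det h).inv fun x hx => ?_).mul (contDiffOn_det fun k l => ?_)
  · exact ((isUnit_iff_isUnit_det _).mp (h0 x hx)).ne_zero
  · by_cases hk : k = j
    · subst hk; simp only [Matrix.updateRow_self]; exact contDiffOn_const
    · simp only [Matrix.updateRow_ne hk]; exact h _ _

lemma exists_matrix_inverse_of_body {ι : Type*} [Fintype ι] [DecidableEq ι] {M : Matrix ι ι (SFR W)}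
    (hM : ∀ i j, IsExt (M i j))
    (hb : ∀ x ∈ W, IsUnit (Matrix.of fun i j => body D ((M i j).rep x))) : ∃ N : Matrix ι ι (SFR W),
    (∀ i j, IsExt (N i j)) ∧ M * N = 1 ∧ N * M = 1 := by
  let P : Body D → Matrix ι ι ℂ := fun x => Matrix.of fun i j => body D ((M i j).rep x)
  let B : Matrix ι ι (SFR W) := fun i j =>
    SFR.fn (fun x => (P x)⁻¹ i j) (contDiffOn_inv (fun i j => smooth_body (M i j).smooth) hb i j)
  let C : Matrix ι ι (SFR W) := fun i j => (M i j).bd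
  have hCB : C * B = 1 ∧ B * C = 1 := by
    have key : ∀ x (hx : x ∈ W), C.map (ev x hx) = (P x).map (algebraMap ℂ (Val D)) ∧
        B.map (ev x hx) = (P x)⁻¹.map (algebraMap ℂ (Val D)) := fun x hx => by
      constructor <;> ext1 i j <;> rw [Matrix.map_apply, Matrix.map_apply]
      · change ev x hx (M i j).bd = algebraMap ℂ (Val D) (body D ((M i j).rep x))
        rw [SFR.at_bd, at_apply]
      · exact SFR.at_fn _ _ hx
    have red : ∀ {A : Matrix ι ι (SFR W)}, (∀ x (hx : x ∈ W), A.map (ev x hx) = 1) → A = 1 :=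
      fun hA => by
        ext1 i j
        refine ext_at fun x hx => (congrFun (congrFun (hA x hx) i) j).trans ?_
        rw [one_apply, one_apply, apply_ite (ev x hx), map_one, map_zero]
    have hdet : ∀ x ∈ W, IsUnit (P x).det := fun x hx => (isUnit_iff_isUnit_det _).mp (hb x hx)
    constructor <;> refine red fun x hx => ?_ <;>
      rw [Matrix.map_mul, (key x hx).1, (key x hx).2, ← Matrix.map_mul]
    · rw [Matrix.mul_nonsing_inv _ (hdet x hx), Matrix.map_one _ (map_zero _) (map_one _)]
    · rw [Matrix.nonsing_inv_mul _ (hdet x hx), Matrix.map_one _ (map_zero _) (map_one _)]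
  let X : Subalgebra ℂ (Matrix ι ι (SFR W)) := (ExtAlg W).matrix
  have hB : B ∈ X := fun i j => isExt_fn _ _
  let n := 1 - M * B
  have hn : n ∈ X := sub_mem X.one_mem (mul_mem (show M ∈ X from hM) hB)
  have hn1 : ∀ x (hx : x ∈ W) i j, ev x hx (n i j) ∈ Au 1 := by
    intro x hx i j
    have : n = (C - M) * B := by rw [sub_mul, hCB.1]
    rw [this, mul_apply, map_sum]
    refine sum_mem fun k _ => ?_
    rw [map_mul]
    refine Au_mul (l := 0) (Au_one ?_) (Au_zero _)
    rw [Matrix.sub_apply, map_sub, SFR.at_bd, ← neg_sub, ← bodyHom_apply, map_neg, bodyHom_apply,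
      body_sub_body, neg_zero]
  have hnk : ∀ k, ∀ x (hx : x ∈ W) i j, ev x hx ((n ^ k) i j) ∈ Au k := by
    intro k x hx
    induction k with
    | zero => exact fun i j => Au_zero _
    | succ k ih =>
      intro i j
      rw [pow_succ, mul_apply, map_sum]
      refine sum_mem fun l _ => ?_
      rw [map_mul]
      exact Au_mul (ih i l) (hn1 x hx l j)
  have hn0 : n ^ (card (OddIdx D) + 1) = 0 := by
    ext1 i j
    exact IsExt.eq_zero (pow_mem hn _ i j) (Nat.lt_succ_self _) fun x hx => hnk _ x hx i j
  let G := ∑ k ∈ range (card (OddIdx D) + 1), n ^ k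
  have hG : (1 - n) * G = 1 ∧ G * (1 - n) = 1 :=
    ⟨by rw [mul_neg_geom_sum, hn0, sub_zero], by rw [geom_sum_mul_neg, hn0, sub_zero]⟩
  have h2 : M * B = 1 - n := (sub_sub_cancel _ _).symm
  refine ⟨B * G, mul_mem hB (sum_mem fun k _ => pow_mem hn k), by rw [← mul_assoc, h2, hG.1], ?_⟩
  have h3 : M = (1 - n) * C := by rw [← h2, mul_assoc, hCB.2, mul_one]
  have h4 : B * G * M = B * ((G * (1 - n)) * C) := by rw [mul_assoc G, ← h3, mul_assoc]
  rw [h4, hG.2, one_mul, hCB.2]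

/-- The values of a matrix of superfunctions. -/
def matAt {ι : Type*} (x : Body D) (hx : x ∈ W) (M : Matrix ι ι (SFR W)) : Matrix ι ι (Val D) :=
  M.map (ev x hx)

lemma exists_matrix_inverse {ι : Type*} [Fintype ι] [DecidableEq ι] {M : Matrix ι ι (SFR W)}
    (hM : ∀ i j, IsExt (M i j)) (h : ∀ x (hx : x ∈ W), IsUnit (matAt x hx M)) : ∃ N : Matrix ι ι
    (SFR W), (∀ i j, IsExt (N i j)) ∧ M * N = 1 ∧ N * M = 1 := by
  refine exists_matrix_inverse_of_body hM fun x hx => ?_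
  have := (h x hx).map (RingHom.mapMatrix (bodyHom (D := D)).toRingHom)
  convert this using 1
  ext i j
  rw [of_apply, ← at_apply _ hx]; rfl

end BV

open BV.SFR (at_of ext_at at_apply at_res at_sg at_der rep_of of_rep res_of hom_res rd_res_pos resF at_resF xc hom_X rd_X ld_X)
open Matrix (fromBlocks fromBlocks_multiply isUnit_iff_isUnit_det det_one det_mul)
open Finset (range mem_range sum_range_succ)

open BV.SFR (fn at_fn)

namespace SuperCalc

variable {R : Type*} [Ring R] [Algebra ℂ R] {Z : Type*} {p : Z → ZMod 2} {C : SuperCalc R p}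
  {q r : ZMod 2} {a b : R}

section Laplacian

variable {ι : Type*} [Fintype ι] (c : ι → Z) (E : ι → ι → R)

variable (C) in
/-- The odd Laplacian of a bivector and a density `ρ` with inverse `ρ'`. -/
def lap (ρ ρ' f : R) : R :=
  ∑ i, ∑ j, (sgn (p (c i)) / 2) • (ρ' * C.ld (c i) (ρ * E i j * C.ld (c j) f))

variable {c E} {ρ ρ' : R} (hE : C.OddBivector c E) (hρ : C.Hom 0 ρ) (hρ' : ρ' * ρ = 1)

lemma lap_add (f g : R) : C.lap c E ρ ρ' (f + g) = C.lap c E ρ ρ' f + C.lap c E ρ ρ' g := by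
  simp only [lap, map_add, mul_add, smul_add, sum_add_distrib]

lemma lap_smul (k : ℂ) (f : R) : C.lap c E ρ ρ' (k • f) = k • C.lap c E ρ ρ' f := by
  simp only [lap, map_smul, mul_smul_comm, smul_sum]
  exact sum_congr rfl fun i _ => sum_congr rfl fun j _ => smul_comm _ _ _

include hρ hρ'

include hE in
lemma OddBivector.lap_exp {Y e : R} (hY : C.Hom 0 Y) (he : ∀ z, C.ld z e = C.ld z Y * e) : C.lap c E
    ρ ρ' e = (C.lap c E ρ ρ' Y + (1 / 2 : ℂ) • C.br c E Y Y) * e := by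
  simp only [lap, br, smul_sum, ← sum_add_distrib, sum_mul]
  refine sum_congr rfl fun i _ => sum_congr rfl fun j _ => ?_
  rw [he, ← mul_assoc, ld_mul', he, mul_add, smul_add, add_mul, smul_mul_assoc, mul_assoc ρ' _ e]
  congr 1
  have e1 : ∀ x y : ZMod 2, x + y + 1 + (y + 0) = x + 1 ∧ x * (0 + (x + 1)) = 0 ∧
      (x + 1) * (x + 0) = 0 := by decide
  have h1 := ((hE.hom i j).mul (hY.ld (c j))).cast (e1 _ _).1
  rw [mul_assoc ρ, (hρ.mul h1).tw, hY.rd_eq, (e1 (p (c i)) 0).2.1, sgn_zero, one_smul, mul_assoc ρ,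
    ← mul_assoc ρ' ρ, hρ', one_mul, ← mul_assoc, h1.comm_of (hY.ld (c i)) (e1 _ 0).2.2,
    smul_mul_assoc, smul_mul_assoc, zero_add, mul_one, ← mul_assoc (C.ld (c i) Y), div_eq_inv_mul,
    one_div, smul_mul_assoc, smul_mul_assoc, smul_smul]

lemma lap_eq (g : R) : C.lap c E ρ ρ' g = (1 / 2 : ℂ) • ( (∑ i, sgn (p (c i)) • C.ld (c i) (∑ j, E i
    j * C.ld (c j) g)) + ρ' * ∑ i, C.rd (c i) ρ * ∑ j, E i j * C.ld (c j) g) := by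
  simp only [lap, map_sum, mul_sum, smul_sum, ← sum_add_distrib, smul_add]
  refine sum_congr rfl fun i _ => sum_congr rfl fun j _ => ?_
  rw [mul_assoc, ld_mul', hρ.tw, mul_zero, sgn_zero, one_smul, mul_add, ← mul_assoc ρ' ρ, hρ',
    one_mul, hρ.rd_eq, smul_mul_assoc, mul_smul_comm, zero_add, mul_one, smul_add, add_comm,
    smul_smul, smul_smul, div_eq_inv_mul, one_div]

end Laplacian

section Canonical

variable {κ μ : Type*} [DecidableEq μ]

/-- Extension of a bivector by canonical pairs. -/
def canon (E : κ → κ → R) : κ ⊕ (μ ⊕ μ) → κ ⊕ (μ ⊕ μ) → R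
  | inl i, inl j => E i j
  | inr (inl m), inr (inr n) => if m = n then 1 else 0
  | inr (inr m), inr (inl n) => if m = n then -1 else 0
  | _, _ => 0

lemma OddBivector.canon {c : κ ⊕ (μ ⊕ μ) → Z} {E : κ → κ → R}
    (hE : C.OddBivector (fun i => c (inl i)) E)
    (hc : ∀ m, p (c (inr (inr m))) = p (c (inr (inl m))) + 1) : C.OddBivector c
    (SuperCalc.canon (μ := μ) E) := by
  have e : ∀ x : ZMod 2, x + (x + 1) + 1 = 0 ∧ x + 1 + x + 1 = 0 ∧ (x + 1) * (x + 1 + 1) = 0 ∧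
    (x + 1 + 1) * (x + 1) = 0 := by decide
  constructor
  · rintro (i | m | m) (j | n | n) <;> simp only [SuperCalc.canon]
    · exact hE.hom i j
    · exact Hom.zero
    · exact Hom.zero
    · exact Hom.zero
    · exact Hom.zero
    · split_ifs with h
      · rw [← h, hc, (e _).1]; exact Hom.one
      · exact Hom.zero
    · exact Hom.zero
    · split_ifs with h
      · rw [← h, hc, (e _).2.1]; exact Hom.one.neg
      · exact Hom.zero
    · exact Hom.zero
  · rintro (i | m | m) (j | n | n) <;> simp only [SuperCalc.canon, smul_zero, neg_zero]
    · exact hE.skew i j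
    · split_ifs with h1 h2 h2
      · rw [← h1, hc, (e _).2.2.1, sgn_zero, one_smul]
      · exact absurd h1.symm h2
      · exact absurd h2.symm h1
      · rw [smul_zero, neg_zero]
    · split_ifs with h1 h2 h2
      · rw [← h1, hc, (e _).2.2.2, sgn_zero, one_smul, neg_neg]
      · exact absurd h1.symm h2
      · exact absurd h2.symm h1
      · rw [smul_zero, neg_zero]

variable [Fintype κ] [Fintype μ] (c : κ ⊕ (μ ⊕ μ) → Z) (E : κ → κ → R)

lemma sum_canon (F : κ ⊕ (μ ⊕ μ) → κ ⊕ (μ ⊕ μ) → R → R) (hF : ∀ i j, F i j 0 = 0) : ∑ i, ∑ j, F i j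
    (SuperCalc.canon E i j) = (∑ i, ∑ j, F (inl i) (inl j) (E i j)) + ∑ m,
    (F (inr (inl m)) (inr (inr m)) 1 + F (inr (inr m)) (inr (inl m)) (-1)) := by
  simp only [sum_sum_type, SuperCalc.canon, hF, Finset.sum_const_zero, add_zero, zero_add]
  rw [sum_add_distrib]
  congr 2
  · refine sum_congr rfl fun m _ => ?_
    rw [sum_eq_single m]
    · rw [if_pos rfl]
    · intro n _ h; rw [if_neg h.symm, hF]
    · simp
  · refine sum_congr rfl fun m _ => ?_
    rw [sum_eq_single m]
    · rw [if_pos rfl]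
    · intro n _ h; rw [if_neg h.symm, hF]
    · simp

lemma br_canon (f g : R) : C.br c (SuperCalc.canon E) f g = C.br (fun i => c (inl i)) E f g + ∑ m,
    (C.rd (c (inr (inl m))) f * C.ld (c (inr (inr m))) g - C.rd (c (inr (inr m))) f * C.ld (c (inr
    (inl m))) g) := by
  rw [br, sum_canon E (fun i j x => C.rd (c i) f * x * C.ld (c j) g) (by simp)]
  simp only [mul_one, mul_neg, neg_mul, ← sub_eq_add_neg]; rfl

lemma lap_canon {ρ ρ' : R} (hρ : C.Hom 0 ρ) (hρ' : ρ' * ρ = 1)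
    (hc : ∀ m, p (c (inr (inr m))) = p (c (inr (inl m))) + 1) (h0 : ∀ m, C.ld (c (inr m)) ρ = 0)
    (f : R) : C.lap c (SuperCalc.canon E) ρ ρ' f = C.lap (fun i => c (inl i)) E ρ ρ' f + ∑ m, sgn
    (p (c (inr (inl m)))) • C.ld (c (inr (inl m))) (C.ld (c (inr (inr m))) f) := by
  rw [lap, sum_canon E (fun i j x => (sgn (p (c i)) / 2) • (ρ' * C.ld (c i) (ρ * x * C.ld (c j) f)))
    (by simp)]
  congr 1
  refine sum_congr rfl fun m _ => ?_
  have key : ∀ m n, ρ' * C.ld (c (inr m)) (ρ * C.ld (c n) f) =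
      C.ld (c (inr m)) (C.ld (c n) f) := fun m n => by
    rw [ld_mul', h0, zero_mul, zero_add, hρ.tw, mul_zero, sgn_zero, one_smul, ← mul_assoc, hρ',
      one_mul]
  rw [mul_one, key, mul_neg_one, neg_mul, map_neg, mul_neg, key, C.ld_comm (c (inr (inr m))), ←
    neg_one_smul ℂ (_ • _), smul_smul, smul_smul, ← add_smul, hc]
  congr 1
  generalize p (c (inr (inl m))) = x
  have : (x + 1) * x = 0 := by revert x; decide
  rw [this, sgn_zero, sgn_add, sgn_one]
  ring

end Canonical

lemma tw_add (q : ZMod 2) (a b : R) : C.tw q (a + b) = C.tw q a + C.tw q b := by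
  unfold SuperCalc.tw; split_ifs <;> simp

lemma hom_ind {P : R → Prop} (h0 : ∀ q a, C.Hom q a → P a) (h1 : ∀ a b, P a → P b → P (a + b))
    (a : R) : P a := by
  obtain ⟨x, y, hx, hy, rfl⟩ := C.exists_hom_add a
  exact h1 _ _ (h0 _ _ hx) (h0 _ _ hy)

/-- The entries of the inverse of a homogeneous matrix are homogeneous. -/
lemma hom_inverse {m n : Type*} [Fintype m] [DecidableEq m] [Fintype n] [DecidableEq n]
    {x : m → ZMod 2} {y : n → ZMod 2} {M : Matrix m n R} {N : Matrix n m R}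
    (hM : ∀ i j, C.Hom (x i + y j) (M i j)) (h1 : M * N = 1) (h2 : N * M = 1) (i : n) (j : m) :
    C.Hom (y i + x j) (N i j) := by
  let N' : Matrix n m R := fun i j => sgn (y i + x j) • C.σ (N i j)
  have h3 : M * N' = 1 := by
    ext i k
    have h4 := congrArg C.σ (congrFun (congrFun h1 i) k)
    rw [mul_apply, map_sum] at h4
    have h5 : (M * N') i k = sgn (x i + x k) • ∑ j, C.σ (M i j * N j k) := by
      rw [mul_apply, smul_sum]
      refine sum_congr rfl fun j _ => ?_
      rw [map_mul, hM i j, mul_smul_comm, smul_mul_assoc, sgn_smul_smul]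
      congr 2
      generalize x i = x1; generalize x k = x2; generalize y j = y1
      clear * -; revert x1 x2 y1; decide
    rw [h5, h4, one_apply]
    split_ifs with h
    · subst h; rw [map_one, CharTwo.add_self_eq_zero, sgn_zero, one_smul]
    · rw [map_zero, smul_zero]
  have h4 : N' = N := by
    calc N' = N * M * N' := by rw [h2, Matrix.one_mul]
      _ = N := by rw [Matrix.mul_assoc, h3, Matrix.mul_one]
  have h5 : sgn (y i + x j) • C.σ (N i j) = N i j := congrFun (congrFun h4 i) j
  unfold Hom
  conv_rhs => rw [← h5]
  rw [smul_smul, sgn_mul_self, one_smul]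

section Bracket

variable {ι : Type*} [Fintype ι] {c : ι → Z} {E : ι → ι → R} (hE : C.OddBivector c E)

variable (C c E) in
/-- The Hamiltonian vector field components `E^{ij} ∂_j f`. -/
def ham (f : R) (i : ι) : R := ∑ j, E i j * C.ld (c j) f

lemma br_eq_ham (f g : R) : C.br c E f g = ∑ i, C.rd (c i) f * C.ham c E g i := by
  simp only [br, ham, mul_sum, mul_assoc]

include hE

lemma OddBivector.ham_hom {f : R} (hf : C.Hom q f) (i : ι) : C.Hom (p (c i) + q + 1)
    (C.ham c E f i) :=
  Hom.sum fun j _ => ((hE.hom i j).mul (hf.ld _)).cast (by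
    generalize p (c i) = x; generalize p (c j) = y; clear * -; revert x y q; decide)

lemma OddBivector.br_mul_left' {g : R} (hg : C.Hom r g) (f h : R) : C.br c E (f * h) g = f * C.br c
    E h g + C.br c E f g * C.tw (r + 1) h := by
  simp only [br_eq_ham, sum_mul, mul_sum, ← sum_add_distrib]
  refine sum_congr rfl fun i _ => ?_
  rw [rd_mul, add_mul, mul_assoc, mul_assoc, mul_assoc]
  congr 2
  rw [(hE.ham_hom hg i).mul_eq_tw]
  unfold SuperCalc.tw
  generalize p (c i) = x
  have : ∀ x r : ZMod 2, x = 0 ∨ x = 1 := by decide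
  rcases this x 0 with rfl | rfl <;> rcases this r 0 with rfl | rfl <;>
    simp [show (1 : ZMod 2) + 1 = 0 from rfl, C.σσ]

lemma OddBivector.br_mul_right' {f : R} (hf : C.Hom q f) (g h : R) : C.br c E f (g * h) = C.br c E f
    g * h + C.tw (q + 1) g * C.br c E f h := by
  refine hom_ind (C := C) (P := fun g => C.br c E f (g * h) = C.br c E f g * h + C.tw (q + 1) g *
    C.br c E f h) (fun r g hg => ?_) (fun a b ha hb => ?_) g
  · rw [hE.br_mul_right hf hg, hg.tw, smul_mul_assoc, mul_comm r]
  · rw [add_mul, br_add_right, ha, hb, tw_add, br_add_right, add_mul, add_mul]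
    abel

lemma OddBivector.ld_br_self {u : Z} (hu : ∀ i j, C.ld u (E i j) = 0) {g : R} (hg : C.Hom 0 g) :
    C.ld u (C.br c E g g) = (2 : ℂ) • C.br c E (C.ld u g) g := by
  rw [hE.ld_br hu hg, hE.br_skew hg (hg.ld u), smul_neg, sgn_smul_smul, neg_eq_sgn_smul,
    sgn_smul_smul, two_smul]
  have : ∀ x : ZMod 2, 1 + (x * (0 + 1) + (0 + 1) * (x + 0 + 1)) = 0 := by decide
  rw [this, sgn_zero, one_smul]

lemma OddBivector.jacobi_of_ham {g : R} (hg : C.Hom 0 g)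
    (hT : ∀ i, C.br c E (C.ham c E g i) g = (1 / 2 : ℂ) • C.ham c E (C.br c E g g) i) (f : R) : C.br
    c E (C.br c E f g) g = (1 / 2 : ℂ) • C.br c E f (C.br c E g g) := by
  have hV := hE.ham_hom hg
  rw [br_eq_ham f g, br_sum_left]
  have h1 : ∀ i, C.br c E (C.rd (c i) f * C.ham c E g i) g =
      (1 / 2 : ℂ) • (C.rd (c i) f * C.ham c E (C.br c E g g) i) +
      ∑ k, C.rd (c k) (C.rd (c i) f) * (C.ham c E g k * C.σ (C.ham c E g i)) := by
    intro i
    rw [hE.br_mul_left hg, hT, mul_smul_comm, br_eq_ham (C.rd (c i) f), sum_mul]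
    simp only [mul_assoc]
  simp only [h1, sum_add_distrib]
  rw [← smul_sum, ← br_eq_ham, add_eq_left]
  refine Grassmann.eq_zero_of_eq_neg ?_
  conv_lhs => rw [sum_comm]
  rw [← sum_neg_distrib]
  refine sum_congr rfl fun i _ => ?_
  rw [← sum_neg_distrib]
  refine sum_congr rfl fun k _ => ?_
  rw [hV i, hV k, rd_comm (c i), mul_smul_comm, mul_smul_comm, (hV i).comm (hV k), smul_mul_assoc,
    mul_smul_comm, mul_smul_comm, mul_smul_comm, sgn_smul_smul, sgn_smul_smul, neg_eq_sgn_smul,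
    sgn_smul_smul]
  congr 2
  generalize p (c i) = x; generalize p (c k) = y; clear * -; revert x y; decide

end Bracket

section Dirac

variable {ι τ : Type*} [Fintype ι] [Fintype τ] {c : ι → Z} {E D : ι → ι → R}
  (hE : C.OddBivector c E) {Θ : τ → R} {θ : τ → ZMod 2} (hΘ : ∀ a, C.Hom (θ a) (Θ a))
  {N : τ → τ → R}

variable (C c E Θ N) in
/-- The Dirac bivector. -/
def dir (i j : ι) : R := E i j - ∑ a, ∑ b, C.ham c E (Θ a) i * N a b * ∑ k, C.rd (c k) (Θ b) * E k j

lemma sum_rearrange (u w : ι → R) (h V : τ → ι → R) : ∑ i, ∑ j, u i *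
    (∑ a, ∑ b, h a i * N a b * V b j) * w j = ∑ a, ∑ b, (∑ i, u i * h a i) * N a b * ∑ j, V b j * w
    j := by
  simp only [mul_sum, sum_mul]
  rw [sum_comm]
  simp_rw [sum_comm (s := (Finset.univ : Finset ι)) (t := (Finset.univ : Finset τ))]
  refine sum_congr rfl fun a _ => sum_congr rfl fun b _ =>
    sum_congr rfl fun j _ => sum_congr rfl fun i _ => ?_
  simp only [mul_assoc]

lemma br_dir (f g : R) : C.br c (C.dir c E Θ N) f g = C.br c E f g - ∑ a, ∑ b, C.br c E f (Θ a) * N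
    a b * C.br c E (Θ b) g := by
  have h1 : ∀ b, C.br c E (Θ b) g = ∑ j, (∑ k, C.rd (c k) (Θ b) * E k j) * C.ld (c j) g := by
    intro b
    simp only [br, sum_mul]
    rw [sum_comm]
  have h2 := sum_rearrange (N := N) (fun i => C.rd (c i) f) (fun j => C.ld (c j) g)
    (fun a i => C.ham c E (Θ a) i) (fun b j => ∑ k, C.rd (c k) (Θ b) * E k j)
  simp only [← h1, ← br_eq_ham] at h2
  rw [← h2]
  simp only [br, dir, mul_sub, sub_mul, sum_sub_distrib]

variable [DecidableEq τ] (h1 : (Matrix.of fun a b => C.br c E (Θ a) (Θ b)) * Matrix.of N = 1)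
  (h2 : Matrix.of N * (Matrix.of fun a b => C.br c E (Θ a) (Θ b)) = 1)

include hE hΘ h1 h2

lemma OddBivector.dirac_hom (a b : τ) : C.Hom (θ a + θ b + 1) (N a b) :=
  (hom_inverse (x := fun a => θ a + 1) (y := θ) (fun a b => (hE.br_hom (hΘ a) (hΘ b)).cast (by
    show θ a + θ b + 1 = θ a + 1 + θ b; ring)) h1 h2 a b).cast (by ring)

lemma OddBivector.dirac_skew (a b : τ) : N b a = -(sgn (θ a * θ b) • N a b) := by
  let N' : Matrix τ τ R := fun b a => -(sgn (θ a * θ b) • N a b)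
  have h3 : N' * (Matrix.of fun a b => C.br c E (Θ a) (Θ b)) = 1 := by
    ext c' a
    have h4 := congrFun (congrFun h1 a) c'
    rw [mul_apply] at h4
    have h5 : (N' * (Matrix.of fun a b => C.br c E (Θ a) (Θ b))) c' a = sgn (θ c' * (θ a + 1)) •
        ∑ b, (Matrix.of fun a b => C.br c E (Θ a) (Θ b)) a b * Matrix.of N b c' := by
      rw [mul_apply, smul_sum]
      refine sum_congr rfl fun b _ => ?_
      rw [of_apply, of_apply, of_apply, hE.br_skew (hΘ b) (hΘ a), mul_neg, mul_smul_comm, neg_mul,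
        smul_neg, neg_neg, smul_mul_assoc, (hE.dirac_hom hΘ h1 h2 b c').comm (hE.br_hom (hΘ a) (hΘ
        b)), sgn_smul_smul, sgn_smul_smul]
      congr 2
      generalize θ a = x; generalize θ b = y; generalize θ c' = z
      clear * -; revert x y z; decide
    rw [h5, h4, one_apply, one_apply]
    split_ifs with h h' h'
    · subst h
      generalize θ a = x
      have : x * (x + 1) = 0 := by revert x; decide
      rw [this, sgn_zero, one_smul]
    · exact absurd h.symm h'
    · exact absurd h'.symm h
    · rw [smul_zero]
  have h4 : N' = Matrix.of N := by
    calc N' = N' * ((Matrix.of fun a b => C.br c E (Θ a) (Θ b)) * Matrix.of N) := by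
          rw [h1, mul_one]
      _ = Matrix.of N := by rw [← mul_assoc, h3, one_mul]
  exact (congrFun (congrFun h4 b) a).symm

lemma OddBivector.dir : C.OddBivector c (C.dir c E Θ N) := by
  have hN := hE.dirac_hom hΘ h1 h2
  have hV : ∀ a i, ∑ k, C.rd (c k) (Θ a) * E k i =
      -(sgn ((θ a + 1) * (p (c i) + 1)) • C.ham c E (Θ a) i) := by
    intro a i
    simp only [ham, smul_sum, ← sum_neg_distrib]
    refine sum_congr rfl fun k _ => ?_
    rw [(hΘ a).rd_eq, hE.skew i k, mul_neg, smul_mul_assoc, mul_smul_comm, ((hΘ a).ld (c k)).comm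
      (hE.hom i k), sgn_smul_smul, sgn_smul_smul]
    congr 3
    generalize p (c i) = x; generalize p (c k) = y; generalize θ a = z
    clear * -; revert x y z; decide
  have hh := fun a i => hE.ham_hom (hΘ a) i
  constructor
  · intro i j
    refine (hE.hom i j).sub (Hom.sum fun a _ => Hom.sum fun b _ => ?_)
    rw [hV]
    refine (((hh a i).mul (hN a b)).mul ((hh b j).smul _).neg).cast ?_
    generalize p (c i) = x; generalize p (c j) = y; generalize θ a = z; generalize θ b = w
    clear * -; revert x y z w; decide
  · intro i j
    rw [SuperCalc.dir, SuperCalc.dir, smul_sub, neg_sub', hE.skew i j, smul_sum, ← sum_neg_distrib,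
      sum_comm]
    congr 1
    refine sum_congr rfl fun b _ => ?_
    rw [smul_sum, ← sum_neg_distrib]
    refine sum_congr rfl fun a _ => ?_
    rw [hV, hV, hE.dirac_skew hΘ h1 h2 b a, mul_neg, mul_neg, mul_neg, neg_mul, neg_neg, smul_neg,
      neg_neg, mul_smul_comm, mul_smul_comm, smul_mul_assoc, mul_smul_comm, ((hh a j).mul (hN b
      a)).comm (hh b i), (hh a j).comm (hN b a), mul_smul_comm, ← mul_assoc]
    simp only [sgn_smul_smul]
    congr 2
    generalize p (c i) = x; generalize p (c j) = y; generalize θ a = z; generalize θ b = w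
    clear * -; revert x y z w; decide

end Dirac

section DiracJacobi

variable {ι τ : Type*} [Fintype ι] [Fintype τ] {c : ι → Z} {E D : ι → ι → R}
  (hE : C.OddBivector c E) (hD : C.OddBivector c D) {Θ : τ → R} {θ : τ → ZMod 2}
  (hΘ : ∀ a, C.Hom (θ a) (Θ a)) {N : τ → τ → R} (hN : ∀ a b, C.Hom (θ a + θ b + 1) (N a b))
  (hDE : ∀ f g, C.br c D f g = C.br c E f g - ∑ a, ∑ b, C.br c E f (Θ a) * N a b * C.br c E (Θ b) g)

lemma mem_span_of (a : τ) (x : R) : x * Θ a ∈ Ideal.span (Set.range Θ) :=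
  Ideal.mul_mem_left _ _ (Ideal.subset_span ⟨a, rfl⟩)

include hΘ in
lemma mul_mem_span {h : R} (hh : h ∈ Ideal.span (Set.range Θ)) (x : R) : h * x ∈ Ideal.span
    (Set.range Θ) := by
  induction hh using Submodule.span_induction with
  | mem y hy =>
    obtain ⟨a, rfl⟩ := hy
    rw [(hΘ a).mul_eq_tw]
    exact mem_span_of a _
  | zero => rw [zero_mul]; exact zero_mem _
  | add y z _ _ hy hz => rw [add_mul]; exact add_mem hy hz
  | smul k y _ hy => rw [smul_eq_mul, mul_assoc]; exact Ideal.mul_mem_left _ _ hy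

include hΘ in
lemma span_of_mul (a : τ) (x : R) : Θ a * x ∈ Ideal.span (Set.range Θ) :=
  mul_mem_span hΘ (Ideal.subset_span ⟨a, rfl⟩) x

include hE in
lemma OddBivector.br_mem_span {f : R} (hf : C.Hom q f)
    (h0 : ∀ a, C.br c E f (Θ a) ∈ Ideal.span (Set.range Θ)) {h : R}
    (hh : h ∈ Ideal.span (Set.range Θ)) : C.br c E f h ∈ Ideal.span (Set.range Θ) := by
  induction hh using Submodule.span_induction with
  | mem y hy => obtain ⟨a, rfl⟩ := hy; exact h0 a
  | zero =>
    have : C.br c E f 0 = 0 := by simp [br]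
    rw [this]; exact zero_mem _
  | add y z _ _ hy hz => rw [br_add_right]; exact add_mem hy hz
  | smul k y hy' hy =>
    rw [smul_eq_mul, hE.br_mul_right' hf]
    exact add_mem (Ideal.mul_mem_left _ _ hy') (Ideal.mul_mem_left _ _ hy)

include hE hΘ in
lemma OddBivector.br_mem_span_left {g : R} (hg : C.Hom r g)
    (h0 : ∀ a, C.br c E (Θ a) g ∈ Ideal.span (Set.range Θ)) {h : R}
    (hh : h ∈ Ideal.span (Set.range Θ)) : C.br c E h g ∈ Ideal.span (Set.range Θ) := by
  induction hh using Submodule.span_induction with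
  | mem y hy => obtain ⟨a, rfl⟩ := hy; exact h0 a
  | zero =>
    have : C.br c E 0 g = 0 := by simp [br]
    rw [this]; exact zero_mem _
  | add y z _ _ hy hz => rw [br_add_left]; exact add_mem hy hz
  | smul k y hy' hy =>
    rw [smul_eq_mul, hE.br_mul_left' hg]
    refine add_mem (Ideal.mul_mem_left _ _ hy) (Ideal.mul_mem_left _ _ ?_)
    clear hy
    induction hy' using Submodule.span_induction with
    | mem y hy => obtain ⟨a, rfl⟩ := hy; rw [(hΘ a).tw, ← smul_one_mul]; exact mem_span_of a _
    | zero => unfold SuperCalc.tw; simp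
    | add y z _ _ hy hz => rw [tw_add]; exact add_mem hy hz
    | smul k y _ hy => rw [smul_eq_mul, tw_mul]; exact Ideal.mul_mem_left _ _ hy

variable [DecidableEq τ] (h1 : (Matrix.of fun a b => C.br c E (Θ a) (Θ b)) * Matrix.of N = 1)
  (h2 : Matrix.of N * (Matrix.of fun a b => C.br c E (Θ a) (Θ b)) = 1)

include hDE h1 in
lemma dirac_Θ_left (a : τ) (g : R) : C.br c D (Θ a) g = 0 := by
  rw [hDE, sum_comm, sub_eq_zero]
  have : ∀ b, ∑ a', C.br c E (Θ a) (Θ a') * N a' b * C.br c E (Θ b) g =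
      (if a = b then C.br c E (Θ b) g else 0) := by
    intro b
    have h3 := congrFun (congrFun h1 a) b
    rw [mul_apply, one_apply] at h3
    simp only [of_apply] at h3
    rw [← sum_mul, h3]
    split_ifs <;> simp
  simp only [this, Finset.sum_ite_eq, mem_univ, if_true]

include hDE h2 in
include hE hD hΘ hN hDE h1 h2 in
/-- The Jacobi identity of the Dirac bracket, modulo the constraints. -/
lemma dirac_jacobi {g : R} (hg : C.Hom 0 g) (hJ : ∀ g' f, C.Hom 0 g' → C.br c E (C.br c E f g') g' =
    (1 / 2 : ℂ) • C.br c E f (C.br c E g' g')) {F : R} (hF : C.Hom q F) : C.br c D (C.br c D F g)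
    g - (1 / 2 : ℂ) • C.br c D F (C.br c D g g) ∈ Ideal.span (Set.range Θ) := by
  set J := Ideal.span (Set.range Θ) with hJdef
  have smul_mem : ∀ (k : ℂ) {x : R}, x ∈ J → k • x ∈ J := fun k x hx => by
    rw [← smul_one_mul]; exact Ideal.mul_mem_left _ _ hx
  let η : τ → R := fun a => ∑ b, N a b * C.br c E (Θ b) g
  have hη : ∀ a, C.Hom (θ a) (η a) := fun a => Hom.sum fun b _ =>
    ((hN a b).mul (hE.br_hom (hΘ b) hg)).cast (by
      generalize θ a = x; generalize θ b = y; clear * -; revert x y; decide)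
  have hs : C.Hom 0 (∑ a, Θ a * η a) := Hom.sum fun a _ =>
    ((hΘ a).mul (hη a)).cast (CharTwo.add_self_eq_zero _)
  have hsJ : ∑ a, Θ a * η a ∈ J := sum_mem fun a _ => span_of_mul hΘ a _
  set g' := g - ∑ a, Θ a * η a with hg'def
  have hg' : C.Hom 0 g' := hg.sub hs
  -- brackets with the modified generating function
  have hA : ∀ f, C.br c E f g' - C.br c D f g ∈ J := by
    intro f
    refine hom_ind (C := C) (P := fun f => C.br c E f g' - C.br c D f g ∈ J) (fun q f hf => ?_)
      (fun a b ha hb => ?_) f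
    · have : C.br c E f g' - C.br c D f g = -∑ a, C.tw (q + 1) (Θ a) * C.br c E f (η a) := by
        rw [hDE, hg'def, br_sub_right, br_sum_right]
        simp only [hE.br_mul_right' hf, sum_add_distrib]
        have h3 : ∑ a, C.br c E f (Θ a) * η a =
            ∑ a, ∑ b, C.br c E f (Θ a) * N a b * C.br c E (Θ b) g := by
          simp only [η, mul_sum, mul_assoc]
        rw [h3]; abel
      rw [this]
      refine neg_mem (sum_mem fun a _ => ?_)
      rw [(hΘ a).tw, smul_mul_assoc]
      exact smul_mem _ (span_of_mul hΘ a _)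
    · rw [br_add_left, br_add_left, add_sub_add_comm]
      exact add_mem ha hb
  have hB : ∀ {h}, h ∈ J → C.br c D h g ∈ J := fun hh =>
    hD.br_mem_span_left hΘ hg (fun a => by
      rw [dirac_Θ_left hDE h1]; exact zero_mem _) hh
  have hDD : ∀ f, C.br c D (C.br c D f g) g - (1 / 2 : ℂ) • C.br c E f (C.br c E g' g') ∈ J := by
    intro f
    rw [← hJ g' f hg']
    have e1 := hB (hA f)
    rw [br_sub_left] at e1
    have e2 := hA (C.br c E f g')
    have := neg_mem (add_mem e1 e2)
    convert this using 1
    abel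
  have hgg : C.br c E g' g' - C.br c D g g ∈ J := by
    have e1 := hA g'
    have e2 := hB hsJ
    have e3 : C.br c D g' g = C.br c D g g - C.br c D (∑ a, Θ a * η a) g := by
      rw [hg'def, br_sub_left]
    rw [e3] at e1
    have := sub_mem e1 e2
    convert this using 1
    abel
  have hgood : ∀ {f : R} {q : ZMod 2}, C.Hom q f → (∀ a, C.br c E f (Θ a) ∈ J) →
      C.br c D (C.br c D f g) g - (1 / 2 : ℂ) • C.br c D f (C.br c D g g) ∈ J := by
    intro f q hf h0
    have e1 := hE.br_mem_span hf h0 hgg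
    rw [br_sub_right] at e1
    have e2 : C.br c E f (C.br c D g g) - C.br c D f (C.br c D g g) ∈ J := by
      rw [hDE f, sub_sub_cancel]
      exact sum_mem fun a _ => sum_mem fun b _ =>
        mul_mem_span hΘ (mul_mem_span hΘ (h0 a) _) _
    have := add_mem (hDD f) (smul_mem (1 / 2) (add_mem e1 e2))
    convert this using 1
    rw [smul_add, smul_sub, smul_sub]
    abel
  let κ : τ → R := fun b => ∑ a, C.br c E F (Θ a) * N a b
  have hκ : ∀ b, C.Hom (q + θ b) (κ b) := fun b => Hom.sum fun a _ =>
    ((hE.br_hom hF (hΘ a)).mul (hN a b)).cast (by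
      generalize θ a = x; generalize θ b = y; clear * -; revert x y q; decide)
  set T := ∑ b, κ b * Θ b with hTdef
  have hT : C.Hom q T := Hom.sum fun b _ => ((hκ b).mul (hΘ b)).cast (by
    rw [add_assoc, CharTwo.add_self_eq_zero, add_zero])
  have hTJ : T ∈ J := sum_mem fun b _ => mem_span_of b _
  have hFT := hgood (hF.sub hT) (fun a => by
    have e1 : C.br c E F (Θ a) = ∑ b, κ b * C.br c E (Θ b) (Θ a) := by
      have h3 := fun a' => congrFun (congrFun h2 a') a
      simp only [mul_apply, of_apply] at h3
      simp only [κ, sum_mul]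
      rw [sum_comm]
      simp only [mul_assoc, ← mul_sum, h3, one_apply, mul_ite, mul_one, mul_zero,
        Finset.sum_ite_eq', mem_univ, if_true]
    rw [br_sub_left, hTdef, br_sum_left]
    simp only [hE.br_mul_left' (hΘ a), sum_add_distrib]
    rw [← e1, sub_add_cancel_left]
    refine neg_mem (sum_mem fun b _ => ?_)
    rw [(hΘ b).tw, mul_smul_comm]
    exact smul_mem _ (mem_span_of b _))
  have hDT : ∀ {h : R} {r : ZMod 2}, C.Hom r h → C.br c D T h ∈ J := fun hh =>
    hD.br_mem_span_left hΘ hh (fun a => by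
      rw [dirac_Θ_left hDE h1]; exact zero_mem _) hTJ
  rw [br_sub_left, br_sub_left, br_sub_left] at hFT
  have := add_mem hFT (sub_mem (hB (hDT hg)) (smul_mem (1 / 2) (hDT (hD.br_hom hg hg))))
  convert this using 1
  rw [smul_sub]
  abel

end DiracJacobi

end SuperCalc

open BV.SFR (at_exp)
open SuperCalc

namespace BV

variable {D : FieldContent} {W : Opens (Body D)}

/-- The extended bivector on the zeroth-level space. -/
def EX (ED : Fin (2 * D.N) → Fin (2 * D.N) → SFR W) : Ext D → Ext D → SFR W :=
  SuperCalc.canon (κ := Fin (2 * D.N)) (μ := APi D) ED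

/-- The bivector on the space of all variables. -/
def ET (ED : Fin (2 * D.N) → Fin (2 * D.N) → SFR W) : Coord D → Coord D → SFR W :=
  SuperCalc.canon (κ := Ext D) (μ := Fld D) (EX ED)

variable (W) in
/-- The consequences of the quantum master equation for the lowest orders of the action. -/
structure GaugeData where
  ED : Fin (2 * D.N) → Fin (2 * D.N) → SFR W
  odd : (sc W).OddBivector (gam D) ED
  extE : ∀ A B, IsExt (ED A B)
  ρ : SFR W
  ρ' : SFR W
  even_ρ : (sc W).Hom 0 ρ
  ext_ρ : IsExt ρ
  ρ'_mul : ρ' * ρ = 1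
  ext_ρ' : IsExt ρ'
  pi_ρ : ∀ a, (sc W).ld (inl (inr a)) ρ = 0
  X0 : SFR W
  X1 : SFR W
  even0 : (sc W).Hom 0 X0
  even1 : (sc W).Hom 0 X1
  wt0 : X0 ∈ Wt W {1}
  wt1 : X1 ∈ Wt W {0}
  cme : (sc W).br id (ET ED) X0 X0 = 0
  loop : (sc W).br id (ET ED) X0 X1 = (sc W).lap id (ET ED) ρ ρ' X0

/-- The restriction to vanishing first-level variables other than `λ`. -/
abbrev rr : SFR W →ₐ[ℂ] SFR W := SFR.res keepL

lemma rr_of_ext {f : SFR W} (h : IsExt f) : rr f = f := ext_at fun x hx => by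
  rw [at_res, ← h, at_res, res_res]
  congr 2
  funext z
  exact propext ⟨fun h => h.2, fun h => ⟨Or.inl h, h⟩⟩

lemma ld_aux_of_ext {f : SFR W} (h : IsExt f) (a : Aux D) : (sc W).ld (inr a) f = 0 := by
  rw [← h]; exact SFR.ld_res_neg (by simp) _

lemma rd_aux_of_ext {f : SFR W} (h : IsExt f) (a : Aux D) : (sc W).rd (inr a) f = 0 := by
  rw [← h]; exact SFR.rd_res_neg (by simp) _

lemma IsExt.ld {f : SFR W} (h : IsExt f) (A : Ext D) : IsExt ((sc W).ld (inl A) f) := by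
  unfold IsExt; rw [← SFR.ld_res_pos (P := extP D) (z := inl A) rfl, h]

lemma IsExt.rd {f : SFR W} (h : IsExt f) (A : Ext D) : IsExt ((sc W).rd (inl A) f) := by
  unfold IsExt; rw [← rd_res_pos (P := extP D) (z := inl A) rfl, h]

/-- The ghosts `c` of level `n + 1`. -/
def cF (n : ℕ) (a : AIdx D (n + 1)) : Fld D :=
  inr (inl ⟨⟨n, Nat.lt_of_succ_lt_succ (lt_of_le_of_lt a.2 a.1.1.2)⟩, a⟩)

/-- The antighosts `c̄` of level `n + 1`. -/
def bF (n : ℕ) (a : AIdx D (n + 1)) : Fld D :=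
  inr (inr ⟨⟨n, Nat.lt_of_succ_lt_succ (lt_of_le_of_lt a.2 a.1.1.2)⟩, a⟩)

/-- The fields `λ`. -/
def lF (a : AExt D) : Fld D := inl a

lemma plFld_cF (n : ℕ) (a : AIdx D (n + 1)) : plFld D (cF n a) = n + 2 := rfl
lemma plFld_bF (n : ℕ) (a : AIdx D (n + 1)) : plFld D (bF n a) = -(n + 1) := rfl
lemma plFld_lF (a : AExt D) : plFld D (lF a) = 1 := rfl

lemma sum_gh {M : Type*} [AddCommMonoid M] (f : Gh D → M) (n : ℕ)
    (h : ∀ g, (g.1 : ℕ) ≠ n → f g = 0) : ∑ g, f g = ∑ a : AIdx D (n + 1), f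
    ⟨⟨n, Nat.lt_of_succ_lt_succ (lt_of_le_of_lt a.2 a.1.1.2)⟩, a⟩ := by
  rw [Fintype.sum_sigma]
  by_cases hn : n < D.s
  · rw [sum_eq_single ⟨n, hn⟩]
    · intro i _ hi
      exact sum_eq_zero fun a _ => h _ fun e => hi (Fin.ext e)
    · intro h; exact absurd (mem_univ _) h
  · rw [sum_eq_zero, sum_eq_zero]
    · intro a _
      exact absurd (Nat.lt_of_succ_lt_succ (lt_of_le_of_lt a.2 a.1.1.2)) hn
    · intro i _
      exact sum_eq_zero fun a _ => h _ fun e => hn (e ▸ i.2)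

lemma sum_fld_c {M : Type*} [AddCommMonoid M] (f : Fld D → M) (n : ℕ)
    (h : ∀ φ, plFld D φ ≠ n + 2 → f φ = 0) : ∑ φ, f φ = ∑ a, f (cF n a) := by
  rw [sum_sum_type, sum_sum_type, sum_eq_zero, zero_add, sum_gh (fun g => f (inr (inl g))) n,
    sum_eq_zero (s := Finset.univ)
      (f := fun g => f (inr (inr g))), add_zero]
  · rfl
  · intro g _; exact h _ (by simp only [plFld]; omega)
  · intro g hg; exact h _ (by simp only [plFld]; omega)
  · intro a _; exact h _ (by simp only [plFld]; omega)

lemma sum_fld_b {M : Type*} [AddCommMonoid M] (f : Fld D → M) (n : ℕ)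
    (h : ∀ φ, plFld D φ ≠ -(n + 1) → f φ = 0) : ∑ φ, f φ = ∑ a, f (bF n a) := by
  rw [sum_sum_type, sum_sum_type, sum_eq_zero, zero_add, sum_gh (fun g => f (inr (inr g))) n,
    sum_eq_zero (s := Finset.univ)
      (f := fun g => f (inr (inl g))), zero_add]
  · rfl
  · intro g _; exact h _ (by simp only [plFld]; omega)
  · intro g hg; exact h _ (by simp only [plFld]; omega)
  · intro a _; exact h _ (by simp only [plFld]; omega)

lemma sum_fld_l {M : Type*} [AddCommMonoid M] (f : Fld D → M) (h : ∀ φ, plFld D φ ≠ 1 → f φ = 0) : ∑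
    φ, f φ = ∑ a, f (lF a) := by
  rw [sum_sum_type, sum_sum_type, sum_eq_zero (s := Finset.univ)
      (f := fun g => f (inr (inl g))), sum_eq_zero (s := Finset.univ)
      (f := fun g => f (inr (inr g))), add_zero, add_zero]
  · rfl
  · intro g _; exact h _ (by simp only [plFld]; omega)
  · intro g _; exact h _ (by simp only [plFld]; omega)

lemma sum_fld_split {M : Type*} [AddCommMonoid M] (f : Fld D → M) (k l : ℤ) (hkl : k ≠ l)
    (h : ∀ φ, plFld D φ ≠ k → plFld D φ ≠ l → f φ = 0) : ∑ φ, f φ = ∑ φ,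
    (if plFld D φ = k then f φ else 0) + ∑ φ, (if plFld D φ = l then f φ else 0) := by
  rw [← sum_add_distrib]
  refine sum_congr rfl fun φ _ => ?_
  by_cases hk : plFld D φ = k
  · rw [if_pos hk, if_neg (by omega), add_zero]
  · by_cases hl : plFld D φ = l
    · rw [if_neg hk, if_pos hl, zero_add]
    · rw [if_neg hk, if_neg hl, add_zero, h φ hk hl]

lemma sum_fld_ite_c {M : Type*} [AddCommMonoid M] (f : Fld D → M) (n : ℕ) : ∑ φ,
    (if plFld D φ = n + 2 then f φ else 0) = ∑ a, f (cF n a) := by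
  rw [sum_fld_c _ n fun φ h => if_neg h]
  exact sum_congr rfl fun a _ => if_pos (plFld_cF n a)

lemma sum_fld_ite_b {M : Type*} [AddCommMonoid M] (f : Fld D → M) (n : ℕ) : ∑ φ,
    (if plFld D φ = -(n + 1) then f φ else 0) = ∑ a, f (bF n a) := by
  rw [sum_fld_b _ n fun φ h => if_neg h]
  exact sum_congr rfl fun a _ => if_pos (plFld_bF n a)

namespace GaugeData

variable (S : GaugeData W)

/-- The bracket on the zeroth-level space. -/
abbrev bX (f g : SFR W) : SFR W := (sc W).br inl (EX S.ED) f g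

/-- The total bracket. -/
abbrev bT (f g : SFR W) : SFR W := (sc W).br id (ET S.ED) f g

lemma odd_EX : (sc W).OddBivector inl (EX S.ED) :=
  OddBivector.canon (c := fun i : Ext D => (inl i : Coord D)) S.odd fun _ => rfl

lemma odd_ET : (sc W).OddBivector id (ET S.ED) :=
  OddBivector.canon (c := (id : Coord D → Coord D)) S.odd_EX fun _ => rfl

lemma ext_EX (A B : Ext D) : IsExt (EX S.ED A B) := by
  rcases A with A | a | a <;> rcases B with B | b | b <;> simp only [EX, SuperCalc.canon]
  · exact S.extE A B
  all_goals first
    | exact (ExtAlg W).zero_mem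
    | (split_ifs
       · first
          | exact (ExtAlg W).one_mem
          | exact (ExtAlg W).neg_mem (ExtAlg W).one_mem
       · exact (ExtAlg W).zero_mem)

lemma ext_ET (z w : Coord D) : IsExt (ET S.ED z w) := by
  rcases z with A | a | a <;> rcases w with B | b | b <;> simp only [ET, SuperCalc.canon]
  · exact S.ext_EX A B
  all_goals first
    | exact (ExtAlg W).zero_mem
    | (split_ifs
       · first
          | exact (ExtAlg W).one_mem
          | exact (ExtAlg W).neg_mem (ExtAlg W).one_mem
       · exact (ExtAlg W).zero_mem)

lemma bT_eq (f g : SFR W) : S.bT f g = S.bX f g + ∑ φ : Fld D, ((sc W).rd (fld D φ) f * (sc W).ld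
    (afld D φ) g - (sc W).rd (afld D φ) f * (sc W).ld (fld D φ) g) :=
  br_canon (id : Coord D → Coord D) (EX S.ED) f g

lemma rr_bX (f g : SFR W) : rr (S.bX f g) = S.bX (rr f) (rr g) := by
  simp only [bX, br, map_sum, map_mul]
  refine sum_congr rfl fun A _ => sum_congr rfl fun B _ => ?_
  rw [rr_of_ext (S.ext_EX A B), rd_res_pos (Or.inl rfl), SFR.ld_res_pos (Or.inl rfl)]

lemma rr_bT (f g : SFR W) : rr (S.bT f g) = S.bX (rr f) (rr g) + ∑ φ : Fld D, (rr ((sc W).rd (fld D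
    φ) f) * rr ((sc W).ld (afld D φ) g) - rr ((sc W).rd (afld D φ) f) * rr ((sc W).ld (fld D φ)
    g)) := by
  rw [bT_eq, map_add, rr_bX, map_sum]
  simp only [map_sub, map_mul]

/-- The restricted gauge-fixing fermion `λ^a G_a`. -/
def g : SFR W := rr S.X0

lemma even_g : (sc W).Hom 0 S.g := hom_res S.even0

/-- The constraints `G_a`. -/
def G (a : AExt D) : SFR W := rr ((sc W).rd (lam D a) S.X0)

/-- The restricted Hessian. -/
def h (u v : Coord D) : SFR W := rr ((sc W).ld u ((sc W).rd v S.X0))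

lemma hom_h (u v : Coord D) : (sc W).Hom (par D u + par D v) (S.h u v) :=
  hom_res (((S.even0.rd v).ld u).cast (by rw [add_zero]))

lemma wt_h (u v : Coord D) : (sc W).ld u ((sc W).rd v S.X0) ∈ Wt W {1 - plC u - plC v} :=
  wt_ld u (by rintro _ rfl; simp only [Set.mem_singleton_iff]; ring)
    (wt_rd (T' := {1 - plC v}) v (by rintro _ rfl; rfl) S.wt0)

lemma h_eq_zero {u v : Coord D} (h : 1 < plC u + plC v) : S.h u v = 0 :=
  resL_neg (by omega) (S.wt_h u v)

lemma isExt_of_wt {f : SFR W} (h : f ∈ Wt W {0}) : IsExt (rr f) := by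
  rw [rr, resL_zero h]
  exact ext_at fun x hx => by rw [at_res, at_res, res_res]; simp only [and_self]

lemma ext_h {u v : Coord D} (h : plC u + plC v = 1) : IsExt (S.h u v) := by
  have := S.wt_h u v
  rw [sub_sub, h, sub_self] at this
  exact isExt_of_wt this

lemma wt_rd_X0 (z : Coord D) : (sc W).rd z S.X0 ∈ Wt W {1 - plC z} :=
  wt_rd z (by rintro _ rfl; rfl) S.wt0

lemma wt_ld_X0 (z : Coord D) : (sc W).ld z S.X0 ∈ Wt W {1 - plC z} :=
  wt_ld z (by rintro _ rfl; rfl) S.wt0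

lemma rd_X0_eq_zero {z : Coord D} (h : 1 < plC z) : rr ((sc W).rd z S.X0) = 0 :=
  resL_neg (by omega) (S.wt_rd_X0 z)

lemma ld_X0_eq_zero {z : Coord D} (h : 1 < plC z) : rr ((sc W).ld z S.X0) = 0 :=
  resL_neg (by omega) (S.wt_ld_X0 z)

lemma ld_rd_X0_eq_zero {z u v : Coord D} (h : 1 < plC z + plC u + plC v) : rr
    ((sc W).ld z ((sc W).ld u ((sc W).rd v S.X0))) = 0 :=
  resL_neg (u := 1 - plC u - plC v - plC z) (by omega)
    (wt_ld z (by rintro _ rfl; rfl) (S.wt_h u v))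

lemma ext_G (a : AExt D) : IsExt (S.G a) := isExt_of_wt (by
  have := S.wt_rd_X0 (lam D a)
  rwa [show plC (lam D a) = 1 from rfl, sub_self] at this)

lemma hom_G (a : AExt D) : (sc W).Hom (parAl D a.1) (S.G a) :=
  hom_res ((S.even0.rd _).cast (add_zero _))

lemma plC_fld (φ : Fld D) : plC (fld D φ) = plFld D φ := rfl
lemma plC_afld (φ : Fld D) : plC (afld D φ) = -plFld D φ := rfl

lemma ld_ET (a : Aux D) (z w : Coord D) : (sc W).ld (inr a) (ET S.ED z w) = 0 :=
  ld_aux_of_ext (S.ext_ET z w) a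

/-- The second derivatives of the master equation. -/
lemma hess_rel (u v : Aux D) (hv : 1 < plC (inr v : Coord D)) : ∑ φ : Fld D, (S.h (inr u) (fld D
    φ) * S.h (afld D φ) (inr v) - S.h (inr u) (afld D φ) * S.h (fld D φ) (inr v)) + sgn
    (par D (inr u)) • (S.bX S.g (S.h (inr u) (inr v)) + ∑ φ : Fld D, (rr ((sc W).rd (fld D φ)
    S.X0) * rr ((sc W).ld (afld D φ) ((sc W).ld (inr u) ((sc W).rd (inr v) S.X0))) - rr ((sc W).rd
    (afld D φ) S.X0) * rr ((sc W).ld (fld D φ) ((sc W).ld (inr u) ((sc W).rd (inr v) S.X0))))) =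
    0 := by
  have h1 := S.odd_ET.hessian_br (fun i j => S.ld_ET u i j) (fun i j => S.ld_ET v i j) S.even0 S.cme
  have h2 := congrArg (rr (W := W)) h1
  rw [map_add, map_smul, map_zero] at h2
  rw [rr_bT, rr_bT, S.rd_X0_eq_zero hv] at h2
  have h3 : ∀ f, S.bX f 0 = 0 := fun f => by simp [bX, br]
  rw [h3, zero_add] at h2
  simp only [← ld_rd] at h2
  exact h2

/-- The first derivatives of the master equation. -/
lemma grad_rel (v : Aux D) (hv : 1 < plC (inr v : Coord D)) : ∑ φ : Fld D, (rr ((sc W).rd (fld D φ)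
    S.X0) * S.h (afld D φ) (inr v) - rr ((sc W).rd (afld D φ) S.X0) * S.h (fld D φ) (inr v)) = 0 :=
    by
  have h1 := S.odd_ET.br_rd_self (fun i j => S.ld_ET v i j) S.even0 S.cme
  have h2 := congrArg (rr (W := W)) h1
  rw [map_zero, rr_bT, S.rd_X0_eq_zero hv] at h2
  have h3 : ∀ f, S.bX f 0 = 0 := fun f => by simp [bX, br]
  rw [h3, zero_add] at h2
  exact h2

/-- The restricted master equation. -/
lemma master_rel : S.bX S.g S.g = (2 : ℂ) • ∑ φ : Fld D,
    -(rr ((sc W).rd (fld D φ) S.X0) * rr ((sc W).ld (afld D φ) S.X0)) := by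
  have h2 := congrArg (rr (W := W)) S.cme
  rw [map_zero, rr_bT] at h2
  rw [sum_neg_distrib, smul_neg, eq_neg_iff_add_eq_zero, ← h2, smul_sum]
  congr 1
  refine sum_congr rfl fun φ _ => ?_
  rw [two_smul, sub_eq_add_neg]
  congr 1
  rw [← map_mul, ← map_mul, ← map_neg]
  congr 1
  rw [S.even0.rd_eq, S.even0.rd_eq, smul_mul_assoc, smul_mul_assoc, (S.even0.ld (afld D φ)).comm
    (S.even0.ld (fld D φ)), sgn_smul_smul, neg_eq_sgn_smul, sgn_smul_smul]
  congr 2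
  change _ = 1 + ((par D (fld D φ) + 1) * (0 + 1) + (par D (fld D φ) + 1 + 0) * (par D (fld D φ) + 0))
  generalize par D (fld D φ) = x
  clear * -; revert x; decide

end GaugeData

end BV

namespace SuperCalc

variable {R : Type*} [Ring R] [Algebra ℂ R] {Z : Type*} {p : Z → ZMod 2} {C : SuperCalc R p}
  {q r : ZMod 2} {l m n : Type*} {x : l → ZMod 2} {y : m → ZMod 2} {z : n → ZMod 2}

variable (C) in
/-- A homogeneous supermatrix of parity `q`. -/
def MHom (q : ZMod 2) (x : m → ZMod 2) (y : n → ZMod 2) (M : Matrix m n R) : Prop :=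
  ∀ a b, C.Hom (x a + y b + q) (M a b)

lemma MHom.mul [Fintype m] {M : Matrix l m R} {N : Matrix m n R} (hM : C.MHom q x y M)
    (hN : C.MHom r y z N) : C.MHom (q + r) x z (M * N) := fun a b =>
  Hom.sum fun k _ => ((hM a k).mul (hN k b)).cast (by
    generalize x a = u; generalize y k = v; generalize z b = w; clear * -; revert u v w q r; decide)

lemma MHom.inverse [Fintype n] [DecidableEq n] {x y : n → ZMod 2} {M N : Matrix n n R}
    (hM : C.MHom 0 x y M) (h1 : M * N = 1) (h2 : N * M = 1) : C.MHom 0 y x N := fun a b =>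
  (hom_inverse (fun i j => (hM i j).cast (add_zero _)) h1 h2 a b).cast (add_zero _).symm

lemma trace_comm [Fintype m] [Fintype n] {M : Matrix m n R} {N : Matrix n m R} (hM : C.MHom q y z M)
    (hN : C.MHom r z y N) (hqr : q + r = 1) : Matrix.trace (M * N) = Matrix.trace (N * M) := by
  simp only [Matrix.trace, Matrix.diag, mul_apply]
  rw [sum_comm]
  refine sum_congr rfl fun j _ => sum_congr rfl fun i _ => ?_
  refine (hM i j).comm_of (hN j i) ?_
  generalize y i = u; generalize z j = v; clear * - hqr; revert u v q r; decide

end SuperCalc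

namespace BV.GaugeData

variable {D : FieldContent} {W : Opens (Body D)} (S : GaugeData W)

/-- The parities of the ghosts. -/
def pc (n : ℕ) (a : AIdx D (n + 1)) : ZMod 2 := parAl D a.1 + ((n + 1 : ℕ) : ZMod 2)

/-- The Faddeev-Popov matrices. -/
def Dl (n : ℕ) : Matrix (AIdx D (n + 1)) (AIdx D (n + 1)) (SFR W) :=
  fun a b => S.h (fld D (bF n a)) (fld D (cF n b))
/-- The block `c* c` of the Hessian. -/
def An (n : ℕ) : Matrix (AIdx D (n + 1)) (AIdx D (n + 1)) (SFR W) :=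
  fun a b => S.h (afld D (cF n a)) (fld D (cF n b))
/-- The block `c̄ c̄*` of the Hessian. -/
def Bn (n : ℕ) : Matrix (AIdx D (n + 1)) (AIdx D (n + 1)) (SFR W) :=
  fun a b => S.h (fld D (bF n a)) (afld D (bF n b))
/-- The block `c̄ c̄*` of the Hessian between neighbouring levels. -/
def Tn (n : ℕ) : Matrix (AIdx D (n + 1)) (AIdx D (n + 1 + 1)) (SFR W) :=
  fun a b => S.h (fld D (bF n a)) (afld D (bF (n + 1) b))
/-- The block `c̄ c` of the Hessian between neighbouring levels. -/
def Pn (n : ℕ) : Matrix (AIdx D (n + 1 + 1)) (AIdx D (n + 1)) (SFR W) :=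
  fun a b => S.h (fld D (bF (n + 1) a)) (fld D (cF n b))
/-- The block `c* c` of the Hessian between neighbouring levels. -/
def Rn (n : ℕ) : Matrix (AIdx D (n + 1)) (AIdx D (n + 1 + 1)) (SFR W) :=
  fun a b => S.h (afld D (cF n a)) (fld D (cF (n + 1) b))
/-- The block `c̄ λ` of the Hessian. -/
def P0 : Matrix (AIdx D (0 + 1)) (AExt D) (SFR W) :=
  fun a e => S.h (fld D (bF 0 a)) (lam D e)
/-- The block `λ* c` of the Hessian. -/
def R0 : Matrix (AExt D) (AIdx D (0 + 1)) (SFR W) :=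
  fun e b => S.h (afld D (lF e)) (fld D (cF 0 b))
/-- The block `λ* λ` of the Hessian. -/
def L0 : Matrix (AExt D) (AExt D) (SFR W) :=
  fun e f => S.h (afld D (lF e)) (lam D f)

/-- The parities of `λ`. -/
def pe (e : AExt D) : ZMod 2 := parAl D e.1

lemma hom_Dl (n : ℕ) : (sc W).MHom 0 (pc n) (pc n) (S.Dl n) := fun _ _ =>
  (S.hom_h _ _).cast (add_zero _).symm
lemma hom_Pn (n : ℕ) : (sc W).MHom 0 (pc (n + 1)) (pc n) (S.Pn n) := fun _ _ =>
  (S.hom_h _ _).cast (add_zero _).symm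
lemma hom_P0 : (sc W).MHom 0 (pc 0) pe S.P0 := fun _ _ =>
  (S.hom_h _ _).cast (add_zero _).symm
lemma hom_Bn (n : ℕ) : (sc W).MHom 1 (pc n) (pc n) (S.Bn n) := fun _ _ =>
  (S.hom_h _ _).cast (add_assoc _ _ _).symm
lemma hom_Tn (n : ℕ) : (sc W).MHom 1 (pc n) (pc (n + 1)) (S.Tn n) := fun _ _ =>
  (S.hom_h _ _).cast (add_assoc _ _ _).symm
lemma hom_Rn (n : ℕ) : (sc W).MHom 1 (pc n) (pc (n + 1)) (S.Rn n) := fun _ _ =>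
  (S.hom_h _ _).cast (add_right_comm _ _ _)
lemma hom_R0 : (sc W).MHom 1 pe (pc 0) S.R0 := fun _ _ =>
  (S.hom_h _ _).cast (add_right_comm _ _ _)
lemma hom_L0 : (sc W).MHom 1 pe pe S.L0 := fun _ _ =>
  (S.hom_h _ _).cast (add_right_comm _ _ _)

/-- The contribution of the lower levels to the Hessian identity. -/
def Xn (n : ℕ) : Matrix (AIdx D (n + 1)) (AIdx D (n + 1)) (SFR W) := fun a b =>
  ∑ φ : Fld D, if plFld D φ = n + 1 then
    S.h (fld D (bF n a)) (fld D φ) * S.h (afld D φ) (fld D (cF n b)) else 0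

lemma Xn_zero : S.Xn 0 = S.P0 * S.R0 := by
  ext a b
  rw [Xn, sum_fld_l _ fun φ h => if_neg (by simpa using h), mul_apply]
  exact sum_congr rfl fun e _ => if_pos (by simp [plFld_lF])

lemma Xn_succ (n : ℕ) : S.Xn (n + 1) = S.Pn n * S.Rn n := by
  ext a b
  rw [Xn, mul_apply]
  have := sum_fld_ite_c (fun φ => S.h (fld D (bF (n + 1) a)) (fld D φ) * S.h (afld D φ) (fld D (cF
    (n + 1) b))) n
  refine Eq.trans (sum_congr rfl fun φ _ => ?_) this
  congr 1

lemma h_ff {φ ψ : Fld D} (h : 1 < plFld D φ + plFld D ψ) : S.h (fld D φ) (fld D ψ) = 0 :=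
  S.h_eq_zero h
lemma h_af {φ ψ : Fld D} (h : 1 < -plFld D φ + plFld D ψ) : S.h (afld D φ) (fld D ψ) = 0 :=
  S.h_eq_zero h
lemma h_fa {φ ψ : Fld D} (h : 1 < plFld D φ + -plFld D ψ) : S.h (fld D φ) (afld D ψ) = 0 :=
  S.h_eq_zero h

section Mod

variable {Q : Type*} [Ring Q] [Algebra ℂ Q] (π : SFR W →ₐ[ℂ] Q) (hG : ∀ a, π (S.G a) = 0)

include hG in
lemma pi_field (hy : ∀ a, π (rr ((sc W).rd (afld D (bF 0 a)) S.X0)) = 0) (Y Y' : Fld D → SFR W)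
    (hY : ∀ φ, plFld D φ < 0 → Y φ = 0) (hY' : ∀ φ, 0 < plFld D φ → Y' φ = 0) : π (∑ φ : Fld D, (rr
    ((sc W).rd (fld D φ) S.X0) * Y φ - rr ((sc W).rd (afld D φ) S.X0) * Y' φ)) = 0 := by
  rw [map_sum]
  refine sum_eq_zero fun φ _ => ?_
  rw [map_sub, map_mul, map_mul]
  have key : π (rr ((sc W).rd (fld D φ) S.X0)) * π (Y φ) = 0 := by
    rcases φ with e | g | g
    · exact (congrArg (· * π (Y (inl e))) (hG e)).trans (zero_mul _)
    · rw [S.rd_X0_eq_zero, map_zero, zero_mul]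
      rw [plC_fld]; simp only [plFld]; omega
    · rw [hY, map_zero, mul_zero]
      simp only [plFld]; omega
  rw [key, zero_sub, neg_eq_zero]
  rcases φ with e | g | ⟨⟨i, hi⟩, a⟩
  · rw [hY', map_zero, mul_zero]
    simp only [plFld]; omega
  · rw [hY', map_zero, mul_zero]
    simp only [plFld]; omega
  · rcases i with _ | i
    · exact (congrArg (· * π (Y' _)) (hy a)).trans (zero_mul _)
    · rw [S.rd_X0_eq_zero, map_zero, zero_mul]
      rw [plC_afld]; simp only [plFld]; push_cast; omega

include hG in
lemma hess_diag (hy : ∀ a, π (rr ((sc W).rd (afld D (bF 0 a)) S.X0)) = 0) (n : ℕ)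
    (a b : AIdx D (n + 1)) : π ((S.Dl n * S.An n) a b + S.Xn n a b - (S.Bn n * S.Dl n) a b - (S.Tn
    n * S.Pn n) a b + sgn (pc n a) • S.bX S.g (S.Dl n a b)) = 0 := by
  have h1 := congrArg π (S.hess_rel (inl (bF n a)) (inl (cF n b)) (by
    change 1 < plFld D (cF n b); rw [plFld_cF]; omega))
  rw [map_zero, smul_add, ← add_assoc, map_add, map_smul, S.pi_field π hG hy (fun φ => rr ((sc W).ld
    (afld D φ) _)) (fun φ => rr ((sc W).ld (fld D φ) _)), smul_zero, add_zero] at h1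
  · have e1 : ∑ φ, S.h (fld D (bF n a)) (fld D φ) * S.h (afld D φ) (fld D (cF n b)) =
        (S.Dl n * S.An n) a b + S.Xn n a b := by
      rw [sum_fld_split _ ((n : ℤ) + 2) (n + 1) (by omega)]
      · exact congrArg₂ (· + ·) (sum_fld_ite_c _ n) rfl
      · intro φ h2 h3
        by_cases h4 : (n : ℤ) + 1 < plFld D φ
        · rw [S.h_ff, zero_mul]; rw [plFld_bF]; omega
        · rw [S.h_af, mul_zero]; rw [plFld_cF]; omega
    have e2 : ∑ φ, S.h (fld D (bF n a)) (afld D φ) * S.h (fld D φ) (fld D (cF n b)) =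
        (S.Bn n * S.Dl n) a b + (S.Tn n * S.Pn n) a b := by
      rw [sum_fld_split _ (-((n : ℤ) + 1)) (-(((n + 1 : ℕ) : ℤ) + 1)) (by push_cast; omega)]
      · exact congrArg₂ (· + ·) (sum_fld_ite_b _ n) (sum_fld_ite_b _ (n + 1))
      · intro φ h2 h3
        push_cast at h3
        by_cases h4 : plFld D φ < -((n : ℤ) + 1)
        · rw [S.h_fa, zero_mul]; rw [plFld_bF]; omega
        · rw [S.h_ff, mul_zero]; rw [plFld_cF]; omega
    rw [sum_sub_distrib, e1, e2, ← sub_sub] at h1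
    exact h1
  · intro φ h2
    refine S.ld_rd_X0_eq_zero ?_
    change 1 < -plFld D φ + plFld D (bF n a) + plFld D (cF n b)
    rw [plFld_bF, plFld_cF]; omega
  · intro φ h2
    refine S.ld_rd_X0_eq_zero ?_
    change 1 < plFld D φ + plFld D (bF n a) + plFld D (cF n b)
    rw [plFld_bF, plFld_cF]; omega

include hG in
lemma hess_off (hy : ∀ a, π (rr ((sc W).rd (afld D (bF 0 a)) S.X0)) = 0) (n : ℕ)
    (a : AIdx D (n + 1)) (b : AIdx D (n + 1 + 1)) : π
    ((S.Dl n * S.Rn n) a b - (S.Tn n * S.Dl (n + 1)) a b) = 0 := by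
  have h1 := congrArg π (S.hess_rel (inl (bF n a)) (inl (cF (n + 1) b)) (by
    change 1 < plFld D (cF (n + 1) b); rw [plFld_cF]; omega))
  have h0 : S.h (fld D (bF n a)) (fld D (cF (n + 1) b)) = 0 := by
    rw [S.h_ff]; rw [plFld_bF, plFld_cF]; push_cast; omega
  have h3 : S.bX S.g 0 = 0 := by simp [bX, br]
  rw [map_zero, h0, h3, zero_add, map_add, map_smul, S.pi_field π hG hy (fun φ => rr ((sc W).ld
    (afld D φ) _)) (fun φ => rr ((sc W).ld (fld D φ) _)), smul_zero, add_zero] at h1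
  · have e1 : ∑ φ, S.h (fld D (bF n a)) (fld D φ) * S.h (afld D φ) (fld D (cF (n + 1) b)) =
        (S.Dl n * S.Rn n) a b := by
      rw [sum_fld_c _ n]
      · rfl
      · intro φ h2
        by_cases h4 : (n : ℤ) + 2 < plFld D φ
        · rw [S.h_ff, zero_mul]; rw [plFld_bF]; omega
        · rw [S.h_af, mul_zero]; rw [plFld_cF]; push_cast; omega
    have e2 : ∑ φ, S.h (fld D (bF n a)) (afld D φ) * S.h (fld D φ) (fld D (cF (n + 1) b)) =
        (S.Tn n * S.Dl (n + 1)) a b := by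
      rw [sum_fld_b _ (n + 1)]
      · rfl
      · intro φ h2
        push_cast at h2
        by_cases h4 : plFld D φ < -((n : ℤ) + 2)
        · rw [S.h_fa, zero_mul]; rw [plFld_bF]; omega
        · rw [S.h_ff, mul_zero]; rw [plFld_cF]; push_cast; omega
    rw [sum_sub_distrib, e1, e2] at h1
    exact h1
  · intro φ h2
    refine S.ld_rd_X0_eq_zero ?_
    change 1 < -plFld D φ + plFld D (bF n a) + plFld D (cF (n + 1) b)
    rw [plFld_bF, plFld_cF]; push_cast; omega
  · intro φ h2
    refine S.ld_rd_X0_eq_zero ?_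
    change 1 < plFld D φ + plFld D (bF n a) + plFld D (cF (n + 1) b)
    rw [plFld_bF, plFld_cF]; push_cast; omega

lemma pi_mul_of_right {m n : Type*} [Fintype m] [Fintype n] (M : Matrix m n (SFR W))
    (N N' : Matrix n m (SFR W)) (h : ∀ a b, π (N a b) = π (N' a b)) : π (M * N).trace = π
    (M * N').trace := by
  simp only [Matrix.trace, Matrix.diag, mul_apply, map_sum, map_mul, h]

lemma pi_telescope {m n : Type*} [Fintype m] [Fintype n] [DecidableEq m] [DecidableEq n]
    {x : m → ZMod 2} {y : n → ZMod 2} {D1 I1 : Matrix m m (SFR W)} {D2 I2 : Matrix n n (SFR W)}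
    {R T : Matrix m n (SFR W)} {P : Matrix n m (SFR W)} (h1 : I1 * D1 = 1) (h2 : D2 * I2 = 1)
    (hI1 : (sc W).MHom 0 x x I1) (hI2 : (sc W).MHom 0 y y I2) (hR : (sc W).MHom 1 x y R)
    (hT : (sc W).MHom 1 x y T) (hP : (sc W).MHom 0 y x P)
    (h : ∀ a b, π ((D1 * R) a b) = π ((T * D2) a b)) : π (I1 * (T * P)).trace = π
    (I2 * (P * R)).trace := by
  have e5 : R * I2 = I1 * (D1 * R) * I2 := by
    rw [← Matrix.mul_assoc I1, h1, Matrix.one_mul]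
  have e6 : I1 * T = I1 * (T * D2) * I2 := by
    rw [Matrix.mul_assoc, Matrix.mul_assoc, h2, Matrix.mul_one]
  have e7 : ∀ a b, π ((I1 * T) a b) = π ((R * I2) a b) := by
    intro a b
    rw [e5, e6, mul_apply, mul_apply, map_sum, map_sum]
    refine sum_congr rfl fun c _ => ?_
    rw [map_mul, map_mul]
    congr 1
    rw [mul_apply, mul_apply, map_sum, map_sum]
    refine sum_congr rfl fun d _ => ?_
    rw [map_mul, map_mul, h]
  rw [← Matrix.mul_assoc, trace_comm (hI1.mul hT) hP rfl, pi_mul_of_right π _ _ _ e7, ←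
    Matrix.mul_assoc, trace_comm (hP.mul hR) hI2 rfl]

variable {Di : ∀ n, Matrix (AIdx D (n + 1)) (AIdx D (n + 1)) (SFR W)}
  (h1 : ∀ n, S.Dl n * Di n = 1) (h2 : ∀ n, Di n * S.Dl n = 1)

include h1 h2

lemma hom_Di (n : ℕ) : (sc W).MHom 0 (pc n) (pc n) (Di n) := (S.hom_Dl n).inverse (h1 n) (h2 n)

include hG

/-- The contributions of neighbouring levels telescope. -/
lemma trace_level (hy : ∀ a, π (rr ((sc W).rd (afld D (bF 0 a)) S.X0)) = 0) (n : ℕ) : π ((S.An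
    n).trace - (S.Bn n).trace + (Di n * S.Xn n).trace - (Di (n + 1) * S.Xn (n + 1)).trace + ∑ a, ∑
    b, sgn (pc n a) • (Di n b a * S.bX S.g (S.Dl n a b))) = 0 := by
  have hDi := S.hom_Di h1 h2
  let Y : Matrix (AIdx D (n + 1)) (AIdx D (n + 1)) (SFR W) :=
    fun a b => sgn (pc n a) • S.bX S.g (S.Dl n a b)
  have e1 := pi_mul_of_right π (Di n) (S.Dl n * S.An n + S.Xn n - S.Bn n * S.Dl n - S.Tn n * S.Pn n
    + Y) 0 (fun a b => (S.hess_diag π hG hy n a b).trans (map_zero π).symm)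
  rw [Matrix.mul_zero, Matrix.trace_zero, map_zero] at e1
  have e2 : (Di n * (S.Bn n * S.Dl n)).trace = (S.Bn n).trace := by
    rw [trace_comm (hDi n) ((S.hom_Bn n).mul (S.hom_Dl n)) rfl, Matrix.mul_assoc, h1,
      Matrix.mul_one]
  have e3 : (Di n * Y).trace = ∑ a, ∑ b, sgn (pc n a) • (Di n b a * S.bX S.g (S.Dl n a b)) := by
    rw [Matrix.trace, sum_comm]
    refine sum_congr rfl fun b _ => ?_
    rw [Matrix.diag, mul_apply]
    exact sum_congr rfl fun a _ => mul_smul_comm _ _ _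
  have e4 : π (Di n * (S.Tn n * S.Pn n)).trace = π (Di (n + 1) * S.Xn (n + 1)).trace := by
    rw [S.Xn_succ]
    exact pi_telescope π (h2 n) (h1 (n + 1)) (hDi n) (hDi (n + 1)) (S.hom_Rn n) (S.hom_Tn n)
      (S.hom_Pn n) fun a b => by
        have := S.hess_off π hG hy n a b
        rwa [map_sub, sub_eq_zero] at this
  rw [Matrix.mul_add, Matrix.mul_sub, Matrix.mul_sub, Matrix.mul_add, Matrix.trace_add,
    Matrix.trace_sub, Matrix.trace_sub, Matrix.trace_add, e2, e3, ← Matrix.mul_assoc, h2,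
    Matrix.one_mul] at e1
  rw [← e1]
  simp only [map_add, map_sub, e4]
  abel

end Mod

/-- The antifield derivatives of the action with respect to `c̄*`. -/
def yv (a : AIdx D (0 + 1)) : SFR W := rr ((sc W).rd (afld D (bF 0 a)) S.X0)

lemma isExt_sum {ι : Type*} {s : Finset ι} {f : ι → SFR W} (h : ∀ i ∈ s, IsExt (f i)) : IsExt
    (∑ i ∈ s, f i) := (ExtAlg W).sum_mem h

lemma isExt_matrix_mul {l m n : Type*} [Fintype m] {M : Matrix l m (SFR W)} {N : Matrix m n (SFR W)}
    (hM : ∀ a b, IsExt (M a b)) (hN : ∀ a b, IsExt (N a b)) (a : l) (b : n) : IsExt ((M * N) a b) :=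
  isExt_sum fun c _ => (ExtAlg W).mul_mem (hM a c) (hN c b)

lemma rd_ext_mul {f : SFR W} (hf : IsExt f) (a : Aux D) (g : SFR W) : (sc W).rd (inr a) (f * g) =
    f * (sc W).rd (inr a) g := by
  rw [rd_mul, rd_aux_of_ext hf, zero_mul, add_zero]

variable {I0 : Matrix (AIdx D (0 + 1)) (AIdx D (0 + 1)) (SFR W)}

lemma grad_rel_c (b : AIdx D (0 + 1)) : ∑ e, S.G e * S.R0 e b = ∑ a, S.yv a * S.Dl 0 a b := by
  have h1 := S.grad_rel (inl (cF 0 b)) (by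
    change 1 < plFld D (cF 0 b); rw [plFld_cF]; omega)
  rw [sum_sub_distrib, sub_eq_zero, sum_fld_l, sum_fld_b _ 0] at h1
  · exact h1
  · intro φ h2
    by_cases h4 : plFld D φ < -1
    · have : rr ((sc W).rd (afld D φ) S.X0) = 0 := S.rd_X0_eq_zero (by
        change 1 < -plFld D φ; omega)
      rw [this, zero_mul]
    · have : S.h (fld D φ) (fld D (cF 0 b)) = 0 := S.h_ff (by
        rw [plFld_cF]; push_cast at h2 ⊢; omega)
      exact (congrArg (_ * ·) this).trans (mul_zero _)
  · intro φ h2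
    by_cases h4 : 1 < plFld D φ
    · have : rr ((sc W).rd (fld D φ) S.X0) = 0 := S.rd_X0_eq_zero h4
      rw [this, zero_mul]
    · have : S.h (afld D φ) (fld D (cF 0 b)) = 0 := S.h_af (by
        rw [plFld_cF]; push_cast; omega)
      exact (congrArg (_ * ·) this).trans (mul_zero _)

/-- The coefficients of the constraints in the restricted master equation. -/
def Nv (I0 : Matrix (AIdx D (0 + 1)) (AIdx D (0 + 1)) (SFR W)) (e : AExt D) : SFR W :=
  rr ((sc W).ld (afld D (lF e)) S.X0) -
    ∑ a, (S.R0 * I0) e a * rr ((sc W).ld (fld D (bF 0 a)) S.X0)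

/-- The structure functions of the constraints. -/
def Kv (I0 : Matrix (AIdx D (0 + 1)) (AIdx D (0 + 1)) (SFR W)) :
    Matrix (AExt D) (AExt D) (SFR W) := S.L0 - S.R0 * I0 * S.P0

lemma ext_Dl (n : ℕ) (a b : AIdx D (n + 1)) : IsExt (S.Dl n a b) := S.ext_h (by
  change plFld D (bF n a) + plFld D (cF n b) = 1; rw [plFld_cF, plFld_bF]; omega)
lemma ext_R0 (e : AExt D) (b : AIdx D (0 + 1)) : IsExt (S.R0 e b) := S.ext_h (by
  change -plFld D (lF e) + plFld D (cF 0 b) = 1; rw [plFld_cF, plFld_lF]; omega)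

section

variable (h1 : S.Dl 0 * I0 = 1) (hI : ∀ a b, IsExt (I0 a b))

include h1 in
lemma yv_eq (a : AIdx D (0 + 1)) : S.yv a = ∑ e, S.G e * (S.R0 * I0) e a := by
  have h2 : Matrix.vecMul S.G S.R0 = Matrix.vecMul S.yv (S.Dl 0) := funext fun b => S.grad_rel_c b
  have h3 : Matrix.vecMul (Matrix.vecMul S.G S.R0) I0 = S.yv := by
    rw [h2, Matrix.vecMul_vecMul, h1, Matrix.vecMul_one]
  rw [Matrix.vecMul_vecMul] at h3
  exact (congrFun h3 a).symm

include h1 in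
lemma master_N : S.bX S.g S.g = (-2 : ℂ) • ∑ e, S.G e * S.Nv I0 e := by
  rw [S.master_rel, neg_smul, ← smul_neg]
  congr 1
  have e1 : ∀ φ : Fld D, plFld D φ ≠ 1 → plFld D φ ≠ -1 →
      -(rr ((sc W).rd (fld D φ) S.X0) * rr ((sc W).ld (afld D φ) S.X0)) = 0 := by
    intro φ h2 h3
    by_cases h4 : 1 < plFld D φ
    · have : rr ((sc W).rd (fld D φ) S.X0) = 0 := S.rd_X0_eq_zero h4
      rw [this, zero_mul, neg_zero]
    · have : rr ((sc W).ld (afld D φ) S.X0) = 0 := S.ld_X0_eq_zero (by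
        change 1 < -plFld D φ
        rcases φ with e | ⟨i, a⟩ | ⟨i, a⟩
        · exact absurd rfl h2
        · simp only [plFld] at *; omega
        · simp only [plFld] at *; omega)
      rw [this, mul_zero, neg_zero]
  rw [sum_fld_split _ 1 (-1) (by norm_num) e1]
  have e2 : ∑ φ : Fld D, (if plFld D φ = 1 then
      -(rr ((sc W).rd (fld D φ) S.X0) * rr ((sc W).ld (afld D φ) S.X0)) else 0) =
      -∑ e, S.G e * rr ((sc W).ld (afld D (lF e)) S.X0) := by
    rw [sum_fld_l _ fun φ h => if_neg h, ← sum_neg_distrib]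
    exact sum_congr rfl fun a _ => if_pos (plFld_lF a)
  have e3 : ∑ φ : Fld D, (if plFld D φ = -1 then
      -(rr ((sc W).rd (fld D φ) S.X0) * rr ((sc W).ld (afld D φ) S.X0)) else 0) =
      ∑ a, S.yv a * rr ((sc W).ld (fld D (bF 0 a)) S.X0) := by
    rw [sum_fld_b _ 0 fun φ h => if_neg (by simpa using h)]
    refine sum_congr rfl fun a _ => (if_pos (by rw [plFld_bF]; simp)).trans ?_
    rw [yv, ← map_mul, ← map_mul, ← map_neg]
    congr 1
    rw [S.even0.rd_eq, S.even0.rd_eq, smul_mul_assoc, smul_mul_assoc, (S.even0.ld (afld D (bF 0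
      a))).comm (S.even0.ld (fld D (bF 0 a))), sgn_smul_smul, neg_eq_sgn_smul, sgn_smul_smul]
    congr 2
    change _ = (par D (fld D (bF 0 a)) + 1) * (0 + 1) +
      (par D (fld D (bF 0 a)) + 1 + 0) * (par D (fld D (bF 0 a)) + 0)
    generalize par D (fld D (bF 0 a)) = x
    clear * -; revert x; decide
  rw [e2, e3]
  simp only [S.yv_eq h1, Nv, mul_sub, sum_sub_distrib, sum_mul, mul_sum, mul_assoc]
  rw [sum_comm]
  abel

include hI in
lemma rd_Nv (e f : AExt D) : (sc W).rd (lam D f) (S.Nv I0 e) = S.Kv I0 e f := by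
  have e1 : ∀ z : Coord D, (sc W).rd (lam D f) (rr ((sc W).ld z S.X0)) = S.h z (lam D f) := by
    intro z
    rw [rr, rd_res_pos (P := keepL) (show keepL (lam D f) from Or.inr ⟨f, rfl⟩), ← ld_rd]
    rfl
  rw [Nv, map_sub, map_sum, e1, Kv, Matrix.sub_apply, mul_apply]
  congr 1
  refine sum_congr rfl fun a _ => ?_
  rw [rd_ext_mul (isExt_matrix_mul S.ext_R0 hI e a), e1]
  rfl

lemma rd_g (f : AExt D) : (sc W).rd (lam D f) S.g = S.G f := by
  rw [g, rr, rd_res_pos (P := keepL) (show keepL (lam D f) from Or.inr ⟨f, rfl⟩)]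
  rfl

lemma ld_EX (a : Aux D) (A B : Ext D) : (sc W).ld (inr a) (EX S.ED A B) = 0 :=
  ld_aux_of_ext (S.ext_EX A B) a

include h1 hI in
lemma bX_G (f : AExt D) : S.bX S.g (S.G f) = -∑ e, S.G e * S.Kv I0 e f := by
  have e1 := congrArg ((sc W).rd (lam D f)) (S.master_N h1)
  rw [S.odd_EX.rd_br (fun A B => S.ld_EX _ A B) _ S.even_g, S.rd_g, map_smul, map_sum,
    S.odd_EX.br_skew (S.hom_G f) S.even_g, smul_neg, sgn_smul_smul, neg_eq_sgn_smul, sgn_smul_smul]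
    at e1
  have e2 : 1 + (par D (lam D f) * (0 + 1) + (parAl D f.1 + 1) * (0 + 1)) = 0 := by
    change 1 + (parAl D f.1 * (0 + 1) + (parAl D f.1 + 1) * (0 + 1)) = 0
    generalize parAl D f.1 = x
    clear * -; revert x; decide
  rw [e2, sgn_zero, one_smul, ← two_smul ℂ] at e1
  have e3 : ∀ e, (sc W).rd (lam D f) (S.G e * S.Nv I0 e) = S.G e * S.Kv I0 e f := fun e => by
    rw [rd_ext_mul (S.ext_G e), S.rd_Nv hI]
  simp only [e3] at e1
  have := congrArg ((2⁻¹ : ℂ) • ·) e1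
  simp only [smul_smul] at this
  norm_num at this
  exact this

end

section Mod

variable {Q : Type*} [Ring Q] [Algebra ℂ Q] (π : SFR W →ₐ[ℂ] Q) (hG : ∀ a, π (S.G a) = 0)
  {Di : ∀ n, Matrix (AIdx D (n + 1)) (AIdx D (n + 1)) (SFR W)}
  (h1 : ∀ n, S.Dl n * Di n = 1) (h2 : ∀ n, Di n * S.Dl n = 1)

include hG h1 in
lemma pi_yv (a : AIdx D (0 + 1)) : π (S.yv a) = 0 := by
  rw [S.yv_eq (h1 0), map_sum]
  exact sum_eq_zero fun e _ => by rw [map_mul, hG, zero_mul]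

lemma lap_T : (sc W).lap id (ET S.ED) S.ρ S.ρ' S.X0 = (sc W).lap inl (EX S.ED) S.ρ S.ρ' S.X0 + ∑ φ :
    Fld D, (sc W).ld (afld D φ) ((sc W).rd (fld D φ) S.X0) := by
  have := lap_canon (C := sc W) (id : Coord D → Coord D) (EX S.ED) S.even_ρ S.ρ'_mul
    (fun m => rfl) (fun m => ld_aux_of_ext S.ext_ρ m) S.X0
  refine this.trans ?_
  congr 1
  refine sum_congr rfl fun φ _ => ?_
  rw [S.even0.rd_eq, map_smul, (sc W).ld_comm, sgn_smul_smul]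
  congr 2
  change par D (fld D φ) + par D (fld D φ) * (par D (fld D φ) + 1) = par D (fld D φ) * (0 + 1)
  generalize par D (fld D φ) = x
  clear * -; revert x; decide

lemma rr_lapX : rr ((sc W).lap inl (EX S.ED) S.ρ S.ρ' S.X0) = (sc W).lap inl (EX S.ED) S.ρ S.ρ'
    S.g := by
  simp only [lap, map_sum, map_smul, map_mul]
  refine sum_congr rfl fun A _ => sum_congr rfl fun B _ => ?_
  rw [rr_of_ext S.ext_ρ', rr, ← SFR.ld_res_pos (P := keepL) (z := inl A) (Or.inl rfl), map_mul
    (SFR.res keepL), map_mul (SFR.res keepL), ← SFR.ld_res_pos (P := keepL) (z := inl B) (Or.inl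
    rfl)]
  exact congrArg₂ (fun x y => _ • (_ * (sc W).ld _ (x * y * _))) (rr_of_ext S.ext_ρ)
    (rr_of_ext (S.ext_EX A B))

lemma h_anti (φ : Fld D) : S.h (afld D φ) (fld D φ) = -S.h (fld D φ) (afld D φ) := by
  rw [h, h, ← map_neg]
  congr 1
  rw [S.even0.rd_eq, S.even0.rd_eq, map_smul, map_smul, (sc W).ld_comm, sgn_smul_smul,
    neg_eq_sgn_smul, sgn_smul_smul]
  congr 2
  change par D (fld D φ) * (0 + 1) + (par D (fld D φ) + 1) * par D (fld D φ) =
    1 + (par D (fld D φ) + 1) * (0 + 1)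
  generalize par D (fld D φ) = x
  clear * -; revert x; decide

/-- Fields of a given level. -/
lemma sum_fld_levels {M : Type*} [AddCommMonoid M] (f : Fld D → M) : ∑ φ, f φ = ∑ e, f (lF e) +
    (∑ n ∈ range D.s, ∑ a, f (cF n a) + ∑ n ∈ range D.s, ∑ a, f (bF n a)) := by
  rw [sum_sum_type, sum_sum_type, Fintype.sum_sigma, Fintype.sum_sigma, Finset.sum_range,
    Finset.sum_range]
  rfl

include hG h1 h2 in
lemma loop_rel : π (S.bX S.g (rr S.X1)) = π ((sc W).lap inl (EX S.ED) S.ρ S.ρ' S.g + (S.Kv (Di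
    0)).trace - ∑ n ∈ range D.s, ∑ a, ∑ b, sgn (pc n a) • (Di n b a * S.bX S.g (S.Dl n a b))) := by
  have e1 := congrArg π (congrArg (rr (W := W)) S.loop)
  rw [S.rr_bT, S.lap_T, map_add, map_add, map_add, S.rr_lapX, S.pi_field π hG (S.pi_yv π hG h1) (fun
    φ => rr ((sc W).ld (afld D φ) S.X1)) (fun φ => rr ((sc W).ld (fld D φ) S.X1)), add_zero,
    map_sum, sum_fld_levels] at e1
  · change π (S.bX S.g (rr S.X1)) = _ + π (∑ e, S.L0 e e + (∑ n ∈ range D.s, (S.An n).trace + ∑ n ∈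
      range D.s, ∑ a, S.h (afld D (bF n a)) (fld D (bF n a)))) at e1
    have e2 : ∀ n, ∑ a, S.h (afld D (bF n a)) (fld D (bF n a)) = -(S.Bn n).trace := fun n => by
      simp only [h_anti, sum_neg_distrib]; rfl
    have e3 := fun n => S.trace_level π hG h1 h2 (S.pi_yv π hG h1) n
    have e4 : ∀ m, π (∑ n ∈ range m, (S.An n).trace - ∑ n ∈ range m, (S.Bn n).trace + (Di 0 * S.Xn
      0).trace - (Di m * S.Xn m).trace + ∑ n ∈ range m, ∑ a, ∑ b, sgn (pc n a) • (Di n b a * S.bX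
      S.g (S.Dl n a b))) = 0 := by
      intro m
      induction m with
      | zero => simp
      | succ m ih =>
        rw [sum_range_succ, sum_range_succ, sum_range_succ]
        have := congrArg₂ (· + ·) ih (e3 m)
        simp only [add_zero] at this
        rw [← this, ← map_add]
        congr 1
        abel
    have e5 : (Di D.s * S.Xn D.s).trace = 0 := sum_eq_zero fun a _ =>
      absurd (lt_of_lt_of_le (Nat.lt_succ_self _) a.2) (not_lt.mpr (Nat.lt_succ_iff.mp a.1.1.2))
    have e6 : (Di 0 * S.Xn 0).trace = (S.R0 * Di 0 * S.P0).trace := by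
      rw [S.Xn_zero, ← Matrix.mul_assoc, trace_comm ((S.hom_Di h1 h2 0).mul S.hom_P0) S.hom_R0 rfl,
        Matrix.mul_assoc]
    have e7 := e4 D.s
    rw [e5, sub_zero, e6] at e7
    simp only [e2, sum_neg_distrib] at e1
    rw [Kv, Matrix.trace_sub, e1, ← sub_eq_zero, ← e7, ← map_add, ← map_sub]
    congr 1
    change _ + (S.L0.trace + _) - (_ + (S.L0.trace - _) - _) = _
    abel
  · intro φ h3
    exact resL_neg (u := 0 - plC (afld D φ)) (by change 0 - -plFld D φ < 0; omega)
      (wt_ld _ (by rintro _ rfl; rfl) S.wt1)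
  · intro φ h3
    exact resL_neg (u := 0 - plC (fld D φ)) (by change 0 - plFld D φ < 0; omega)
      (wt_ld _ (by rintro _ rfl; rfl) S.wt1)

end Mod

end BV.GaugeData

namespace SuperCalc

variable {R : Type*} [Ring R] [Algebra ℂ R] {Z : Type*} {p : Z → ZMod 2} {C : SuperCalc R p}
  {q r : ZMod 2} {ι β : Type*} [Fintype ι] [Fintype β] [DecidableEq ι] [DecidableEq β]
  {c : ι → Z} {E : ι → ι → R} {Γ : β → R} {y : β → ZMod 2} {K : Matrix ι β R}

variable (C c Γ) in
/-- The matrix of right derivatives. -/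
def jac : Matrix β ι R := fun b i => C.rd (c i) (Γ b)

variable (C c K) in
/-- The right derivative along a new coordinate, `K` being the inverse of the Jacobian. -/
def rdb (b : β) (f : R) : R := ∑ i, C.rd (c i) f * K i b

section

omit [Fintype β] [DecidableEq β] [DecidableEq ι]

lemma rdb_add (b : β) (f h : R) : C.rdb c K b (f + h) = C.rdb c K b f + C.rdb c K b h := by
  simp only [rdb, map_add, add_mul, sum_add_distrib]

lemma rdb_smul (b : β) (k : ℂ) (f : R) : C.rdb c K b (k • f) = k • C.rdb c K b f := by
  simp only [rdb, map_smul, smul_mul_assoc, smul_sum]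

lemma rdb_sum {κ : Type*} (b : β) (s : Finset κ) (f : κ → R) : C.rdb c K b (∑ k ∈ s, f k) = ∑ k ∈ s,
    C.rdb c K b (f k) := by
  simp only [rdb, map_sum, sum_mul]
  rw [sum_comm]

variable (hK : ∀ i b, C.Hom (p (c i) + y b) (K i b))

include hK

lemma rdb_mul (b : β) (f h : R) : C.rdb c K b (f * h) = f * C.rdb c K b h + C.rdb c K b f * C.tw
    (y b) h := by
  refine hom_ind (C := C) (P := fun h => C.rdb c K b (f * h) = f * C.rdb c K b h + C.rdb c K b f *
    C.tw (y b) h) (fun r h hh => ?_) (fun a b ha hb => ?_) h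
  · simp only [rdb, mul_sum, sum_mul, ← sum_add_distrib]
    refine sum_congr rfl fun i _ => ?_
    rw [rd_mul, add_mul, mul_assoc, hh.tw, hh.tw, mul_smul_comm, smul_mul_assoc, mul_assoc, hh.comm
      (hK i b), mul_smul_comm, sgn_smul_smul, mul_smul_comm, mul_assoc]
    congr 3
    generalize p (c i) = u; generalize y b = v; clear * -; revert u v r; decide
  · rw [mul_add, rdb_add, ha, hb, tw_add, rdb_add, mul_add, mul_add]
    abel

lemma rdb_hom {f : R} (hf : C.Hom q f) (b : β) : C.Hom (y b + q) (C.rdb c K b f) :=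
  Hom.sum fun i _ => ((hf.rd _).mul (hK i b)).cast (by
    generalize p (c i) = u; generalize y b = v; clear * -; revert u v q; decide)

end

lemma rdb_coord (h1 : C.jac c Γ * K = 1) (b b' : β) : C.rdb c K b (Γ b') = if b' = b then 1 else
    0 := by
  have := congrFun (congrFun h1 b') b
  rwa [mul_apply, one_apply] at this

lemma br_chain (h2 : K * C.jac c Γ = 1) (f k : R) : C.br c E f k = ∑ b, C.rdb c K b f * C.br c E
    (Γ b) k := by
  have h3 : ∀ i, ∑ b, K i b * C.br c E (Γ b) k = C.ham c E k i := by
    intro i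
    have h4 : ∀ j, ∑ b, K i b * C.rd (c j) (Γ b) = if i = j then 1 else 0 := fun j => by
      have := congrFun (congrFun h2 i) j
      rwa [mul_apply, one_apply] at this
    simp only [br_eq_ham, mul_sum, ← mul_assoc]
    rw [sum_comm]
    simp only [← sum_mul, h4, ite_mul, one_mul, zero_mul, Finset.sum_ite_eq, mem_univ, if_true]
  simp only [rdb, sum_mul, mul_assoc]
  rw [sum_comm]
  simp only [← mul_sum, h3]
  exact br_eq_ham f k

/-- The change of the divergence of a Hamiltonian vector field under a change of coordinates. -/
lemma divergence_chain (hE : C.OddBivector c E) (hΓ : ∀ b, C.Hom (y b) (Γ b))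
    (hK : ∀ i b, C.Hom (p (c i) + y b) (K i b)) (h2 : K * C.jac c Γ = 1) {g : R} (hg : C.Hom 0 g) :
    ∑ i, C.rd (c i) (C.ham c E g i) = ∑ b, C.rdb c K b (C.br c E (Γ b) g) - ∑ i, ∑ b, sgn
    (p (c i)) • (K i b * C.br c E (C.jac c Γ b i) g) := by
  have hJ : ∀ b i, C.Hom (p (c i) + y b) (C.jac c Γ b i) := fun b i => (hΓ b).rd _
  have hV := hE.ham_hom hg
  have e1 : ∀ b, C.rdb c K b (C.br c E (Γ b) g) = (∑ i, ∑ j, C.rd (c i) (C.ham c E g j) * (K i b *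
    C.jac c Γ b j)) +
      ∑ i, sgn (p (c i)) • (K i b * C.br c E (C.jac c Γ b i) g) := by
    intro b
    rw [rdb, ← sum_add_distrib]
    refine sum_congr rfl fun i _ => ?_
    rw [br_eq_ham, map_sum, sum_mul, br_eq_ham, mul_sum, smul_sum, ← sum_add_distrib]
    refine sum_congr rfl fun j _ => ?_
    have e2 : C.rd (c i) (C.jac c Γ b j * C.ham c E g j) = _ := rd_mul _ _ _
    refine (congrArg (· * K i b) e2).trans ?_
    simp only [add_mul]
    congr 1
    · rw [mul_assoc, (hJ b j).comm_of (((hV j).rd (c i)).mul (hK i b)), mul_assoc]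
      generalize p (c i) = u; generalize p (c j) = w; generalize y b = v
      clear * -; revert u v w; decide
    · have e3 : C.rd (c i) (C.jac c Γ b j) = sgn (p (c i) * p (c j)) •
          C.rd (c j) (C.jac c Γ b i) := rd_comm _ _ _
      rw [e3, (hV j).tw, mul_smul_comm, smul_mul_assoc, smul_mul_assoc, smul_mul_assoc,
        sgn_smul_smul, ((((hJ b i).rd (c j))).mul (hV j)).comm_of (hK i b)]
      · congr 2
        generalize p (c i) = u; generalize p (c j) = w; clear * -; revert u w; decide
      · generalize p (c i) = u; generalize p (c j) = w; generalize y b = v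
        clear * -; revert u v w; decide
  rw [eq_sub_iff_add_eq]
  simp only [e1, sum_add_distrib]
  congr 1
  · have e4 : ∀ i j, ∑ b, K i b * C.jac c Γ b j = if i = j then 1 else 0 := fun i j => by
      have := congrFun (congrFun h2 i) j
      rwa [mul_apply, one_apply] at this
    rw [sum_comm]
    refine sum_congr rfl fun i _ => ?_
    rw [sum_comm]
    simp only [← mul_sum, e4, mul_ite, mul_one, mul_zero, Finset.sum_ite_eq, mem_univ, if_true]
  · rw [sum_comm]

end SuperCalc

namespace BV

variable {D : FieldContent} {W : Opens (Body D)}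

namespace GaugeData

variable (S : GaugeData W) {q r : ZMod 2}

lemma bX_skew {f k : SFR W} (hf : (sc W).Hom q f) (hk : (sc W).Hom r k) : S.bX f k =
    -(sgn ((q + 1) * (r + 1)) • S.bX k f) := S.odd_EX.br_skew hf hk

lemma bX_smul (f : SFR W) (c : ℂ) (k : SFR W) : S.bX f (c • k) = c • S.bX f k :=
  br_smul_right c f k

lemma bX_sum {κ : Type*} (s : Finset κ) (f : SFR W) (k : κ → SFR W) : S.bX f (∑ i ∈ s, k i) = ∑ i ∈
    s, S.bX f (k i) := br_sum_right s f k

lemma bX_mul {f : SFR W} (hf : (sc W).Hom q f) (k l : SFR W) : S.bX f (k * l) = S.bX f k * l +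
    (sc W).tw (q + 1) k * S.bX f l :=
  S.odd_EX.br_mul_right' hf k l

end GaugeData

/-- Coordinates `{F; G; Θ}` adapted to a gauge-fixing action, with the inverse matrices. -/
structure Bars (S : GaugeData W) where
  F : AExt D → SFR W
  Θ : Fin (2 * D.ND) → SFR W
  hom_F : ∀ a, (sc W).Hom (parAl D a.1 + 1) (F a)
  ext_F : ∀ a, IsExt (F a)
  hom_Θ : ∀ a, (sc W).Hom (D.parΘ a) (Θ a)
  ext_Θ : ∀ a, IsExt (Θ a)
  Θ_left : ∀ a f, S.bX (Θ a) f = 0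
  K : Matrix (Ext D) (BarIdx D) (SFR W)
  jac_K : (sc W).jac inl (Sum.elim F (Sum.elim S.G Θ)) * K = 1
  K_jac : K * (sc W).jac inl (Sum.elim F (Sum.elim S.G Θ)) = 1
  ext_K : ∀ i b, IsExt (K i b)
  Di : ∀ n, Matrix (AIdx D (n + 1)) (AIdx D (n + 1)) (SFR W)
  Dl_Di : ∀ n, S.Dl n * Di n = 1
  Di_Dl : ∀ n, Di n * S.Dl n = 1
  ext_Di : ∀ n a b, IsExt (Di n a b)
  M' : Matrix (AExt D) (AExt D) (SFR W)
  M_M' : (Matrix.of fun b e => S.bX (F b) (S.G e)) * M' = 1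
  M'_M : M' * (Matrix.of fun b e => S.bX (F b) (S.G e)) = 1
  jacobi : ∀ b, S.bX (S.bX (F b) S.g) S.g - (1 / 2 : ℂ) • S.bX (F b) (S.bX S.g S.g) ∈
    Ideal.span (Set.range Θ)

namespace Bars

variable {S : GaugeData W} (B : Bars S)

/-- The coordinates. -/
def Γ : BarIdx D → SFR W := Sum.elim B.F (Sum.elim S.G B.Θ)

/-- The constraints. -/
def con : AExt D ⊕ Fin (2 * D.ND) → SFR W := Sum.elim S.G B.Θ

/-- The parities of the constraints. -/
def pcon (D : FieldContent) : AExt D ⊕ Fin (2 * D.ND) → ZMod 2 :=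
  Sum.elim (fun a => parAl D a.1) D.parΘ

lemma hom_con (i) : (sc W).Hom (pcon D i) (B.con i) := by
  rcases i with a | a
  · exact S.hom_G a
  · exact B.hom_Θ a

lemma ext_con (i) : IsExt (B.con i) := by
  rcases i with a | a
  · exact S.ext_G a
  · exact B.ext_Θ a

/-- The ideal of the constraints. -/
def I : Ideal (SFR W) := Ideal.span (Set.range B.con)

instance : B.I.IsTwoSided := ⟨fun x h => mul_mem_span B.hom_con h x⟩

/-- The projection modulo the constraints. -/
def π : SFR W →ₐ[ℂ] SFR W ⧸ B.I := Ideal.Quotient.mkₐ ℂ B.I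

lemma pi_eq_zero {x : SFR W} : B.π x = 0 ↔ x ∈ B.I := Ideal.Quotient.eq_zero_iff_mem

lemma pi_G (a : AExt D) : B.π (S.G a) = 0 :=
  B.pi_eq_zero.mpr (Ideal.subset_span ⟨inl a, rfl⟩)

lemma pi_Θ {x : SFR W} (h : x ∈ Ideal.span (Set.range B.Θ)) : B.π x = 0 := by
  refine B.pi_eq_zero.mpr (Ideal.span_mono ?_ h)
  rintro _ ⟨a, rfl⟩
  exact ⟨inr a, rfl⟩

lemma smul_mem_I (k : ℂ) {x : SFR W} (h : x ∈ B.I) : k • x ∈ B.I := by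
  rw [← smul_one_mul]; exact Ideal.mul_mem_left _ _ h

lemma pi_rd_lam (v : AExt D) {x : SFR W} (h : B.π x = 0) : B.π ((sc W).rd (lam D v) x) = 0 := by
  rw [pi_eq_zero] at h ⊢
  induction h using Submodule.span_induction with
  | mem y hy =>
    obtain ⟨a, rfl⟩ := hy
    rw [rd_aux_of_ext (B.ext_con a)]; exact zero_mem _
  | zero => rw [map_zero]; exact zero_mem _
  | add y z _ _ hy hz => rw [map_add]; exact add_mem hy hz
  | smul k y hy' hy =>
    rw [smul_eq_mul, rd_mul]
    refine add_mem (Ideal.mul_mem_left _ _ hy) (Ideal.mul_mem_left _ _ ?_)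
    clear hy
    induction hy' using Submodule.span_induction with
    | mem y hy =>
      obtain ⟨a, rfl⟩ := hy
      rw [(B.hom_con a).tw]; exact B.smul_mem_I _ (Ideal.subset_span ⟨a, rfl⟩)
    | zero => unfold SuperCalc.tw; simp
    | add y z _ _ hy hz => rw [tw_add]; exact add_mem hy hz
    | smul k y _ hy => rw [smul_eq_mul, tw_mul]; exact Ideal.mul_mem_left _ _ hy

lemma hom_Γ (b : BarIdx D) : (sc W).Hom (parBar D b) (B.Γ b) := by
  rcases b with a | a | a
  · exact B.hom_F a
  · exact S.hom_G a
  · exact B.hom_Θ a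

lemma hom_K (i : Ext D) (b : BarIdx D) : (sc W).Hom (par D (inl i) + parBar D b) (B.K i b) :=
  (hom_inverse (C := sc W) (x := parBar D) (y := fun i => par D (inl i))
    (M := (sc W).jac inl B.Γ) (fun b _ => ((B.hom_Γ b).rd _).cast (add_comm _ _))
    B.jac_K B.K_jac i b)

/-- The odd matrix entries `(F, G)`. -/
def M : Matrix (AExt D) (AExt D) (SFR W) := Matrix.of fun b e => S.bX (B.F b) (S.G e)

lemma hom_M : (sc W).MHom 0 GaugeData.pe GaugeData.pe B.M := fun b e =>
  (S.odd_EX.br_hom (B.hom_F b) (S.hom_G e)).cast (by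
    change parAl D b.1 + 1 + parAl D e.1 + 1 = parAl D b.1 + parAl D e.1 + 0
    generalize parAl D b.1 = u; generalize parAl D e.1 = v; clear * -; revert u v; decide)

lemma hom_M' : (sc W).MHom 0 GaugeData.pe GaugeData.pe B.M' := B.hom_M.inverse B.M_M' B.M'_M

lemma ext_bX {f k : SFR W} (hf : IsExt f) (hk : IsExt k) : IsExt (S.bX f k) :=
  GaugeData.isExt_sum fun A _ => GaugeData.isExt_sum fun C _ =>
    (ExtAlg W).mul_mem ((ExtAlg W).mul_mem (hf.rd A) (S.ext_EX A C)) (hk.ld C)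

lemma ext_M (b e : AExt D) : IsExt (B.M b e) := ext_bX (B.ext_F b) (S.ext_G e)

/-- The derivation `(·, g)`. -/
abbrev Q (S : GaugeData W) (f : SFR W) : SFR W := S.bX f S.g

/-- The right derivative along a coordinate. -/
abbrev db (b : BarIdx D) (f : SFR W) : SFR W := (sc W).rdb inl B.K b f

/-- The structure functions of the constraints. -/
abbrev Kv : Matrix (AExt D) (AExt D) (SFR W) := S.Kv (B.Di 0)

lemma hom_Kv : (sc W).MHom 1 GaugeData.pe GaugeData.pe B.Kv := by
  have h := ((S.hom_R0.mul (S.hom_Di B.Dl_Di B.Di_Dl 0)).mul S.hom_P0)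
  exact fun e f => (S.hom_L0 e f).sub (h e f)

lemma hom_Q {q : ZMod 2} {f : SFR W} (hf : (sc W).Hom q f) : (sc W).Hom (q + 1) (Q S f) :=
  (S.odd_EX.br_hom hf S.even_g).cast (by rw [add_zero])

lemma hom_db (b : BarIdx D) {q : ZMod 2} {f : SFR W} (hf : (sc W).Hom q f) : (sc W).Hom
    (parBar D b + q) (B.db b f) := rdb_hom B.hom_K hf b

lemma rd_Q (v : AExt D) (f : SFR W) : (sc W).rd (lam D v) (Q S f) = S.bX f (S.G v) + sgn
    (parAl D v.1) • Q S ((sc W).rd (lam D v) f) := by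
  rw [Q, S.odd_EX.rd_br (fun A C => S.ld_EX _ A C) f S.even_g, S.rd_g]
  congr 3
  exact mul_one _

lemma rd_Q_ext (v : AExt D) {f : SFR W} (hf : IsExt f) : (sc W).rd (lam D v) (Q S f) = S.bX f
    (S.G v) := by
  rw [rd_Q, rd_aux_of_ext hf, Q, show S.bX 0 S.g = 0 by simp [GaugeData.bX, br], smul_zero,
    add_zero]

lemma pi_Q_Q_F (b : AExt D) : B.π (Q S (Q S (B.F b)) + ∑ e, B.M b e * S.Nv (B.Di 0) e) = 0 := by
  have h1 := B.pi_Θ (B.jacobi b)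
  rw [S.master_N (B.Dl_Di 0), GaugeData.bX_smul, GaugeData.bX_sum, smul_smul, map_sub, sub_eq_zero] at h1
  rw [map_add, h1, ← map_add, smul_sum, ← sum_add_distrib, map_sum]
  refine sum_eq_zero fun e _ => ?_
  rw [S.bX_mul (B.hom_F b), map_add, map_smul, map_add, map_mul _ (SuperCalc.tw _ _ _), (S.hom_G
    e).tw, map_smul, B.pi_G, smul_zero, zero_mul, add_zero, ← map_smul]
  norm_num [M]

lemma pi_Q_F (b v : AExt D) : B.π (S.bX (Q S (B.F b)) (S.G v) + sgn (parAl D v.1) • Q S (B.M b v) +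
    ∑ e, B.M b e * B.Kv e v) = 0 := by
  have h1 := B.pi_rd_lam v (B.pi_Q_Q_F b)
  rw [map_add, rd_Q, rd_Q_ext v (B.ext_F b), map_sum] at h1
  rw [← h1]
  congr 2
  refine sum_congr rfl fun e _ => ?_
  rw [GaugeData.rd_ext_mul (B.ext_M b e), S.rd_Nv (B.ext_Di 0)]

lemma pi_G_G (d v : AExt D) : B.π (S.bX (S.G d) (S.G v)) = 0 := by
  rw [← rd_Q_ext v (S.ext_G d)]
  refine B.pi_rd_lam v ?_
  rw [Q, S.bX_skew (S.hom_G d) S.even_g, S.bX_G (B.Dl_Di 0) (B.ext_Di 0), smul_neg, neg_neg,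
    map_smul, map_sum, sum_eq_zero, smul_zero]
  intro e _
  rw [map_mul, B.pi_G, zero_mul]

lemma chain (f k : SFR W) : S.bX f k = ∑ a, B.db (inl a) f * S.bX (B.F a) k + ∑ a, B.db
    (inr (inl a)) f * S.bX (S.G a) k := by
  have h1 := br_chain (C := sc W) (c := inl) (E := EX S.ED) (Γ := B.Γ) (K := B.K) B.K_jac f k
  rw [sum_sum_type, sum_sum_type] at h1
  refine h1.trans (congrArg₂ _ rfl ?_)
  refine Eq.trans (congrArg (_ + ·) (sum_eq_zero fun a _ =>
    (congrArg (_ * ·) (B.Θ_left a k)).trans (mul_zero _))) (add_zero _)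

lemma pi_bX_G (f : SFR W) (v : AExt D) : B.π (S.bX f (S.G v)) = ∑ d, B.π (B.db (inl d) f) * B.π
    (B.M d v) := by
  rw [B.chain, map_add, map_sum, map_sum]
  simp only [map_mul, pi_G_G, mul_zero, Finset.sum_const_zero, add_zero]
  rfl

/-- A function which commutes with the gauge-fixing fermion modulo the constraints does not depend
on the gauge coordinates modulo the constraints. -/
lemma pi_db_of_Q {f : SFR W} (hf : IsExt f) (h : B.π (Q S f) = 0) (d : AExt D) : B.π
    (B.db (inl d) f) = 0 := by
  have h1 : ∀ v, ∑ d, B.π (B.db (inl d) f) * B.π (B.M d v) = 0 := fun v => by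
    rw [← pi_bX_G, ← rd_Q_ext v hf]
    exact B.pi_rd_lam v h
  have h3 : ∀ e, ∑ v, B.π (B.M e v) * B.π (B.M' v d) = if e = d then 1 else 0 := fun e => by
    have := congrArg B.π (congrFun (congrFun B.M_M' e) d)
    rw [mul_apply, map_sum, one_apply, apply_ite B.π, map_one, map_zero] at this
    simp only [map_mul] at this
    exact this
  calc B.π (B.db (inl d) f) = ∑ e, B.π (B.db (inl e) f) * ∑ v, B.π (B.M e v) * B.π (B.M' v d) := by
        simp only [h3, mul_ite, mul_one, mul_zero, Finset.sum_ite_eq', mem_univ, if_true]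
    _ = ∑ v, (∑ e, B.π (B.db (inl e) f) * B.π (B.M e v)) * B.π (B.M' v d) := by
        simp only [mul_sum, sum_mul, mul_assoc]
        rw [sum_comm]
    _ = 0 := by simp only [h1, zero_mul, Finset.sum_const_zero]

/-- The logarithmic derivative of `sdet (F, G)`. -/
def lnM : SFR W := ∑ b, ∑ v, sgn (parAl D v.1) • (B.M' v b * Q S (B.M b v))

/-- The logarithmic derivative of the Jacobian. -/
def lnJ : SFR W := ∑ i, ∑ b, sgn (par D (inl i)) •
  (B.K i b * Q S ((sc W).jac inl B.Γ b i))

lemma pi_div_F : B.π (∑ d, B.db (inl d) (Q S (B.F d))) = -B.π (B.lnM + B.Kv.trace) := by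
  have e1 : ∀ b, B.π (∑ v, B.M' v b * S.bX (Q S (B.F b)) (S.G v)) =
      ∑ d, ∑ v, B.π (B.db (inl d) (Q S (B.F b)) * (B.M d v * B.M' v b)) := by
    intro b
    rw [map_sum, sum_comm]
    refine sum_congr rfl fun v _ => ?_
    rw [map_mul, B.pi_bX_G, mul_sum]
    refine sum_congr rfl fun d _ => ?_
    rw [← map_mul, ← map_mul, ← mul_assoc (B.db (inl d) (Q S (B.F b)))]
    refine congrArg B.π ?_
    refine Hom.comm_of (B.hom_M' v b) ((B.hom_db (inl d) (hom_Q (B.hom_F b))).mul (B.hom_M d v)) ?_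
    change (parAl D v.1 + parAl D b.1 + 0) * (parAl D d.1 + 1 + (parAl D b.1 + 1 + 1) + (parAl D d.1
      + parAl D v.1 + 0)) = 0
    generalize parAl D v.1 = x; generalize parAl D b.1 = y; generalize parAl D d.1 = z
    clear * -; revert x y z; decide
  have e2 : ∀ b, ∑ d, ∑ v, B.π (B.db (inl d) (Q S (B.F b)) * (B.M d v * B.M' v b)) =
      B.π (B.db (inl b) (Q S (B.F b))) := by
    intro b
    have h3 : ∀ d, ∑ v, B.M d v * B.M' v b = if d = b then 1 else 0 := fun d => by
      have := congrFun (congrFun B.M_M' d) b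
      rwa [mul_apply, one_apply] at this
    simp only [← map_sum, ← mul_sum, h3, mul_ite, mul_one, mul_zero, Finset.sum_ite_eq', mem_univ,
      if_true]
  have e3 : ∑ b, ∑ v, B.M' v b * ∑ e, B.M b e * B.Kv e v = B.Kv.trace := by
    have h3 : ∀ v e, ∑ b, B.M' v b * B.M b e = if v = e then 1 else 0 := fun v e => by
      have := congrFun (congrFun B.M'_M v) e
      rwa [mul_apply, one_apply] at this
    rw [sum_comm]
    refine sum_congr rfl fun v _ => ?_
    simp only [mul_sum, ← mul_assoc]
    rw [sum_comm]
    simp only [← sum_mul, h3, ite_mul, one_mul, zero_mul, Finset.sum_ite_eq, mem_univ, if_true]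
    rfl
  rw [map_sum]
  simp only [← e2, ← e1]
  rw [eq_neg_iff_add_eq_zero, ← map_sum, ← map_add, ← e3, lnM, ← sum_add_distrib, ← sum_add_distrib,
    map_sum]
  refine sum_eq_zero fun b _ => ?_
  rw [← sum_add_distrib, ← sum_add_distrib, map_sum]
  refine sum_eq_zero fun v _ => ?_
  rw [← mul_smul_comm, ← mul_add, ← mul_add, map_mul, ← add_assoc, B.pi_Q_F, mul_zero]

lemma Q_G (b : AExt D) : Q S (S.G b) = -(sgn (parAl D b.1) • ∑ e, S.G e * B.Kv e b) := by
  rw [Q, S.bX_skew (S.hom_G b) S.even_g, S.bX_G (B.Dl_Di 0) (B.ext_Di 0), smul_neg, neg_neg,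
    neg_eq_sgn_smul, sgn_smul_smul]
  congr 2
  generalize parAl D b.1 = x; clear * -; revert x; decide

lemma pi_div_G (b : AExt D) : B.π (B.db (inr (inl b)) (Q S (S.G b))) = -B.π (B.Kv b b) := by
  rw [B.Q_G, ← neg_smul, db, rdb_smul, rdb_sum, map_smul, map_sum, sum_eq_single b]
  · rw [rdb_mul B.hom_K, map_add, map_mul, B.pi_G, zero_mul, zero_add, (B.hom_Kv b b).tw]
    have h1 : (sc W).rdb inl B.K (inr (inl b)) (S.G b) = 1 :=
      (rdb_coord (Γ := B.Γ) B.jac_K (inr (inl b)) (inr (inl b))).trans (if_pos rfl)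
    rw [h1, one_mul, map_smul, smul_smul, neg_mul, ← sgn_add, neg_smul]
    have : parAl D b.1 + parBar D (inr (inl b)) *
        (GaugeData.pe b + GaugeData.pe b + 1) = 0 := by
      change parAl D b.1 + parAl D b.1 * (parAl D b.1 + parAl D b.1 + 1) = 0
      generalize parAl D b.1 = x; clear * -; revert x; decide
    rw [this, sgn_zero, one_smul]
  · intro e _ he
    have h1 : (sc W).rdb inl B.K (inr (inl b)) (S.G e) = 0 :=
      (rdb_coord (Γ := B.Γ) B.jac_K (inr (inl b)) (inr (inl e))).trans
        (if_neg (by simpa using he))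
    rw [rdb_mul B.hom_K, h1, zero_mul, add_zero, map_mul, B.pi_G, zero_mul]
  · intro h; exact absurd (mem_univ _) h

lemma pi_div : B.π (∑ i, (sc W).rd (inl i) ((sc W).ham inl (EX S.ED) S.g i)) = -B.π
    (B.lnJ + B.lnM + (2 : ℂ) • B.Kv.trace) := by
  rw [divergence_chain (Γ := B.Γ) S.odd_EX B.hom_Γ B.hom_K B.K_jac S.even_g, sum_sum_type,
    sum_sum_type, sum_eq_zero (s := Finset.univ)
      (f := fun a : Fin (2 * D.ND) => (sc W).rdb inl B.K _ ((sc W).br inl (EX S.ED) (B.Γ (inr (inr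
        a))) S.g)), add_zero]
  · have e1 : ∑ a, B.π (B.db (inr (inl a)) (Q S (S.G a))) = -B.π B.Kv.trace := by
      simp only [pi_div_G, sum_neg_distrib, ← map_sum]; rfl
    have e2 := B.pi_div_F
    change B.π (∑ a, B.db (inl a) (Q S (B.F a)) + ∑ a, B.db (inr (inl a)) (Q S (S.G a)) - B.lnJ) = _
    rw [map_sub, map_add, e2, map_sum, e1, two_smul]
    simp only [map_add]
    abel
  · intro a _
    have : (sc W).br inl (EX S.ED) (B.Γ (inr (inr a))) S.g = 0 := B.Θ_left a S.g
    rw [this]; simp [rdb]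

/-- The logarithmic derivative of the alternating product. -/
def lnΔ : SFR W := ∑ n ∈ range D.s, ∑ a, ∑ b, sgn (GaugeData.pc n b) •
  (B.Di n b a * Q S (S.Dl n a b))

lemma lap_g : (sc W).lap inl (EX S.ED) S.ρ S.ρ' S.g = (1 / 2 : ℂ) •
    ((∑ i, (sc W).rd (inl i) ((sc W).ham inl (EX S.ED) S.g i)) + S.ρ' * Q S S.ρ) := by
  have h1 : ∀ i, (sc W).rd (inl i) ((sc W).ham inl (EX S.ED) S.g i) =
      sgn (par D (inl i)) • (sc W).ld (inl i) ((sc W).ham inl (EX S.ED) S.g i) := by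
    intro i
    refine (Hom.rd_eq (S.odd_EX.ham_hom S.even_g i) (inl i)).trans ?_
    congr 2
    generalize par D (inl i) = x; clear * -; revert x; decide
  have h2 : Q S S.ρ = ∑ i, (sc W).rd (inl i) S.ρ * (sc W).ham inl (EX S.ED) S.g i :=
    br_eq_ham _ _
  rw [h2, sum_congr rfl fun i _ => h1 i]
  exact lap_eq S.even_ρ S.ρ'_mul S.g

/-- The one-loop identity. -/
theorem one_loop : B.π (Q S (rr S.X1) + (1 / 2 : ℂ) • (B.lnJ + B.lnM - S.ρ' * Q S S.ρ) + B.lnΔ) =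
    0 := by
  have e1 := S.loop_rel B.π B.pi_G B.Dl_Di B.Di_Dl
  have e2 : S.bX S.g (rr S.X1) = Q S (rr S.X1) := by
    rw [S.bX_skew S.even_g (hom_res S.even1), neg_eq_sgn_smul, sgn_smul_smul]
    rw [show (1 : ZMod 2) + (0 + 1) * (0 + 1) = 0 by decide, sgn_zero, one_smul]
  have e3 : ∑ n ∈ range D.s, ∑ a, ∑ b,
      sgn (GaugeData.pc n a) • (B.Di n b a * S.bX S.g (S.Dl n a b)) = B.lnΔ := by
    refine sum_congr rfl fun n _ => sum_congr rfl fun a _ =>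
      sum_congr rfl fun b _ => ?_
    rw [S.bX_skew S.even_g (S.hom_Dl n a b), neg_eq_sgn_smul, sgn_smul_smul, mul_smul_comm,
      sgn_smul_smul]
    congr 2
    generalize GaugeData.pc n a = x; generalize GaugeData.pc n b = y; clear * -; revert x y; decide
  rw [e2, e3, lap_g, map_sub, map_add, map_smul, map_add, B.pi_div] at e1
  rw [map_add, map_add, e1]
  simp only [map_add, map_smul, map_sub, smul_add, smul_sub, smul_neg, smul_smul]
  norm_num
  abel

end Bars

end BV

namespace SuperCalc

variable {R : Type} [Ring R] [Algebra ℂ R] {Z : Type*} {p : Z → ZMod 2} {C : SuperCalc R p}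
  {q r : ZMod 2}

variable (C) in
/-- The subalgebra of even elements. -/
def evenAlg : Subalgebra ℂ R := AlgHom.equalizer C.σ (AlgHom.id ℂ R)

variable (C) in
/-- The commutative algebra of even elements. -/
abbrev Ev : Type _ := C.evenAlg

instance : CommRing C.Ev :=
  { (inferInstance : Ring C.Ev) with
    mul_comm := fun a b => Subtype.ext (C.even_mul a.1 b.1 a.2) }

lemma Ev.hom (a : C.Ev) : C.Hom 0 (a : R) := hom_zero_iff.mpr a.2

variable (C) in
/-- The inclusion of the even elements. -/
def evInc : C.Ev →+* R := C.evenAlg.toSubring.subtype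

lemma evInc_apply (a : C.Ev) : C.evInc a = (a : R) := rfl

variable (C) in
/-- Odd right derivations. -/
structure OddDer where
  Q : R →ₗ[ℂ] R
  mul : ∀ a b, Q (a * b) = a * Q b + Q a * C.σ b
  hom : ∀ {q a}, C.Hom q a → C.Hom (q + 1) (Q a)

variable (Δ : C.OddDer)

lemma OddDer.one : Δ.Q 1 = 0 := by
  have := Δ.mul 1 1
  rw [map_one C.σ, mul_one, mul_one, one_mul] at this
  exact left_eq_add.mp this

lemma OddDer.even_mul (a b : C.Ev) : Δ.Q (a * b : R) = a * Δ.Q b + b * Δ.Q a := by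
  rw [Δ.mul, show C.σ (b : R) = b from b.2, ← C.even_mul b (Δ.Q a) b.2]

lemma OddDer.prod {κ : Type*} [DecidableEq κ] (s : Finset κ) (f : κ → C.Ev) : Δ.Q
    (C.evInc (∏ i ∈ s, f i)) = ∑ i ∈ s, C.evInc (∏ j ∈ s.erase i, f j) * Δ.Q (f i) := by
  induction s using Finset.induction_on with
  | empty => rw [Finset.prod_empty, Finset.sum_empty, map_one, Δ.one]
  | insert a s ha ih =>
    rw [Finset.prod_insert ha, map_mul, evInc_apply, evInc_apply, Δ.even_mul, ← evInc_apply (∏ i ∈ s, f i), ih,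
      Finset.sum_insert ha, Finset.erase_insert ha, add_comm, mul_sum]
    congr 1
    refine sum_congr rfl fun i hi => ?_
    have hia : i ≠ a := fun h => ha (h ▸ hi)
    rw [Finset.erase_insert_of_ne hia.symm, Finset.prod_insert (fun h => ha (Finset.mem_of_mem_erase h)),
      map_mul, mul_assoc]
    rfl

section Det

variable {n : Type*} [Fintype n] [DecidableEq n]

lemma prod_updateRow {S : Type*} [CommRing S] (A : Matrix n n S) (i j : n) (τ : Equiv.Perm n) : ∏ k,
    (A.updateRow i (Pi.single j 1)) (τ k) k = if τ j = i then ∏ k ∈ Finset.univ.erase j, A (τ k) k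
    else 0 := by
  split_ifs with h
  · rw [← Finset.mul_prod_erase _ _ (mem_univ j), h, Matrix.updateRow_self, Pi.single_eq_same, one_mul]
    refine Finset.prod_congr rfl fun k hk => ?_
    rw [Matrix.updateRow_ne]
    intro h'
    exact Finset.ne_of_mem_erase hk (τ.injective (h'.trans h.symm))
  · refine Finset.prod_eq_zero (mem_univ (τ.symm i)) ?_
    rw [Equiv.apply_symm_apply, Matrix.updateRow_self, Pi.single_eq_of_ne]
    intro h'
    exact h (by rw [← h', Equiv.apply_symm_apply])

lemma OddDer.det (A : Matrix n n C.Ev) : Δ.Q (C.evInc A.det) = ∑ i, ∑ j, C.evInc (A.adjugate j i) *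
    Δ.Q (A i j) := by
  have h1 : ∀ (k : ℤˣ) (a : C.Ev), Δ.Q (C.evInc ((k : ℤ) * a)) = (k : ℤ) • Δ.Q (C.evInc a) := by
    intro k a
    rw [← zsmul_eq_mul, map_zsmul, map_zsmul]
  have h2 : ∀ i j, C.evInc (A.adjugate j i) * Δ.Q (A i j) = ∑ τ : Equiv.Perm n,
      if τ j = i then ((Equiv.Perm.sign τ : ℤˣ) : ℤ) •
        (C.evInc (∏ k ∈ Finset.univ.erase j, A (τ k) k) * Δ.Q (A (τ j) j)) else 0 := by
    intro i j
    rw [Matrix.adjugate_apply, Matrix.det_apply', map_sum, sum_mul]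
    refine sum_congr rfl fun τ _ => ?_
    rw [prod_updateRow]
    split_ifs with h
    · rw [← zsmul_eq_mul, map_zsmul, smul_mul_assoc, h]
    · rw [mul_zero, map_zero, zero_mul]
  simp only [h2]
  rw [Matrix.det_apply', map_sum, map_sum]
  simp only [h1, Δ.prod, smul_sum]
  rw [sum_comm]
  conv_rhs => rw [sum_comm]
  refine sum_congr rfl fun j _ => ?_
  rw [sum_comm]
  refine sum_congr rfl fun τ _ => ?_
  rw [Finset.sum_ite_eq]
  simp

lemma OddDer.det_eq {A A' : Matrix n n C.Ev} (h : A * A' = 1) : Δ.Q (C.evInc A.det) = C.evInc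
    A.det * ∑ i, ∑ j, C.evInc (A' j i) * Δ.Q (A i j) := by
  have h1 : A.adjugate = A.det • A' := by
    calc A.adjugate = A.adjugate * (A * A') := by rw [h, mul_one]
      _ = A.det • A' := by rw [← mul_assoc, Matrix.adjugate_mul, smul_mul_assoc, one_mul]
  rw [Δ.det, mul_sum]
  refine sum_congr rfl fun i _ => ?_
  rw [mul_sum]
  refine sum_congr rfl fun j _ => ?_
  rw [h1, Matrix.smul_apply, smul_eq_mul, map_mul, mul_assoc]

end Det

section Slog

variable {ι : Type*} [Fintype ι] {x : ι → ZMod 2}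

/-- The logarithmic derivative `str (N Q(M))` of a matrix `M` with inverse `N`. -/
def OddDer.slog (x : ι → ZMod 2) (N M : Matrix ι ι R) : R :=
  ∑ a, ∑ b, sgn (x b) • (N b a * Δ.Q (M a b))

lemma OddDer.slog_mul [DecidableEq ι] {M1 M2 N1 N2 : Matrix ι ι R} (hM1 : C.MHom 0 x x M1)
    (hM2 : C.MHom 0 x x M2) (hN1 : C.MHom 0 x x N1) (hN2 : C.MHom 0 x x N2) (h1 : N1 * M1 = 1)
    (h2 : M2 * N2 = 1) : Δ.slog x (N2 * N1) (M1 * M2) = Δ.slog x N1 M1 + Δ.slog x N2 M2 := by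
  have e1 : ∀ b c, ∑ a, (N2 * N1) b a * M1 a c = N2 b c := fun b c => by
    rw [← mul_apply, mul_assoc, h1, mul_one]
  have e2 : ∀ c e, ∑ b, M2 c b * N2 b e = (1 : Matrix ι ι R) c e := fun c e => by
    rw [← mul_apply, h2]
  have e3 : ∀ a b c, sgn (x b) • ((N2 * N1) b a * (Δ.Q (M1 a c) * C.σ (M2 c b))) =
      ∑ e, sgn (x c) • (M2 c b * N2 b e * (N1 e a * Δ.Q (M1 a c))) := by
    intro a b c
    rw [mul_apply, sum_mul, smul_sum]
    refine sum_congr rfl fun e _ => ?_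
    rw [hM2 c b, mul_smul_comm, mul_smul_comm, sgn_smul_smul, mul_assoc (M2 c b), (hM2 c b).comm
      (((hN2 b e).mul ((hN1 e a).mul (Δ.hom (hM1 a c))))), sgn_smul_smul]
    simp only [mul_assoc]
    congr 2
    generalize x a = u; generalize x b = v; generalize x c = w; generalize x e = t
    clear * -; revert u v w t; decide
  have e4 : Δ.slog x (N2 * N1) (M1 * M2) = Δ.slog x N2 M2 +
      ∑ a, ∑ b, ∑ c, sgn (x b) • ((N2 * N1) b a * (Δ.Q (M1 a c) * C.σ (M2 c b))) := by
    have : ∀ a b, sgn (x b) • ((N2 * N1) b a * Δ.Q ((M1 * M2) a b)) =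
        (∑ c, sgn (x b) • ((N2 * N1) b a * M1 a c * Δ.Q (M2 c b))) +
          ∑ c, sgn (x b) • ((N2 * N1) b a * (Δ.Q (M1 a c) * C.σ (M2 c b))) := by
      intro a b
      rw [mul_apply (M := M1), map_sum, mul_sum, smul_sum, ← sum_add_distrib]
      refine sum_congr rfl fun c _ => ?_
      rw [Δ.mul, mul_add, smul_add, mul_assoc]
    simp only [OddDer.slog, this, sum_add_distrib]
    congr 1
    rw [sum_comm]
    conv_rhs => rw [sum_comm]
    refine sum_congr rfl fun b _ => ?_
    rw [sum_comm]
    refine sum_congr rfl fun c _ => ?_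
    rw [← smul_sum, ← sum_mul, e1]
  rw [e4, add_comm]
  congr 1
  simp only [e3, OddDer.slog]
  refine sum_congr rfl fun a _ => ?_
  rw [sum_comm]
  refine sum_congr rfl fun c _ => ?_
  rw [sum_comm]
  simp only [← smul_sum, ← sum_mul, e2, one_apply, ite_mul, one_mul, zero_mul, Finset.sum_ite_eq,
    mem_univ, if_true]

lemma OddDer.slog_reindex {κ : Type*} [Fintype κ] (e : κ ≃ ι) (N M : Matrix ι ι R) : Δ.slog (x ∘ e)
    (N.submatrix e e) (M.submatrix e e) = Δ.slog x N M := by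
  rw [OddDer.slog, OddDer.slog, ← Equiv.sum_comp e]
  exact sum_congr rfl fun a _ =>
    Equiv.sum_comp e (fun b => sgn (x b) • (N b (e a) * Δ.Q (M (e a) b)))

end Slog

section Blocks

variable {m n : Type*} [Fintype m] [Fintype n] [DecidableEq m] [DecidableEq n]

/-- The parities of a standard supermatrix. -/
def blk : m ⊕ n → ZMod 2 := Sum.elim (fun _ => 0) (fun _ => 1)

lemma MHom.blocks {A : Matrix m m R} {B : Matrix m n R} {B' : Matrix n m R} {E : Matrix n n R}
    (hA : ∀ i j, C.Hom 0 (A i j)) (hB : ∀ i j, C.Hom 1 (B i j)) (hB' : ∀ i j, C.Hom 1 (B' i j))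
    (hE : ∀ i j, C.Hom 0 (E i j)) : C.MHom 0 blk blk (fromBlocks A B B' E) := by
  rintro (i | i) (j | j)
  · exact hA i j
  · exact hB i j
  · exact hB' i j
  · exact hE i j

lemma hom_one_apply (i j : n) : C.Hom 0 ((1 : Matrix n n R) i j) := by
  rw [one_apply]
  split_ifs
  · exact Hom.one
  · exact Hom.zero

lemma hom_mul_apply {l m n : Type*} [Fintype m] {M : Matrix l m R} {N : Matrix m n R}
    (hM : ∀ i j, C.Hom q (M i j)) (hN : ∀ i j, C.Hom r (N i j)) (i : l) (j : n) : C.Hom (q + r)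
    ((M * N) i j) := Hom.sum fun k _ => (hM i k).mul (hN k j)

lemma OddDer.Q_one_apply (i j : n) : Δ.Q ((1 : Matrix n n R) i j) = 0 := by
  rw [one_apply]
  split_ifs
  · exact Δ.one
  · exact map_zero _

/-- The logarithmic derivative of an invertible supermatrix, by the block decomposition. -/
lemma OddDer.slog_blocks {A : Matrix m m R} {B : Matrix m n R} {B' : Matrix n m R}
    {E E' : Matrix n n R} {N : Matrix (m ⊕ n) (m ⊕ n) R}
    (hM : C.MHom 0 blk blk (fromBlocks A B B' E)) (h1 : fromBlocks A B B' E * N = 1)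
    (h2 : N * fromBlocks A B B' E = 1) (h3 : E * E' = 1) (h4 : E' * E = 1) : (A - B * E' * B') *
    N.toBlocks₁₁ = 1 ∧ N.toBlocks₁₁ * (A - B * E' * B') = 1 ∧ Δ.slog blk N (fromBlocks A B B' E) =
    (∑ i, ∑ j, N.toBlocks₁₁ j i * Δ.Q ((A - B * E' * B') i j)) - ∑ i, ∑ j, E' j i * Δ.Q (E i j) :=
    by
  have hN := hM.inverse h1 h2
  set S := A - B * E' * B' with hS
  set S' := N.toBlocks₁₁ with hS'
  have hA : ∀ i j, C.Hom 0 (A i j) := fun i j => hM (inl i) (inl j)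
  have hB : ∀ i j, C.Hom 1 (B i j) := fun i j => hM (inl i) (inr j)
  have hB' : ∀ i j, C.Hom 1 (B' i j) := fun i j => hM (inr i) (inl j)
  have hE : ∀ i j, C.Hom 0 (E i j) := fun i j => hM (inr i) (inr j)
  have hE' : ∀ i j, C.Hom 0 (E' i j) := fun i j =>
    hom_inverse (x := fun _ => 0) (y := fun _ => 0) (fun i j => hE i j) h3 h4 i j
  have hSh : ∀ i j, C.Hom 0 (S i j) := fun i j =>
    (hA i j).sub (hom_mul_apply (hom_mul_apply hB hE') hB' i j)
  have hSh' : ∀ i j, C.Hom 0 (S' i j) := fun i j => hN (inl i) (inl j)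
  have b1 := h1
  have b2 := h2
  rw [← Matrix.fromBlocks_toBlocks N, fromBlocks_multiply, ← Matrix.fromBlocks_one,
    Matrix.fromBlocks_inj] at b1 b2
  have e1 : N.toBlocks₂₁ = -(E' * (B' * S')) := by
    rw [eq_neg_iff_add_eq_zero]
    have := congrArg (E' * ·) b1.2.2.1
    simp only [Matrix.mul_add, Matrix.mul_zero, ← Matrix.mul_assoc, h4, Matrix.one_mul] at this
    rw [add_comm, ← this, Matrix.mul_assoc]
  have e2 : N.toBlocks₁₂ = -(S' * B * E') := by
    rw [eq_neg_iff_add_eq_zero]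
    have := congrArg (· * E') b2.2.1
    simp only [Matrix.add_mul, Matrix.zero_mul, Matrix.mul_assoc, h3, Matrix.mul_one] at this
    rw [add_comm, ← this, Matrix.mul_assoc]
  have hSS' : S * S' = 1 := by
    rw [← b1.1, e1, hS, Matrix.sub_mul, Matrix.mul_neg, ← sub_eq_add_neg]
    simp only [Matrix.mul_assoc, hS']
  have hS'S : S' * S = 1 := by
    rw [← b2.1, e2, hS, Matrix.mul_sub, Matrix.neg_mul, ← sub_eq_add_neg]
    simp only [Matrix.mul_assoc, hS']
  refine ⟨hSS', hS'S, ?_⟩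
  let U := fromBlocks (1 : Matrix m m R) (B * E') 0 (1 : Matrix n n R)
  let U' := fromBlocks (1 : Matrix m m R) (-(B * E')) 0 (1 : Matrix n n R)
  let L := fromBlocks (1 : Matrix m m R) 0 (E' * B') (1 : Matrix n n R)
  let L' := fromBlocks (1 : Matrix m m R) 0 (-(E' * B')) (1 : Matrix n n R)
  let T := fromBlocks S 0 0 E
  let T' := fromBlocks S' 0 0 E'
  have hU1 : U' * U = 1 := by simp [U, U', fromBlocks_multiply]
  have hU2 : U * U' = 1 := by simp [U, U', fromBlocks_multiply]
  have hL2 : L * L' = 1 := by simp [L, L', fromBlocks_multiply]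
  have hT1 : T' * T = 1 := by simp [T, T', fromBlocks_multiply, hS'S, h4]
  have hT2 : T * T' = 1 := by simp [T, T', fromBlocks_multiply, hSS', h3]
  have hMd : fromBlocks A B B' E = U * T * L := by
    simp only [U, T, L, fromBlocks_multiply, Matrix.one_mul, Matrix.mul_one, Matrix.mul_zero,
      Matrix.zero_mul, add_zero, zero_add, Matrix.mul_assoc, h4]
    rw [← Matrix.mul_assoc E, h3, Matrix.one_mul, hS, Matrix.mul_assoc, sub_add_cancel]
  have hNd : N = L' * (T' * U') := by
    have : U * T * L * (L' * (T' * U')) = 1 := by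
      rw [mul_assoc, ← mul_assoc L, hL2, one_mul, mul_assoc U, ← mul_assoc T, hT2, one_mul, hU2]
    calc N = N * (U * T * L * (L' * (T' * U'))) := by rw [this, mul_one]
      _ = L' * (T' * U') := by rw [← mul_assoc, ← hMd, h2, one_mul]
  have z : ∀ i j, C.Hom 1 ((0 : Matrix m n R) i j) := fun _ _ => Hom.zero
  have z' : ∀ i j, C.Hom 1 ((0 : Matrix n m R) i j) := fun _ _ => Hom.zero
  have hBE := hom_mul_apply hB hE'
  have hEB := hom_mul_apply hE' hB'
  have mU : C.MHom 0 blk blk U := MHom.blocks hom_one_apply hBE z' hom_one_apply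
  have mU' : C.MHom 0 blk blk U' :=
    MHom.blocks hom_one_apply (fun i j => (hBE i j).neg) z' hom_one_apply
  have mL : C.MHom 0 blk blk L := MHom.blocks hom_one_apply z hEB hom_one_apply
  have mL' : C.MHom 0 blk blk L' :=
    MHom.blocks hom_one_apply z (fun i j => (hEB i j).neg) hom_one_apply
  have mT : C.MHom 0 blk blk T := MHom.blocks hSh z z' hE
  have mT' : C.MHom 0 blk blk T' := MHom.blocks hSh' z z' hE'
  rw [hMd, hNd, Δ.slog_mul (mU.mul mT) mL (mT'.mul mU') mL' (by
      rw [mul_assoc, ← mul_assoc U', hU1, one_mul, hT1]) hL2,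
    Δ.slog_mul mU mT mU' mT' hU1 hT2]
  have sU : Δ.slog blk U' U = 0 := by
    simp [OddDer.slog, U, U', sum_sum_type, Δ.Q_one_apply]
  have sL : Δ.slog blk L' L = 0 := by
    simp [OddDer.slog, L, L', sum_sum_type, Δ.Q_one_apply]
  rw [sU, sL, zero_add, add_zero]
  simp [OddDer.slog, T, T', sum_sum_type, blk, sgn_zero, sgn_one, sub_eq_add_neg]

end Blocks

lemma inverse_eq {T : Type*} [MonoidWithZero T] {a b : T} (h1 : a * b = 1) (h2 : b * a = 1) :
    Ring.inverse a = b := Ring.inverse_unit ⟨a, b, h1, h2⟩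

lemma centralLift_map {S T : Type} [CommRing S] [Ring T] (φ : S →+* T)
    (hφ : ∀ a, φ a ∈ Subring.center T) {m n : Type*} (M : Matrix m n S) : centralLift (M.map φ) =
    M.map (φ.codRestrict (Subring.center T) hφ) := by
  ext1 i j
  exact dif_pos (hφ (M i j))

lemma sdet_map {ι : Type*} [Fintype ι] [DecidableEq ι] {x : ι → ZMod 2} {T S : Type} [CommRing S]
    [Ring T] (φ : S →+* T) (hφ : ∀ a, φ a ∈ Subring.center T) (M : Matrix ι ι T)
    {E E' : Matrix {i // ¬ x i = 0} {i // ¬ x i = 0} S} {A : Matrix {i // x i = 0} {i // x i = 0} S}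
    (hE : ∀ i j, φ (E i j) = M i.1 j.1) (hEE : E * E' = 1)
    (hA : ∀ i j, φ (A i j) = M i.1 j.1 - ∑ l, (∑ k, M i.1 k.1 * φ (E' k l)) * M l.1 j.1) : sdet x
    M = φ A.det * φ E'.det := by
  let v : {i // x i = 0} → ι := Subtype.val
  let w : {i // ¬ x i = 0} → ι := Subtype.val
  let E1 := M.submatrix w w
  let F1 := (centralLift E1)⁻¹.map Subtype.val
  let φ' : S →+* Subring.center T := φ.codRestrict (Subring.center T) hφ
  have e0 : E1 = E.map φ := by ext1 i j; exact (hE i j).symm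
  have e1 : centralLift E1 = E.map φ' := by rw [e0, centralLift_map φ hφ]
  have e2 : (centralLift E1)⁻¹ = E'.map φ' := by
    rw [e1]
    refine Matrix.inv_eq_right_inv ?_
    rw [← Matrix.map_mul, hEE, Matrix.map_one _ (map_zero _) (map_one _)]
  have e3 : F1 = E'.map φ := by
    ext1 i j
    exact congrArg (Subtype.val) (congrFun (congrFun e2 i) j)
  have e4 : M.submatrix v v - M.submatrix v w * F1 * M.submatrix w v = A.map φ := by
    ext1 i j
    rw [Matrix.map_apply, hA, e3]
    rfl
  have e5 : ∀ {l : Type _} [Fintype l] [DecidableEq l] (X : Matrix l l S),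
      (((X.map φ').det : Subring.center T) : T) = φ X.det := by
    intro l _ _ X
    have : (X.map φ').det = φ' X.det := (RingHom.map_det _ _).symm
    rw [this]; rfl
  have e6 : Ring.inverse (φ E.det) = φ E'.det := inverse_eq
    (by rw [← map_mul, ← det_mul, hEE, det_one, map_one])
    (by rw [← map_mul, mul_comm, ← det_mul, hEE, det_one, map_one])
  change (((centralLift (M.submatrix v v - M.submatrix v w * F1 * M.submatrix w v)).det : Subring.center T) : T) *
    Ring.inverse (((centralLift E1).det : Subring.center T) : T) = _
  rw [e4, centralLift_map φ hφ, e1, e5, e5, e6]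

/-- Superdeterminants and their logarithmic derivatives. -/
theorem exists_sdet {ι : Type*} [Fintype ι] [DecidableEq ι] {x : ι → ZMod 2} {M N : Matrix ι ι R}
    (hM : C.MHom 0 x x M) (h1 : M * N = 1) (h2 : N * M = 1)
    {E' : Matrix {i // ¬ x i = 0} {i // ¬ x i = 0} R}
    (h3 : (Matrix.of fun i j : {i // ¬ x i = 0} => M i.1 j.1) * E' = 1)
    (h4 : E' * (Matrix.of fun i j : {i // ¬ x i = 0} => M i.1 j.1) = 1) : ∃ s s' : C.Ev, s * s' =
    1 ∧ (∀ Δ : C.OddDer, Δ.Q s = s * Δ.slog x N M) ∧ ∀ {T : Type} [Ring T] (φ : R →+* T),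
    (∀ a : C.Ev, φ a ∈ Subring.center T) → sdet x (M.map φ) = φ s := by
  let eq : {i // x i = 0} ⊕ {i // ¬ x i = 0} ≃ ι := Equiv.sumCompl fun i => x i = 0
  let v : {i // x i = 0} → ι := Subtype.val
  let w : {i // ¬ x i = 0} → ι := Subtype.val
  let A := M.submatrix v v
  let B := M.submatrix v w
  let B' := M.submatrix w v
  let E := M.submatrix w w
  have hMb : M.submatrix eq eq = fromBlocks A B B' E := by
    ext1 i j
    rcases i with i | i <;> rcases j with j | j <;> rfl
  have hx : x ∘ eq = blk := by
    funext i
    rcases i with i | i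
    · exact i.2
    · have : ∀ t : ZMod 2, ¬ t = 0 → t = 1 := by decide
      exact this _ i.2
  have hMh : C.MHom 0 blk blk (fromBlocks A B B' E) := by
    rw [← hMb, ← hx]
    exact fun i j => hM _ _
  have key := fun Δ : C.OddDer => Δ.slog_blocks hMh (N := N.submatrix eq eq) (E' := E')
    (by rw [← hMb, Matrix.submatrix_mul_equiv, h1, Matrix.submatrix_one_equiv])
    (by rw [← hMb, Matrix.submatrix_mul_equiv, h2, Matrix.submatrix_one_equiv]) h3 h4
  obtain ⟨k1, k2, -⟩ := key ⟨0, by simp, fun _ => Hom.zero⟩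
  have hN : C.MHom 0 blk blk (N.submatrix eq eq) := by
    rw [← hx]; exact fun i j => hM.inverse h1 h2 _ _
  have hE : ∀ i j, C.Hom 0 (E i j) := fun i j => hMh (inr i) (inr j)
  have hE' : ∀ i j, C.Hom 0 (E' i j) := fun i j =>
    hom_inverse (x := fun _ => 0) (y := fun _ => 0) (fun i j => hE i j) h3 h4 i j
  have hS' : ∀ i j, C.Hom 0 ((N.submatrix eq eq).toBlocks₁₁ i j) := fun i j =>
    hN (inl i) (inl j)
  have hS : ∀ i j, C.Hom 0 ((A - B * E' * B') i j) := fun i j =>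
    hom_inverse (x := fun _ => 0) (y := fun _ => 0) (fun i j => hS' i j) k2 k1 i j
  let S0 : Matrix _ _ C.Ev := fun i j => ⟨(A - B * E' * B') i j, hom_zero_iff.mp (hS i j)⟩
  let S0' : Matrix _ _ C.Ev := fun i j =>
    ⟨(N.submatrix eq eq).toBlocks₁₁ i j, hom_zero_iff.mp (hS' i j)⟩
  let E0 : Matrix _ _ C.Ev := fun i j => ⟨E i j, hom_zero_iff.mp (hE i j)⟩
  let E0' : Matrix _ _ C.Ev := fun i j => ⟨E' i j, hom_zero_iff.mp (hE' i j)⟩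
  have lift : ∀ {l : Type _} [Fintype l] [DecidableEq l] (X Y : Matrix l l C.Ev),
      X.map C.evInc * Y.map C.evInc = 1 → X * Y = 1 := by
    intro l _ _ X Y h
    ext1 i j
    have := congrFun (congrFun h i) j
    rw [← Matrix.map_mul, Matrix.map_apply, one_apply] at this
    rw [one_apply]
    refine Subtype.ext (this.trans ?_)
    split_ifs <;> rfl
  have hSS : S0 * S0' = 1 := lift _ _ k1
  have hEE : E0 * E0' = 1 := lift _ _ h3
  refine ⟨S0.det * E0'.det, S0'.det * E0.det, ?_, ?_, ?_⟩
  · calc S0.det * E0'.det * (S0'.det * E0.det) = (S0 * S0').det * (E0 * E0').det := by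
          rw [det_mul, det_mul]; ring
      _ = 1 := by rw [hSS, hEE, det_one, det_one, mul_one]
  · intro Δ
    have d1 := Δ.det_eq hSS
    have d2 := Δ.det_eq hEE
    have d3 : Δ.Q (C.evInc E0'.det) = -(C.evInc E0'.det * ∑ i, ∑ j, E' j i * Δ.Q (E i j)) := by
      have e1 : E0.det * E0'.det = 1 := by rw [← det_mul, hEE, det_one]
      have e2 : C.evInc E0'.det * C.evInc E0.det = 1 := by rw [← map_mul, mul_comm, e1, map_one]
      have e3 := Δ.even_mul E0.det E0'.det
      have e4 : (E0.det : R) * E0'.det = 1 := congrArg C.evInc e1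
      rw [e4, Δ.one] at e3
      have e5 := congrArg (C.evInc E0'.det * ·) e3
      simp only [mul_zero, mul_add] at e5
      rw [← evInc_apply, ← evInc_apply, ← mul_assoc, e2, one_mul, d2, ← mul_assoc (C.evInc E0'.det)
        (C.evInc E0.det), e2, one_mul] at e5
      rw [eq_neg_iff_add_eq_zero]
      exact e5.symm
    have d4 : Δ.slog x N M = _ := (Δ.slog_reindex eq N M).symm
    rw [d4, hx, hMb, (key Δ).2.2]
    have d5 : Δ.Q ((S0.det * E0'.det : C.Ev) : R) = _ := Δ.even_mul S0.det E0'.det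
    rw [d5]
    rw [← evInc_apply, ← evInc_apply, d1, d3, mul_neg, mul_sub, sub_eq_neg_add, ← mul_assoc, ←
      mul_assoc]
    have d6 : C.evInc E0'.det * C.evInc S0.det = C.evInc S0.det * C.evInc E0'.det := by
      rw [← map_mul, mul_comm, map_mul]
    rw [d6]
    rfl
  · intro T _ φ hφ
    rw [sdet_map (φ.comp C.evInc) hφ (M.map φ) (E := E0) (E' := E0') (A := S0) (fun i j => rfl) hEE]
    · rw [← map_mul]; rfl
    · intro i j
      change φ ((A - B * E' * B') i j) = _
      rw [Matrix.sub_apply, mul_apply, map_sub, map_sum]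
      refine congrArg₂ (· - ·) rfl (sum_congr rfl fun l _ => ?_)
      rw [map_mul, mul_apply, map_sum]
      simp only [map_mul]
      rfl

end SuperCalc

namespace BV

variable {D : FieldContent} {x : Body D} {W : Opens (Body D)}

lemma body_of_odd {f : SFR W} (h : (sc W).Hom 1 f) (hx : x ∈ W) : body D (ev x hx f) = 0 := by
  have h1 := body_sig (ev x hx f)
  rw [← sc_σ_at, h, sgn_one, neg_one_smul, map_neg, ← bodyHom_apply, map_neg] at h1
  exact self_eq_neg.mp h1.symm

lemma at_surjective (hx : x ∈ W) (v : Val D) : ∃ f : SFR W, ev x hx f = v :=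
  ⟨of (fun _ => v) (smooth_const v W), at_of _ _ hx⟩

lemma at_mem_center {f : SFR W} (h : (sc W).σ f = f) (hx : x ∈ W) : ev x hx f ∈ Subring.center
    (Val D) := by
  rw [Subring.mem_center_iff]
  intro v
  obtain ⟨k, rfl⟩ := at_surjective hx v
  rw [← map_mul, ← map_mul, (sc W).even_mul f k h]

lemma mem_center_of_even {f : SFR W} (h : (sc W).σ f = f) : f ∈ Subring.center (SFR W) := by
  rw [Subring.mem_center_iff]
  intro k
  exact ((sc W).even_mul f k h).symm

theorem SFR.exists_sdet {ι : Type*} [Fintype ι] [DecidableEq ι] {p : ι → ZMod 2}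
    {M N : Matrix ι ι (SFR W)} (hM : (sc W).MHom 0 p p M) (hMe : ∀ i j, IsExt (M i j))
    (h1 : M * N = 1) (h2 : N * M = 1) : ∃ s s' : (sc W).Ev, s * s' = 1 ∧ IsExt (s : SFR W) ∧
    (∀ Δ : (sc W).OddDer, Δ.Q s = s * Δ.slog p N M) ∧ ∀ x (hx : x ∈ W), sdet p (M.map (ev x hx)) =
    ev x hx s := by
  have hN := hM.inverse h1 h2
  obtain ⟨E', _, h3, h4⟩ := exists_matrix_inverse_of_body
    (M := Matrix.of fun i j : {i // ¬ p i = 0} => M i.1 j.1) (fun i j => hMe _ _) (by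
    intro x hx
    have hu : (Matrix.of fun i j : {i // ¬ p i = 0} => body D ((M i.1 j.1).rep x)) *
        (Matrix.of fun i j : {i // ¬ p i = 0} => body D ((N i.1 j.1).rep x)) = 1 := by
      ext1 i j
      have h5 := congrArg (bodyHom (D := D)) (congrArg (ev x hx) (congrFun (congrFun h1 i.1) j.1))
      rw [mul_apply, map_sum, map_sum, one_apply, apply_ite (ev x hx), apply_ite (bodyHom (D := D)),
        map_one, map_zero, map_one, map_zero] at h5
      rw [mul_apply, one_apply]
      simp only [Subtype.ext_iff]
      rw [← h5, ← Fintype.sum_subtype_add_sum_subtype (fun k => p k = 0)]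
      refine Eq.symm (Eq.trans (congrArg₂ (· + ·) (sum_eq_zero ?_) rfl) ((zero_add _).trans ?_))
      swap
      · refine sum_congr rfl fun k _ => ?_
        rw [map_mul, map_mul, of_apply, of_apply, bodyHom_apply, bodyHom_apply, at_apply, at_apply]
      · intro k _
        have h6 : (sc W).Hom 1 (M i.1 k.1) := (hM i.1 k.1).cast (by
          rw [k.2, add_zero, add_zero]
          have : ∀ t : ZMod 2, ¬ t = 0 → t = 1 := by decide
          exact this _ i.2)
        rw [map_mul, map_mul, bodyHom_apply (ev x hx (M i.1 k.1)), body_of_odd h6, zero_mul]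
    exact IsUnit.of_mul_eq_one _ hu)
  obtain ⟨s, s', e1, e2, e3⟩ := SuperCalc.exists_sdet hM h1 h2 h3 h4
  refine ⟨s, s', e1, ?_, e2, fun x hx => e3 (ev x hx).toRingHom fun a => at_mem_center a.2 hx⟩
  have k1 := e3 (RingHom.id (SFR W)) fun a => mem_center_of_even a.2
  have k2 := e3 (SFR.res (extP D)).toRingHom fun a => mem_center_of_even (by
    have := hom_res (P := extP D) (Ev.hom a)
    exact hom_zero_iff.mp this)
  have k3 : M.map (SFR.res (extP D)).toRingHom = M.map (RingHom.id (SFR W)) := by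
    ext1 i j
    exact hMe i j
  rw [k3, k1] at k2
  exact k2.symm

lemma IsExt.inverse {s s' : SFR W} (h : s * s' = 1) (h' : s' * s = 1) (hs : IsExt s) : IsExt s' :=
    by
  have h1 : SFR.res (extP D) s' * s = 1 := by
    have := congrArg (SFR.res (extP D)) h'
    rwa [map_mul, map_one, hs] at this
  unfold IsExt
  calc SFR.res (extP D) s' = SFR.res (extP D) s' * (s * s') := by rw [h, mul_one]
    _ = s' := by rw [← mul_assoc, h1, one_mul]

namespace Bars

variable {S : GaugeData W} (B : Bars S)

variable (S) in
/-- The derivation `(·, g)` as an odd derivation. -/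
def der : (sc W).OddDer where
  Q := ∑ i, ∑ j, (LinearMap.mulRight ℂ ((sc W).ld (inl j) S.g)).comp
    ((LinearMap.mulRight ℂ (EX S.ED i j)).comp ((sc W).rd (inl i)))
  mul a b := by
    have h : ∀ f, (∑ i, ∑ j, (LinearMap.mulRight ℂ ((sc W).ld (inl j) S.g)).comp
        ((LinearMap.mulRight ℂ (EX S.ED i j)).comp ((sc W).rd (inl i)))) f = Q S f := fun f => by
      simp [LinearMap.sum_apply, Q, GaugeData.bX, br]
    rw [h, h, h]
    exact S.odd_EX.br_mul_left S.even_g a b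
  hom {q a} ha := by
    have h : (∑ i, ∑ j, (LinearMap.mulRight ℂ ((sc W).ld (inl j) S.g)).comp ((LinearMap.mulRight ℂ
      (EX S.ED i j)).comp ((sc W).rd (inl i)))) a = Q S a := by
      simp [LinearMap.sum_apply, Q, GaugeData.bX, br]
    rw [h]
    exact hom_Q ha

lemma der_Q (f : SFR W) : (der S).Q f = Q S f := by
  simp [der, LinearMap.sum_apply, Q, GaugeData.bX, br]

lemma log_mul (Δ : (sc W).OddDer) {u v : (sc W).Ev} {l m : SFR W} (hu : Δ.Q u = u * l)
    (hv : Δ.Q v = v * m) : Δ.Q ((u * v : (sc W).Ev) : SFR W) = (u * v : (sc W).Ev) * (l + m) := by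
  have h1 : ((u * v : (sc W).Ev) : SFR W) = u * v := rfl
  have h2 : (u : SFR W) * v = v * u := (sc W).even_mul _ _ u.2
  rw [h1, Δ.even_mul, hu, hv, mul_add, add_comm, ← mul_assoc, ← mul_assoc, h2]

/-- Logarithmic derivatives of products. -/
lemma log_prod {ι : Type*} (t : Finset ι) (Δ : (sc W).OddDer) (u : ι → (sc W).Ev) (l : ι → SFR W)
    (h : ∀ i, Δ.Q (u i) = u i * l i) : Δ.Q ((sc W).evInc (∏ i ∈ t, u i)) = (sc W).evInc
    (∏ i ∈ t, u i) * ∑ i ∈ t, l i := by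
  classical
  induction t using Finset.induction_on with
  | empty => rw [Finset.prod_empty, Finset.sum_empty, map_one, Δ.one, mul_zero]
  | insert a t ha ih =>
    rw [Finset.prod_insert ha, Finset.sum_insert ha]
    exact log_mul Δ (h a) ih

lemma log_inv (Δ : (sc W).OddDer) {u u' : (sc W).Ev} {l : SFR W} (hu : u * u' = 1)
    (h : Δ.Q u = u * l) : Δ.Q u' = u' * -l := by
  have e3 := Δ.even_mul u u'
  have e4 : (u : SFR W) * u' = 1 := congrArg (sc W).evInc hu
  have e5 : (u' : SFR W) * u = 1 := by rw [(sc W).even_mul _ _ u'.2, e4]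
  rw [e4, Δ.one, h] at e3
  have e6 := congrArg ((u' : SFR W) * ·) e3
  simp only [mul_zero, mul_add] at e6
  rw [← mul_assoc, e5, one_mul, ← mul_assoc (u' : SFR W) (u : SFR W), e5, one_mul] at e6
  rw [mul_neg, eq_neg_iff_add_eq_zero]
  exact e6.symm

lemma slog_der {ι : Type*} [Fintype ι] (p : ι → ZMod 2) (N M : Matrix ι ι (SFR W)) : (der S).slog p
    N M = ∑ a, ∑ b, sgn (p b) • (N b a * Q S (M a b)) := by
  simp only [OddDer.slog, der_Q]

lemma ext_Γ (b : BarIdx D) : IsExt (B.Γ b) := by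
  rcases b with a | a | a
  · exact B.ext_F a
  · exact S.ext_G a
  · exact B.ext_Θ a

lemma exists_sdet_jac (e : BarIdx D ≃ Ext D) (he : ∀ i, parExt D (e i) = parBar D i) : ∃ s s' :
    (sc W).Ev, s * s' = 1 ∧ IsExt (s : SFR W) ∧ (der S).Q s = s * B.lnJ ∧ ∀ x (hx : x ∈ W), ev x hx
    s = sdet (parExt D) (Matrix.of fun X Y => ev x hx ((sc W).rd (inl Y) (B.Γ (e.symm X)))) := by
  obtain ⟨s, s', h1, h2, h3, h4⟩ := SFR.exists_sdet (p := parExt D)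
    (M := ((sc W).jac inl B.Γ).submatrix e.symm id) (N := B.K.submatrix id e.symm)
    (fun X Y => ((B.hom_Γ (e.symm X)).rd (inl Y)).cast (by
      rw [← he, Equiv.apply_symm_apply, add_zero, add_comm]; rfl))
    (fun X Y => (B.ext_Γ (e.symm X)).rd Y)
    (by
      have h := congrArg (fun T => Matrix.submatrix T e.symm e.symm) B.jac_K
      rwa [Matrix.submatrix_one_equiv] at h)
    (by
      rw [Matrix.submatrix_mul_equiv B.K _ id e.symm id, Matrix.submatrix_id_id]
      exact B.K_jac)
  refine ⟨s, s', h1, h2, ?_, fun x hx => (h4 x hx).symm⟩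
  rw [h3, slog_der, lnJ, sum_comm]
  refine congrArg _ (sum_congr rfl fun X _ => ?_)
  exact Equiv.sum_comp e.symm fun b => sgn (parExt D X) •
    (B.K X b * Q S ((sc W).jac inl B.Γ b X))

lemma exists_sdet_M : ∃ s s' : (sc W).Ev, s * s' = 1 ∧ IsExt (s : SFR W) ∧ (der S).Q s = s * B.lnM ∧
    ∀ x (hx : x ∈ W), ev x hx s = sdet (fun a : AExt D => parAl D a.1) (B.M.map (ev x hx)) := by
  obtain ⟨s, s', h1, h2, h3, h4⟩ := SFR.exists_sdet B.hom_M B.ext_M B.M_M' B.M'_M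
  refine ⟨s, s', h1, h2, ?_, fun x hx => (h4 x hx).symm⟩
  rw [h3, slog_der, lnM]
  rfl

lemma exists_sdet_Dl (n : ℕ) : ∃ s s' : (sc W).Ev, s * s' = 1 ∧ IsExt (s : SFR W) ∧ (der S).Q s =
    s * ∑ a, ∑ b, sgn (parAl D b.1) • (B.Di n b a * Q S (S.Dl n a b)) ∧ ∀ x (hx : x ∈ W), ev x hx
    s = sdet (fun a : AIdx D (n + 1) => parAl D a.1) ((S.Dl n).map (ev x hx)) := by
  obtain ⟨s, s', h1, h2, h3, h4⟩ := SFR.exists_sdet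
    (p := fun a : AIdx D (n + 1) => parAl D a.1) (M := S.Dl n) (N := B.Di n)
    (fun a b => (S.hom_Dl n a b).cast (by
      change parAl D a.1 + _ + (parAl D b.1 + _) + 0 = parAl D a.1 + parAl D b.1 + 0
      generalize parAl D a.1 = u; generalize parAl D b.1 = v
      generalize ((n + 1 : ℕ) : ZMod 2) = w; clear * -; revert u v w; decide))
    (fun a b => S.ext_Dl n a b) (B.Dl_Di n) (B.Di_Dl n)
  refine ⟨s, s', h1, h2, ?_, fun x hx => (h4 x hx).symm⟩
  rw [h3, slog_der]

lemma exists_alt : ∃ A A' : (sc W).Ev, A * A' = 1 ∧ IsExt (A : SFR W) ∧ (der S).Q A = A * B.lnΔ ∧ ∀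
    x (hx : x ∈ W), ev x hx A = (List.ofFn fun i : Fin D.s => if Even ((i : ℕ) + 1) then sdet (fun
    a : AIdx D ((i : ℕ) + 1) => parAl D a.1) ((S.Dl i).map (ev x hx)) else Ring.inverse (sdet (fun
    a : AIdx D ((i : ℕ) + 1) => parAl D a.1) ((S.Dl i).map (ev x hx)))).prod := by
  choose s s' h1 h2 h3 h4 using B.exists_sdet_Dl
  have h1' : ∀ n, ((s' n : (sc W).Ev) : SFR W) * s n = 1 := fun n =>
    congrArg (sc W).evInc ((mul_comm _ _).trans (h1 n))
  have h1'' : ∀ n, ((s n : (sc W).Ev) : SFR W) * s' n = 1 := fun n => congrArg (sc W).evInc (h1 n)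
  let f : Fin D.s → (sc W).Ev := fun i => if Even ((i : ℕ) + 1) then s i else s' i
  refine ⟨∏ i, f i, ∏ i : Fin D.s, if Even ((i : ℕ) + 1) then s' i else s i, ?_, ?_, ?_, ?_⟩
  · rw [← Finset.prod_mul_distrib]
    refine Finset.prod_eq_one fun i _ => ?_
    simp only [f]
    split_ifs
    · exact h1 _
    · rw [mul_comm]; exact h1 _
  · have : (∏ i, f i) ∈ ((ExtAlg W).toSubsemiring.comap (sc W).evInc) := by
      refine Subsemiring.prod_mem _ fun i _ => ?_
      simp only [f]
      split_ifs
      · exact h2 i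
      · exact IsExt.inverse (h1'' i) (h1' i) (h2 i)
    exact this
  · have e1 := log_prod Finset.univ (der S) f (fun i : Fin D.s => sgn ((((i : ℕ) + 1 : ℕ)) : ZMod 2) •
      ∑ a, ∑ b, sgn (parAl D b.1) • (B.Di i b a * Q S (S.Dl i a b))) (by
      intro i
      simp only [f]
      split_ifs with hi
      · rw [(ZMod.natCast_eq_zero_iff_even).mpr hi, sgn_zero, one_smul]; exact h3 i
      · rw [(ZMod.natCast_eq_one_iff_odd).mpr (Nat.not_even_iff_odd.mp hi), sgn_one, neg_one_smul]
        exact log_inv (der S) (h1 i) (h3 i))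
    refine e1.trans (congrArg _ ?_)
    rw [lnΔ, ← Fin.sum_univ_eq_sum_range fun n => ∑ a, ∑ b, sgn (GaugeData.pc n b) • (B.Di n b a * Q
      S (S.Dl n a b))]
    refine sum_congr rfl fun i _ => ?_
    rw [smul_sum]
    refine sum_congr rfl fun a _ => ?_
    rw [smul_sum]
    refine sum_congr rfl fun b _ => ?_
    rw [sgn_smul_smul, add_comm]
    rfl
  · intro x hx
    have e2 : ev x hx ((sc W).evInc (∏ i, f i)) =
        (List.ofFn fun i => ev x hx ((sc W).evInc (f i))).prod := by
      rw [← List.prod_ofFn, map_list_prod, map_list_prod, List.map_ofFn, List.map_ofFn]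
      rfl
    refine e2.trans (congrArg (fun t => (List.ofFn t).prod) (funext fun i => ?_))
    simp only [f]
    rw [← h4]
    split_ifs
    · rfl
    · rw [inverse_eq (b := ev x hx (s' i))]
      · rfl
      · rw [← map_mul, h1'', map_one]
      · rw [← map_mul, h1', map_one]

/-- The quantities in the one-loop formula, and the logarithmic derivative of their product. -/
theorem exists_formula (e : BarIdx D ≃ Ext D) (he : ∀ i, parExt D (e i) = parBar D i) : ∃ P P' A
    A' : (sc W).Ev, P * P' = 1 ∧ A * A' = 1 ∧ IsExt (P : SFR W) ∧ IsExt (A : SFR W) ∧ (∃ l m : SFR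
    W, (der S).Q P = P * l ∧ (der S).Q A = A * m ∧ B.π ((der S).Q (rr S.X1) + (1 / 2 : ℂ) • l + m) =
    0) ∧ (∀ x (hx : x ∈ W), ev x hx P = sdet (parExt D) (Matrix.of fun X Y => ev x hx ((sc W).rd
    (inl Y) (B.Γ (e.symm X)))) * sdet (fun a : AExt D => parAl D a.1) (B.M.map (ev x hx)) * ev x hx
    S.ρ') ∧ ∀ x (hx : x ∈ W), ev x hx A = (List.ofFn fun i : Fin D.s => if Even ((i : ℕ) + 1) then
    sdet (fun a : AIdx D ((i : ℕ) + 1) => parAl D a.1) ((S.Dl i).map (ev x hx)) else Ring.inverse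
    (sdet (fun a : AIdx D ((i : ℕ) + 1) => parAl D a.1) ((S.Dl i).map (ev x hx)))).prod := by
  obtain ⟨J, J', j1, j2, j3, j4⟩ := B.exists_sdet_jac e he
  obtain ⟨M, M', m1, m2, m3, m4⟩ := B.exists_sdet_M
  obtain ⟨A, A', a1, a2, a3, a4⟩ := B.exists_alt
  have r1 : S.ρ * S.ρ' = 1 := by
    rw [(sc W).even_mul _ _ (hom_zero_iff.mp S.even_ρ), S.ρ'_mul]
  let r : (sc W).Ev := ⟨S.ρ, hom_zero_iff.mp S.even_ρ⟩
  let r' : (sc W).Ev := ⟨S.ρ', by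
    have h1 : (sc W).σ S.ρ' * S.ρ = 1 := by
      have := congrArg (sc W).σ S.ρ'_mul
      rwa [map_mul, map_one, hom_zero_iff.mp S.even_ρ] at this
    change (sc W).σ S.ρ' = S.ρ'
    rw [← mul_one ((sc W).σ S.ρ'), ← r1, ← mul_assoc, h1, one_mul]⟩
  have hr : r * r' = 1 := Subtype.ext r1
  have r2 : (der S).Q r = r * (S.ρ' * Q S S.ρ) := by
    rw [der_Q, ← mul_assoc]
    change Q S S.ρ = S.ρ * S.ρ' * Q S S.ρ
    rw [r1, one_mul]
  refine ⟨J * M * r', J' * M' * r, A, A', ?_, a1, ?_, a2, ⟨_, _, log_mul _ (log_mul _ j3 m3)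
    (log_inv _ hr r2), a3, ?_⟩, fun x hx => ?_, a4⟩
  · calc J * M * r' * (J' * M' * r) = (J * J') * (M * M') * (r * r') := by ring
      _ = 1 := by rw [j1, m1, hr, one_mul, one_mul]
  · exact (ExtAlg W).mul_mem ((ExtAlg W).mul_mem j2 m2) S.ext_ρ'
  · rw [der_Q, ← sub_eq_add_neg]; exact B.one_loop
  · rw [← j4, ← m4, ← map_mul, ← map_mul]
    rfl

end Bars

end BV

namespace SuperCalc

variable {R : Type*} [Ring R] [Algebra ℂ R] {Z : Type*} {p : Z → ZMod 2} {C : SuperCalc R p}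
  {κ μ : Type*} [Fintype κ] [Fintype μ] [DecidableEq μ] {c : κ ⊕ (μ ⊕ μ) → Z} {E : κ → κ → R}

lemma rd_ham {v : Z} (h0 : ∀ i j, C.rd v (E i j) = 0) (g : R) {c : κ → Z} (i : κ) : C.rd v
    (C.ham c E g i) = ∑ j, E i j * C.ld (c j) (C.rd v g) := by
  rw [ham, map_sum]
  refine sum_congr rfl fun j _ => ?_
  rw [rd_mul, h0, zero_mul, add_zero, ld_rd]

/-- The Jacobi identity extends to canonical pairs. -/
lemma OddBivector.jacobi_canon (hE : C.OddBivector (fun i => c (inl i)) E)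
    (hc : ∀ m, p (c (inr (inr m))) = p (c (inr (inl m))) + 1)
    (h0 : ∀ m i j, C.ld (c (inr m)) (E i j) = 0) {g : R} (hg : C.Hom 0 g) (hJ : ∀ i, C.br (fun i =>
    c (inl i)) E (C.ham (fun i => c (inl i)) E g i) g = (1 / 2 : ℂ) • C.ham (fun i => c (inl i)) E
    (C.br (fun i => c (inl i)) E g g) i) (f : R) : C.br c (SuperCalc.canon E)
    (C.br c (SuperCalc.canon E) f g) g = (1 / 2 : ℂ) • C.br c (SuperCalc.canon E) f
    (C.br c (SuperCalc.canon E) g g) := by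
  set cl : κ → Z := fun i => c (inl i)
  set Ec := SuperCalc.canon (μ := μ) E
  have hX : C.OddBivector c Ec := OddBivector.canon hE hc
  have r0 : ∀ m i j, C.rd (c (inr m)) (E i j) = 0 := fun m i j => by
    rw [(hE.hom i j).rd_eq, h0, smul_zero]
  have hu : ∀ m i j, C.ld (c (inr m)) (Ec i j) = 0 := by
    rintro m (i | i | i) (j | j | j) <;> simp only [Ec, SuperCalc.canon, map_zero, h0] <;>
      split_ifs <;> simp only [map_zero, map_neg, ld_one, neg_zero]
  have hl : ∀ k i, C.ham c Ec k (inl i) = C.ham cl E k i := fun k i => by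
    simp [ham, cl, Ec, SuperCalc.canon, sum_sum_type]
  have hp : ∀ k m, C.ham c Ec k (inr (inl m)) =
      C.ld (c (inr (inr m))) k := fun k m => by
    simp [ham, Ec, SuperCalc.canon, sum_sum_type]
  have hs : ∀ k m, C.ham c Ec k (inr (inr m)) =
      -C.ld (c (inr (inl m))) k := fun k m => by
    simp [ham, Ec, SuperCalc.canon, sum_sum_type]
  refine hX.jacobi_of_ham hg (fun i => ?_) f
  rcases i with i | m | m
  · rw [hl, hl, br_canon, br_canon, hJ]
    have e1 : ∀ a b, C.ham cl E (a + b) i =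
        C.ham cl E a i + C.ham cl E b i := fun a b => by
      simp only [ham, map_add, mul_add, sum_add_distrib]
    rw [e1, smul_add]
    refine congrArg _ ?_
    simp only [rd_ham (r0 _)]
    simp only [ham, sum_mul, ← sum_sub_distrib]
    rw [sum_comm, smul_sum]
    refine sum_congr rfl fun j _ => ?_
    simp only [mul_assoc, ← mul_sub, ← mul_sum, ← mul_smul_comm]
    refine congrArg _ ?_
    rw [map_sum, smul_sum]
    refine sum_congr rfl fun m _ => ?_
    have k1 : ∀ z, C.rd z g = sgn (p z) • C.ld z g := fun z => by
      rw [hg.rd_eq, zero_add, mul_one]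
    have k2 : C.ld (c (inl j)) (C.rd (c (inr (inl m))) g * C.ld (c (inr (inr m))) g - C.rd (c (inr
      (inr m))) g * C.ld (c (inr (inl m))) g) = (2 : ℂ) •
        (C.ld (c (inl j)) (C.rd (c (inr (inl m))) g) * C.ld (c (inr (inr m))) g - C.ld (c (inl j))
          (C.rd (c (inr (inr m))) g) * C.ld (c (inr (inl m))) g) := by
      rw [map_sub, ld_mul', ld_mul', (hg.rd _).tw, (hg.rd _).tw, k1, k1]
      simp only [map_smul, smul_mul_assoc, smul_smul, ← sgn_add]
      rw [(hg.ld (c (inr (inl m)))).comm ((hg.ld (c (inr (inr m)))).ld (c (inl j))), (hg.ld (c (inr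
        (inr m)))).comm ((hg.ld (c (inr (inl m)))).ld (c (inl j)))]
      simp only [smul_smul, ← sgn_add, hc]
      generalize p (c (inr (inl m))) = x
      generalize p (c (inl j)) = y
      rw [show y * (x + 0) + x + (x + 0) * (y + (x + 1 + 0)) = x by clear * -; revert x y; decide,
        show y * (x + 1 + 0) + (x + 1) + (x + 1 + 0) * (y + (x + 0)) = x + 1 by
          clear * -; revert x y; decide, sgn_add, sgn_one]
      module
    rw [k2, smul_smul]
    norm_num [cl]
  · rw [hp, hp, hX.ld_br_self (fun i j => hu _ i j) hg, smul_smul]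
    norm_num
  · rw [hs, hs, hX.ld_br_self (fun i j => hu _ i j) hg, br_neg_left, ← smul_neg, smul_neg, smul_neg,
      smul_smul]
    norm_num

end SuperCalc

namespace BV

variable {D : FieldContent} {x : Body D} {V W : Opens (Body D)}

/-! ### Restriction to smaller open sets -/

/-- The restriction of a superfunction to a smaller open set. -/
def SFR.restrF (h : W ≤ V) (f : SFR V) : SFR W := of f.rep fun d S => (f.smooth d S).mono h

lemma SFR.at_restrF (h : W ≤ V) (f : SFR V) (hx : x ∈ W) : ev x hx (SFR.restrF h f) = ev x (h hx)
    f := by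
  rw [at_apply f (h hx)]; exact at_of _ _ hx

/-- The restriction of superfunctions to a smaller open set. -/
def SFR.restr (h : W ≤ V) : SFR V →ₐ[ℂ] SFR W where
  toFun := SFR.restrF h
  map_one' := ext_at fun x hx => by rw [SFR.at_restrF, map_one, map_one]
  map_mul' a b := ext_at fun x hx => by
    rw [SFR.at_restrF, map_mul, map_mul, SFR.at_restrF, SFR.at_restrF]
  map_zero' := ext_at fun x hx => by rw [SFR.at_restrF, map_zero, map_zero]
  map_add' a b := ext_at fun x hx => by
    rw [SFR.at_restrF, map_add, map_add, SFR.at_restrF, SFR.at_restrF]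
  commutes' k := ext_at fun x hx => by
    rw [SFR.at_restrF, AlgHom.commutes, AlgHom.commutes]

lemma SFR.at_restr (h : W ≤ V) (f : SFR V) (hx : x ∈ W) : ev x hx (SFR.restr h f) = ev x (h hx) f :=
    SFR.at_restrF h f hx

lemma Smooth.mono {f : SF D} (hf : Smooth D V f) (h : W ≤ V) : Smooth D W f :=
  fun d S => (hf d S).mono h

lemma SFR.restr_of (h : W ≤ V) (f : SF D) (hf : Smooth D V f) : SFR.restr h (of f hf) = of f
    (hf.mono h) := ext_at fun x hx => by
  rw [SFR.at_restr, at_of, at_of]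

lemma SFR.restr_σ (h : W ≤ V) (f : SFR V) : SFR.restr h ((sc V).σ f) = (sc W).σ (SFR.restr h f) :=
    ext_at fun x hx => by
  rw [SFR.at_restr, sc_σ_at, sc_σ_at, SFR.at_restr]

lemma SFR.restr_ld (h : W ≤ V) (z : Coord D) (f : SFR V) : SFR.restr h ((sc V).ld z f) = (sc W).ld z
    (SFR.restr h f) := ext_at fun x hx => by
  rw [SFR.at_restr, sc_ld_at, sc_ld_at]
  exact ld_congr (W := W) (fun y hy => (rep_of _ _ hy).symm) z hx

lemma SFR.restr_hom (h : W ≤ V) {q : ZMod 2} {f : SFR V} (hf : (sc V).Hom q f) : (sc W).Hom q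
    (SFR.restr h f) := by
  unfold Hom; rw [← SFR.restr_σ, hf, map_smul]

lemma SFR.restr_rd (h : W ≤ V) (z : Coord D) (f : SFR V) : SFR.restr h ((sc V).rd z f) = (sc W).rd z
    (SFR.restr h f) := by
  refine hom_ind (C := sc V) (P := fun f => SFR.restr h ((sc V).rd z f) = (sc W).rd z (SFR.restr h f))
    (fun q a ha => ?_) (fun a b ha hb => ?_) f
  · rw [ha.rd_eq, (SFR.restr_hom h ha).rd_eq, map_smul, SFR.restr_ld]
  · rw [map_add, map_add, map_add, map_add, ha, hb]

lemma SFR.restr_br (h : W ≤ V) {ι : Type*} [Fintype ι] (c : ι → Coord D) (E : ι → ι → SFR V)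
    (f g : SFR V) : SFR.restr h ((sc V).br c E f g) = (sc W).br c (fun i j => SFR.restr h (E i j))
    (SFR.restr h f) (SFR.restr h g) := by
  simp only [br, map_sum, map_mul, SFR.restr_rd, SFR.restr_ld]

lemma SFR.restr_res (h : W ≤ V) (P : Coord D → Prop) (f : SFR V) : SFR.restr h (SFR.res P f) =
    SFR.res P (SFR.restr h f) := ext_at fun x hx => by
  rw [SFR.at_restr, at_res, at_res, SFR.at_restr]

lemma IsExt.restr (h : W ≤ V) {f : SFR V} (hf : IsExt f) : IsExt (SFR.restr h f) := by
  unfold IsExt; rw [← SFR.restr_res, hf]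

lemma SFR.restr_canon (h : W ≤ V) {κ μ : Type*} [DecidableEq μ] (E : κ → κ → SFR V) :
    (fun i j => SFR.restr h (SuperCalc.canon (μ := μ) E i j)) =
      SuperCalc.canon fun i j => SFR.restr h (E i j) := by
  funext i j
  rcases i with i | i | i <;> rcases j with j | j | j <;> simp only [SuperCalc.canon] <;>
    (try split_ifs) <;> simp only [map_zero, map_one, map_neg]

lemma wt_restr (h : W ≤ V) {T : Set ℤ} {f : SFR V} (hf : f ∈ Wt V T) : SFR.restr h f ∈ Wt W T :=
  mem_wt.mpr fun x hx => by rw [SFR.at_restr]; exact mem_wt.mp hf x (h hx)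

lemma restr_ET (h : W ≤ V) (E : Fin (2 * D.N) → Fin (2 * D.N) → SFR V) :
    (fun i j => SFR.restr h (ET E i j)) = ET fun i j => SFR.restr h (E i j) := by
  unfold ET EX; rw [SFR.restr_canon, SFR.restr_canon]

lemma restr_EX (h : W ≤ V) (E : Fin (2 * D.N) → Fin (2 * D.N) → SFR V) :
    (fun i j => SFR.restr h (EX E i j)) = EX fun i j => SFR.restr h (E i j) := by
  unfold EX; rw [SFR.restr_canon]

/-- The restriction of the data to a smaller open set. -/
def GaugeData.restr (S : GaugeData V) (h : W ≤ V) : GaugeData W where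
  ED A B := SFR.restr h (S.ED A B)
  odd := ⟨fun A B => SFR.restr_hom h (S.odd.hom A B), fun A B => by
    rw [S.odd.skew A B, map_neg, map_smul]⟩
  extE A B := (S.extE A B).restr h
  ρ := SFR.restr h S.ρ
  ρ' := SFR.restr h S.ρ'
  even_ρ := SFR.restr_hom h S.even_ρ
  ext_ρ := S.ext_ρ.restr h
  ρ'_mul := by rw [← map_mul, S.ρ'_mul, map_one]
  ext_ρ' := S.ext_ρ'.restr h
  pi_ρ a := by rw [← SFR.restr_ld, S.pi_ρ, map_zero]
  X0 := SFR.restr h S.X0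
  X1 := SFR.restr h S.X1
  even0 := SFR.restr_hom h S.even0
  even1 := SFR.restr_hom h S.even1
  wt0 := wt_restr h S.wt0
  wt1 := wt_restr h S.wt1
  cme := by rw [← restr_ET h, ← SFR.restr_br, S.cme, map_zero]
  loop := by
    rw [← restr_ET h, ← SFR.restr_br, S.loop]
    simp only [lap, map_sum, map_smul, map_mul, SFR.restr_ld]

/-! ### Functions of the variables `Γ` -/

lemma ld_of_gamFun {f : SF D} (hf : Smooth D W f) (h : IsΓFun D W f) (a : APi D ⊕ APi D) : (sc W).ld
    (inl (inr a)) (of f hf) = 0 := by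
  have hP : ∀ b, ¬ (fun z : Coord D => ∃ A, z = inl (inl A)) (inr b) := by
    rintro b ⟨A, hA⟩; simp at hA
  rw [sc_ld_of]
  refine ext_at fun x hx => ?_
  rw [at_of, map_zero]
  by_cases ha : par D (inl (inr a)) = 0
  · rw [ld_body ha]
    refine ext fun d => ?_
    rw [coeff_pdBody, map_zero]
    refine sum_eq_zero fun S _ => ?_
    have h1 : fderiv ℝ (BV.comp D f d S) x (Pi.single ⟨inr a, ha⟩ 1) = 0 := by
      have h2 : DifferentiableAt ℝ (BV.comp D f d S) x :=
        ((hf d S).contDiffAt (W.2.mem_nhds hx)).differentiableAt (by simp)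
      rw [← h2.lineDeriv_eq_fderiv, lineDeriv]
      refine (Filter.EventuallyEq.deriv_eq ?_).trans (deriv_const 0 (BV.comp D f d S x))
      have h3 : ∀ᶠ t in nhds (0 : ℝ), x + t • (Pi.single ⟨inr a, ha⟩ 1 : Body D) ∈ W :=
        (by fun_prop : Continuous fun t : ℝ => x + t • (Pi.single ⟨inr a, ha⟩ 1 : Body D)).tendsto' 0 x
          (by simp) |>.eventually (W.2.mem_nhds hx)
      filter_upwards [h3] with t ht
      unfold BV.comp
      rw [h.2 _ ht x hx fun b hb => ?_]
      have : b ≠ ⟨inr a, ha⟩ := by rintro rfl; simp at hb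
      simp [Pi.single_eq_of_ne this]
    rw [h1, zero_smul]
  · rw [ld_odd ha]
    refine ext fun d => ?_
    rw [coeff_pdOdd, map_zero, ← h.1 x hx, kill_eq_res hP, coeff_res]
    by_cases hd : Supp (fun z : Coord D => ∃ A, z = inl (inl A)) d
    · rw [resCoeff_pos hd]
      refine dO_kl_neg _ ?_ _
      rintro ⟨A, hA⟩; simp at hA
    · rw [resCoeff_neg hd, map_zero]

lemma isExt_of_gamFun {f : SF D} (hf : Smooth D W f) (h : IsΓFun D W f) : IsExt (of f hf) := by
  have hP : ∀ b, ¬ (fun z : Coord D => ∃ A, z = inl (inl A)) (inr b) := by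
    rintro b ⟨A, hA⟩; simp at hA
  refine ext_at fun x hx => ?_
  rw [at_res, at_of, ← h.1 x hx, kill_eq_res hP, res_res]
  congr 2
  funext z
  exact propext ⟨fun h => h.2, fun h => ⟨by obtain ⟨A, rfl⟩ := h; rfl, h⟩⟩

end BV

open BV.SFR (at_restr restr_of restr_ld)
open BV.SFR (restrF at_restrF restr_hom restr_res restr_br restr_rd restr_canon restr_σ restr)

namespace BV

variable {D : FieldContent} {x : Body D} {W : Opens (Body D)}

/-! ### Planck numbers of brackets and Laplacians -/

/-- The set `T` of Planck numbers lowered by that of a variable. -/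
def sh (T : Set ℤ) (z : Coord D) : Set ℤ := {v | ∃ u ∈ T, v = u - plC z}

lemma mem_sh {T : Set ℤ} {z : Coord D} {u : ℤ} (h : u ∈ T) : u - plC z ∈ sh T z := ⟨u, h, rfl⟩

lemma ET_eq_zero {E : Fin (2 * D.N) → Fin (2 * D.N) → SFR W} {z w : Coord D}
    (h : plC z + plC w ≠ 0) : ET E z w = 0 := by
  rcases z with A | a | a <;> rcases w with B | b | b <;> simp only [ET, SuperCalc.canon] <;>
    first
    | exact absurd rfl h
    | rfl
    | (split_ifs with hab
       · subst hab
         simp [plC, pl] at h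
       · rfl)

lemma wt_ET {E : Fin (2 * D.N) → Fin (2 * D.N) → SFR W} (hE : ∀ A B, IsExt (E A B))
    (z w : Coord D) : ET E z w ∈ Wt W {0} := by
  have h0 : (0 : SFR W) ∈ Wt W {0} := zero_mem _
  have h1 : (1 : SFR W) ∈ Wt W {0} := wt_ext (map_one _)
  rcases z with (A | a | a) | a | a <;> rcases w with (B | b | b) | b | b <;>
    simp only [ET, EX, SuperCalc.canon] <;> first
    | exact wt_ext (hE A B)
    | exact h0
    | (split_ifs
       · first
         | exact h1
         | exact neg_mem h1
       · exact h0)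

variable {E : Fin (2 * D.N) → Fin (2 * D.N) → SFR W} (hE : ∀ A B, IsExt (E A B)) {ρ ρ' f g : SFR W}
  {T T' T'' : Set ℤ}

include hE in
lemma wt_br (hT : ∀ u ∈ T, ∀ u' ∈ T', u + u' ∈ T'') (hf : f ∈ Wt W T) (hg : g ∈ Wt W T') : (sc W).br
    id (ET E) f g ∈ Wt W T'' := by
  refine sum_mem fun z _ => sum_mem fun w _ => ?_
  by_cases h : plC z + plC w = 0
  · refine wt_mul (T := sh T z) (T' := sh T' w) ?_
      (wt_mul (T := sh T z) (T' := {0}) ?_ (wt_rd z (fun u hu => mem_sh hu) hf) (wt_ET hE z w))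
      (wt_ld w (fun u hu => mem_sh hu) hg)
    · rintro _ ⟨u, hu, rfl⟩ _ ⟨u', hu', rfl⟩
      rw [show u - plC z + (u' - plC w) = u + u' by omega]
      exact hT u hu u' hu'
    · rintro _ ⟨u, hu, rfl⟩ _ rfl
      exact ⟨u, hu, add_zero _⟩
  · rw [ET_eq_zero h, mul_zero, zero_mul]; exact zero_mem _

include hE in
lemma wt_lap (hρ : IsExt ρ) (hρ' : IsExt ρ') (hf : f ∈ Wt W T) : (sc W).lap id (ET E) ρ ρ' f ∈ Wt W
    T := by
  have k : ∀ {T : Set ℤ} {a b : SFR W}, a ∈ Wt W {0} → b ∈ Wt W T → a * b ∈ Wt W T :=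
    fun ha hb => wt_mul (by rintro _ rfl u hu; rwa [zero_add]) ha hb
  refine sum_mem fun z _ => sum_mem fun w _ => ?_
  by_cases h : plC z + plC w = 0
  · refine Submodule.smul_mem _ _ (k (wt_ext hρ') (wt_ld (T := sh T w) z ?_ (k (k (wt_ext hρ) (wt_ET
      hE z w)) (wt_ld w (fun u hu => mem_sh hu) hf))))
    rintro _ ⟨u, hu, rfl⟩
    rw [show u - plC w - plC z = u by omega]
    exact hu
  · rw [ET_eq_zero h, mul_zero, zero_mul, map_zero, mul_zero, smul_zero]
    exact zero_mem _

lemma wt_separate {a b c : SFR W} {k : ℤ} (h : a + b + c = 0) (ha : a ∈ Wt W {k + 1})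
    (hb : b ∈ Wt W {k}) (hc : c ∈ Wt W (Set.Iio k)) : a = 0 ∧ b = 0 := by
  have h1 : a = 0 := by
    refine wt_disjoint (T' := Set.Iic k) ?_ ha ?_
    · rw [Set.disjoint_singleton_left, Set.mem_Iic]; omega
    · rw [add_assoc] at h
      rw [eq_neg_of_add_eq_zero_left h]
      exact neg_mem (Submodule.add_mem _ (wt_mono (by rintro _ rfl; exact Set.mem_Iic.mpr le_rfl)
        hb) (wt_mono Set.Iio_subset_Iic_self hc))
  refine ⟨h1, ?_⟩
  rw [h1, zero_add] at h
  refine wt_disjoint (T' := Set.Iio k) ?_ hb ?_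
  · rw [Set.disjoint_singleton_left, Set.mem_Iio]; omega
  · rw [eq_neg_of_add_eq_zero_left h]; exact neg_mem hc

include hE in
/-- The lowest orders of the quantum master equation. -/
lemma master_orders (hO' : (sc W).OddBivector id (ET E)) (hρ : IsExt ρ) (hρ' : IsExt ρ')
    {X0 X1 X2 : SFR W} {t : ℂ} (ht : t ≠ 0) (e0 : (sc W).Hom 0 X0) (e1 : (sc W).Hom 0 X1)
    (e2 : (sc W).Hom 0 X2) (w0 : X0 ∈ Wt W {1}) (w1 : X1 ∈ Wt W {0}) (w2 : X2 ∈ Wt W (Set.Iio 0))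
    (h : (sc W).lap id (ET E) ρ ρ' (-t⁻¹ • (X0 + t • X1 + X2)) + (1 / 2 : ℂ) • (sc W).br id (ET E)
    (-t⁻¹ • (X0 + t • X1 + X2)) (-t⁻¹ • (X0 + t • X1 + X2)) = 0) : (sc W).br id (ET E) X0 X0 = 0 ∧
    (sc W).br id (ET E) X0 X1 = (sc W).lap id (ET E) ρ ρ' X0 := by
  have sk : ∀ {a b : SFR W}, (sc W).Hom 0 a → (sc W).Hom 0 b →
      (sc W).br id (ET E) a b = (sc W).br id (ET E) b a := fun ha hb => by
    rw [hO'.br_skew ha hb, neg_eq_sgn_smul, sgn_smul_smul]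
    rw [show (1 : ZMod 2) + (0 + 1) * (0 + 1) = 0 by decide, sgn_zero, one_smul]
  have h' := congrArg (fun y => (t * t) • y) h
  simp only [lap_smul, lap_add, br_smul_left, br_smul_right, br_add_left, br_add_right] at h'
  rw [sk e1 e0, sk e2 e0, sk e2 e1] at h'
  have h2 : (1 / 2 : ℂ) • (sc W).br id (ET E) X0 X0 + t • ((sc W).br id (ET E) X0 X1 - (sc W).lap id
    (ET E) ρ ρ' X0) + ((1 / 2 * t * t) • (sc W).br id (ET E) X1 X1 + (1 / 2 : ℂ) • (sc W).br id (ET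
    E) X2 X2 + (sc W).br id (ET E) X0 X2 + t • (sc W).br id (ET E) X1 X2 - (t * t) • (sc W).lap id
    (ET E) ρ ρ' X1 - t • (sc W).lap id (ET E) ρ ρ' X2) = 0 := by
    refine Eq.trans ?_ (h'.trans (smul_zero _))
    match_scalars <;> field_simp <;> ring
  have hm : ∀ {k : ℤ}, k ≤ 0 → Wt W {k} ≤ Wt W (Set.Iio 1) := fun hk =>
    wt_mono (by rintro _ rfl; exact Set.mem_Iio.mpr (by omega))
  have hm' : Wt W (Set.Iio 0) ≤ Wt W (Set.Iio 1) := wt_mono (Set.Iio_subset_Iio (by norm_num))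
  obtain ⟨h3, h4⟩ := wt_separate (k := 1) h2
    (Submodule.smul_mem _ _ (wt_br hE (by rintro _ rfl _ rfl; rfl) w0 w0))
    (Submodule.smul_mem _ _ (sub_mem (wt_br hE (by rintro _ rfl _ rfl; rfl) w0 w1)
      (wt_lap hE hρ hρ' w0))) (by
    refine sub_mem (sub_mem (add_mem (Submodule.add_mem _ (add_mem (Submodule.smul_mem _ _ ?_)
      (Submodule.smul_mem _ _ ?_)) ?_) (Submodule.smul_mem _ _ ?_)) (Submodule.smul_mem _ _ ?_))
      (Submodule.smul_mem _ _ ?_)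
    · exact hm le_rfl (wt_br hE (by rintro _ rfl _ rfl; rfl) w1 w1)
    · refine wt_br hE (fun u hu u' hu' => ?_) w2 w2
      simp only [Set.mem_Iio] at *; omega
    · refine wt_br hE (fun u hu u' hu' => ?_) w0 w2
      simp only [Set.mem_Iio, Set.mem_singleton_iff] at *; omega
    · refine wt_br hE (fun u hu u' hu' => ?_) w1 w2
      simp only [Set.mem_Iio, Set.mem_singleton_iff] at *; omega
    · exact hm le_rfl (wt_lap hE hρ hρ' w1)
    · exact hm' (wt_lap hE hρ hρ' w2))
  exact ⟨(smul_eq_zero.mp h3).resolve_left (by norm_num),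
    sub_eq_zero.mp ((smul_eq_zero.mp h4).resolve_left ht)⟩

/-! ### The action -/

section Action

variable {ħ : ℂ} {Ω : ℕ → SF D} (hs : ∀ k, Smooth D W (Ω k))
  (hp : ∀ k, HasParity D W 0 (Ω k)) (hw : ∀ k, ∀ x ∈ W, planck D (Ω k) x = (1 - (k : ℂ)) • Ω k x)

include hs hw in
lemma wt_order (k : ℕ) : of (Ω k) (hs k) ∈ Wt W {1 - (k : ℤ)} :=
  wt_of_planck (hs k) fun x hx => by rw [hw k x hx]; push_cast; rfl

/-- The orders of the action which contribute to a coefficient. -/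
def orders (d : Expo D) : Finset ℕ :=
  Finset.univ.image fun S : Finset (OddIdx D) => (1 - (plD d + ∑ o ∈ S, plC o.1)).toNat

include hs hw in
lemma coeff_order {d : Expo D} {k : ℕ} (hk : k ∉ orders d) (hx : x ∈ W) : coeff d (Ω k x) = 0 := by
  refine (monoBasis D).ext_elem fun S => ?_
  rw [map_zero, Finsupp.zero_apply]
  by_contra h
  have h1 := mem_wt_iff.mp (wt_order hs hw k) x hx d S (by rwa [at_of])
  rw [Set.mem_singleton_iff] at h1
  exact hk (Finset.mem_image.mpr ⟨S, mem_univ _, by omega⟩)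

include hs hw in
lemma coeff_action {d : Expo D} (hx : x ∈ W) (s : Finset ℕ) (h : orders d ⊆ s) : coeff d
    (action D ħ Ω x) = ∑ k ∈ s, (Complex.I * ħ) ^ k • coeff d (Ω k x) := by
  refine finsum_eq_sum_of_support_subset _ fun k hk => ?_
  by_contra h1
  refine hk ?_
  change (Complex.I * ħ) ^ k • coeff d (Ω k x) = 0
  rw [coeff_order hs hw (fun h2 => h1 (h h2)) hx, smul_zero]

include hs hw in
lemma smooth_action : Smooth D W (action D ħ Ω) := by
  rw [smooth_iff]
  intro d ℓ
  have h1 : ContDiffOn ℝ ∞ (fun x => ∑ k ∈ orders d, (Complex.I * ħ) ^ k * ℓ (coeff d (Ω k x))) W :=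
    ContDiffOn.sum fun k _ => contDiffOn_const.mul (smooth_iff.mp (hs k) d ℓ)
  refine h1.congr fun x hx => ?_
  rw [coeff_action hs hw hx _ subset_rfl, map_sum]
  simp only [map_smul, smul_eq_mul]

include hs hp hw in
lemma action_parity : HasParity D W 0 (action D ħ Ω) := by
  rw [← hom_of_iff (hf := smooth_action hs hw)]
  refine ext_at fun x hx => ext fun d => ?_
  rw [sgn_zero, one_smul, sc_σ_at, coeff_sig, at_of, coeff_action hs hw hx _ subset_rfl, map_sum]
  refine sum_congr rfl fun k _ => ?_
  rw [map_smul, ← coeff_sig, ← flip_apply, hp k x hx, sgn_zero, one_smul]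

include hs hw in
lemma wt_tail : of (action D ħ Ω) (smooth_action hs hw) -
    (of (Ω 0) (hs 0) + (Complex.I * ħ) • of (Ω 1) (hs 1)) ∈ Wt W (Set.Iio 0) := by
  rw [mem_wt_iff]
  intro x hx d S h
  rw [map_sub, map_add, map_smul, at_of, at_of, at_of, map_sub, map_add, coeff_smul', coeff_action
    hs hw hx (orders d ∪ {0, 1}) Finset.subset_union_left] at h
  rw [← Finset.sum_sdiff (Finset.subset_union_right (s₁ := orders d) (s₂ := {0, 1})),
    Finset.sum_pair (by norm_num), pow_zero, pow_one, one_smul, add_sub_cancel_right, map_sum,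
    Finsupp.finsetSum_apply] at h
  obtain ⟨k, hk, h1⟩ := Finset.exists_ne_zero_of_sum_ne_zero h
  rw [map_smul, Finsupp.smul_apply] at h1
  have h2 := mem_wt_iff.mp (wt_order hs hw k) x hx d S (by
    rw [at_of]; exact fun h3 => h1 (by rw [h3, smul_zero]))
  rw [Set.mem_singleton_iff] at h2
  simp only [Finset.mem_sdiff, Finset.mem_insert, Finset.mem_singleton, not_or] at hk
  rw [Set.mem_Iio]
  omega

end Action

end BV

namespace BV

variable {D : FieldContent} {x : Body D} {V W : Opens (Body D)}

/-! ### Brackets of superfunctions -/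

lemma at_sum {κ : Type*} (s : Finset κ) (f : κ → SFR W) (hx : x ∈ W) : ev x hx (∑ k ∈ s, f k) = ∑
    k ∈ s, ev x hx (f k) := map_sum _ _ _

lemma sum_SF_apply {κ : Type*} (s : Finset κ) (f : κ → SF D) (x : Body D) : (∑ k ∈ s, f k) x = ∑ k ∈
    s, f k x := Finset.sum_apply _ _ _

lemma at_br_of {ι : Type*} [Fintype ι] (c : ι → Coord D) (E : ι → ι → SFR W) {f g : SF D}
    (hf : Smooth D W f) (hg : Smooth D W g) (hx : x ∈ W) : ev x hx
    ((sc W).br c E (of f hf) (of g hg)) = ∑ i, ∑ j, BV.rd D (c i) f x * ev x hx (E i j) * BV.ld D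
    (c j) g x := by
  rw [br, at_sum]
  refine sum_congr rfl fun i _ => ?_
  rw [at_sum]
  refine sum_congr rfl fun j _ => ?_
  rw [map_mul, map_mul, sc_ld_of, sc_rd_of, at_of, at_of]

section Data

variable {E : Bivector D} (hE : IsAntisymplectic D V E) {Θ : Fin (2 * D.ND) → SF D}
  (hΘ : IsSecondClass D V E Θ) {ρ : SF D} (hρ : IsDensity D V ρ)

/-- The bivector as a matrix of superfunctions. -/
def biv (A B : Fin (2 * D.N)) : SFR V := of (E A B) (hE.smooth A B)

/-- The second-class constraints. -/
def theta (a : Fin (2 * D.ND)) : SFR V := of (Θ a) (hΘ.smooth a)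

lemma bracket_eq {f g : SF D} (hf : Smooth D V f) (hg : Smooth D V g) (hx : x ∈ V) : ev x hx
    ((sc V).br (gam D) (biv hE) (of f hf) (of g hg)) = bracket D E f g x := by
  rw [at_br_of, bracket, sum_SF_apply]
  refine sum_congr rfl fun A _ => ?_
  rw [sum_SF_apply]
  refine sum_congr rfl fun B _ => ?_
  rw [biv, at_of]
  rfl

include hE in
lemma smooth_bracket {f g : SF D} (hf : Smooth D V f) (hg : Smooth D V g) : Smooth D V
    (bracket D E f g) :=
  ((sc V).br (gam D) (biv hE) (of f hf) (of g hg)).smooth.congr fun x hx => by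
    rw [← bracket_eq hE hf hg hx, at_apply]

lemma of_bracket {f g : SF D} (hf : Smooth D V f) (hg : Smooth D V g) : of (bracket D E f g)
    (smooth_bracket hE hf hg) = (sc V).br (gam D) (biv hE) (of f hf) (of g hg) := ext_at fun x hx =>
    by
  rw [at_of, bracket_eq]

lemma odd_biv : (sc V).OddBivector (gam D) (biv hE) :=
  ⟨fun A B => hom_of_iff.mpr (hE.parity A B), fun A B => ext_at fun x hx => by
    rw [map_neg, map_smul, biv, biv, at_of, at_of]; exact hE.skew A B x hx⟩

lemma isExt_biv (A B) : IsExt (biv hE A B) := isExt_of_gamFun _ (hE.isΓFun A B)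

lemma ld_biv (a : APi D ⊕ APi D) (A B) : (sc V).ld (inl (inr a)) (biv hE A B) = 0 :=
  ld_of_gamFun _ (hE.isΓFun A B) a

lemma hom_theta (a) : (sc V).Hom (D.parΘ a) (theta hΘ a) := hom_of_iff.mpr (hΘ.parity a)

lemma isExt_theta (a) : IsExt (theta hΘ a) := isExt_of_gamFun _ (hΘ.isΓFun a)

lemma isExt_br {ι : Type*} [Fintype ι] {c : ι → Ext D} {E : ι → ι → SFR W}
    (hE : ∀ i j, IsExt (E i j)) {f g : SFR W} (hf : IsExt f) (hg : IsExt g) : IsExt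
    ((sc W).br (fun i => inl (c i)) E f g) :=
  (ExtAlg W).sum_mem fun i _ => (ExtAlg W).sum_mem fun j _ =>
    (ExtAlg W).mul_mem ((ExtAlg W).mul_mem (hf.rd (c i)) (hE i j)) (hg.ld (c j))

lemma par_rep {q : ZMod 2} {f : SFR V} (hf : (sc V).Hom q f) : HasParity D V q f.rep := by
  rw [← hom_of_iff (hf := f.smooth), of_rep]; exact hf

/-- The Jacobi identity of the antibracket with an even function. -/
lemma jacobi_biv {g : SFR V} (hg : (sc V).Hom 0 g) {q : ZMod 2} {f : SFR V} (hf : (sc V).Hom q f) :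
    (sc V).br (gam D) (biv hE) ((sc V).br (gam D) (biv hE) f g) g = (1 / 2 : ℂ) • (sc V).br (gam D)
    (biv hE) f ((sc V).br (gam D) (biv hE) g g) := by
  have hO := odd_biv hE
  have h1 : sgn ((q + 1) * (0 + 1)) • (sc V).br (gam D) (biv hE) f ((sc V).br (gam D) (biv hE) g g) +
      sgn ((0 + 1) * (q + 1)) • (sc V).br (gam D) (biv hE) g ((sc V).br (gam D) (biv hE) g f) +
      sgn ((0 + 1) * (0 + 1)) • (sc V).br (gam D) (biv hE) g ((sc V).br (gam D) (biv hE) f g) = 0 := by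
    refine ext_at fun x hx => ?_
    have h2 := hE.jacobi q 0 0 f.rep g.rep g.rep f.smooth g.smooth g.smooth
      (par_rep hf)
      (par_rep hg)
      (par_rep hg) x hx
    rw [← bracket_eq hE f.smooth (smooth_bracket hE g.smooth g.smooth) hx, ← bracket_eq hE g.smooth
      (smooth_bracket hE f.smooth g.smooth) hx, ← bracket_eq hE g.smooth (smooth_bracket hE g.smooth
      f.smooth) hx] at h2
    rw [of_bracket hE f.smooth g.smooth, of_bracket hE g.smooth f.smooth, of_bracket hE g.smooth
      g.smooth, of_rep, of_rep] at h2
    rw [map_add, map_add, map_smul, map_smul, map_smul, map_zero]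
    exact h2
  rw [hO.br_skew hg hf, hO.br_skew hg (hO.br_hom hf hg)] at h1
  rw [neg_eq_sgn_smul, br_smul_right, br_smul_right, hO.br_skew hg (hO.br_hom hf hg)] at h1
  simp only [neg_eq_sgn_smul, sgn_smul_smul] at h1
  have h3 := congrArg (fun y => (2⁻¹ * sgn (q + 1)) • y) h1
  simp only [smul_add, smul_zero, mul_smul, sgn_smul_smul] at h3
  have k : ∀ q : ZMod 2, q + 1 + (q + 1) * (0 + 1) = 0 ∧
      q + 1 + ((0 + 1) * (q + 1) + (1 + ((0 + 1) * (q + 1) + (1 + (0 + 1) * (q + 0 + 1 + 1))))) = 1 ∧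
      q + 1 + ((0 + 1) * (0 + 1) + (1 + (0 + 1) * (q + 0 + 1 + 1))) = 1 := by decide
  obtain ⟨k1, k2, k3⟩ := k q
  rw [k1, k2, k3, sgn_zero, sgn_one, one_smul, neg_one_smul, add_assoc, ← smul_add, ← two_smul ℂ,
    smul_smul] at h3
  rw [show (1 / 2 : ℂ) = 2⁻¹ by norm_num, eq_comm, ← sub_eq_zero, ← h3]
  match_scalars <;> norm_num

lemma exists_theta_inv : ∃ N : Fin (2 * D.ND) → Fin (2 * D.ND) → SFR V, (∀ a b, IsExt (N a b)) ∧
    (Matrix.of fun a b => (sc V).br (gam D) (biv hE) (theta hΘ a) (theta hΘ b)) * Matrix.of N = 1 ∧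
    Matrix.of N * (Matrix.of fun a b => (sc V).br (gam D) (biv hE) (theta hΘ a) (theta hΘ b)) = 1 :=
    by
  obtain ⟨N, h1, h2, h3⟩ := exists_matrix_inverse
    (M := Matrix.of fun a b => (sc V).br (gam D) (biv hE) (theta hΘ a) (theta hΘ b))
    (fun a b => isExt_br (c := inl) (isExt_biv hE) (isExt_theta hΘ a) (isExt_theta hΘ b))
    (fun x hx => by
      convert hΘ.isUnit x hx using 1
      ext1 a b
      exact bracket_eq hE (hΘ.smooth a) (hΘ.smooth b) hx)
  exact ⟨N, h1, h2, h3⟩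

variable {N : Fin (2 * D.ND) → Fin (2 * D.ND) → SFR V}
  (h1 : (Matrix.of fun a b => (sc V).br (gam D) (biv hE) (theta hΘ a) (theta hΘ b)) * Matrix.of N = 1)
  (h2 : Matrix.of N * (Matrix.of fun a b => (sc V).br (gam D) (biv hE) (theta hΘ a) (theta hΘ b)) = 1)

include h1 h2

/-- The pointwise Dirac bracket. -/
lemma dirac_at {f g : SF D} (hf : Smooth D V f) (hg : Smooth D V g) (hx : x ∈ V) : ev x hx
    ((sc V).br (gam D) ((sc V).dir (gam D) (biv hE) (theta hΘ) N) (of f hf) (of g hg)) = dirac D E Θ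
    f g x := by
  have hm : ∀ M M' : Matrix (Fin (2 * D.ND)) (Fin (2 * D.ND)) (SFR V), M * M' = 1 →
      M.map (ev x hx) * M'.map (ev x hx) = 1 := fun M M' h => by
    rw [← Matrix.map_mul, h, Matrix.map_one _ (map_zero _) (map_one _)]
  have hT : (Matrix.of fun a b => (sc V).br (gam D) (biv hE) (theta hΘ a) (theta hΘ b)).map
      (ev x hx) = thetaMatrix D E Θ x := by
    ext1 a b
    exact bracket_eq hE (hΘ.smooth a) (hΘ.smooth b) hx
  have hN : Ring.inverse (thetaMatrix D E Θ x) = (Matrix.of N).map (ev x hx) :=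
    inverse_eq (by rw [← hT]; exact hm _ _ h1) (by rw [← hT]; exact hm _ _ h2)
  rw [br_dir, map_sub, bracket_eq, dirac, at_sum, hN]
  refine congrArg _ (sum_congr rfl fun a _ => ?_)
  rw [at_sum]
  refine sum_congr rfl fun b _ => ?_
  rw [map_mul, map_mul, theta, theta, bracket_eq, bracket_eq]
  rfl

lemma diracExt_at {f g : SF D} (hf : Smooth D V f) (hg : Smooth D V g) (hx : x ∈ V) : ev x hx
    ((sc V).br inl (EX ((sc V).dir (gam D) (biv hE) (theta hΘ) N)) (of f hf) (of g hg)) = diracExt D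
    E Θ f g x := by
  rw [EX, br_canon, map_add]
  change ev x hx ((sc V).br (gam D) _ _ _) + _ = _
  rw [dirac_at hE hΘ h1 h2, at_sum, diracExt]
  change _ = _ + (∑ a : APi D, (BV.rd D (piI D a) f * BV.ld D (piS D a) g - BV.rd D (piS D a) f *
    BV.ld D (piI D a) g)) x
  rw [sum_SF_apply]
  refine congrArg _ (sum_congr rfl fun a _ => ?_)
  rw [map_sub, map_mul, map_mul, sc_rd_of, sc_rd_of, sc_ld_of, sc_ld_of, at_of, at_of, at_of, at_of]
  rfl

lemma dir_at (A B : Fin (2 * D.N)) (hx : x ∈ V) : ev x hx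
    ((sc V).dir (gam D) (biv hE) (theta hΘ) N A B) = diracBivector D E Θ A B x := by
  rw [diracBivector, ← dirac_at hE hΘ h1 h2 (smooth_coord _) (smooth_coord _) hx]
  refine congrArg _ ?_
  change _ = (sc V).br (gam D) _ (xc _) (xc _)
  simp [br, ld_X, rd_X]

/-- The pointwise odd Laplacian. -/
lemma lapD_at {ρ' : SFR V} (hr : ρ' * of ρ hρ.smooth = 1) {f : SF D} (hf : Smooth D V f)
    (hx : x ∈ V) : ev x hx ((sc V).lap id (ET ((sc V).dir (gam D) (biv hE) (theta hΘ) N)) (of ρ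
    hρ.smooth) ρ' (of f hf)) = lapD D E Θ ρ f x := by
  have hrho : (sc V).Hom 0 (of ρ hρ.smooth) := hom_of_iff.mpr hρ.parity
  have hr' : of ρ hρ.smooth * ρ' = 1 := by
    rw [(sc V).even_mul _ _ (hom_zero_iff.mp hrho), hr]
  have hi : Ring.inverse (ρ x) = ev x hx ρ' :=
    inverse_eq (by rw [← at_of ρ hρ.smooth hx, ← map_mul, hr', map_one])
      (by rw [← at_of ρ hρ.smooth hx, ← map_mul, hr, map_one])
  rw [ET, lap_canon (c := id) _ hrho hr (fun _ => rfl) (fun m => ld_aux_of_ext (isExt_of_gamFun _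
    hρ.isΓFun) m)]
  change ev x hx ((sc V).lap inl _ _ _ _ + _) = _
  rw [EX, lap_canon (c := inl) _ hrho hr (fun _ => rfl) (fun m => ld_of_gamFun _ hρ.isΓFun m)]
  rw [map_add, map_add, lapD]
  refine congrArg₂ (· + ·) (congrArg₂ (· + ·) ?_ ?_) ?_
  · rw [lap, at_sum, oddLaplacian]
    refine sum_congr rfl fun A _ => ?_
    rw [at_sum]
    refine sum_congr rfl fun B _ => ?_
    rw [map_smul, map_mul, hi, sc_ld_at]
    refine congrArg (fun y => (sgn (D.parΓ A) / 2) • (ev x hx ρ' * y)) (ld_congr (W := V) ?_ _ hx)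
    intro y hy
    rw [← at_apply _ hy, map_mul, map_mul, dir_at hE hΘ h1 h2, sc_ld_of, at_of, at_of]
    rfl
  · rw [at_sum, sum_SF_apply]
    refine sum_congr rfl fun a _ => ?_
    rw [map_smul, sc_ld_of, sc_ld_of, at_of]
    rfl
  · rw [at_sum, sum_SF_apply]
    refine sum_congr rfl fun a _ => ?_
    rw [map_smul]
    simp only [id]
    rw [sc_ld_of, sc_ld_of, at_of]
    rfl

end Data

variable {E : Bivector D} {Θ : Fin (2 * D.ND) → SF D} {ρ : SF D} {Ω : ℕ → SF D} {ħ : ℂ}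

section Canon

variable (hE : IsAntisymplectic D V E) (hΘ : IsSecondClass D V E Θ)

lemma odd_canon_biv : (sc V).OddBivector (inl : Ext D → Coord D) (EX (biv hE)) :=
  OddBivector.canon (c := fun i : Ext D => (inl i : Coord D)) (odd_biv hE) fun _ => rfl

lemma rd_theta (a) (i : APi D ⊕ APi D) : (sc V).rd (inl (inr i)) (theta hΘ a) = 0 := by
  rw [(hom_theta hΘ a).rd_eq, theta, ld_of_gamFun _ (hΘ.isΓFun a), smul_zero]

lemma canon_theta_right (f : SFR V) (a) : (sc V).br inl (EX (biv hE)) f (theta hΘ a) = (sc V).br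
    (gam D) (biv hE) f (theta hΘ a) := by
  rw [EX, br_canon, sum_eq_zero, add_zero]
  intro m _
  rw [theta, ld_of_gamFun _ (hΘ.isΓFun a), ld_of_gamFun _ (hΘ.isΓFun a), mul_zero, mul_zero, sub_zero]

lemma canon_theta_left (f : SFR V) (a) : (sc V).br inl (EX (biv hE)) (theta hΘ a) f = (sc V).br
    (gam D) (biv hE) (theta hΘ a) f := by
  rw [EX, br_canon, sum_eq_zero, add_zero]
  intro m _
  rw [rd_theta, rd_theta, zero_mul, zero_mul, sub_zero]

lemma canon_dirac (N : Fin (2 * D.ND) → Fin (2 * D.ND) → SFR V) (f g : SFR V) : (sc V).br inl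
    (EX ((sc V).dir (gam D) (biv hE) (theta hΘ) N)) f g = (sc V).br inl (EX (biv hE)) f g - ∑ a, ∑
    b, (sc V).br inl (EX (biv hE)) f (theta hΘ a) * N a b * (sc V).br inl (EX (biv hE)) (theta hΘ b)
    g := by
  simp only [canon_theta_left, canon_theta_right]
  rw [EX, br_canon, EX, br_canon]
  change (sc V).br (gam D) _ f g + _ = (sc V).br (gam D) _ f g + _ - _
  rw [br_dir, sub_add_eq_add_sub]

lemma canon_jacobi {g : SFR V} (hg : (sc V).Hom 0 g) (f : SFR V) : (sc V).br inl (EX (biv hE))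
    ((sc V).br inl (EX (biv hE)) f g) g = (1 / 2 : ℂ) • (sc V).br inl (EX (biv hE)) f
    ((sc V).br inl (EX (biv hE)) g g) := by
  refine OddBivector.jacobi_canon (c := (inl : Ext D → Coord D)) (odd_biv hE) (fun _ => rfl)
    (fun m i j => ld_biv hE m i j) hg (fun i => ?_) f
  have h : ∀ k : SFR V, (sc V).ham (gam D) (biv hE) k i =
      (sc V).br (gam D) (biv hE) (xc (gam D i)) k := fun k => by
    simp [ham, br, rd_X]
  change (sc V).br (gam D) (biv hE) ((sc V).ham (gam D) (biv hE) g i) g =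
    (1 / 2 : ℂ) • (sc V).ham (gam D) (biv hE) ((sc V).br (gam D) (biv hE) g g) i
  rw [h, h]
  exact jacobi_biv hE hg (hom_X _)

end Canon

lemma IsExt.exists_inverse {f : SFR W} (hf : IsExt f) (h : ∀ x ∈ W, IsUnit (f.rep x)) : ∃ f' : SFR
    W, IsExt f' ∧ f * f' = 1 ∧ f' * f = 1 := by
  obtain ⟨R, r1, r2, r3⟩ := exists_matrix_inverse_of_body
    (M := Matrix.of fun _ _ : Fin 1 => f) (fun _ _ => hf) (fun x hx => by
      rw [isUnit_iff_isUnit_det, Matrix.det_unique]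
      exact (isUnit_Val_iff.mp (h x hx)).isUnit)
  refine ⟨R 0 0, r1 0 0, ?_, ?_⟩
  · have := congrFun (congrFun r2 0) 0
    rwa [mul_apply, Fin.sum_univ_one, Matrix.one_apply_eq] at this
  · have := congrFun (congrFun r3 0) 0
    rwa [mul_apply, Fin.sum_univ_one, Matrix.one_apply_eq] at this

/-- The data extracted from a gauge-fixing action. -/
theorem exists_gaugeData (hE : IsAntisymplectic D V E) (hΘ : IsSecondClass D V E Θ)
    (hρ : IsDensity D V ρ) (hħ : ħ ≠ 0) (hΩ : IsGaugeFixingAction D V ħ E Θ ρ Ω) : ∃ S : GaugeData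
    V, S.X0 = of (Ω 0) (hΩ.smooth 0) ∧ S.X1 = of (Ω 1) (hΩ.smooth 1) ∧ S.ρ = of ρ hρ.smooth ∧ (∀ {f
    g : SF D} (hf : Smooth D V f) (hg : Smooth D V g) {x : Body D} (hx : x ∈ V), ev x hx (S.bX (of f
    hf) (of g hg)) = diracExt D E Θ f g x) ∧ (∀ a f, S.bX (theta hΘ a) f = 0) ∧ ∀ {q : ZMod 2}
    {F g : SFR V}, (sc V).Hom q F → (sc V).Hom 0 g → S.bX (S.bX F g) g - (1 / 2 : ℂ) • S.bX F
    (S.bX g g) ∈ Ideal.span (Set.range (theta hΘ)) := by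
  obtain ⟨N, hN, h1, h2⟩ := exists_theta_inv hE hΘ
  have hO := odd_biv hE
  have oD := hO.dir (hom_theta hΘ) h1 h2
  have oX : (sc V).OddBivector (inl : Ext D → Coord D)
      (EX ((sc V).dir (gam D) (biv hE) (theta hΘ) N)) :=
    OddBivector.canon (c := fun i : Ext D => (inl i : Coord D)) oD fun _ => rfl
  have oT : (sc V).OddBivector id (ET ((sc V).dir (gam D) (biv hE) (theta hΘ) N)) :=
    OddBivector.canon (c := (id : Coord D → Coord D)) oX fun _ => rfl
  have xD : ∀ A B, IsExt ((sc V).dir (gam D) (biv hE) (theta hΘ) N A B) := fun A B => by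
    refine (ExtAlg V).sub_mem (isExt_biv hE A B) ((ExtAlg V).sum_mem fun a _ =>
      (ExtAlg V).sum_mem fun b _ => (ExtAlg V).mul_mem ((ExtAlg V).mul_mem ?_ (hN a b)) ?_)
    · exact (ExtAlg V).sum_mem fun j _ =>
        (ExtAlg V).mul_mem (isExt_biv hE A j) ((isExt_theta hΘ a).ld _)
    · exact (ExtAlg V).sum_mem fun j _ =>
        (ExtAlg V).mul_mem ((isExt_theta hΘ b).rd _) (isExt_biv hE j B)
  have hrho : (sc V).Hom 0 (of ρ hρ.smooth) := hom_of_iff.mpr hρ.parity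
  obtain ⟨R, r1, r2, hr⟩ := (isExt_of_gamFun hρ.smooth hρ.isΓFun).exists_inverse
    fun x hx => by rw [← at_apply _ hx, at_of]; exact hρ.isUnit x hx
  have hsm := smooth_action (ħ := ħ) hΩ.smooth hΩ.planck
  have e0 : (sc V).Hom 0 (of (Ω 0) (hΩ.smooth 0)) := hom_of_iff.mpr (hΩ.parity 0)
  have e1 : (sc V).Hom 0 (of (Ω 1) (hΩ.smooth 1)) := hom_of_iff.mpr (hΩ.parity 1)
  have eA : (sc V).Hom 0 (of (action D ħ Ω) hsm) :=
    hom_of_iff.mpr (action_parity hΩ.smooth hΩ.parity hΩ.planck)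
  have w0 := wt_order hΩ.smooth hΩ.planck 0
  have w1 := wt_order hΩ.smooth hΩ.planck 1
  rw [Nat.cast_zero, sub_zero] at w0
  rw [Nat.cast_one, sub_self] at w1
  have ht : Complex.I * ħ ≠ 0 := mul_ne_zero Complex.I_ne_zero hħ
  have hY : (sc V).Hom 0 (-(Complex.I * ħ)⁻¹ • of (action D ħ Ω) hsm) := eA.smul _
  set Y := -(Complex.I * ħ)⁻¹ • of (action D ħ Ω) hsm
  have hb : ∀ x (hx : x ∈ V), ev x hx (SFR.exp Y) = boltzmann D ħ Ω x := fun x hx => by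
    rw [at_exp, map_smul, at_of, boltzmann]
    congr 2
    field_simp
    rw [Complex.I_sq]
  have hexp : SFR.exp Y = of (boltzmann D ħ Ω) ((SFR.exp Y).smooth.congr fun x hx => by
      rw [← at_apply _ hx, hb]) := ext_at fun x hx => by rw [hb, at_of]
  have hm : (sc V).lap id (ET ((sc V).dir (gam D) (biv hE) (theta hΘ) N)) (of ρ hρ.smooth)
      R (SFR.exp Y) = 0 := by
    rw [hexp]
    refine ext_at fun x hx => ?_
    rw [lapD_at hE hΘ hρ h1 h2 hr, hΩ.master x hx, map_zero]
  rw [oT.lap_exp hrho hr hY (fun z => SFR.ld_exp (hom_zero_iff.mp hY) z)] at hm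
  have hm' := SFR.mul_exp_eq_zero hm
  have ho := master_orders xD oT (isExt_of_gamFun _ hρ.isΓFun) r1 ht e0 e1
    ((eA.sub (e0.add (e1.smul (Complex.I * ħ))))) w0 w1
    (wt_tail hΩ.smooth hΩ.planck) (by rwa [add_sub_cancel])
  refine ⟨⟨_, oD, xD, of ρ hρ.smooth, R, hrho, isExt_of_gamFun _ hρ.isΓFun, hr, r1, ld_of_gamFun _
    hρ.isΓFun, _, _, e0, e1, w0, w1, ho.1, ho.2⟩, rfl, rfl, rfl, ?_, ?_, ?_⟩
  · intro f g hf hg x hx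
    exact diracExt_at hE hΘ h1 h2 hf hg hx
  all_goals
    have h1' : (Matrix.of fun a b => (sc V).br inl (EX (biv hE)) (theta hΘ a) (theta hΘ b)) *
        Matrix.of N = 1 := by simpa only [canon_theta_left] using h1
    have h2' : Matrix.of N * (Matrix.of fun a b =>
        (sc V).br inl (EX (biv hE)) (theta hΘ a) (theta hΘ b)) = 1 := by
      simpa only [canon_theta_left] using h2
  · exact fun a f => dirac_Θ_left (canon_dirac hE hΘ N) h1' a f
  · intro q F g hF hg
    exact dirac_jacobi (odd_canon_biv hE) oX (hom_theta hΘ) (hO.dirac_hom (hom_theta hΘ) h1 h2)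
      (canon_dirac hE hΘ N) h1' h2' hg (fun g' f hg' => canon_jacobi hE hg' f) hF

variable {F : AExt D → SF D} {e : BarIdx D ≃ Ext D}

lemma smooth_atZero {f : SF D} (hf : Smooth D W f) : Smooth D W (atZero D f) :=
  (smooth_res _ hf).congr fun x _ => atZero_eq f x

lemma rr_of {f : SF D} (hf : Smooth D W f) (h : of f hf ∈ Wt W {0}) : rr (of f hf) = of (atZero D f)
    (smooth_atZero hf) := by
  rw [rr, resL_zero h, res_of]
  exact of_congr _ _ fun x _ => (atZero_eq f x).symm

namespace GaugeData

variable {S : GaugeData W} {hs0 : Smooth D W (Ω 0)} (h0 : S.X0 = of (Ω 0) hs0)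
include h0

lemma G_eq (a : AExt D) : S.G a = of (BV.G D Ω a) (smooth_atZero (smooth_rd hs0 (lam D a))) := by
  have h1 := S.wt_rd_X0 (lam D a)
  rw [show plC (lam D a) = 1 from rfl, sub_self, h0, sc_rd_of] at h1
  rw [GaugeData.G, h0, sc_rd_of, rr_of _ h1]
  rfl

lemma Dl_at (i : Fin D.s) (hx : x ∈ W) : (S.Dl i).map (ev x hx) = FP D Ω i x := by
  ext1 a b
  have h1 := S.wt_h (fld D (bF i a)) (fld D (cF i b))
  rw [show (1 : ℤ) - plC (fld D (bF i a)) - plC (fld D (cF i b)) = 0 by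
    rw [plC_fld, plC_fld, plFld_bF, plFld_cF]; ring, h0, sc_rd_of, sc_ld_of] at h1
  change ev x hx (S.h (fld D (bF i a)) (fld D (cF i b))) = _
  rw [GaugeData.h, h0, sc_rd_of, sc_ld_of, rr_of _ h1, at_of]
  rfl

omit h0 in
lemma X1_eq {hs1 : Smooth D W (Ω 1)} (h1 : S.X1 = of (Ω 1) hs1) : rr S.X1 = of (H D Ω)
    (smooth_atZero hs1) := by
  rw [h1, rr_of _ (h1 ▸ S.wt1)]
  rfl

end GaugeData

/-- The adapted coordinates of a gauge-fixing action. -/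
theorem exists_bars (hE : IsAntisymplectic D V E) (hΘ : IsSecondClass D V E Θ)
    (hρ : IsDensity D V ρ) (hħ : ħ ≠ 0) (hΩ : IsGaugeFixingAction D V ħ E Θ ρ Ω)
    (hF : IsCoordinateSystem D V e (barΓ D F Ω Θ)) (hW : W ≤ V)
    (hu : ∀ x ∈ W, IsUnit (FG D E Θ F Ω x) ∧ ∀ i, IsUnit (FP D Ω i x)) : ∃ (S : GaugeData W)
    (B : Bars S), S.X0 = of (Ω 0) ((hΩ.smooth 0).mono hW) ∧ S.X1 = of (Ω 1)
    ((hΩ.smooth 1).mono hW) ∧ S.ρ = of ρ (hρ.smooth.mono hW) ∧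
    (∀ b, B.Γ b = of (barΓ D F Ω Θ b) ((hF.smooth b).mono hW)) ∧ ∀ x (hx : x ∈ W), B.M.map
    (ev x hx) = FG D E Θ F Ω x := by
  obtain ⟨T, hX0, hX1, hr, hbr, hl, hj⟩ := exists_gaugeData hE hΘ hρ hħ hΩ
  let S := T.restr hW
  have h0 : S.X0 = of (Ω 0) ((hΩ.smooth 0).mono hW) := by
    change restr hW T.X0 = _
    rw [hX0, restr_of]
  have hG := GaugeData.G_eq h0
  have hFs : ∀ a, Smooth D V (F a) := fun a => hF.smooth (inl a)
  have hGs : ∀ a, Smooth D V (BV.G D Ω a) := fun a => hF.smooth (inr (inl a))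
  let Fs : AExt D → SFR W := fun a => of (F a) ((hFs a).mono hW)
  let Θs : Fin (2 * D.ND) → SFR W := fun a => restr hW (theta hΘ a)
  let Γs := Sum.elim Fs (Sum.elim S.G Θs)
  have hΓ : ∀ b, Γs b =
      of (barΓ D F Ω Θ b) ((hF.smooth b).mono hW) := by
    rintro (a | a | a)
    · rfl
    · exact hG a
    · exact restr_of hW _ _
  have hext : ∀ b, IsExt (Γs b) := fun b => by
    rw [hΓ, isExt_of_iff]; exact fun x hx => hF.isExtFun b x (hW hx)
  have hpar : ∀ b, (sc W).Hom (parBar D b) (Γs b) := fun b => by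
    rw [hΓ, hom_of_iff]; exact fun x hx => hF.parity b x (hW hx)
  have hbX : ∀ f g : SFR V, S.bX (restr hW f) (restr hW g) = restr hW (T.bX f g) :=
    fun f g => by
      rw [GaugeData.bX, GaugeData.bX, restr_br, restr_EX]; rfl
  have hM : ∀ x (hx : x ∈ W), (Matrix.of fun b e => S.bX (Fs b) (S.G e)).map (ev x hx) =
      FG D E Θ F Ω x := fun x hx => by
    ext1 a b
    have h1 := hbX (of (F a) (hFs a))
      (of (BV.G D Ω b) (hGs b))
    rw [restr_of, restr_of] at h1
    rw [Matrix.map_apply, of_apply, hG, h1, at_restr]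
    exact hbr _ _ (hW hx)
  obtain ⟨M', -, m2, m3⟩ := exists_matrix_inverse
    (M := Matrix.of fun b e => S.bX (Fs b) (S.G e))
    (fun a b => Bars.ext_bX (hext (inl a)) (S.ext_G b))
    (fun x hx => by
      have := (hu x hx).1
      rwa [← hM x hx] at this)
  have hD : ∀ n, ∃ N : Matrix (AIdx D (n + 1)) (AIdx D (n + 1)) (SFR W),
      (∀ i j, IsExt (N i j)) ∧ S.Dl n * N = 1 ∧ N * S.Dl n = 1 := fun n => by
    by_cases hn : n < D.s
    · refine exists_matrix_inverse (S.ext_Dl n) fun x hx => ?_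
      have := (hu x hx).2 ⟨n, hn⟩
      rwa [← GaugeData.Dl_at h0 ⟨n, hn⟩ hx] at this
    · have : IsEmpty (AIdx D (n + 1)) :=
        ⟨fun a => hn (Nat.lt_of_succ_lt_succ (lt_of_le_of_lt a.2 a.1.1.2))⟩
      exact ⟨1, fun i => isEmptyElim i, Subsingleton.elim _ _, Subsingleton.elim _ _⟩
  choose Di d1 d2 d3 using hD
  have hJ : ∀ x (hx : x ∈ W), (((sc W).jac inl Γs).submatrix
      e.symm id).map (ev x hx) = jacobian D e (barΓ D F Ω Θ) x := fun x hx => by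
    ext1 X Y
    change ev x hx ((sc W).rd (inl Y) (Γs (e.symm X))) = _
    rw [hΓ, sc_rd_of, at_of]
    rfl
  obtain ⟨K, k1, k2, k3⟩ := exists_matrix_inverse
    (M := ((sc W).jac inl Γs).submatrix e.symm id)
    (fun X Y => (hext (e.symm X)).rd Y)
    (fun x hx => by
      have := hF.isUnit x (hW hx)
      rwa [← hJ x hx] at this)
  have hXX : ∀ j a, ∑ i, (sc W).rd (inl i) (Θs a) * EX S.ED i j = 0 := fun j a => by
    have h1 : T.bX (theta hΘ a) (xc (inl j)) = 0 := hl _ _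
    have h2 := congrArg (restr hW) h1
    rw [← hbX, map_zero] at h2
    rw [← h2, GaugeData.bX, br]
    refine sum_congr rfl fun i _ => ?_
    rw [sum_eq_single j, ← restr_ld, ld_X, if_pos rfl, map_one, mul_one]
    · intro k _ hk
      rw [← restr_ld, ld_X, if_neg fun h => hk (Sum.inl_injective h), map_zero, mul_zero]
    · intro h; exact absurd (mem_univ _) h
  let B : Bars S :=
    { F := Fs
      Θ := Θs
      hom_F := fun a => hpar (inl a)
      ext_F := fun a => hext (inl a)
      hom_Θ := fun a => hpar (inr (inr a))
      ext_Θ := fun a => hext (inr (inr a))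
      Θ_left := fun a f => by
        rw [GaugeData.bX, br, sum_comm]
        refine sum_eq_zero fun j _ => ?_
        rw [← sum_mul, hXX, zero_mul]
      K := K.submatrix id e
      jac_K := by
        have h := congrArg (fun T => Matrix.submatrix T e e) k2
        rw [Matrix.submatrix_one_equiv] at h
        rw [← h]
        ext1 b c
        simp [Γs, mul_apply]
      K_jac := by
        rw [← k3]
        ext1 b c
        rw [mul_apply, mul_apply, ← Equiv.sum_comp e.symm]
        simp [Γs]
      ext_K := fun i b => k1 i (e b)
      Di := Di
      Dl_Di := d2
      Di_Dl := d3
      ext_Di := d1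
      M' := M'
      M_M' := m2
      M'_M := m3
      jacobi := fun b => by
        have hFb : (sc V).Hom (parAl D b.1 + 1) (of (F b) (hFs b)) :=
          hom_of_iff.mpr (hF.parity (inl b))
        have h1 := hj hFb T.even_g
        have h2 := Ideal.mem_map_of_mem (restr hW) h1
        rw [Ideal.map_span, ← Set.range_comp] at h2
        rw [map_sub, map_smul, ← hbX, ← hbX, ← hbX, ← hbX, restr_of] at h2
        have h3 : restr hW T.g = S.g := restr_res hW _ _
        rw [h3] at h2
        exact h2 }
  refine ⟨S, B, h0, ?_, ?_, hΓ, hM⟩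
  · change restr hW T.X1 = _
    rw [hX1, restr_of]
  · change restr hW T.ρ = _
    rw [hr, restr_of]

end BV

namespace Hadamard

open Set Metric Topology MeasureTheory

section

variable {E F : Type*} [NormedAddCommGroup E] [NormedSpace ℝ E] [NormedAddCommGroup F]
  [NormedSpace ℝ F]

/-- Smoothness of an integral depending on a parameter. -/
lemma contDiffOn_integral {s : Set E} (hs : IsOpen s) {Φ : E → ℝ → F} {k : Set ℝ} (hk : IsCompact k)
    (h0 : ∀ p ∈ s, ∀ t ∉ k, Φ p t = 0)
    (hΦ : ContDiffOn ℝ ∞ (fun q : E × ℝ => Φ q.1 q.2) (s ×ˢ univ)) : ContDiffOn ℝ ∞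
    (fun p => ∫ t, Φ p t) s := by
  have h := contDiffOn_convolution_left_with_param_comp (μ := volume) (n := (⊤ : ℕ∞))
    (L := ContinuousLinearMap.flip (ContinuousLinearMap.lsmul ℝ ℝ : ℝ →L[ℝ] F →L[ℝ] F))
    (v := fun _ : E => (0 : ℝ)) contDiffOn_const (f := fun _ : ℝ => (1 : ℝ))
    (g := Φ) hs hk (fun p t hp ht => h0 p hp t ht) (locallyIntegrable_const 1) hΦ
  refine h.congr fun p _ => ?_
  simp [MeasureTheory.convolution]

end

section

variable {ι : Type*} (p : Set ι) [DecidablePred (· ∈ p)]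

/-- Scaling the coordinates in `p`. -/
def scale (t : ℝ) (z : ι → ℝ) : ι → ℝ := fun i => if i ∈ p then t * z i else z i

/-- The projection on the coordinates in `p`. -/
def proj (z : ι → ℝ) : ι → ℝ := fun i => if i ∈ p then z i else 0

lemma hasDerivAt_scale [Fintype ι] (z : ι → ℝ) (t : ℝ) : HasDerivAt (fun t => scale p t z)
    (proj p z) t := by
  rw [hasDerivAt_pi]
  intro i
  by_cases hi : i ∈ p
  · simpa [scale, proj, hi] using (hasDerivAt_id t).mul_const (z i)
  · simpa [scale, proj, hi] using hasDerivAt_const t (z i)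

lemma contDiff_scale [Fintype ι] : ContDiff ℝ ∞ (fun q : (ι → ℝ) × ℝ => scale p q.2 q.1) := by
  rw [contDiff_pi]
  intro i
  by_cases hi : i ∈ p
  · simp only [scale, hi, if_true]; fun_prop
  · simp only [scale, hi, if_false]; fun_prop

lemma proj_eq_sum [Fintype ι] [DecidableEq ι] (z : ι → ℝ) : proj p z = ∑ i,
    (if i ∈ p then z i else 0) • (Pi.single i 1 : ι → ℝ) := by
  ext j
  rw [Finset.sum_apply, sum_eq_single j]
  · simp [proj]
  · intro i _ hi; simp [hi.symm]
  · simp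

lemma scale_mem_ball [Fintype ι] {z₀ z : ι → ℝ} {r t : ℝ} (h0 : ∀ i ∈ p, z₀ i = 0)
    (hz : z ∈ ball z₀ r) (ht0 : 0 ≤ t) (ht1 : t ≤ 1) : scale p t z ∈ ball z₀ r := by
  rw [mem_ball, dist_pi_lt_iff (pos_of_mem_ball hz)]
  intro i
  have hi := (dist_le_pi_dist z z₀ i).trans_lt (mem_ball.1 hz)
  by_cases hp : i ∈ p
  · simp only [scale, hp, if_true, h0 i hp, dist_zero_right] at hi ⊢
    rw [norm_mul, Real.norm_of_nonneg ht0]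
    exact (mul_le_of_le_one_left (norm_nonneg _) ht1).trans_lt hi
  · simpa [scale, hp] using hi

/-- Hadamard's lemma on a ball centred on the common zero locus of the coordinates in `p`. -/
theorem ball_version [Fintype ι] {z₀ : ι → ℝ} {r : ℝ} (h0 : ∀ i ∈ p, z₀ i = 0) {k : (ι → ℝ) → ℂ}
    (hk : ContDiffOn ℝ ∞ k (ball z₀ r)) (hv : ∀ z ∈ ball z₀ r, (∀ i ∈ p, z i = 0) → k z = 0) : ∃ u :
    ι → (ι → ℝ) → ℂ, (∀ i, ContDiffOn ℝ ∞ (u i) (ball z₀ r)) ∧ ∀ z ∈ ball z₀ r, k z = ∑ i, if i ∈ p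
    then (z i : ℂ) * u i z else 0 := by
  classical
  let σ := Real.smoothTransition
  have hσ : ContDiff ℝ ∞ σ := Real.smoothTransition.contDiff
  have hmem : ∀ z ∈ ball z₀ r, ∀ t, scale p (σ t) z ∈ ball z₀ r := fun z hz t =>
    scale_mem_ball p h0 hz (Real.smoothTransition.nonneg t) (Real.smoothTransition.le_one t)
  have hdσ : ContDiff ℝ ∞ (deriv σ) := hσ.deriv'
  have hd0 : ∀ t ∉ Icc (0 : ℝ) 1, deriv σ t = 0 := by
    intro t ht
    rw [mem_Icc, not_and_or, not_le, not_le] at ht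
    have : σ =ᶠ[𝓝 t] fun _ => σ t := by
      rcases ht with ht | ht
      · filter_upwards [Iio_mem_nhds ht] with s hs
        exact (Real.smoothTransition.zero_of_nonpos (le_of_lt hs)).trans
          (Real.smoothTransition.zero_of_nonpos ht.le).symm
      · filter_upwards [Ioi_mem_nhds ht] with s hs
        exact (Real.smoothTransition.one_of_one_le (le_of_lt hs)).trans
          (Real.smoothTransition.one_of_one_le ht.le).symm
    rw [this.deriv_eq, deriv_const]
  have hfd : ContDiffOn ℝ ∞ (fderiv ℝ k) (ball z₀ r) :=
    hk.fderiv_of_isOpen isOpen_ball (by simp)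
  let Φ : ι → (ι → ℝ) → ℝ → ℂ := fun i z t =>
    deriv σ t • fderiv ℝ k (scale p (σ t) z) (Pi.single i 1)
  have hΦ : ∀ i, ContDiffOn ℝ ∞ (fun q : (ι → ℝ) × ℝ => Φ i q.1 q.2) (ball z₀ r ×ˢ univ) := by
    intro i
    have h1 : ContDiffOn ℝ ∞ (fun q : (ι → ℝ) × ℝ => scale p (σ q.2) q.1) (ball z₀ r ×ˢ univ) :=
      ((contDiff_scale p).comp (contDiff_fst.prodMk (hσ.comp contDiff_snd))).contDiffOn
    have h2 := hfd.comp h1 fun q hq => hmem q.1 hq.1 q.2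
    exact ((hdσ.comp contDiff_snd).contDiffOn).smul (h2.clm_apply contDiffOn_const)
  refine ⟨fun i z => ∫ t, Φ i z t, fun i => contDiffOn_integral isOpen_ball
    (isCompact_Icc (a := (0 : ℝ)) (b := 1)) (fun z _ t ht => by simp only [Φ, hd0 t ht, zero_smul]) (hΦ i), fun z hz => ?_⟩
  have hder : ∀ t, HasDerivAt (fun t => k (scale p (σ t) z))
      (∑ i, if i ∈ p then (z i : ℂ) * Φ i z t else 0) t := by
    intro t
    have h1 : HasFDerivAt k (fderiv ℝ k (scale p (σ t) z)) (scale p (σ t) z) :=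
      ((hk.contDiffAt (isOpen_ball.mem_nhds (hmem z hz t))).differentiableAt (by simp)).hasFDerivAt
    have h2 : HasDerivAt (fun t => scale p (σ t) z) (deriv σ t • proj p z) t :=
      (hasDerivAt_scale p z (σ t)).scomp t
        ((hσ.differentiable (by simp)) t).hasDerivAt
    have h3 := h1.comp_hasDerivAt t h2
    refine h3.congr_deriv ?_
    rw [map_smul, proj_eq_sum, map_sum, smul_sum]
    refine sum_congr rfl fun i _ => ?_
    by_cases hi : i ∈ p
    · simp only [hi, if_true, Φ, map_smul, Complex.real_smul]; ring
    · simp [hi]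
  have hcont : ∀ i, Continuous fun t => Φ i z t := fun i => by
    have := (hΦ i).continuousOn.comp_continuous (f := fun t : ℝ => (z, t)) (by fun_prop)
      (fun t => ⟨hz, mem_univ t⟩)
    exact this
  have hcont' : ∀ i, Continuous fun t => if i ∈ p then (z i : ℂ) * Φ i z t else 0 := fun i => by
    by_cases hi : i ∈ p
    · simp only [hi, if_true]; exact continuous_const.mul (hcont i)
    · simp only [hi, if_false]; exact continuous_const
  have hint : ∀ i, ∫ t in (0 : ℝ)..1, Φ i z t = ∫ t, Φ i z t := by
    intro i
    rw [intervalIntegral.integral_of_le zero_le_one, ← integral_Icc_eq_integral_Ioc]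
    exact setIntegral_eq_integral_of_forall_compl_eq_zero fun t ht => by
      simp only [Φ, hd0 t ht, zero_smul]
  have hftc := intervalIntegral.integral_eq_sub_of_hasDerivAt (a := 0) (b := 1)
    (fun t _ => hder t)
    (Continuous.intervalIntegrable (continuous_finsetSum _ fun i _ => hcont' i) _ _)
  have e1 : scale p (σ 1) z = z := by
    ext i; simp [scale, σ]
  have e0 : k (scale p (σ 0) z) = 0 := hv _ (hmem z hz 0) fun i hi => by simp [scale, σ, hi]
  rw [e1, e0, sub_zero] at hftc
  rw [← hftc, intervalIntegral.integral_finsetSum]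
  · refine sum_congr rfl fun i _ => ?_
    by_cases hi : i ∈ p
    · simp only [hi, if_true]
      rw [← hint, intervalIntegral.integral_const_mul]
    · simp [hi]
  · exact fun i _ => (hcont' i).intervalIntegrable _ _

end

/-- A smooth map with invertible derivatives has smooth local inverses. -/
lemma exists_chart {E : Type*} [NormedAddCommGroup E] [NormedSpace ℝ E] [CompleteSpace E]
    {W : Set E} (hW : IsOpen W) {y : E → E} (hy : ContDiffOn ℝ ∞ y W)
    (hd : ∀ x ∈ W, ∃ f : E ≃L[ℝ] E, HasFDerivAt y (f : E →L[ℝ] E) x) {x₀ : E} (hx : x₀ ∈ W) : ∃ r >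
    0, ∃ φ : E → E, (∀ z ∈ ball (y x₀) r, φ z ∈ W ∧ y (φ z) = z) ∧ ContDiffOn ℝ ∞ φ
    (ball (y x₀) r) ∧ ∀ᶠ x in 𝓝 x₀, x ∈ W ∧ y x ∈ ball (y x₀) r ∧ φ (y x) = x := by
  obtain ⟨f, hf⟩ := hd x₀ hx
  have hc := hy.contDiffAt (hW.mem_nhds hx)
  let e := hc.toOpenPartialHomeomorph y hf (by simp)
  have he : ∀ x, e x = y x := fun x => rfl
  have hs : x₀ ∈ e.source := hc.mem_toOpenPartialHomeomorph_source hf (by simp)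
  have hT : IsOpen (e.target ∩ e.symm ⁻¹' W) := e.isOpen_inter_preimage_symm hW
  have hm : y x₀ ∈ e.target ∩ e.symm ⁻¹' W := ⟨by rw [← he]; exact e.map_source hs, by
    rw [mem_preimage, ← he, e.left_inv hs]; exact hx⟩
  obtain ⟨r, hr, hb⟩ := Metric.isOpen_iff.1 hT _ hm
  refine ⟨r, hr, e.symm, fun z hz => ⟨(hb hz).2, e.right_inv (hb hz).1⟩, fun z hz => ?_, ?_⟩
  · obtain ⟨f', hf'⟩ := hd _ (hb hz).2
    exact (e.contDiffAt_symm (hb hz).1 hf' (hy.contDiffAt (hW.mem_nhds (hb hz).2))).contDiffWithinAt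
  · filter_upwards [hW.mem_nhds hx, e.open_source.mem_nhds hs, hc.continuousAt.preimage_mem_nhds
      (ball_mem_nhds _ hr)] with x h1 h2 h3
    exact ⟨h1, h3, e.left_inv h2⟩

open Set Metric Topology MeasureTheory
open scoped Manifold in

/-- Gluing of local smooth solutions of a family of convex conditions on an open set. -/
lemma glue {E F : Type*} [NormedAddCommGroup E] [NormedSpace ℝ E] [FiniteDimensional ℝ E]
    [NormedAddCommGroup F] [NormedSpace ℝ F] (W : Opens E) {t : E → Set F}
    (ht : ∀ x ∈ W, Convex ℝ (t x))
    (hl : ∀ x ∈ W, ∃ N ∈ 𝓝 x, N ⊆ W ∧ ∃ g : E → F, ContDiffOn ℝ ∞ g N ∧ ∀ y ∈ N, g y ∈ t y) : ∃ g :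
    E → F, ContDiffOn ℝ ∞ g W ∧ ∀ x ∈ W, g x ∈ t x := by
  classical
  have hσ : SigmaCompactSpace W := by
    have := FiniteDimensional.proper_real E
    have := W.isOpen.locallyCompactSpace
    infer_instance
  obtain ⟨g, hg⟩ := exists_contMDiffMap_forall_mem_convex_of_local (n := (⊤ : ℕ∞)) (F := F)
    (I := 𝓘(ℝ, E)) (M := W) (t := fun x => t x) (fun x => ht x x.2) fun x => by
      obtain ⟨N, hN, -, g, hg, hgt⟩ := hl x x.2
      obtain ⟨N', hN', ho, hx⟩ := _root_.mem_nhds_iff.1 hN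
      refine ⟨Subtype.val ⁻¹' N', (continuous_subtype_val.continuousAt).preimage_mem_nhds
        (ho.mem_nhds hx), fun y => g y, fun y hy => ?_, fun y hy => hgt _ (hN' hy)⟩
      refine ContMDiffAt.contMDiffWithinAt (contMDiffAt_subtype_iff.2 ?_)
      exact contMDiffAt_iff_contDiffAt.2
        ((hg.mono hN').contDiffAt (ho.mem_nhds hy))
  refine ⟨fun x => if h : x ∈ W then g ⟨x, h⟩ else 0, fun x hx => ?_, fun x hx => ?_⟩
  · refine ContDiffAt.contDiffWithinAt (contMDiffAt_iff_contDiffAt.1 ?_)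
    refine (contMDiffAt_subtype_iff (U := W) (x := ⟨x, hx⟩)).1 ?_
    have : (fun y : W => if h : (y : E) ∈ W then g ⟨y, h⟩ else 0) = g := by
      funext y; exact dif_pos y.2
    rw [this]
    exact g.contMDiff ⟨x, hx⟩
  · simp only [dif_pos hx]; exact hg ⟨x, hx⟩

variable {ι : Type*} [Fintype ι] (p : Set ι) {W : Opens (ι → ℝ)}
  {y : (ι → ℝ) → ι → ℝ}

/-- Hadamard's lemma: a smooth function which vanishes on the common zero locus of some of the
functions of a coordinate system is a combination of these functions. -/
theorem exists_eq_sum [DecidablePred (· ∈ p)] (hy : ContDiffOn ℝ ∞ y W)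
    (hd : ∀ x ∈ W, ∃ f : (ι → ℝ) ≃L[ℝ] (ι → ℝ), HasFDerivAt y (f : (ι → ℝ) →L[ℝ] (ι → ℝ)) x)
    {w : (ι → ℝ) → ℂ} (hw : ContDiffOn ℝ ∞ w W) (h0 : ∀ x ∈ W, (∀ i ∈ p, y x i = 0) → w x = 0) : ∃
    u : ι → (ι → ℝ) → ℂ, (∀ i, ContDiffOn ℝ ∞ (u i) W) ∧ ∀ x ∈ W, w x = ∑ i, if i ∈ p then
    (y x i : ℂ) * u i x else 0 := by
  classical
  have hyi : ∀ i, ContDiffOn ℝ ∞ (fun x => (y x i : ℂ)) W := fun i =>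
    Complex.ofRealCLM.contDiff.comp_contDiffOn (contDiffOn_pi.1 hy i)
  have hl : ∀ x ∈ W, ∃ N ∈ 𝓝 x, N ⊆ W ∧ ∃ g : (ι → ℝ) → ι → ℂ, ContDiffOn ℝ ∞ g N ∧
      ∀ z ∈ N, g z ∈ {u | w z = ∑ i, if i ∈ p then (y z i : ℂ) * u i else 0} := by
    intro x hx
    by_cases hp : ∀ i ∈ p, y x i = 0
    · obtain ⟨r, hr, φ, h1, h2, h3⟩ := exists_chart W.isOpen hy hd hx
      obtain ⟨u, hu, huw⟩ := ball_version p (z₀ := y x) (r := r) hp (k := w ∘ φ)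
        (hw.comp h2 fun z hz => (h1 z hz).1) fun z hz hz0 => h0 _ (h1 z hz).1 fun i hi => by
          rw [(h1 z hz).2]; exact hz0 i hi
      obtain ⟨N, hN, ho, hxN⟩ := _root_.mem_nhds_iff.1 h3
      refine ⟨N, ho.mem_nhds hxN, fun z hz => (hN hz).1, fun z i => u i (y z), ?_, fun z hz => ?_⟩
      · exact contDiffOn_pi.2 fun i => (hu i).comp (hy.mono fun z hz => (hN hz).1)
          fun z hz => (hN hz).2.1
      · change w z = _
        rw [← huw _ (hN hz).2.1, Function.comp_apply, (hN hz).2.2]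
    · push Not at hp
      obtain ⟨i, hi, hne⟩ := hp
      have hc : ContinuousAt (fun x => y x i) x :=
        (continuous_apply i).continuousAt.comp (hy.continuousOn.continuousAt (W.isOpen.mem_nhds hx))
      obtain ⟨N, hN, ho, hxN⟩ := _root_.mem_nhds_iff.1
        ((hc.eventually_ne hne).and (W.isOpen.mem_nhds hx))
      refine ⟨N, ho.mem_nhds hxN, fun z hz => (hN hz).2, fun z => Pi.single i (w z * (y z i : ℂ)⁻¹),
        ?_, fun z hz => ?_⟩
      · refine contDiffOn_pi.2 fun j => ?_
        by_cases hj : j = i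
        · subst hj
          simp only [Pi.single_eq_same]
          exact (hw.mono fun z hz => (hN hz).2).mul
            (((hyi j).mono fun z hz => (hN hz).2).inv fun z hz => Complex.ofReal_ne_zero.2 (hN
              hz).1)
        · simp only [Pi.single_eq_of_ne hj]; exact contDiffOn_const
      · change w z = _
        rw [sum_eq_single i]
        · dsimp only
          rw [if_pos hi, Pi.single_eq_same, mul_left_comm, mul_inv_cancel₀, mul_one]
          exact Complex.ofReal_ne_zero.2 (hN hz).1
        · intro j _ hj
          dsimp only
          rw [Pi.single_eq_of_ne hj, mul_zero, ite_self]
        · exact fun h => absurd (Finset.mem_univ _) h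
  obtain ⟨g, hg, hgt⟩ := glue (F := ι → ℂ) W
    (t := fun x => {u | w x = ∑ i, if i ∈ p then (y x i : ℂ) * u i else 0}) (fun x hx => by
      intro a ha b hb s t _ _ hst
      change w x = _ at ha; change w x = _ at hb; change w x = _
      have hst' : (s : ℂ) + t = 1 := by exact_mod_cast hst
      calc w x = s * w x + t * w x := by rw [← add_mul, hst', one_mul]
        _ = s * (∑ i, if i ∈ p then (y x i : ℂ) * a i else 0) +
            t * ∑ i, if i ∈ p then (y x i : ℂ) * b i else 0 := by rw [← ha, ← hb]
        _ = _ := by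
          rw [mul_sum, mul_sum, ← sum_add_distrib]
          refine sum_congr rfl fun i _ => ?_
          by_cases hi : i ∈ p
          · simp only [hi, if_true, Pi.add_apply, Pi.smul_apply, Complex.real_smul]; ring
          · simp [hi]) hl
  exact ⟨fun i x => g x i, contDiffOn_pi.1 hg, hgt⟩

/-- A function on a connected level set whose derivative vanishes in the directions tangent to the
level set is constant. -/
theorem exists_const (hy : ContDiffOn ℝ ∞ y W)
    (hd : ∀ x ∈ W, ∃ f : (ι → ℝ) ≃L[ℝ] (ι → ℝ), HasFDerivAt y (f : (ι → ℝ) →L[ℝ] (ι → ℝ)) x)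
    {w : (ι → ℝ) → ℂ} (hw : ContDiffOn ℝ ∞ w W) {T : Set (ι → ℝ)}
    (hT : ∀ x, x ∈ T ↔ x ∈ W ∧ ∀ i ∈ p, y x i = 0) (hc : IsPreconnected T)
    (hv : ∀ x ∈ T, ∀ v, (∀ i ∈ p, fderiv ℝ y x v i = 0) → fderiv ℝ w x v = 0) : ∃ c, ∀ x ∈ T, w x =
    c := by
  have hl : IsLocallyConstant (fun x : T => w x) := by
    rw [IsLocallyConstant.iff_eventually_eq]
    rintro ⟨x, hx⟩
    obtain ⟨hxW, hx0⟩ := (hT x).1 hx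
    obtain ⟨r, hr, φ, h1, h2, h3⟩ := exists_chart W.isOpen hy hd hxW
    have hφ : ∀ z ∈ ball (y x) r, HasFDerivAt φ (fderiv ℝ φ z) z := fun z hz =>
      ((h2.contDiffAt (isOpen_ball.mem_nhds hz)).differentiableAt (by simp)).hasFDerivAt
    have hev : ∀ᶠ z in 𝓝 x, z ∈ T → w z = w x := by
      filter_upwards [h3] with z hz hzT
      have key : ∀ t ∈ Icc (0 : ℝ) 1, HasDerivWithinAt
          (fun t : ℝ => w (φ (y x + t • (y z - y x)))) 0 (Icc 0 1) t := by
        intro t ht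
        have hm : y x + t • (y z - y x) ∈ ball (y x) r := by
          have := (convex_ball (y x) r).add_smul_sub_mem (mem_ball_self hr) hz.2.1 ht
          exact this
        set q := y x + t • (y z - y x) with hq
        have hqT : φ q ∈ T := (hT _).2 ⟨(h1 q hm).1, fun i hi => by
          rw [(h1 q hm).2, hq]
          simp [hx0 i hi, ((hT z).1 hzT).2 i hi]⟩
        have e1 : HasDerivAt (fun t : ℝ => y x + t • (y z - y x)) (y z - y x) t := by
          simpa using ((hasDerivAt_id t).smul_const (y z - y x)).const_add (y x)
        have e2 := (hφ q hm).comp_hasDerivAt t e1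
        have hyd : HasFDerivAt y (fderiv ℝ y (φ q)) (φ q) :=
          ((hy.contDiffAt (W.isOpen.mem_nhds (h1 q hm).1)).differentiableAt (by simp)).hasFDerivAt
        have hwd : HasFDerivAt w (fderiv ℝ w (φ q)) (φ q) :=
          ((hw.contDiffAt (W.isOpen.mem_nhds (h1 q hm).1)).differentiableAt (by simp)).hasFDerivAt
        have e3 := hwd.comp_hasDerivAt t e2
        have e4 : fderiv ℝ y (φ q) (fderiv ℝ φ q (y z - y x)) = y z - y x := by
          have h5 : HasFDerivAt (y ∘ φ) (ContinuousLinearMap.id ℝ _) q :=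
            (hasFDerivAt_id q).congr_of_eventuallyEq (by
              filter_upwards [isOpen_ball.mem_nhds hm] with a ha using (h1 a ha).2)
          have := (hyd.comp q (hφ q hm)).unique h5
          exact DFunLike.congr_fun this (y z - y x)
        rw [hv _ hqT _ fun i hi => by
          rw [e4, Pi.sub_apply, hx0 i hi, ((hT z).1 hzT).2 i hi, sub_zero]] at e3
        exact e3.hasDerivWithinAt
      have := constant_of_derivWithin_zero (fun t ht => (key t ht).differentiableWithinAt)
        (fun t ht => (key t (Ico_subset_Icc_self ht)).derivWithin (uniqueDiffOn_Icc zero_lt_one t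
          (Ico_subset_Icc_self ht))) 1 (right_mem_Icc.2 zero_le_one)
      simp only [one_smul, zero_smul, add_zero, add_sub_cancel] at this
      rw [hz.2.2, (h3.self_of_nhds).2.2] at this
      exact this
    filter_upwards [continuous_subtype_val.continuousAt.eventually hev] with z hz using hz z.2
  have : PreconnectedSpace T := isPreconnected_iff_preconnectedSpace.1 hc
  by_cases hne : T.Nonempty
  · obtain ⟨x₀, hx₀⟩ := hne
    exact ⟨w x₀, fun x hx => hl.apply_eq_of_preconnectedSpace ⟨x, hx⟩ ⟨x₀, hx₀⟩⟩
  · exact ⟨0, fun x hx => (hne ⟨x, hx⟩).elim⟩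

end Hadamard

namespace BV

variable {D : FieldContent} {x : Body D} {W : Opens (Body D)} {k l : ℕ} {f g : SFR W}

variable (W) in
/-- The superfunctions whose monomials have total degree at least `m`. -/
def Fil (m : ℕ) : Submodule ℂ (SFR W) where
  carrier := {f | ∀ x (hx : x ∈ W), ev x hx f ∈ Au m}
  add_mem' hf hg x hx := by rw [map_add]; exact add_mem (hf x hx) (hg x hx)
  zero_mem' x hx := by rw [map_zero]; exact zero_mem _
  smul_mem' c f hf x hx := by rw [map_smul]; exact Submodule.smul_mem _ _ (hf x hx)

lemma Fil_mul (hf : f ∈ Fil W k) (hg : g ∈ Fil W l) : f * g ∈ Fil W (k + l) := fun x hx => by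
  rw [map_mul]; exact Au_mul (hf x hx) (hg x hx)

lemma Fil_zero (f : SFR W) : f ∈ Fil W 0 := fun _ _ => Au_zero _

lemma Fil_anti (h : k ≤ l) : Fil W l ≤ Fil W k := fun _ hf x hx => Au_anti h (hf x hx)

lemma Fil_one (h : ∀ x (hx : x ∈ W), body D (ev x hx f) = 0) : f ∈ Fil W 1 :=
  fun x hx => Au_one (h x hx)

lemma Fil_ld_even {A : Ext D} (hA : par D (inl A) = 0) (hf : f ∈ Fil W k) : (sc W).ld (inl A) f ∈
    Fil W k := by
  intro x hx d
  rw [sc_ld_at, ld_body hA]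
  refine K_pdBody f.smooth (fun y hy => ?_) _ hx
  rw [← at_apply f hy]; exact hf y hy d

lemma Fil_ld_odd {z : Coord D} (hz : ¬ par D z = 0) (hf : f ∈ Fil W (k + 1)) : (sc W).ld z f ∈ Fil W
    k := by
  intro x hx d
  rw [sc_ld_at, ld_odd hz, coeff_pdOdd]
  have h6 := hf x hx d
  rw [at_apply] at h6
  by_cases hd : k ≤ d.degree
  · rw [Nat.sub_eq_zero_of_le hd]; exact mem_aug_zero _
  refine K_dO _ (fun u hu => ?_) h6
  rw [Set.mem_Ici] at hu ⊢
  rw [Nat.sub_add_comm (le_of_not_ge hd)] at hu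
  push_cast at hu
  exact le_sub_iff_add_le.mpr hu

lemma Fil_σ (hf : f ∈ Fil W k) : (sc W).σ f ∈ Fil W k := fun x hx d => by
  rw [sc_σ_at, coeff_sig]; exact K_inv (hf x hx d)

lemma Fil_rd_even {A : Ext D} (hA : par D (inl A) = 0) (hf : f ∈ Fil W k) : (sc W).rd (inl A) f ∈
    Fil W k := by
  unfold SuperCalc.rd; rw [if_pos hA]; exact Fil_ld_even hA hf

lemma Fil_rd_odd {z : Coord D} (hz : ¬ par D z = 0) (hf : f ∈ Fil W (k + 1)) : (sc W).rd z f ∈ Fil W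
    k := by
  unfold SuperCalc.rd; rw [if_neg hz]; exact neg_mem (Fil_ld_odd hz (Fil_σ hf))

lemma IsExt.eq_zero_of_Fil (h : IsExt f) (hk : card (OddIdx D) < k) (hf : f ∈ Fil W k) : f = 0 :=
    h.eq_zero hk hf

lemma coeff_zero_X_mul (o : OddIdx D) (hx : x ∈ W) (f : SFR W) : coeff 0
    (ev x hx (xc o.1 * (sc W).ld o.1 f)) = th o * dO o (coeff 0 (ev x hx f)) := by
  rw [map_mul, xc, at_of, coord_odd o.2, MvPowerSeries.coeff_C_mul, sc_ld_at, ld_odd o.2,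
    coeff_pdOdd, at_apply]

lemma IsExt.X (A : Ext D) : IsExt (xc (W := W) (inl A)) := SFR.res_X_pos rfl

/-- Euler's formula. -/
lemma IsExt.euler_left (hf : IsExt f) (hk : f ∈ Fil W k) : ∑ A : Ext D with ¬ par D (inl A) = 0, xc
    (inl A) * (sc W).ld (inl A) f - (k : ℂ) • f ∈ Fil W (k + 1) := by
  have hE : IsExt (∑ A : Ext D with ¬ par D (inl A) = 0, xc (inl A) * (sc W).ld (inl A) f - (k : ℂ)
    • f) :=
    (ExtAlg W).sub_mem (GaugeData.isExt_sum fun A _ => (ExtAlg W).mul_mem (IsExt.X A) (hf.ld A))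
      ((ExtAlg W).smul_mem hf _)
  intro x hx d
  by_cases hd : d = 0
  swap
  · rw [hE.coeff hx hd]; exact zero_mem _
  subst hd
  have h1 : MvPowerSeries.coeff 0 (ev x hx (∑ A : Ext D with ¬ par D (inl A) = 0, xc (inl A) * (sc
    W).ld (inl A) f)) =
      wtOp (fun _ => 1) (MvPowerSeries.coeff 0 (ev x hx f)) := by
    rw [wtOp_apply]
    simp only [Int.cast_one, one_smul]
    have h2 := sum_dite_zero (fun z : Coord D => ¬ par D z = 0) fun o =>
      MvPowerSeries.coeff 0 (ev x hx (xc o.1 * (sc W).ld o.1 f))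
    rw [sum_sum_type, sum_eq_zero (s := (Finset.univ : Finset (Aux D))), add_zero] at h2
    · rw [map_sum, map_sum, Finset.sum_filter]
      refine Eq.trans (sum_congr rfl fun A _ => ?_) (h2.trans (sum_congr rfl fun o _ =>
        coeff_zero_X_mul o hx f))
      split_ifs <;> rfl
    · intro a _
      split_ifs
      · rfl
      · rw [ld_aux_of_ext hf, mul_zero, map_zero, map_zero]
  rw [map_sub, map_sub, h1, map_smul, coeff_smul', aug, mem_K_iff monoBasis_isMono]
  intro S hS
  have h3 := hk x hx 0
  rw [aug, mem_K_iff monoBasis_isMono] at h3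
  rw [map_sub, map_smul, Finsupp.sub_apply, repr_wtOp monoBasis_isMono, Finsupp.smul_apply,
    smul_eq_mul, ← sub_mul, mul_ne_zero_iff] at hS
  have h4 := h3 S hS.2
  simp only [Finset.sum_const, nsmul_eq_mul, mul_one, Set.mem_Ici, Nat.cast_le, map_zero,
    Nat.sub_zero] at h4 ⊢
  have h5 : S.card ≠ k := by
    rintro h; apply hS.1; simp [h]
  omega

lemma rd_mul_X {z : Coord D} (hz : ¬ par D z = 0) (f : SFR W) : (sc W).rd z f * xc z = xc z *
    (sc W).ld z f := by
  refine hom_ind (C := sc W) (P := fun f => (sc W).rd z f * xc z = xc z * (sc W).ld z f)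
    (fun r f hf => ?_) (fun a b ha hb => by rw [map_add, map_add, add_mul, mul_add, ha, hb]) f
  have h1 : par D z = 1 := by
    revert hz; generalize par D z = u; clear * -; revert u; decide
  rw [hf.rd_eq, smul_mul_assoc, (hf.ld z).comm (hom_X z), sgn_smul_smul, h1]
  conv_rhs => rw [← one_smul ℂ (xc z * _)]
  refine congrArg (· • _) ?_
  rw [show 1 * (r + 1) + (1 + r) * 1 = (0 : ZMod 2) by clear * -; revert r; decide, sgn_zero]

lemma IsExt.euler (hf : IsExt f) (hk : f ∈ Fil W k) : ∑ A : Ext D with ¬ par D (inl A) = 0,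
    (sc W).rd (inl A) f * xc (inl A) - (k : ℂ) • f ∈ Fil W (k + 1) := by
  rw [sum_congr rfl fun A hA => rd_mul_X (Finset.mem_filter.mp hA).2 f]
  exact hf.euler_left hk

end BV

namespace BV

variable {D : FieldContent} {W : Opens (Body D)} {k : ℕ}

namespace Bars

variable {S : GaugeData W} (B : Bars S) {f : SFR W}

lemma db_Γ (b b' : BarIdx D) : B.db b (B.Γ b') = if b' = b then 1 else 0 := rdb_coord B.jac_K b b'

lemma ext_Γ' (b) : IsExt (B.Γ b) := by
  rcases b with a | a
  · exact B.ext_F a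
  · exact B.ext_con a

lemma rd_eq_sum (f : SFR W) (A : Ext D) : (sc W).rd (inl A) f = ∑ b, B.db b f * (sc W).rd (inl A)
    (B.Γ b) := by
  have h : ∀ i, ∑ b, B.K i b * (sc W).rd (inl A) (B.Γ b) = if i = A then 1 else 0 := by
    intro i
    have := congrFun (congrFun B.K_jac i) A
    rwa [mul_apply, one_apply] at this
  simp only [db, rdb, sum_mul, mul_assoc]
  rw [sum_comm]
  simp only [← mul_sum, h, mul_ite, mul_one, mul_zero, Finset.sum_ite_eq', mem_univ, if_true]

lemma ext_db (hf : IsExt f) (b : BarIdx D) : IsExt (B.db b f) :=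
  GaugeData.isExt_sum fun A _ => (ExtAlg W).mul_mem (hf.rd A) (B.ext_K A b)

lemma db_sub (b : BarIdx D) (f g : SFR W) : B.db b (f - g) = B.db b f - B.db b g := by
  rw [sub_eq_add_neg, ← neg_one_smul ℂ g, db, rdb_add, rdb_smul, neg_one_smul, ← sub_eq_add_neg]

lemma db_mem_I {f : SFR W} (h : f ∈ B.I) (a : AExt D) : B.db (inl a) f ∈ B.I := by
  unfold I at h
  induction h using Submodule.span_induction with
  | mem y hy =>
    obtain ⟨i, rfl⟩ := hy
    have : B.db (inl a) (B.Γ (inr i)) = 0 := by rw [db_Γ, if_neg (by simp)]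
    exact (congrArg (· ∈ B.I) this).mpr (zero_mem _)
  | zero => rw [← zero_smul ℂ (0 : SFR W), db, rdb_smul, zero_smul]; exact zero_mem _
  | add y z _ _ hy hz => rw [db, rdb_add]; exact add_mem hy hz
  | smul k y hy' hy =>
    rw [smul_eq_mul, db, rdb_mul B.hom_K]
    refine add_mem (Ideal.mul_mem_left _ _ hy) (Ideal.mul_mem_left _ _ ?_)
    clear hy
    induction hy' using Submodule.span_induction with
    | mem y hy =>
      obtain ⟨i, rfl⟩ := hy
      rw [(B.hom_con i).tw]; exact B.smul_mem_I _ (Ideal.subset_span ⟨i, rfl⟩)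
    | zero => unfold SuperCalc.tw; simp
    | add y z _ _ hy hz => rw [tw_add]; exact add_mem hy hz
    | smul k y _ hy => rw [smul_eq_mul, tw_mul]; exact Ideal.mul_mem_left _ _ hy

lemma Fil_of_odd {q : ZMod 2} (hq : ¬ q = 0) (hf : (sc W).Hom q f) : f ∈ Fil W 1 :=
  Fil_one fun x hx => body_of_odd (by
    have : q = 1 := by revert hq; clear * -; revert q; decide
    rwa [this] at hf) hx

/-- The odd part of the Euler vector field in the new coordinates. -/
def euler (i : Ext D) : SFR W := ∑ b with ¬ parBar D b = 0, B.K i b * B.Γ b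

lemma euler_even {i : Ext D} (hi : par D (inl i) = 0) : B.euler i ∈ Fil W 2 :=
  sum_mem fun b hb => Fil_mul (k := 1) (l := 1) (Fil_of_odd (by
      rw [hi, zero_add]; exact (Finset.mem_filter.mp hb).2) (B.hom_K i b))
    (Fil_of_odd (Finset.mem_filter.mp hb).2 (B.hom_Γ b))

lemma euler_odd {i : Ext D} (hi : ¬ par D (inl i) = 0) : B.euler i - xc (inl i) ∈ Fil W 2 := by
  let X : Ext D → SFR W := fun j => xc (inl j)
  let J : BarIdx D → Ext D → SFR W := fun b j => (sc W).rd (inl j) (B.Γ b)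
  have h1 : ∀ j, ∑ b with ¬ parBar D b = 0, B.K i b * J b j =
      (if i = j then 1 else 0) - ∑ b with parBar D b = 0, B.K i b * J b j := by
    intro j
    have := congrFun (congrFun B.K_jac i) j
    rw [mul_apply, one_apply] at this
    rw [eq_sub_iff_add_eq, ← this, add_comm]
    exact Finset.sum_filter_add_sum_filter_not _ _ _
  have h2 : ∑ b with ¬ parBar D b = 0, B.K i b *
      (∑ j with ¬ par D (inl j) = 0, J b j * X j) =
      X i - ∑ j with ¬ par D (inl j) = 0,
        (∑ b with parBar D b = 0, B.K i b * J b j) * X j := by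
    simp only [mul_sum, ← mul_assoc]
    rw [sum_comm]
    simp only [← sum_mul, h1, sub_mul, sum_sub_distrib]
    congr 1
    rw [sum_eq_single i]
    · rw [if_pos rfl, one_mul]
    · intro j _ hj; rw [if_neg (Ne.symm hj), zero_mul]
    · intro h; exact absurd (Finset.mem_filter_univ i |>.mpr hi) h
  have h3 : B.euler i - X i = (∑ b with ¬ parBar D b = 0, B.K i b * (B.Γ b - ∑ j with ¬ par D (inl
    j) = 0, J b j * X j)) -
      ∑ j with ¬ par D (inl j) = 0, (∑ b with parBar D b = 0, B.K i b * J b j) * X j := by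
    simp only [mul_sub, sum_sub_distrib]
    rw [h2, euler]; abel
  have h4 : ∀ j, ¬ par D (inl j) = 0 → X j ∈ Fil W 1 := fun j hj =>
    Fil_of_odd hj (hom_X _)
  refine (congrArg (· ∈ Fil W 2) h3).mpr (sub_mem (sum_mem fun b hb => ?_) (sum_mem fun j hj => ?_))
  · have h5 := (B.ext_Γ' b).euler (Fil_of_odd (Finset.mem_filter.mp hb).2 (B.hom_Γ b))
    rw [Nat.cast_one, one_smul] at h5
    have h6 := neg_mem h5
    rw [neg_sub] at h6
    have h7 := Fil_mul (Fil_zero (B.K i b)) h6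
    rwa [zero_add] at h7
  · refine Fil_mul (k := 1) (l := 1) (sum_mem fun b hb => ?_)
      (h4 j (Finset.mem_filter.mp hj).2)
    have h5 := Fil_mul (k := 1) (l := 0) (Fil_of_odd (by
      rw [(Finset.mem_filter.mp hb).2, add_zero]; exact hi) (B.hom_K i b)) (Fil_zero (J b j))
    exact h5

lemma euler_sub (hf : IsExt f) (hk : f ∈ Fil W (k + 1)) : ∑ b with ¬ parBar D b = 0, B.db b f * B.Γ
    b - ((k + 1 : ℕ) : ℂ) • f ∈ Fil W (k + 2) := by
  have h1 : ∑ b with ¬ parBar D b = 0, B.db b f * B.Γ b =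
      ∑ i, (sc W).rd (inl i) f * B.euler i := by
    simp only [db, rdb, sum_mul, mul_assoc, euler, mul_sum]
    rw [sum_comm]
  have h2 : ∑ b with ¬ parBar D b = 0, B.db b f * B.Γ b - ((k + 1 : ℕ) : ℂ) • f =
      (∑ i with par D (inl i) = 0, (sc W).rd (inl i) f * B.euler i) +
      (∑ i with ¬ par D (inl i) = 0, (sc W).rd (inl i) f * (B.euler i - xc (inl i))) +
      (∑ i with ¬ par D (inl i) = 0, (sc W).rd (inl i) f * xc (inl i) - ((k + 1 : ℕ) : ℂ) • f) := by
    rw [h1, ← Finset.sum_filter_add_sum_filter_not Finset.univ (fun i => par D (inl i) = 0)]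
    simp only [mul_sub, sum_sub_distrib]
    abel
  rw [h2]
  refine add_mem (add_mem (sum_mem fun i hi => ?_) (sum_mem fun i hi => ?_)) (hf.euler hk)
  · exact Fil_anti (by omega) (Fil_mul (Fil_rd_even (Finset.mem_filter.mp hi).2 hk)
      (B.euler_even (Finset.mem_filter.mp hi).2))
  · exact Fil_mul (Fil_rd_odd (Finset.mem_filter.mp hi).2 hk)
      (B.euler_odd (Finset.mem_filter.mp hi).2)

/-- A function of positive order in the odd variables whose derivatives along `F` vanish modulo the
constraints lies in the ideal of the constraints. -/
lemma mem_I_of_Fil (hf : IsExt f) (h1 : f ∈ Fil W 1) (hd : ∀ a, B.db (inl a) f ∈ B.I) : f ∈ B.I :=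
    by
  have key : ∀ k : ℕ, ∃ h, IsExt h ∧ h ∈ Fil W (k + 1) ∧ f - h ∈ B.I := by
    intro k
    induction k with
    | zero => exact ⟨f, hf, h1, by rw [sub_self]; exact zero_mem _⟩
    | succ k ih =>
      obtain ⟨h, he, hF, hI⟩ := ih
      set N := ∑ b with ¬ parBar D b = 0, B.db b h * B.Γ b with hN
      have hNI : N ∈ B.I := by
        refine sum_mem fun b _ => ?_
        rcases b with a | a
        · refine Ideal.mul_mem_right _ _ ?_
          have h3 := B.db_mem_I hI a
          have h4 : B.db (inl a) h = B.db (inl a) f - B.db (inl a) (f - h) := by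
            rw [db_sub]; abel
          rw [h4]; exact sub_mem (hd a) h3
        · exact Ideal.mul_mem_left _ _ (Ideal.subset_span ⟨a, rfl⟩)
      have hk : ((k + 1 : ℕ) : ℂ) ≠ 0 := by exact_mod_cast k.succ_ne_zero
      have hNe : IsExt N := GaugeData.isExt_sum fun b _ =>
        (ExtAlg W).mul_mem (B.ext_db he b) (B.ext_Γ' b)
      refine ⟨h - (((k + 1 : ℕ) : ℂ)⁻¹) • N, (ExtAlg W).sub_mem he ((ExtAlg W).smul_mem hNe _), ?_,
        ?_⟩
      · have h5 := Submodule.smul_mem _ (-(((k + 1 : ℕ) : ℂ)⁻¹)) (B.euler_sub he hF)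
        rwa [smul_sub, ← hN, smul_smul, neg_mul, inv_mul_cancel₀ hk, neg_one_smul, neg_smul,
          sub_neg_eq_add, neg_add_eq_sub] at h5
      · rw [← sub_add]
        exact add_mem hI (B.smul_mem_I _ hNI)
  obtain ⟨h, he, hF, hI⟩ := key (card (OddIdx D))
  rwa [he.eq_zero_of_Fil (Nat.lt_succ_self _) hF, sub_zero] at hI

end Bars

open Topology

variable {x : Body D}

lemma fderiv_body_single (f : SFR W) (hx : x ∈ W) (i : BodyIdx D) : fderiv ℝ
    (fun x => body D (f.rep x)) x (Pi.single i 1) = body D (ev x hx ((sc W).ld (inl i.1) f)) := by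
  have h := pdBody_apply f.smooth i 0 bod.toLinearMap hx
  rw [sc_ld_at, ld_body i.2, body_eq_coeff]
  have h1 : (fun y => bod.toLinearMap (coeff 0 (f.rep y))) =
      fun y => body D (f.rep y) := funext fun y => (body_eq_coeff _).symm
  rw [h1, AlgHom.toLinearMap_apply] at h
  exact h.symm

lemma fderiv_body (f : SFR W) (hx : x ∈ W) (v : Body D) : fderiv ℝ (fun x => body D (f.rep x)) x v =
    ∑ i : BodyIdx D, (v i : ℂ) * body D (ev x hx ((sc W).ld (inl i.1) f)) := by
  classical
  conv_lhs => rw [pi_eq_sum_univ' v]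
  rw [map_sum]
  refine sum_congr rfl fun i _ => ?_
  rw [map_smul, ← fderiv_body_single f hx i, Complex.real_smul]

namespace Bars

variable {S : GaugeData W} (B : Bars S) {f : SFR W} (e : BarIdx D ≃ Ext D)

lemma fderiv_body_eq (f : SFR W) (hx : x ∈ W) (v : Body D) : fderiv ℝ (fun x => body D (f.rep x)) x
    v = ∑ b, body D (ev x hx (B.db b f)) * fderiv ℝ (fun x => body D ((B.Γ b).rep x)) x v := by
  have h : ∀ (g : SFR W) (i : BodyIdx D), (sc W).ld (inl i.1) g = (sc W).rd (inl i.1) g :=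
    fun g i => by unfold SuperCalc.rd; rw [if_pos i.2]
  simp only [fderiv_body _ hx, h, mul_sum]
  rw [sum_comm]
  refine sum_congr rfl fun i _ => ?_
  rw [B.rd_eq_sum, map_sum, ← bodyHom_apply, map_sum, mul_sum]
  refine sum_congr rfl fun b _ => ?_
  rw [map_mul, map_mul, bodyHom_apply, bodyHom_apply]
  ring

/-- The bodies of the even coordinates. -/
def y (x : Body D) : Body D := fun i => (body D ((B.Γ (e.symm i.1)).rep x)).re

/-- The indices of the even constraints. -/
def conIdx : Set (BodyIdx D) := {i | (e.symm i.1).isRight = true}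

instance : DecidablePred (· ∈ conIdx e) := fun i =>
  inferInstanceAs (Decidable ((e.symm i.1).isRight = true))

/-- The surface where the constraints vanish. -/
def surface : Set (Body D) := {x | x ∈ W ∧ ∀ i, body D ((B.con i).rep x) = 0}

lemma contDiffOn_y : ContDiffOn ℝ ∞ (B.y e) W := contDiffOn_pi.2 fun i =>
  Complex.reCLM.contDiff.comp_contDiffOn (smooth_body (B.Γ (e.symm i.1)).smooth)

variable (hr : ∀ b, ∀ x ∈ W, (body D ((B.Γ b).rep x)).im = 0)

include hr in
lemma ofReal_y (hx : x ∈ W) (i : BodyIdx D) : ((B.y e x i : ℝ) : ℂ) = body D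
    ((B.Γ (e.symm i.1)).rep x) :=
  Complex.ext rfl (hr _ x hx).symm

include hr in
lemma fderiv_y (hx : x ∈ W) (v : Body D) (i : BodyIdx D) : fderiv ℝ
    (fun x => body D ((B.Γ (e.symm i.1)).rep x)) x v = ((fderiv ℝ (B.y e) x v i : ℝ) : ℂ) := by
  have hd : DifferentiableAt ℝ (B.y e) x :=
    ((B.contDiffOn_y e).contDiffAt (W.isOpen.mem_nhds hx)).differentiableAt (by simp)
  have h1 : HasFDerivAt (fun x => ((B.y e x i : ℝ) : ℂ))
      ((Complex.ofRealCLM.comp (ContinuousLinearMap.proj i)).comp (fderiv ℝ (B.y e) x)) x :=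
    (Complex.ofRealCLM.comp (ContinuousLinearMap.proj (R := ℝ) (φ := fun _ : BodyIdx D => ℝ)
      i)).hasFDerivAt.comp x hd.hasFDerivAt
  have h2 : (fun x => body D ((B.Γ (e.symm i.1)).rep x)) =ᶠ[𝓝 x]
      fun x => ((B.y e x i : ℝ) : ℂ) := by
    filter_upwards [W.isOpen.mem_nhds hx] with z hz using (B.ofReal_y e hr hz i).symm
  rw [h2.fderiv_eq, h1.fderiv]
  rfl

variable (he : ∀ b, parExt D (e b) = parBar D b)

lemma body_Γ_odd {b : BarIdx D} (hb : ¬ parBar D b = 0) (hx : x ∈ W) : body D ((B.Γ b).rep x) = 0 :=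
    by
  rw [← at_apply _ hx]
  exact body_of_odd (by
    have : parBar D b = 1 := by revert hb; generalize parBar D b = u; clear * -; revert u; decide
    have h := B.hom_Γ b
    rwa [this] at h) hx

lemma fderiv_Γ_odd {b : BarIdx D} (hb : ¬ parBar D b = 0) (hx : x ∈ W) : fderiv ℝ
    (fun x => body D ((B.Γ b).rep x)) x = 0 := by
  have h : (fun x => body D ((B.Γ b).rep x)) =ᶠ[𝓝 x] fun _ => 0 := by
    filter_upwards [W.isOpen.mem_nhds hx] with z hz using B.body_Γ_odd hb hz
  rw [h.fderiv_eq]; simp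

/-- The index of an even coordinate. -/
def idx {b : BarIdx D} (hb : parBar D b = 0) : BodyIdx D := ⟨e b, (he b).trans hb⟩

include hr he in
lemma fderiv_Γ_eq_zero {b : BarIdx D} (hx : x ∈ W) {v : Body D}
    (h : ∀ hb : parBar D b = 0, fderiv ℝ (B.y e) x v (idx e he hb) = 0) : fderiv ℝ
    (fun x => body D ((B.Γ b).rep x)) x v = 0 := by
  by_cases hb : parBar D b = 0
  · have h1 := B.fderiv_y e hr hx v (idx e he hb)
    rw [h hb] at h1
    simpa [idx] using h1
  · rw [B.fderiv_Γ_odd hb hx]; rfl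

include hr he in
lemma exists_equiv (hx : x ∈ W) : ∃ f : Body D ≃L[ℝ] Body D, HasFDerivAt (B.y e)
    (f : Body D →L[ℝ] Body D) x := by
  have hd : DifferentiableAt ℝ (B.y e) x :=
    ((B.contDiffOn_y e).contDiffAt (W.isOpen.mem_nhds hx)).differentiableAt (by simp)
  have hinj : Function.Injective (fderiv ℝ (B.y e) x : Body D →ₗ[ℝ] Body D) := by
    rw [← LinearMap.ker_eq_bot, LinearMap.ker_eq_bot']
    intro v hv
    have hv' : ∀ j, fderiv ℝ (B.y e) x v j = 0 := fun j => congrFun hv j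
    ext i
    have h1 := B.fderiv_body_eq (xc (inl i.1)) hx v
    rw [sum_eq_zero fun b _ => by
      rw [B.fderiv_Γ_eq_zero e hr he hx fun hb => hv' _, mul_zero], fderiv_body _ hx,
      sum_eq_single i] at h1
    · rw [ld_X, if_pos rfl, map_one, ← bodyHom_apply, map_one, mul_one] at h1
      exact_mod_cast h1
    · intro j _ hj
      rw [ld_X, if_neg, map_zero, ← bodyHom_apply, map_zero, mul_zero]
      intro h
      exact hj (Subtype.ext (Sum.inl_injective h))
    · exact fun h => absurd (mem_univ _) h
  let f := (LinearEquiv.ofInjectiveEndo _ hinj).toContinuousLinearEquiv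
  refine ⟨f, ?_⟩
  have : (f : Body D →L[ℝ] Body D) = fderiv ℝ (B.y e) x := by
    ext v i; rfl
  rw [this]
  exact hd.hasFDerivAt

include hr he in
lemma mem_surface_iff (x : Body D) : x ∈ B.surface ↔ x ∈ W ∧ ∀ i ∈ conIdx e, B.y e x i = 0 := by
  refine and_congr_right fun hx => ⟨fun h i hi => ?_, fun h a => ?_⟩
  · obtain ⟨a, ha⟩ := Sum.isRight_iff.mp hi
    have h1 := B.ofReal_y e hr hx i
    rw [ha] at h1
    have h2 : body D ((B.Γ (inr a)).rep x) = 0 := h a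
    rw [h2] at h1
    exact_mod_cast h1
  · by_cases hb : parBar D (inr a) = 0
    · have h1 := B.ofReal_y e hr hx (idx e he hb)
      rw [h _ (by simp [conIdx, idx]), Complex.ofReal_zero] at h1
      simp only [idx, e.symm_apply_apply] at h1
      exact h1.symm
    · exact B.body_Γ_odd hb hx

lemma body_of_mem_I {f : SFR W} (h : f ∈ B.I) (hx : x ∈ B.surface) : body D (ev x hx.1 f) = 0 := by
  unfold I at h
  induction h using Submodule.span_induction with
  | mem y hy => obtain ⟨a, rfl⟩ := hy; rw [at_apply]; exact hx.2 a
  | zero => rw [map_zero, ← bodyHom_apply, map_zero]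
  | add a b _ _ ha hb => rw [map_add, ← bodyHom_apply, map_add, bodyHom_apply, bodyHom_apply, ha,
    hb, add_zero]
  | smul k a _ ha => rw [smul_eq_mul, map_mul, ← bodyHom_apply, map_mul, bodyHom_apply (ev x _ a),
    ha, mul_zero]

include hr he in
/-- On a connected surface the body of a function with vanishing derivatives along `F` is
constant. -/
theorem exists_body_eq (hc : IsPreconnected B.surface) (hd : ∀ a, B.db (inl a) f ∈ B.I) : ∃ c, ∀ x ∈
    B.surface, body D (f.rep x) = c :=
  Hadamard.exists_const (conIdx e) (B.contDiffOn_y e) (fun x hx => B.exists_equiv e hr he hx)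
    (smooth_body f.smooth) (B.mem_surface_iff e hr he) hc fun x hx v hv => by
      rw [B.fderiv_body_eq f hx.1]
      refine sum_eq_zero fun b _ => ?_
      rcases b with a | a
      · rw [B.body_of_mem_I (hd a) hx, zero_mul]
      · rw [B.fderiv_Γ_eq_zero e hr he hx.1 fun hb => hv _ (by simp [conIdx, idx]), mul_zero]

include hr he in
/-- A function with vanishing derivatives along `F` whose body is constant on the surface is
constant modulo the constraints. -/
theorem sub_const_mem (hf : IsExt f) (hd : ∀ a, B.db (inl a) f ∈ B.I) {c : ℂ}
    (hc : ∀ x ∈ B.surface, body D (f.rep x) = c) : f - algebraMap ℂ (SFR W) c ∈ B.I := by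
  obtain ⟨u, hu, hw⟩ := Hadamard.exists_eq_sum (conIdx e) (B.contDiffOn_y e)
    (fun x hx => B.exists_equiv e hr he hx)
    (w := fun x => body D (f.rep x) - c) ((smooth_body f.smooth).sub contDiffOn_const)
    (fun x hx h => by
      rw [hc x ((B.mem_surface_iff e hr he x).mpr ⟨hx, h⟩), sub_self])
  set i₀ := ∑ i, if i ∈ conIdx e then B.Γ (e.symm i.1) * fn (u i) (hu i) else 0 with hi₀
  have hI : i₀ ∈ B.I := sum_mem fun i _ => by
    split_ifs with hi
    · obtain ⟨a, ha⟩ := Sum.isRight_iff.mp hi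
      rw [ha]
      exact Ideal.mul_mem_right _ _ (Ideal.subset_span ⟨a, rfl⟩)
    · exact zero_mem _
  have hE : IsExt i₀ := GaugeData.isExt_sum fun i _ => by
    split_ifs with hi
    · exact (ExtAlg W).mul_mem (B.ext_Γ' _) (isExt_fn _ _)
    · exact (ExtAlg W).zero_mem
  have h1 : f - algebraMap ℂ (SFR W) c - i₀ ∈ B.I := by
    refine B.mem_I_of_Fil ((ExtAlg W).sub_mem ((ExtAlg W).sub_mem hf ((ExtAlg W).algebraMap_mem c))
      hE) (Fil_one fun x hx => ?_) fun a => ?_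
    · have h2 := hw x hx
      rw [map_sub, map_sub, AlgHom.commutes, hi₀, map_sum, ← bodyHom_apply, map_sub, map_sub,
        AlgHom.commutes, map_sum, bodyHom_apply, at_apply]
      refine sub_eq_zero.mpr (h2.trans (sum_congr rfl fun i _ => ?_))
      split_ifs with hi
      · rw [map_mul, map_mul, at_fn, AlgHom.commutes, bodyHom_apply, at_apply, B.ofReal_y e hr hx]
        rfl
      · rw [map_zero, map_zero]
    · rw [db_sub, db_sub]
      refine sub_mem (sub_mem (hd a) ?_) (B.db_mem_I hI a)
      have : B.db (inl a) (algebraMap ℂ (SFR W) c) = 0 := by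
        refine sum_eq_zero fun i _ => ?_
        rw [rd_algebraMap, zero_mul]
      rw [this]; exact zero_mem _
  exact (Submodule.sub_mem_iff_left _ hI).mp h1

end Bars

open Topology

lemma pow_sub_pow_mem {v w : Val D} {m : ℕ} (hv : v ∈ Au 1) (hw : w ∈ Au 1) (h : v - w ∈ Au m)
    (n : ℕ) : v ^ (n + 1) - w ^ (n + 1) ∈ Au (m + n) := by
  induction n with
  | zero => rwa [zero_add, pow_one, pow_one]
  | succ n ih =>
    have e : v ^ (n + 1 + 1) - w ^ (n + 1 + 1) = v * (v ^ (n + 1) - w ^ (n + 1)) +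
        (v - w) * w ^ (n + 1) := by
      rw [pow_succ' v (n + 1), pow_succ' w (n + 1), mul_sub, sub_mul]; abel
    rw [e]
    refine add_mem ?_ (Au_mul h (Au_pow hw _))
    have := Au_mul hv ih
    rwa [add_comm 1, add_assoc] at this

lemma sub_mem_of_expVal_eq {v w : Val D} (h : expVal D v = expVal D w) (hb : body D v = body D w)
    (m : ℕ) : v - w ∈ Au m := by
  induction m with
  | zero => exact Au_zero _
  | succ m ih =>
    intro d
    set c := algebraMap ℂ (Val D) (body D w) with hc
    have h1 := congrArg (coeff d) h
    rw [coeff_expVal (n := d.degree + card (OddIdx D) + 2) (by omega),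
      coeff_expVal (n := d.degree + card (OddIdx D) + 2) (by omega), hb, ← hc] at h1
    have h2 := smul_right_injective (Lam D) (Complex.exp_ne_zero (body D w)) h1
    have hvw : v - c - (w - c) = v - w := by abel
    rw [← sub_eq_zero, ← sum_sub_distrib, Finset.sum_range_succ', Finset.sum_range_succ'] at h2
    simp only [zero_add, pow_one, pow_zero, sub_self, add_zero, Nat.factorial_one, Nat.cast_one,
      inv_one, one_smul, ← smul_sub, ← map_sub, hvw] at h2
    rw [eq_neg_of_add_eq_zero_right h2]
    refine neg_mem (sum_mem fun n _ => Submodule.smul_mem _ _ ?_)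
    have h3 := pow_sub_pow_mem (m := m) (v := v - c) (w := w - c)
      (Au_one (by rw [hc, ← hb]; exact body_sub_body v)) (Au_one (body_sub_body w)) (by rw [hvw]; exact ih) (n + 1)
    exact Au_anti (by omega) h3 d

lemma res_expVal (P : Coord D → Prop) (v : Val D) : res P (expVal D v) = expVal D (res P v) := by
  have hb : body D (res P v) = body D v := by
    rw [body_eq_coeff, body_eq_coeff, coeff_res, resCoeff_pos (supp_zero P), bod_kl]
  refine ext fun d => ?_
  rw [coeff_res, coeff_expVal (Nat.lt_succ_self _), coeff_expVal (Nat.lt_succ_self _), hb, map_smul,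
    map_sum]
  refine congrArg _ (sum_congr rfl fun n _ => ?_)
  rw [map_smul, ← coeff_res, map_pow, map_sub, AlgHom.commutes]

lemma IsExt.exp {Y : SFR W} (h : IsExt Y) : IsExt Y.exp := ext_at fun x hx => by
  rw [at_res, at_exp, res_expVal, ← at_res, h]

lemma IsExt.σ {f : SFR W} (h : IsExt f) : IsExt ((sc W).σ f) := by
  unfold IsExt; rw [← SFR.σ_res, h]

/-- An exponent is even if the exponential is even. -/
lemma even_of_exp {Y : SFR W} (hY : IsExt Y) (h : (sc W).σ Y.exp = Y.exp) : (sc W).σ Y = Y := by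
  have hE : IsExt (Y - (sc W).σ Y) := (ExtAlg W).sub_mem hY hY.σ
  refine (sub_eq_zero.mp (hE.eq_zero_of_Fil (Nat.lt_succ_self _) fun x hx => ?_)).symm
  rw [map_sub]
  refine sub_mem_of_expVal_eq ?_ (by rw [sc_σ_at, body_sig]) _
  rw [sc_σ_at, ← sig_expVal, ← at_exp, ← sc_σ_at, h]

lemma eq_zero_of_hom {f : SFR W} (h0 : (sc W).Hom 0 f) (h1 : (sc W).Hom 1 f) : f = 0 := by
  unfold Hom at h0 h1
  rw [h0, sgn_zero, sgn_one, one_smul, neg_one_smul] at h1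
  have h2 : (2 : ℂ) • f = 0 := by rw [two_smul]; exact eq_neg_iff_add_eq_zero.mp h1
  exact (smul_eq_zero.mp h2).resolve_left two_ne_zero

/-- A square root of an invertible even superfunction is even. -/
lemma even_of_sq {s P P' : SFR W} (h : s * s = P) (hP : (sc W).σ P = P) (hP' : P * P' = 1) :
    (sc W).σ s = s := by
  obtain ⟨a, b, ha, hb, rfl⟩ := (sc W).exists_hom_add s
  have hc : ∀ k, a * k = k * a := fun k => (sc W).even_mul _ _ (hom_zero_iff.mp ha)
  have hbb : b * b = 0 := by
    have := hb.comm hb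
    rw [one_mul, sgn_one, neg_one_smul] at this
    have h2 : (2 : ℂ) • (b * b) = 0 := by rw [two_smul]; exact eq_neg_iff_add_eq_zero.mp this
    exact (smul_eq_zero.mp h2).resolve_left two_ne_zero
  have h1 : P - a * a = (2 : ℂ) • (a * b) := by
    rw [← h, add_mul, mul_add, mul_add, hbb, ← hc b, two_smul]; abel
  have h3 : (2 : ℂ) • (a * b) = 0 := eq_zero_of_hom
    (by rw [← h1]; exact (hom_zero_iff.mpr hP).sub ((ha.mul ha).cast (add_zero 0)))
    (((ha.mul hb).cast (zero_add 1)).smul 2)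
  have h4 : a * b = 0 := (smul_eq_zero.mp h3).resolve_left two_ne_zero
  rw [h3, sub_eq_zero] at h1
  have h5 : b = 0 := by
    calc b = P' * (P * b) := by rw [← mul_assoc, ← (sc W).even_mul _ _ hP, hP', one_mul]
      _ = 0 := by rw [h1, mul_assoc, h4, mul_zero, mul_zero]
  rw [h5, add_zero]
  exact hom_zero_iff.mp ha

namespace Bars

variable {S : GaugeData W} (B : Bars S) {f : SFR W} (e : BarIdx D ≃ Ext D)

lemma Q_exp {Y : SFR W} (hY : (sc W).σ Y = Y) : (der S).Q Y.exp = Y.exp * (der S).Q Y := by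
  have h0 := SFR.σ_exp hY
  have h : ∀ i, (sc W).rd i Y.exp = Y.exp * (sc W).rd i Y := fun i => by
    rw [(hom_zero_iff.mpr h0).rd_eq, (hom_zero_iff.mpr hY).rd_eq, SFR.ld_exp hY, mul_smul_comm, (sc
      W).even_mul Y.exp _ h0]
  simp only [der_Q, Q, GaugeData.bX, br, h, mul_sum, mul_assoc]

lemma even_H : (sc W).σ (rr S.X1) = rr S.X1 := hom_zero_iff.mp (hom_res S.even1)

lemma ext_H : IsExt (rr S.X1) := by
  rw [resL_zero S.wt1]
  refine ext_at fun x hx => ?_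
  rw [at_res, at_res, res_res]
  congr 2
  funext z
  exact propext and_self_iff

variable (hr : ∀ b, ∀ x ∈ W, (body D ((B.Γ b).rep x)).im = 0)
  (he : ∀ b, parExt D (e b) = parBar D b) (hc : IsPreconnected B.surface)

include hr he hc

lemma exists_const (hf : IsExt f) (hQ : B.π ((der S).Q f) = 0) : ∃ c,
    (∀ x ∈ B.surface, body D (f.rep x) = c) ∧ f - algebraMap ℂ (SFR W) c ∈ B.I := by
  rw [der_Q] at hQ
  have hd : ∀ a, B.db (inl a) f ∈ B.I := fun a => B.pi_eq_zero.mp (B.pi_db_of_Q hf hQ a)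
  obtain ⟨c, h⟩ := B.exists_body_eq e hr he hc hd
  exact ⟨c, h, B.sub_const_mem e hr he hf hd h⟩

lemma exists_const_of_unit {f' : SFR W} (hf : IsExt f) (hQ : B.π ((der S).Q f) = 0)
    (hu : f * f' = 1) : ∃ c, c ≠ 0 ∧ f - algebraMap ℂ (SFR W) c ∈ B.I := by
  by_cases hn : B.surface.Nonempty
  · obtain ⟨c, h1, h2⟩ := B.exists_const e hr he hc hf hQ
    obtain ⟨x, hx⟩ := hn
    refine ⟨c, ?_, h2⟩
    rintro rfl
    have h3 := congrArg (fun g => bodyHom (ev x hx.1 g)) hu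
    simp only [map_mul, map_one] at h3
    rw [bodyHom_apply, at_apply, h1 x hx, zero_mul] at h3
    exact zero_ne_one h3
  · rw [der_Q] at hQ
    exact ⟨1, one_ne_zero, B.sub_const_mem e hr he hf (fun a => B.pi_eq_zero.mp (B.pi_db_of_Q hf hQ
      a)) fun x hx => absurd ⟨x, hx⟩ hn⟩

theorem exp_formula {P P' A A' : (sc W).Ev} {l m : SFR W} (hP : P * P' = 1) (hA : A * A' = 1)
    (hPe : IsExt (P : SFR W)) (hAe : IsExt (A : SFR W)) (hl : (der S).Q P = P * l)
    (hm : (der S).Q A = A * m) (h : B.π ((der S).Q (rr S.X1) + (1 / 2 : ℂ) • l + m) = 0) : ∃ C : ℂ,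
    C ≠ 0 ∧ SFR.exp ((-2 : ℂ) • rr S.X1) - C • (P * (A * A) : SFR W) ∈ B.I := by
  set Y := (-2 : ℂ) • rr S.X1 with hY
  have hYe : (sc W).σ Y = Y := by rw [hY, map_smul, even_H]
  have hx : IsExt Y.exp := IsExt.exp ((ExtAlg W).smul_mem ext_H _)
  obtain ⟨g', g1, g2, g3⟩ := hx.exists_inverse fun x hx => by
    rw [← at_apply _ hx, at_exp]; exact isUnit_expVal _
  have hge : (sc W).σ g' = g' := by
    have h1 : (sc W).σ g' * Y.exp = 1 := by
      have := congrArg (sc W).σ g3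
      rwa [map_mul, map_one, SFR.σ_exp hYe] at this
    rw [← mul_one ((sc W).σ g'), ← g2, ← mul_assoc, h1, one_mul]
  let u : (sc W).Ev := ⟨Y.exp, SFR.σ_exp hYe⟩
  let u' : (sc W).Ev := ⟨g', hge⟩
  have hu : u * u' = 1 := Subtype.ext g2
  have h1 := log_mul _ (log_inv _ hu (Q_exp hYe)) (log_mul _ hl (log_mul _ hm hm))
  set F : (sc W).Ev := u' * (P * (A * A)) with hF
  have hFe : IsExt (F : SFR W) :=
    (ExtAlg W).mul_mem g1 ((ExtAlg W).mul_mem hPe ((ExtAlg W).mul_mem hAe hAe))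
  have hFi : F * (u * (P' * (A' * A'))) = 1 := by
    calc F * (u * (P' * (A' * A'))) = (u * u') * (P * P') * (A * A') * (A * A') := by
          rw [hF]; ring
      _ = 1 := by rw [hu, hP, hA]; simp
  have h2 : B.π ((der S).Q F) = 0 := by
    have h3 : -(der S).Q Y + (l + (m + m)) =
        (2 : ℂ) • ((der S).Q (rr S.X1) + (1 / 2 : ℂ) • l + m) := by
      rw [hY, map_smul, smul_add, smul_add, smul_smul, neg_smul, neg_neg, two_smul ℂ m]
      norm_num
      abel
    rw [h1, h3, map_mul, map_smul, h, smul_zero, mul_zero]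
  obtain ⟨c, c0, hcm⟩ := B.exists_const_of_unit e hr he hc hFe h2 (congrArg (sc W).evInc hFi)
  refine ⟨c⁻¹, inv_ne_zero c0, ?_⟩
  have h4 : Y.exp - c⁻¹ • (P * (A * A) : SFR W) =
      (-c⁻¹) • (Y.exp * ((F : SFR W) - algebraMap ℂ (SFR W) c)) := by
    have h5 : Y.exp * (F : SFR W) = P * (A * A) := by
      change Y.exp * (g' * (P * (A * A) : SFR W)) = _
      rw [← mul_assoc, g2, one_mul]
    rw [mul_sub, h5, Algebra.algebraMap_eq_smul_one, mul_smul_comm, mul_one, smul_sub, smul_smul,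
      neg_mul, inv_mul_cancel₀ c0, neg_smul, neg_smul, one_smul]
    abel
  rw [h4]
  exact B.smul_mem_I _ (Ideal.mul_mem_left _ _ hcm)

theorem log_formula {P P' A A' : (sc W).Ev} {l m R L : SFR W} (hP : P * P' = 1) (hA : A * A' = 1)
    (hl : (der S).Q P = P * l) (hm : (der S).Q A = A * m)
    (h : B.π ((der S).Q (rr S.X1) + (1 / 2 : ℂ) • l + m) = 0) (hLe : IsExt L) (hR : R * R = P)
    (hL : L.exp = R * A) : ∃ c : ℂ, rr S.X1 - (algebraMap ℂ (SFR W) c - L) ∈ B.I := by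
  have hRe : (sc W).σ R = R := even_of_sq hR P.2 (congrArg (sc W).evInc hP)
  have hLx : (sc W).σ L.exp = L.exp := by
    rw [hL, map_mul, hRe, show (sc W).σ (A : SFR W) = A from A.2]
  have hL0 := even_of_exp hLe hLx
  let u : (sc W).Ev := ⟨L.exp, hLx⟩
  have hu : u * u = P * (A * A) := Subtype.ext (by
    change L.exp * L.exp = P * (A * A : SFR W)
    rw [hL, ← hR, mul_assoc, ← mul_assoc (A : SFR W) R A, (sc W).even_mul (A : SFR W) R A.2,
      mul_assoc, mul_assoc])
  have hQ : (der S).Q u = u * (der S).Q L := Q_exp hL0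
  have h1 := log_mul _ hQ hQ
  have h2 := log_mul _ hl (log_mul _ hm hm)
  rw [← hu] at h2
  obtain ⟨V, h3⟩ : ∃ V, (u * u) * V = 1 := by
    refine ⟨P' * (A' * A'), ?_⟩
    calc (u * u) * (P' * (A' * A')) = (P * P') * (A * A') * (A * A') := by rw [hu]; ring
      _ = 1 := by rw [hP, hA]; simp
  have h4 : (der S).Q L + (der S).Q L = l + (m + m) := by
    have h5 := congrArg ((V : SFR W) * ·) (h1.symm.trans h2)
    have h6 : (V : SFR W) * (u * u : (sc W).Ev) = 1 :=
      congrArg (sc W).evInc ((mul_comm _ _).trans h3)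
    simp only [← mul_assoc, h6, one_mul] at h5
    exact h5
  have h5 : (der S).Q L = (1 / 2 : ℂ) • l + m := by
    have : (2 : ℂ) • (der S).Q L = (2 : ℂ) • ((1 / 2 : ℂ) • l + m) := by
      rw [two_smul, h4, smul_add, smul_smul, two_smul ℂ m]; norm_num
    exact smul_right_injective _ (two_ne_zero (α := ℂ)) this
  obtain ⟨c, -, hcm⟩ := B.exists_const e hr he hc (f := rr S.X1 + L)
    ((ExtAlg W).add_mem ext_H hLe) (by rw [map_add, h5, ← add_assoc]; exact h)
  exact ⟨c, by rwa [sub_sub_eq_add_sub]⟩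

end Bars

end BV

namespace BV

variable {D : FieldContent} {V W : Opens (Body D)} {E : Bivector D} {Θ : Fin (2 * D.ND) → SF D}
  {ρ : SF D} {Ω : ℕ → SF D} {ħ : ℂ} {F : AExt D → SF D} {e : BarIdx D ≃ Ext D}

lemma IsExt.rep {f : SFR W} (h : IsExt f) : IsExtFun D W f.rep :=
  isExt_of_iff.mp (show IsExt (of f.rep f.smooth) by rwa [of_rep])

lemma Bars.isBigO {S : GaugeData W} (B : Bars S) {hs : ∀ b, Smooth D W (barΓ D F Ω Θ b)}
    (hΓ : ∀ b, B.Γ b = of (barΓ D F Ω Θ b) (hs b)) {y : SFR W} (hy : IsExt y) (h : y ∈ B.I)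
    {f : SF D} (hf : ∀ x (hx : x ∈ W), f x = ev x hx y) : IsBigO D W Ω Θ f := by
  obtain ⟨c, hc⟩ := Submodule.mem_span_range_iff_exists_fun (R := SFR W).mp h
  let w : AExt D ⊕ Fin (2 * D.ND) → SFR W := fun i => (sc W).tw (pcon D i) (SFR.res (extP D) (c i))
  have hr : ∀ i, IsExt (SFR.res (extP D) (c i)) := fun i => ext_at fun x hx => by
    rw [at_res, at_res, res_res]; simp only [and_self]
  have hw : ∀ i, IsExt (w i) := fun i => by
    change IsExt ((sc W).tw _ _)
    unfold SuperCalc.tw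
    split_ifs
    · exact hr i
    · rw [IsExt, ← SFR.σ_res, hr i]
  have h1 : y = ∑ i, B.con i * w i := by
    conv_lhs => rw [← hy, ← hc, map_sum]
    refine sum_congr rfl fun i _ => ?_
    rw [smul_eq_mul, map_mul, B.ext_con i, (B.hom_con i).mul_eq_tw]
    refine congrArg (· * B.con i) ?_
    simp only [w, SuperCalc.tw]
    split_ifs
    · rfl
    · exact ((sc W).σσ _).symm
  refine ⟨fun a => (w (inl a)).rep, fun a => (w (inr a)).rep, fun a => ⟨(hw _).rep, SFR.smooth _⟩,
    fun a => ⟨(hw _).rep, SFR.smooth _⟩, fun x hx => ?_⟩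
  have hG : ∀ a, ev x hx (S.G a) = G D Ω a x := fun a => by
    rw [show S.G a = B.Γ (inr (inl a)) from rfl, hΓ, at_of]; rfl
  have hT : ∀ a, ev x hx (B.Θ a) = Θ a x := fun a => by
    rw [show B.Θ a = B.Γ (inr (inr a)) from rfl, hΓ, at_of]; rfl
  rw [hf x hx, h1, sum_sum_type, map_add, map_sum, map_sum]
  refine congrArg₂ _ (sum_congr rfl fun a _ => ?_) (sum_congr rfl fun a _ => ?_)
  · rw [map_mul, ← hG, at_apply (w _) hx]; rfl
  · rw [map_mul, ← hT, at_apply (w _) hx]; rfl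

/-- The gauge-fixing action at vanishing first-level variables. -/
theorem gauge_fixing_formulas (hE : IsAntisymplectic D V E) (hΘ : IsSecondClass D V E Θ)
    (hρ : IsDensity D V ρ) (hħ : ħ ≠ 0) (hΩ : IsGaugeFixingAction D V ħ E Θ ρ Ω)
    (hF : IsCoordinateSystem D V e (barΓ D F Ω Θ)) (hW : W ≤ V)
    (hu : ∀ x ∈ W, IsUnit (FG D E Θ F Ω x) ∧ ∀ i, IsUnit (FP D Ω i x))
    (hc : IsPreconnected (W ∩ onShell D V Ω Θ)) : (∃ C : ℂ, C ≠ 0 ∧ IsBigO D W Ω Θ (fun x => expVal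
    D ((-2 : ℂ) • H D Ω x) - C • (radicand D E Θ ρ F Ω e x * altProd D Ω x ^ 2))) ∧ ∀ R L : SF D,
    Smooth D W R → Smooth D W L → IsExtFun D W R → IsExtFun D W L →
    (∀ x ∈ W, R x ^ 2 = radicand D E Θ ρ F Ω e x) →
    (∀ x ∈ W, expVal D (L x) = R x * altProd D Ω x) → ∃ c : ℂ, IsBigO D W Ω Θ
    (fun x => H D Ω x - (algebraMap ℂ (Val D) c - L x)) := by
  obtain ⟨S, B, h0, h1, hr, hΓ, hM⟩ := exists_bars hE hΘ hρ hħ hΩ hF hW hu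
  obtain ⟨P, P', A, A', hP, hA, hPe, hAe, ⟨l, m, hl, hm, hlm⟩, hPx, hAx⟩ :=
    B.exists_formula e hF.parity_eq
  have hreal : ∀ b, ∀ x ∈ W, (body D ((B.Γ b).rep x)).im = 0 := fun b x hx => by
    rw [hΓ, rep_of _ _ hx]; exact hF.real b x (hW hx)
  have hs : B.surface = (W : Set (Body D)) ∩ onShell D V Ω Θ := by
    have h2 : ∀ x ∈ W, ∀ b, (B.Γ b).rep x = barΓ D F Ω Θ b x := fun x hx b => by
      rw [hΓ, rep_of _ _ hx]
    ext x
    refine ⟨fun h => ⟨h.1, hW h.1, fun a => ?_, fun a => ?_⟩, fun h => ⟨h.1, ?_⟩⟩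
    · rw [← h.2 (inl a)]
      exact congrArg (body D) (h2 x h.1 (inr (inl a))).symm
    · rw [← h.2 (inr a)]
      exact congrArg (body D) (h2 x h.1 (inr (inr a))).symm
    · rintro (a | a)
      · rw [← h.2.2.1 a]
        exact congrArg (body D) (h2 x h.1 (inr (inl a)))
      · rw [← h.2.2.2 a]
        exact congrArg (body D) (h2 x h.1 (inr (inr a)))
  have hc' : IsPreconnected B.surface := hs ▸ hc
  have hPr : ∀ x (hx : x ∈ W), ev x hx P = radicand D E Θ ρ F Ω e x := fun x hx => by
    rw [hPx x hx, hM x hx, radicand]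
    refine congrArg₂ _ (congrArg₂ _ (congrArg _ ?_) rfl) ?_
    · ext1 X Y
      rw [of_apply, hΓ, sc_rd_of, at_of]; rfl
    · have e1 := congrArg (ev x hx) S.ρ'_mul
      have e2 := congrArg (ev x hx)
        (((sc W).even_mul _ S.ρ' (hom_zero_iff.mp S.even_ρ)).trans S.ρ'_mul)
      rw [map_mul, map_one, hr, at_of] at e1 e2
      exact (inverse_eq e2 e1).symm
  have hAr : ∀ x (hx : x ∈ W), ev x hx A = altProd D Ω x := fun x hx => by
    rw [hAx x hx, altProd]
    simp only [GaugeData.Dl_at h0 _ hx]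
  have hH : ∀ x (hx : x ∈ W), ev x hx (rr S.X1) = H D Ω x := fun x hx => by
    rw [GaugeData.X1_eq h1]; exact at_of _ _ hx
  constructor
  · obtain ⟨C, hC, h⟩ := B.exp_formula e hreal hF.parity_eq hc' hP hA hPe hAe hl hm hlm
    refine ⟨C, hC, B.isBigO hΓ ?_ h fun x hx => ?_⟩
    · exact (ExtAlg W).sub_mem (IsExt.exp ((ExtAlg W).smul_mem Bars.ext_H _))
        ((ExtAlg W).smul_mem ((ExtAlg W).mul_mem hPe ((ExtAlg W).mul_mem hAe hAe)) _)
    · rw [map_sub, at_exp, map_smul, map_smul, map_mul, map_mul, hPr, hAr, hH, pow_two]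
  · intro R L hR hL hRe hLe hR2 hLR
    obtain ⟨c, h⟩ := B.log_formula e hreal hF.parity_eq hc' hP hA hl hm hlm
      (R := of R hR) (L := of L hL) (isExt_of_iff.mpr hLe)
      (ext_at fun x hx => by rw [map_mul, at_of, hPr, ← pow_two, hR2 x hx])
      (ext_at fun x hx => by rw [map_mul, at_exp, at_of, at_of, hAr, hLR x hx])
    refine ⟨c, B.isBigO hΓ ?_ h fun x hx => ?_⟩
    · exact (ExtAlg W).sub_mem Bars.ext_H ((ExtAlg W).sub_mem ((ExtAlg W).algebraMap_mem c)
        (isExt_of_iff.mpr hLe))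
    · rw [map_sub, map_sub, hH, at_of, AlgHom.commutes]

variable {x : Body D}

/-- The body at a point. -/
def SFR.bodyAt (x : Body D) (hx : x ∈ W) : SFR W →ₐ[ℂ] ℂ := bodyHom.comp (ev x hx)

lemma SFR.bodyAt_apply (hx : x ∈ W) (f : SFR W) : SFR.bodyAt x hx f = body D (ev x hx f) := rfl

lemma SFR.bodyAt_σ (hx : x ∈ W) (f : SFR W) : SFR.bodyAt x hx ((sc W).σ f) = SFR.bodyAt x hx f := by
  rw [SFR.bodyAt_apply, sc_σ_at, body_sig]; rfl

lemma SFR.bodyAt_rd (hx : x ∈ W) (z : Coord D) (f : SFR W) : SFR.bodyAt x hx ((sc W).rd z f) =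
    SFR.bodyAt x hx ((sc W).ld z f) := by
  unfold SuperCalc.rd
  split_ifs with h
  · rfl
  · change SFR.bodyAt x hx (-(sc W).ld z ((sc W).σ f)) = _
    rw [(sc W).ld_σ, sgn, if_neg h, neg_one_smul, neg_neg, SFR.bodyAt_σ]

lemma exists_inverse_near {ι : Type*} [Fintype ι] [DecidableEq ι] {M : Matrix ι ι (SFR V)}
    (hM : ∀ i j, IsExt (M i j)) (hx : x ∈ V) (h : IsUnit (M.map (SFR.bodyAt x hx))) : ∃
    (W : Opens (Body D)) (hW : W ≤ V) (_ : x ∈ W) (N : Matrix ι ι (SFR W)), (∀ i j, IsExt (N i j)) ∧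
    M.map (restr hW) * N = 1 ∧ N * M.map (restr hW) = 1 := by
  let A : Body D → Matrix ι ι ℂ := fun y => Matrix.of fun i j => body D ((M i j).rep y)
  have hA : ∀ y (hy : y ∈ V), M.map (SFR.bodyAt y hy) = A y := fun y hy => by
    ext i j
    rw [Matrix.map_apply, SFR.bodyAt_apply, at_apply]; rfl
  have hd : ContDiffOn ℝ ∞ (fun y => (A y).det) V :=
    contDiffOn_det fun i j => smooth_body (M i j).smooth
  let W : Opens (Body D) := ⟨V ∩ (fun y => (A y).det) ⁻¹' {0}ᶜ,
    hd.continuousOn.isOpen_inter_preimage V.2 isOpen_compl_singleton⟩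
  have hW : W ≤ V := fun y hy => hy.1
  refine ⟨W, hW, ⟨hx, ?_⟩, exists_matrix_inverse_of_body (fun i j => (hM i j).restr hW) fun y hy =>
    ?_⟩
  · rw [hA, isUnit_iff_isUnit_det] at h
    exact h.ne_zero
  · have h1 : (Matrix.of fun i j => body D ((M.map (restr hW) i j).rep y)) = A y := by
      ext i j
      rw [of_apply, ← at_apply _ hy, Matrix.map_apply, at_restr, at_apply]; rfl
    rw [h1, isUnit_iff_isUnit_det]
    exact isUnit_iff_ne_zero.mpr hy.2

lemma isUnit_map_at {ι : Type*} [Fintype ι] [DecidableEq ι] {M : Matrix ι ι (SFR V)}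
    (hM : ∀ i j, IsExt (M i j)) (hx : x ∈ V) (h : IsUnit (M.map (SFR.bodyAt x hx))) : IsUnit
    (M.map (ev x hx)) := by
  obtain ⟨W, hW, hxW, N, -, h1, h2⟩ := exists_inverse_near hM hx h
  have e1 : (M.map (restr hW)).map (ev x hxW) = M.map (ev x hx) := by
    ext1 i j
    rw [Matrix.map_apply, Matrix.map_apply, at_restr]; rfl
  refine ⟨⟨M.map (ev x hx), N.map (ev x hxW), ?_, ?_⟩, rfl⟩
  · rw [← e1, ← Matrix.map_mul, h1, Matrix.map_one _ (map_zero _) (map_one _)]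
  · rw [← e1, ← Matrix.map_mul, h2, Matrix.map_one _ (map_zero _) (map_one _)]

/-! ### The ghost blocks on the constraint surface -/

lemma bodyAt_of_wt {u : ℤ} (hu : u ≠ 0) {f : SFR W} (h : f ∈ Wt W {u}) (hx : x ∈ W) : SFR.bodyAt x
    hx f = 0 := by
  rw [SFR.bodyAt_apply, body_eq_coeff, ← repr_empty monoBasis_isMono]
  by_contra h2
  have := mem_wt_iff.mp h x hx 0 ∅ h2
  rw [map_zero, Finset.sum_empty, add_zero] at this
  exact hu this.symm

/-- The variables of the Hessian. -/
def hidx (D : FieldContent) : Ext D ⊕ Fld D → Coord D := Sum.elim inl (fld D)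

lemma hessian_eq_zero {hs : Smooth D W (Ω 0)} (hw : of (Ω 0) hs ∈ Wt W {1}) (hx : x ∈ W)
    {i j : Ext D ⊕ Fld D} (h : plC (hidx D i) + plC (hidx D j) ≠ 1) : hessian D Ω x i j = 0 := by
  have h1 : (sc W).ld (hidx D i) ((sc W).rd (hidx D j) (of (Ω 0) hs)) ∈
      Wt W {1 - plC (hidx D j) - plC (hidx D i)} :=
    wt_ld (T := {1 - plC (hidx D j)}) _ (by rintro _ rfl; rfl) (wt_rd _ (by rintro _ rfl; rfl) hw)
  have h2 := bodyAt_of_wt (by omega) h1 hx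
  rwa [SFR.bodyAt_apply, sc_rd_of, sc_ld_of, at_of] at h2

lemma body_atZero (f : SF D) (x : Body D) : body D (atZero D f x) = body D (f x) := by
  rw [atZero_eq, body_eq_coeff, body_eq_coeff, coeff_res, resCoeff_pos (supp_zero _), bod_kl]

lemma FP_body (i : Fin D.s) (x : Body D) (a b) : body D (FP D Ω i x a b) = hessian D Ω x
    (inr (inr (inr ⟨i, a⟩))) (inr (inr (inl ⟨i, b⟩))) :=
  body_atZero _ x

lemma card_hessian : card (AExt D ⊕ Fld D) = 2 *
    (card (AExt D) + ∑ i : Fin D.s, card (AIdx D ((i : ℕ) + 1))) := by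
  rw [Fintype.card_sum, Fintype.card_sum, Fintype.card_sum, Fintype.card_sigma]; ring

lemma isUnit_FP_body {hs : Smooth D W (Ω 0)} (hw : of (Ω 0) hs ∈ Wt W {1}) (hx : x ∈ W)
    (hr : (hessian D Ω x).rank = card (AExt D ⊕ Fld D)) (i : Fin D.s) : IsUnit
    ((FP D Ω i x).map (body D)) := by
  set Hs := hessian D Ω x with hHs
  let Φ : (Ext D ⊕ Fld D → ℂ) →ₗ[ℂ] (AExt D ⊕ Fld D → ℂ) := LinearMap.pi (Sum.elim (fun a =>
    LinearMap.proj (inr (inl a)) ∘ₗ Hs.mulVecLin) (Sum.elim (fun a => LinearMap.proj (inr (inl a)))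
    (Sum.elim (fun g => LinearMap.proj (inr (inr (inr g)))) (fun g => LinearMap.proj (inr (inr (inr
    g))) ∘ₗ Hs.mulVecLin))))
  have hk : LinearMap.ker Φ ≤ LinearMap.ker Hs.mulVecLin := fun v hv => by
    have h1 : ∀ j, Φ v j = 0 := fun j => congrFun hv j
    refine funext fun j => ?_
    have hz : ∀ k, (v k ≠ 0 → plC (hidx D j) + plC (hidx D k) ≠ 1) → Hs j k * v k = 0 :=
      fun k hk => by
        by_cases h0 : v k = 0
        · rw [h0, mul_zero]
        · rw [hHs, hessian_eq_zero hw hx (hk h0), zero_mul]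
    have l1 : ∀ a, v (inr (inl a)) = 0 := fun a => h1 (inr (inl a))
    have l2 : ∀ g, v (inr (inr (inr g))) = 0 :=
      fun g => h1 (inr (inr (inl g)))
    have key : (¬ ∃ a, j = inr (inl a)) → (¬ ∃ g, j = inr (inr (inr g))) →
        ∑ k, Hs j k * v k = 0 := fun n1 n2 => sum_eq_zero fun k _ => hz k fun hk => by
      have p1 : plC (hidx D j) = 0 ∨ 2 ≤ plC (hidx D j) := by
        rcases j with j | j | j | j
        · exact Or.inl rfl
        · exact absurd ⟨j, rfl⟩ n1
        · refine Or.inr ?_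
          change 2 ≤ ((j.1 : ℕ) : ℤ) + 2
          omega
        · exact absurd ⟨j, rfl⟩ n2
      have p2 : plC (hidx D k) = 0 ∨ 2 ≤ plC (hidx D k) := by
        rcases k with k | k | k | k
        · exact Or.inl rfl
        · exact absurd (l1 k) hk
        · refine Or.inr ?_
          change 2 ≤ ((k.1 : ℕ) : ℤ) + 2
          omega
        · exact absurd (l2 k) hk
      omega
    rcases j with j | j | j | j
    · exact key (by simp) (by simp)
    · exact h1 (inl j)
    · exact key (by simp) (by simp)
    · exact h1 (inr (inr (inr j)))
  have hsurj : Function.Surjective Φ := by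
    rw [← LinearMap.range_eq_top]
    refine Submodule.eq_top_of_finrank_eq (le_antisymm (Submodule.finrank_le _) ?_)
    have e1 := LinearMap.finrank_range_add_finrank_ker Φ
    have e2 := LinearMap.finrank_range_add_finrank_ker Hs.mulVecLin
    have e3 := Submodule.finrank_mono hk
    have e4 : Module.finrank ℂ (LinearMap.range Hs.mulVecLin) = _ := hr
    rw [Module.finrank_fintype_fun_eq_card]
    omega
  rw [← Matrix.mulVec_surjective_iff_isUnit]
  intro w
  obtain ⟨v, hv⟩ := hsurj (Sum.elim 0 (Sum.elim 0 (Sum.elim 0 fun g =>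
    if h : g.1 = i then w (h ▸ g.2) else 0)))
  refine ⟨fun b => v (inr (inr (inl ⟨i, b⟩))), funext fun a => ?_⟩
  have h1 := congrFun hv (inr (inr (inr ⟨i, a⟩)))
  have h2 : ∑ k, Hs (inr (inr (inr ⟨i, a⟩))) k * v k = w a := by
    refine Eq.trans h1 ?_
    simp
  rw [← h2]
  change ∑ b, body D (FP D Ω i x a b) * _ = _
  have hz : ∀ k, plC (hidx D (inr (inr (inr ⟨i, a⟩)))) + plC (hidx D k) ≠ 1 →
      Hs (inr (inr (inr ⟨i, a⟩))) k * v k = 0 := fun k hk => by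
    rw [hHs, hessian_eq_zero hw hx hk, zero_mul]
  have hp : plC (hidx D (inr (inr (inr ⟨i, a⟩)))) = -(((i : ℕ) : ℤ) + 1) := rfl
  refine Finset.sum_of_injOn (fun b => inr (inr (inl ⟨i, b⟩))) (fun b _ c _ h => ?_)
    (fun b _ => Finset.mem_coe.mpr (mem_univ _)) (fun k _ hk => hz k ?_) fun b _ => ?_
  · simpa using h
  · rw [hp]
    rcases k with k | k | ⟨j, b⟩ | k
    · change _ + (0 : ℤ) ≠ 1; omega
    · change _ + (1 : ℤ) ≠ 1; omega
    · change _ + (((j : ℕ) : ℤ) + 2) ≠ 1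
      intro h
      obtain rfl : j = i := Fin.ext (by omega)
      exact hk ⟨b, Finset.mem_coe.mpr (mem_univ _), rfl⟩
    · change _ + -(((k.1 : ℕ) : ℤ) + 1) ≠ 1; omega
  · rw [FP_body]

open BV.SFR (bodyAt bodyAt_apply)

lemma GaugeData.bodyAt_bX_G (S : GaugeData W) (hx : x ∈ W)
    {I0 : Matrix (AIdx D (0 + 1)) (AIdx D (0 + 1)) (SFR W)} (h1 : S.Dl 0 * I0 = 1)
    (hI : ∀ a b, IsExt (I0 a b)) (hG : ∀ a, bodyAt x hx (S.G a) = 0) (a b : AExt D) : bodyAt x hx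
    (S.bX (S.G a) (S.G b)) = 0 := by
  have h0 : (sc W).br inl (EX S.ED) S.g 0 = 0 := by
    simp [br]
  have h2 := congrArg ((sc W).rd (lam D a)) (S.bX_G h1 hI b)
  rw [S.odd_EX.rd_br (fun A B => S.ld_EX _ A B) _ (S.hom_G b), rd_aux_of_ext (S.ext_G b), h0, zero_add, S.rd_g, map_neg, map_sum] at h2
  have h3 := congrArg (bodyAt x hx) h2
  rw [map_smul, map_neg, map_sum, sum_eq_zero, neg_zero] at h3
  · exact (smul_eq_zero.mp h3).resolve_left (sgn_ne_zero _)
  · intro c _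
    rw [rd_ext_mul (S.ext_G c), map_mul, hG, zero_mul]

lemma isUnit_map_body {ι : Type*} [Fintype ι] [DecidableEq ι] {M : Matrix ι ι (Val D)}
    (h : IsUnit M) : IsUnit (M.map (body D)) :=
  h.map (RingHom.mapMatrix (bodyHom (D := D)).toRingHom)

section

variable (hE : IsAntisymplectic D V E) (hΘ : IsSecondClass D V E Θ)

/-- The degeneracies of the extended Dirac bracket are spanned by the constraints. -/
lemma exists_theta_coeff (hx : x ∈ V) {N : Fin (2 * D.ND) → Fin (2 * D.ND) → SFR V} {f : SFR V}
    (hf : ∀ i, bodyAt x hx ((sc V).br inl (EX ((sc V).dir (gam D) (biv hE) (theta hΘ) N)) (xc (inl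
    i)) f) = 0) : ∃ ν : Fin (2 * D.ND) → ℂ, ∀ j, bodyAt x hx ((sc V).ld (inl j) f) = ∑ a, bodyAt x
    hx ((sc V).ld (inl j) (theta hΘ a)) * ν a := by
  set β := bodyAt x hx
  have hX : ∀ z w : Coord D, (sc V).rd z (xc w) = if z = w then 1 else 0 := fun z w => by
    rw [rd_X]
  have h1 : ∀ i, β ((sc V).br (gam D) ((sc V).dir (gam D) (biv hE) (theta hΘ) N) (xc (inl i)) f) + ∑
    m : APi D,
      (β ((sc V).rd (piI D m) (xc (inl i))) * β ((sc V).ld (piS D m) f) -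
        β ((sc V).rd (piS D m) (xc (inl i))) * β ((sc V).ld (piI D m) f)) = 0 := fun i => by
    rw [← hf i, EX, br_canon, map_add, map_sum]
    simp only [map_sub, map_mul]
  have h0 : ∀ i : APi D ⊕ APi D, β ((sc V).ld (inl (inr i)) f) = 0 := fun i => by
    have := h1 (inr i.swap)
    rw [br, sum_eq_zero fun A _ => sum_eq_zero fun B _ => by
      rw [hX, if_neg (by simp), zero_mul, zero_mul], map_zero, zero_add] at this
    rcases i with i | i <;> simpa [hX, piI, piS, apply_ite β] using this
  have hg : ∀ A g, (sc V).br (gam D) (biv hE) (xc (gam D A)) g =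
      ∑ B, biv hE A B * (sc V).ld (gam D B) g := fun A g => by
    rw [br, sum_eq_single A]
    · exact sum_congr rfl fun B _ => by rw [hX, if_pos rfl, one_mul]
    · intro C _ hC
      exact sum_eq_zero fun B _ => by rw [hX, if_neg (by simpa using hC), zero_mul, zero_mul]
    · exact fun h => absurd (mem_univ _) h
  let ν : Fin (2 * D.ND) → ℂ := fun a => ∑ b, β (N a b) * β ((sc V).br (gam D) (biv hE) (theta hΘ b) f)
  have hΓ : ∀ A, ∑ B, β (biv hE A B) * (β ((sc V).ld (gam D B) f) -
      ∑ a, β ((sc V).ld (gam D B) (theta hΘ a)) * ν a) = 0 := fun A => by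
    have h2 := h1 (inl A)
    rw [sum_eq_zero (fun m _ => by
      rw [hX, hX, if_neg (by simp), if_neg (by simp), map_zero, zero_mul, zero_mul, sub_zero]),
      add_zero, br_dir, hg, map_sub, map_sum] at h2
    rw [← h2]
    simp only [mul_sub, sum_sub_distrib, map_sum, map_mul]
    refine congrArg₂ _ rfl ?_
    simp only [hg, map_sum, map_mul, ν, mul_sum, sum_mul]
    rw [sum_comm]
    refine sum_congr rfl fun a _ => ?_
    rw [sum_comm]
    exact sum_congr rfl fun b _ => sum_congr rfl fun B _ => by ring
  have hEu : IsUnit (Matrix.of fun A B => β (biv hE A B)) := by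
    have := isUnit_map_body (hE.nondeg x hx)
    convert this using 1
    ext A B
    change body D (ev x hx (of (E A B) (hE.smooth A B))) = _
    rw [at_of]; rfl
  have hinj := Matrix.mulVec_injective_iff_isUnit.mpr hEu
  have hz := @hinj (fun B => β ((sc V).ld (gam D B) f) - ∑ a, β ((sc V).ld (gam D B) (theta hΘ a)) *
    ν a) 0 (by rw [Matrix.mulVec_zero]; exact funext hΓ)
  refine ⟨ν, fun j => ?_⟩
  rcases j with A | m
  · exact sub_eq_zero.mp (congrFun hz A)
  · rw [sum_eq_zero fun a _ => by
      rw [theta, ld_of_gamFun _ (hΘ.isΓFun a), map_zero, zero_mul]]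
    exact h0 m

include hE hΘ in
/-- The bracket matrix and the ghost matrices are invertible on the constraint surface. -/
theorem isUnit_of_onShell (hρ : IsDensity D V ρ) (hħ : ħ ≠ 0)
    (hΩ : IsGaugeFixingAction D V ħ E Θ ρ Ω) (hF : IsCoordinateSystem D V e (barΓ D F Ω Θ))
    (hS : x ∈ onShell D V Ω Θ) : IsUnit (FG D E Θ F Ω x) ∧ ∀ i, IsUnit (FP D Ω i x) := by
  have hx : x ∈ V := hS.1
  obtain ⟨T, hX0, -, -, hbr, hl, -⟩ := exists_gaugeData hE hΘ hρ hħ hΩ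
  have hw : of (Ω 0) (hΩ.smooth 0) ∈ Wt V {1} := hX0 ▸ T.wt0
  have hDl : ∀ i : Fin D.s, IsUnit ((T.Dl i).map (bodyAt x hx)) := fun i => by
    have h1 := isUnit_FP_body hw hx ((hΩ.rank x hS).trans card_hessian.symm) i
    rw [← GaugeData.Dl_at hX0 i hx] at h1
    exact h1
  refine ⟨?_, fun i => by
    rw [← GaugeData.Dl_at hX0 i hx]; exact isUnit_map_at (T.ext_Dl i) hx (hDl i)⟩
  set β := bodyAt x hx with hβ
  let Γ : BarIdx D → SFR V := fun b => of (barΓ D F Ω Θ b) (hF.smooth b)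
  have hGeq : ∀ a, T.G a = Γ (inr (inl a)) := GaugeData.G_eq hX0
  have hG0 : ∀ a, β (T.G a) = 0 := fun a => by
    rw [hGeq, hβ, bodyAt_apply, at_of]; exact hS.2.1 a
  -- the constraints are in involution
  have hGG : ∀ a b, β (T.bX (T.G a) (T.G b)) = 0 := by
    have hn : ∃ (W : Opens (Body D)) (hW : W ≤ V) (_ : x ∈ W)
        (I0 : Matrix (AIdx D (0 + 1)) (AIdx D (0 + 1)) (SFR W)), (∀ i j, IsExt (I0 i j)) ∧
        (T.Dl 0).map (restr hW) * I0 = 1 := by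
      by_cases h0 : 0 < D.s
      · obtain ⟨W, hW, hxW, N, h1, h2, -⟩ := exists_inverse_near (T.ext_Dl 0) hx (hDl ⟨0, h0⟩)
        exact ⟨W, hW, hxW, N, h1, h2⟩
      · have : IsEmpty (AIdx D (0 + 1)) :=
          ⟨fun a => h0 (Nat.lt_of_succ_lt_succ (lt_of_le_of_lt a.2 a.1.1.2))⟩
        exact ⟨V, le_rfl, hx, 1, fun i => isEmptyElim i, Subsingleton.elim _ _⟩
    obtain ⟨W, hW, hxW, I0, h1, h2⟩ := hn
    have hr : ∀ z (f : SFR V), restr hW (rr ((sc V).rd z f)) =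
        rr ((sc W).rd z (restr hW f)) := fun z f => by
      rw [rr, restr_res, restr_rd]
    have hG : ∀ a, (T.restr hW).G a = restr hW (T.G a) := fun a => (hr _ _).symm
    have hD : (T.restr hW).Dl 0 = (T.Dl 0).map (restr hW) := by
      ext1 a b
      change rr ((sc W).ld _ ((sc W).rd _ (restr hW T.X0))) = restr hW (rr _)
      rw [← restr_rd, ← restr_ld, ← restr_res]
    have hval : ∀ f, bodyAt x hxW (restr hW f) = β f := fun f => by
      rw [bodyAt_apply, at_restr]; rfl
    intro a b
    rw [← (T.restr hW).bodyAt_bX_G hxW (hD ▸ h2) h1 (fun a => by rw [hG, hval, hG0]) a b, hG, hG,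
      ← hval, restr_br, restr_EX]
    rfl
  have hM : (Matrix.of fun a b => T.bX (Γ (inl a)) (T.G b)).map (ev x hx) =
      FG D E Θ F Ω x := by
    ext1 a b
    rw [Matrix.map_apply, of_apply, hGeq]
    exact hbr _ _ hx
  have hext : ∀ b, IsExt (Γ b) := fun b => isExt_of_iff.mpr (hF.isExtFun b)
  rw [← hM]
  refine isUnit_map_at (fun a b => Bars.ext_bX (hext _) (T.ext_G b)) hx ?_
  rw [← Matrix.mulVec_injective_iff_isUnit, ← Matrix.coe_mulVecLin, ← LinearMap.ker_eq_bot,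
    LinearMap.ker_eq_bot']
  intro w hw0
  let k : SFR V := ∑ b, w b • T.G b
  have hbk : ∀ f, β (T.bX f k) = ∑ b, β (T.bX f (T.G b)) * w b := fun f => by
    rw [GaugeData.bX, br_sum_right, map_sum]
    exact sum_congr rfl fun b _ => by rw [br_smul_right, map_smul, smul_eq_mul, mul_comm]
  have hΓk : ∀ b, β (T.bX (Γ b) k) = 0 := by
    rintro (a | a | a)
    · rw [hbk]; exact congrFun hw0 a
    · rw [hbk]
      exact sum_eq_zero fun b _ => by rw [← hGeq, hGG, zero_mul]
    · have : T.bX (Γ (inr (inr a))) k = 0 := hl a k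
      rw [this, map_zero]
  have hJ : IsUnit (Matrix.of fun X Y => β ((sc V).rd (inl Y) (Γ (e.symm X)))) := by
    have := isUnit_map_body (hF.isUnit x hx)
    convert this using 1
    ext X Y
    rw [of_apply, sc_rd_of, hβ, bodyAt_apply, at_of]; rfl
  have hζ : (fun i => β ((sc V).ham inl (EX T.ED) k i)) = 0 := by
    have hi := Matrix.mulVec_injective_iff_isUnit.mpr hJ
    refine @hi _ 0 ?_
    rw [Matrix.mulVec_zero]
    refine funext fun X => ?_
    rw [Pi.zero_apply, ← hΓk (e.symm X), GaugeData.bX, br_eq_ham, map_sum]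
    exact sum_congr rfl fun i _ => (map_mul β _ _).symm
  obtain ⟨N, -, h1, h2⟩ := exists_theta_inv hE hΘ
  obtain ⟨ν, hν⟩ := exists_theta_coeff hE hΘ hx (N := N) (f := k) fun i => by
    have e1 : T.bX (xc (inl i)) k = ∑ j, (sc V).rd (inl j) (xc (inl i)) *
      (sc V).ham inl (EX T.ED) k j := br_eq_ham _ _
    have e2 := hbr (smooth_coord (inl i)) k.smooth hx
    rw [← diracExt_at hE hΘ h1 h2 (smooth_coord _) k.smooth hx, of_rep] at e2
    refine (congrArg (body D) e2).symm.trans ?_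
    change β (T.bX (xc (inl i)) k) = 0
    rw [e1, map_sum]
    exact sum_eq_zero fun j _ => by rw [map_mul, congrFun hζ j, Pi.zero_apply, mul_zero]
  let u : BarIdx D → ℂ := Sum.elim 0 (Sum.elim w (-ν))
  have hu : (fun X => u (e.symm X)) = 0 := by
    have hi := Matrix.vecMul_injective_iff_isUnit.mpr hJ
    refine hi (Eq.trans (funext fun Y => ?_) (Matrix.zero_vecMul _).symm)
    change ∑ X, u (e.symm X) * β ((sc V).rd (inl Y) (Γ (e.symm X))) = 0
    rw [Equiv.sum_comp e.symm fun b => u b * β ((sc V).rd (inl Y) (Γ b)), sum_sum_type,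
      sum_sum_type, sum_eq_zero fun a _ => zero_mul _, zero_add]
    have h3 : ∑ b, w b * β ((sc V).rd (inl Y) (Γ (inr (inl b)))) =
        ∑ a, β ((sc V).rd (inl Y) (Γ (inr (inr a)))) * ν a := by
      refine (Eq.symm ?_).trans ((hν Y).trans (sum_congr rfl fun a _ =>
        congrArg (· * ν a) (SFR.bodyAt_rd hx _ _).symm))
      rw [map_sum, map_sum]
      exact sum_congr rfl fun b _ => by
        rw [map_smul, map_smul, smul_eq_mul, ← hGeq, SFR.bodyAt_rd]
    change ∑ b, w b * β ((sc V).rd (inl Y) (Γ (inr (inl b)))) +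
      ∑ a, -ν a * β ((sc V).rd (inl Y) (Γ (inr (inr a)))) = 0
    rw [h3, ← sum_add_distrib]
    exact sum_eq_zero fun a _ => by ring
  refine funext fun b => ?_
  have := congrFun hu (e (inr (inl b)))
  rw [e.symm_apply_apply] at this
  exact this

end

end BV

end

theorem mainTheorem4 (D : BV.FieldContent) (U : Set (BV.Body D)) (hU : IsOpen U)
    (ħ : ℂ) (hħ : ħ ≠ 0)
    (E : BV.Bivector D) (hE : BV.IsAntisymplectic D U E)
    (Θ : Fin (2 * D.ND) → BV.SF D) (hΘ : BV.IsSecondClass D U E Θ)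
    (ρ : BV.SF D) (hρ : BV.IsDensity D U ρ)
    (Ω : ℕ → BV.SF D) (hΩ : BV.IsGaugeFixingAction D U ħ E Θ ρ Ω)
    (F : BV.AExt D → BV.SF D) (e : BV.BarIdx D ≃ BV.Ext D)
    (hF : BV.IsCoordinateSystem D U e (BV.barΓ D F Ω Θ)) :
    (∀ x ∈ BV.onShell D U Ω Θ,
      IsUnit (BV.FG D E Θ F Ω x) ∧ ∀ i, IsUnit (BV.FP D Ω i x)) ∧
    ∀ W : Set (BV.Body D), IsOpen W → W ⊆ U →
      (∀ x ∈ W, IsUnit (BV.FG D E Θ F Ω x) ∧ ∀ i, IsUnit (BV.FP D Ω i x)) →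
      IsPreconnected (W ∩ BV.onShell D U Ω Θ) →
      (∃ C : ℂ, C ≠ 0 ∧ BV.IsBigO D W Ω Θ (fun x =>
        BV.expVal D ((-2 : ℂ) • BV.H D Ω x) -
          C • (BV.radicand D E Θ ρ F Ω e x * BV.altProd D Ω x ^ 2))) ∧
      ∀ S L : BV.SF D, BV.Smooth D W S → BV.Smooth D W L →
        BV.IsExtFun D W S → BV.IsExtFun D W L →
        (∀ x ∈ W, S x ^ 2 = BV.radicand D E Θ ρ F Ω e x) →
        (∀ x ∈ W, BV.expVal D (L x) = S x * BV.altProd D Ω x) →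
        ∃ c : ℂ, BV.IsBigO D W Ω Θ (fun x =>
          BV.H D Ω x - (algebraMap ℂ (BV.Val D) c - L x)) := by
  refine ⟨fun x hx => BV.isUnit_of_onShell (V := ⟨U, hU⟩) hE hΘ hρ hħ hΩ hF hx,
    fun W hW hWU hu hc => ?_⟩
  exact BV.gauge_fixing_formulas (V := ⟨U, hU⟩) (W := ⟨W, hW⟩) hE hΘ hρ hħ hΩ hF hWU hu hc
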